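/- **Setting.** Let $\mathbf c=(c_{ij})_{i,j\in I}$ be an indecomposable Cartan matrix of finite type, with symmetrizer $(d_i)$ without common factor, $b_{ij}=d_ic_{ij}$. Fix a bipartite colouring (parity) of the vertices of the Dynkin diagram and let $Q$ be the quiver on $I$ with an arrow $i\to j$ whenever $c_{ij}<0$, $i$ is even and $j$ is odd; the parity is chosen so that $d_i\le d_j$ for each arrow $i\to j$. Let $V=\bigoplus_iV_i$, $W=\bigoplus_iW_i$ be $I$-graded complex vector spaces with bases, of dimensions $a_i$, $l_i$; $G=\prod_i GL(V_i)$, and $T_W$ the diagonal torus of $\prod_iGL(W_i)$. Let $K_i=\mathbb C((z_i))$, $\mathcal O_i=\mathbb C[[z_i]]$, $G_K=\prod_iGL(V_i\otimes K_i)$, $G_{\mathcal O}=\prod_iGL(V_i\otimes\mathcal O_i)$, $\mathrm{Gr}=G_K/G_{\mathcal O}$. For an arrow $i\to j$ put $z=z_i^{-c_{ij}}=z_j^{-c_{ji}}$. Let $N_K$ be the space of pairs $(A,B)$ with $A_i\in\mathrm{Hom}_{K_i}(W_i\otimes K_i,V_i\otimes K_i)$ for $i\in I$ and $B_{ji}\in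 \mathrm{Hom}_{\mathbb C((z))}(V_i\otimes K_i,V_j\otimes K_j)$ for $i\to j$; $N_{\mathcal O}\subset N_K$ consists of the pairs preserving the standard lattices. Put $\mathcal T=G_K\times_{G_{\mathcal O}}N_{\mathcal O}=\{([g],n)\in\mathrm{Gr}\times N_K:\ n\in gN_{\mathcal O}\}$, let $\pi:\mathcal T\to N_K$ be the projection and $\mathcal R=\pi^{-1}(N_{\mathcal O})$. Fix half-integers $\sigma_i$ with $b_{ij}=2\sigma_i-2\sigma_j-2d_i+2d_j$ for $i\to j$. The rotation group $\mathbb G_m$ has coordinate $\tau^2$ ($\tau$ being a coordinate on the double cover by which it is replaced); $\tau^2$ acts by $z_i\mapsto\tau^{2d_i}z_i$ on $G_K$, and by $\tau^{2(\sigma_i+nd_i)}$ on $V_i\otimes z_i^n$ and $W_i\otimes z_i^n$. Put $\widetilde G_K=G_K\rtimes\mathbb G_m$, $\widetilde G_{\mathcal O}=G_{\mathcal O}\rtimes\mathbb G_m$ and $\dot G_K=\widetilde G_K\times T_W$; $\dot G_K$ acts on $N_K$ and $\mathcal T$. **Even coweights.** Let ${}^0I\subset I\times\mathbb Z$ be an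 equivalence class of the equivalence relation generated by $(i,r)\sim(j,r+b_{ij})$, $b_{ij}\ne0$. A rational coweight $\gamma=(\gamma_{i,s})$ of the diagonal torus of $G$ (or $\rho=(\rho_{i,s})$ of $T_W$) is *even* if all $(i,2d_i\gamma_{i,s})$ (all $(i,2d_i\rho_{i,s})$) lie in ${}^0I$. Put $\tau^{2\gamma}=(\mathrm{diag}(\tau^{2d_i\gamma_{i,s}})_s)_i$, $\tau^{2\tilde\gamma}=(\tau^{2\gamma},\tau^2)\in\widetilde G_K$ and $\tau^{2\dot\gamma}=(\tau^{2\tilde\gamma},\tau^{2\rho})\in\dot G_K$; superscripts $\tilde\gamma,\dot\gamma$ denote fixed points (for conjugation, in the case of groups) of all these elements. **Unfolded quiver.** $\underline Q$ has vertex set $\underline I=\{(i,r)\in{}^0I:1\le r\le2d_i\}$, and arrows $(i,r)\to(j,s)$ if $i\to j$ in $Q$ and $s-r+b_{ij}\in2\gcd(d_i,d_j)\mathbb Z$. Let $\underline V_{\gamma,(i,r)}\subset V_i$ be spanned by the basis vectors $e_s$ with $2d_i\gamma_{i,s}\equiv r$ mod $2d_i$, and similarly $\underline W_\rho$. Fix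 even $\gamma,\rho$ and put $\underline V=\underline V_\gamma$, $\underline W=\underline W_\rho$, $\underline G=\prod_{x\in\underline I}GL(\underline V_x)$, and let $\underline N$ be the space of pairs $(A,B)$ with $A_x:\underline W_x\to\underline V_x$ and $B_{yx}:\underline V_x\to\underline V_y$ for each arrow $x\to y$ of $\underline Q$. For $\eta$ even with $\underline V_\eta=\underline V$ put $\hat\eta_{(i,r)}=\eta_{(i,r)}-\frac r{2d_i}$ (a cocharacter); $\eta$ is *dominant* if each $\hat\eta_x$ is a dominant cocharacter of $GL(\underline V_x)$. Let $\underline P_\eta\subset\underline G$ be the parabolic subgroup of all $g$ such that $\lim_{\tau\to0}\mathrm{Ad}(\tau^{-\hat\eta})g$ exists in $\underline G$. Give the basis vector $e_s\in V_i$ the degree $2d_i\eta_{i,s}$ and similarly for $\underline W$ with $\rho$, except that in type $G_2$ the degrees at the vertex $i$ with $d_i=1$ are lowered by $2$ (for both $\underline V$ and $\underline W$); let $\underline V_\eta^k,\underline W_\rho^k$ be the graded pieces, $\underline V_\eta^{\le k}=\bigoplus_{l\le k}\underline V_\eta^l$, and $$N_\eta^\rho=\{(A,B)\in\underline N:\ A(\underline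 W_\rho^k)\subset\underline V_\eta^{\le k},\ B(\underline V_\eta^{\le k})\subset\underline V_\eta^{<k}\ \ \forall k\}.$$ Let $\mathscr X_\eta^\rho$ be the variety of triples $(F,A,B)$, where $F=(F^{\le k})_{k\in\mathbb Z}$ is an increasing $\mathbb Z$-weighted flag of $\underline I$-graded subspaces of $\underline V$, with $F^{\le k}/F^{<k}$ of the same dimension vector as $\underline V_\eta^k$, and $(A,B)\in\underline N$ satisfies $A(\underline W_\rho^{\le k})\subset F^{\le k}$, $B(F^{\le k})\subset F^{<k}$ for all $k$. Put $\widetilde{\underline G}=\underline G\rtimes\mathbb G_m$ and $\widetilde{\underline P}_\eta=\underline P_\eta\rtimes\mathbb G_m$, where $\tau^2$ acts by conjugation by $\tau^{-2\gamma}$; $\widetilde{\underline G}$ acts on $\underline N$, $\mathscr X^\rho_\eta$ and $\underline G\times_{\underline P_\eta}N^\rho_\eta$, extending the action of $\underline G$, where $\tau^2$ acts as $(\tau^{-2\gamma},\tau^{-2\rho})$. Let $\mathrm{Gr}^{\tilde\gamma,\eta}=(G_K)^{\tilde\gamma}\cdot[z^{\hat\eta-\hat\gamma}]$, and let $\mathcal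 T^{\dot\gamma,\eta}$, $\mathcal R^{\dot\gamma,\eta}$ be the parts of the (reduced) fixed loci $\mathcal T^{\dot\gamma},\mathcal R^{\dot\gamma}$ over it. For an algebraic group $H$ let $R_H$ be the complexified Grothendieck group of finite dimensional rational representations, and $K^H(Y)$ the complexified Grothendieck group of $H$-equivariant coherent sheaves. Restricting the equivariant bundles $G_K\times_{G_{\mathcal O}}(V'\otimes\mathscr O_{N_{\mathcal O}})$ on $\mathcal T$ and $\underline G\times_{\underline P_\eta}(V''\otimes\mathscr O_{N^\rho_\eta})$ on $\underline G\times_{\underline P_\eta}N^\rho_\eta$ defines maps $\mathrm{ind}:R_{G_{\mathcal O}}\to K^{(G_{\mathcal O})^{\tilde\gamma}}(\mathcal T^{\dot\gamma,\eta})$ and $\mathrm{ind}:R_{\underline P_\eta}\to K^{\underline P_\gamma}(\underline G\times_{\underline P_\eta}N^\rho_\eta)$. **Proposition.** Let $\rho$ be even, let $\gamma,\eta$ be even and dominant with $\underline V_\eta=\underline V_\gamma=\underline V$. Evaluation at $z_i=1$ gives group isomorphisms $ev:(\widetilde G_K)^{\tilde\gamma}\cong\widetilde{\underline G}$, $(\widetilde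 G_{\mathcal O})^{\tilde\gamma}\cong\widetilde{\underline P}_\gamma$, $(G_{\mathcal O})^{\tilde\gamma}\cong\underline P_\gamma$, and: (a) There is an isomorphism of $\widetilde{\underline G}$-varieties $\underline G\times_{\underline P_\eta}N_\eta^\rho\cong\mathscr X_\eta^\rho$, given by $[g,n]\mapsto(g\cdot(\underline V_\eta^{\le k})_k,\ g\cdot n)$. (b) There is an isomorphism of varieties $\mathcal T^{\dot\gamma,\eta}\cong\mathscr X_\eta^\rho$ that intertwines the action of $(\widetilde G_K)^{\tilde\gamma}$ and the action of $\widetilde{\underline G}$ (via $ev$). For each $v\in R_{G_{\mathcal O}}$ it identifies $\mathrm{ind}(v)\in K^{(G_{\mathcal O})^{\tilde\gamma}}(\mathcal T^{\dot\gamma,\eta})$ with $\mathrm{ind}(v_\eta)\in K^{\underline P_\gamma}(\mathscr X_\eta^\rho)$, where $v_\eta\in R_{\underline P_\eta}$ is the restriction of $v$ to $(G_{\mathcal O})^{\tilde\eta}\cong\underline P_\eta$ (evaluation at $1$), and $\mathscr X^\rho_\eta$ is identified with $\underline G\times_{\underline P_\eta}N^\rho_\eta$ by (a). (c) Evaluation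 at $1$ gives an isomorphism $(N_K)^{\dot\gamma}\cong\underline N$ that maps $(N_{\mathcal O})^{\dot\gamma}$ onto $N_\gamma^\rho$, and there is a commutative diagram of varieties $$\begin{array}{ccccc}\mathcal R^{\dot\gamma,\eta}&\hookrightarrow&\mathcal T^{\dot\gamma,\eta}&\cong&\mathscr X_\eta^\rho\\ {\scriptstyle\pi_1}\downarrow&&{\scriptstyle\pi}\downarrow&&\downarrow\\ N_\gamma^\rho&\to&(N_K)^{\dot\gamma}&\cong&\underline N\end{array}$$ where the right vertical map is $(F,A,B)\mapsto(A,B)$ and the right upper isomorphism is that of (b). The right square is equivariant with respect to $(\widetilde G_K)^{\tilde\gamma}\cong\widetilde{\underline G}$, the left square with respect to $(\widetilde G_{\mathcal O})^{\tilde\gamma}\cong\widetilde{\underline P}_\gamma$. -/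

import Mathlib

open scoped Topology

noncomputable section

namespace FixedLocus

/-! ### Varieties as spaces with functions -/

/-- A space with functions over `ℂ`: a (Zariski) topology together with the notion of a complex
valued function being regular in a neighbourhood of a point. A complex algebraic variety is
determined by the space with functions formed by its closed points and its regular functions, and
morphisms of varieties are the morphisms of spaces with functions. -/
structure FunSp (X : Type) where
  top : TopologicalSpace X
  RegAt : (X → ℂ) → X → Prop
  const : ∀ (c : ℂ) (x : X), RegAt (fun _ => c) x
  add : ∀ {f g : X → ℂ} {x : X}, RegAt f x → RegAt g x → RegAt (fun y => f y + g y) x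
  mul : ∀ {f g : X → ℂ} {x : X}, RegAt f x → RegAt g x → RegAt (fun y => f y * g y) x

namespace FunSp

/-- Open subsets. -/
abbrev Op {X : Type} (S : FunSp X) : Type := {U : Set X // IsOpen[S.top] U}

/-- The algebra of regular functions on a subset `U` (used for open `U`). -/
def O {X : Type} (S : FunSp X) (U : Set X) : Subalgebra ℂ (U → ℂ) where
  carrier := {f | ∃ F : X → ℂ, (∀ x ∈ U, S.RegAt F x) ∧ ∀ x : U, f x = F x}
  add_mem' := by
    rintro f g ⟨F, hF, hf⟩ ⟨G, hG, hg⟩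
    exact ⟨_, fun x hx => S.add (hF x hx) (hG x hx), fun x => by simp [hf, hg]⟩
  mul_mem' := by
    rintro f g ⟨F, hF, hf⟩ ⟨G, hG, hg⟩
    exact ⟨_, fun x hx => S.mul (hF x hx) (hG x hx), fun x => by simp [hf, hg]⟩
  algebraMap_mem' c := ⟨fun _ => c, fun x _ => S.const c x, fun _ => rfl⟩

/-- The Zariski topology on affine space with coordinates indexed by `κ`. -/
abbrev zariski (κ : Type) : TopologicalSpace (κ → ℂ) :=
  TopologicalSpace.generateFrom {U | ∃ q : MvPolynomial κ ℂ, U = {x | MvPolynomial.eval x q ≠ 0}}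

/-- Affine space with coordinates indexed by `κ` (possibly infinitely many): the Zariski topology,
and functions that are locally quotients of polynomials. -/
def affine (κ : Type) : FunSp (κ → ℂ) where
  top := zariski κ
  RegAt f x := ∃ U : Set (κ → ℂ), IsOpen[zariski κ] U ∧ x ∈ U ∧
    ∃ p q : MvPolynomial κ ℂ, ∀ y ∈ U, MvPolynomial.eval y q ≠ 0 ∧
      f y = MvPolynomial.eval y p / MvPolynomial.eval y q
  const c x := ⟨Set.univ, @isOpen_univ _ (zariski κ), trivial, MvPolynomial.C c, 1, by simp⟩
  add := by
    rintro f g x ⟨U, hU, hx, p, q, h⟩ ⟨U', hU', hx', p', q', h'⟩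
    refine ⟨U ∩ U', @IsOpen.inter _ (zariski κ) _ _ hU hU', ⟨hx, hx'⟩, p * q' + q * p', q * q',
      fun y hy => ?_⟩
    obtain ⟨h1, h2⟩ := h y hy.1
    obtain ⟨h3, h4⟩ := h' y hy.2
    refine ⟨by simp [h1, h3], ?_⟩
    beta_reduce
    rw [h2, h4, div_add_div _ _ h1 h3]
    simp
  mul := by
    rintro f g x ⟨U, hU, hx, p, q, h⟩ ⟨U', hU', hx', p', q', h'⟩
    refine ⟨U ∩ U', @IsOpen.inter _ (zariski κ) _ _ hU hU', ⟨hx, hx'⟩, p * p', q * q',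
      fun y hy => ?_⟩
    obtain ⟨h1, h2⟩ := h y hy.1
    obtain ⟨h3, h4⟩ := h' y hy.2
    refine ⟨by simp [h1, h3], ?_⟩
    beta_reduce
    rw [h2, h4, div_mul_div_comm]
    simp

/-- The structure induced along a map `i : Y → X` (for `i` injective: the reduced subspace): a
function is regular if it is locally the restriction of a regular function of `X`. -/
def induced {X Y : Type} (i : Y → X) (S : FunSp X) : FunSp Y where
  top := S.top.induced i
  RegAt f y := ∃ F : X → ℂ, S.RegAt F (i y) ∧
    ∃ U : Set X, IsOpen[S.top] U ∧ i y ∈ U ∧ ∀ y', i y' ∈ U → f y' = F (i y')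
  const c y := ⟨fun _ => c, S.const c _, Set.univ, @isOpen_univ _ S.top, trivial, by simp⟩
  add := by
    rintro f g x ⟨F, hF, U, hU, hx, h⟩ ⟨F', hF', U', hU', hx', h'⟩
    exact ⟨_, S.add hF hF', U ∩ U', @IsOpen.inter _ S.top _ _ hU hU', ⟨hx, hx'⟩,
      fun y hy => by beta_reduce; rw [h y hy.1, h' y hy.2]⟩
  mul := by
    rintro f g x ⟨F, hF, U, hU, hx, h⟩ ⟨F', hF', U', hU', hx', h'⟩
    exact ⟨_, S.mul hF hF', U ∩ U', @IsOpen.inter _ S.top _ _ hU hU', ⟨hx, hx'⟩,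
      fun y hy => by beta_reduce; rw [h y hy.1, h' y hy.2]⟩

/-- The final structure for a family of maps `q a : X a → Y`: a set is open, a function is regular,
if all its pullbacks are. For one quotient map this is the quotient structure, for the inclusions
of an exhausting family of closed pieces it is the structure of an ind-variety. -/
def coinduced {ι : Type} {X : ι → Type} {Y : Type} (q : ∀ a, X a → Y) (S : ∀ a, FunSp (X a)) :
    FunSp Y where
  top := ⨆ a, (S a).top.coinduced (q a)
  RegAt f y := ∃ U : Set Y, IsOpen[⨆ a, (S a).top.coinduced (q a)] U ∧ y ∈ U ∧
    ∀ a x, q a x ∈ U → (S a).RegAt (fun x' => f (q a x')) x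
  const c y := ⟨Set.univ, @isOpen_univ _ (_), trivial, fun a x _ => (S a).const c x⟩
  add := by
    rintro f g x ⟨U, hU, hx, h⟩ ⟨U', hU', hx', h'⟩
    exact ⟨U ∩ U', @IsOpen.inter _ (_) _ _ hU hU', ⟨hx, hx'⟩,
      fun a y hy => (S a).add (h a y hy.1) (h' a y hy.2)⟩
  mul := by
    rintro f g x ⟨U, hU, hx, h⟩ ⟨U', hU', hx', h'⟩
    exact ⟨U ∩ U', @IsOpen.inter _ (_) _ _ hU hU', ⟨hx, hx'⟩,
      fun a y hy => (S a).mul (h a y hy.1) (h' a y hy.2)⟩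

/-- The quotient structure for one map. -/
def quotient {X Y : Type} (q : X → Y) (S : FunSp X) : FunSp Y :=
  coinduced (ι := Unit) (fun _ => q) (fun _ => S)

/-- The structure of a subvariety of an affine space embedded by the coordinates `c`. -/
def coord {X κ : Type} (c : X → κ → ℂ) : FunSp X := induced c (affine κ)

/-- Morphisms of spaces with functions. -/
def IsMor {X Y : Type} (S : FunSp X) (T : FunSp Y) (f : X → Y) : Prop :=
  (∀ U, IsOpen[T.top] U → IsOpen[S.top] (f ⁻¹' U)) ∧
    ∀ (g : Y → ℂ) (x : X), T.RegAt g (f x) → S.RegAt (fun x' => g (f x')) x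

/-- Isomorphisms of spaces with functions. -/
def IsIso {X Y : Type} (S : FunSp X) (T : FunSp Y) (f : X ≃ Y) : Prop :=
  IsMor S T f ∧ IsMor T S f.symm

end FunSp

/-! ### Equivariant coherent sheaves and their Grothendieck group -/

section Sheaves

variable {H Y : Type} [Group H] [MulAction H Y]

/-- A presheaf of modules over the structure sheaf, with an action of the abstract group `H`
compatible with the action on `Y`. For `s` a section over `U`, `map h U V _ s` is the translate
`h · s`, a section over `h U`, restricted to `V ⊆ h U`. -/
structure EqPre (H : Type) {Y : Type} [Group H] [MulAction H Y] (S : FunSp Y) where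
  sec : S.Op → Type
  [acg : ∀ U, AddCommGroup (sec U)]
  [mod : ∀ U, Module (S.O U.1) (sec U)]
  map : ∀ (h : H) (U V : S.Op), (∀ y ∈ V.1, h⁻¹ • y ∈ U.1) → sec U →+ sec V
  map_one : ∀ (U : S.Op) (hU) (s : sec U), map 1 U U hU s = s
  map_map : ∀ (h k : H) (U V W : S.Op) (hUV) (hVW) (hUW) (s : sec U),
    map h V W hVW (map k U V hUV s) = map (h * k) U W hUW s
  map_smul : ∀ (h : H) (U V : S.Op) (hUV : ∀ y ∈ V.1, h⁻¹ • y ∈ U.1) (f : S.O U.1) (f' : S.O V.1)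
    (s : sec U), (∀ y : V.1, f'.1 y = f.1 ⟨h⁻¹ • y.1, hUV y.1 y.2⟩) →
      map h U V hUV (f • s) = f' • map h U V hUV s

attribute [instance] EqPre.acg EqPre.mod

variable {S : FunSp Y}

/-- Restriction of sections. -/
def EqPre.res (F : EqPre H S) {U V : S.Op} (h : V.1 ⊆ U.1) : F.sec U →+ F.sec V :=
  F.map 1 U V fun y hy => by simpa using h hy

/-- Restriction of regular functions. -/
def resO (S : FunSp Y) {U V : Set Y} (h : V ⊆ U) (f : S.O U) : S.O V :=
  ⟨fun y => f.1 ⟨y.1, h y.2⟩, by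
    obtain ⟨F, hF, hf⟩ := f.2
    exact ⟨F, fun x hx => hF x (h hx), fun x => hf ⟨x.1, h x.2⟩⟩⟩

/-- An `H`-equivariant sheaf of modules on `Y`, for an algebraic group `H`. The algebraicity of the
action, which is the existence of an isomorphism between the pullbacks of the sheaf by the action
map and by the projection `H × Y → Y`, is expressed by `rational`: locally on `H × Y`, the section
`(h, y) ↦ (h · s)(y)` is a combination of sections `t k` pulled back from `Y` whose coefficients are
regular functions on `H × Y`, i.e., quotients of sums of products of regular functions on `H` and
on `Y`. -/
structure EqSheaf (SH : FunSp H) (S : FunSp Y) extends EqPre H S where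
  glue : ∀ (ι : Type) (U : ι → S.Op) (W : S.Op) (hU : ∀ a, (U a).1 ⊆ W.1)
    (_ : ∀ y ∈ W.1, ∃ a, y ∈ (U a).1) (s : ∀ a, sec (U a))
    (_ : ∀ (a b : ι) (V : S.Op) (ha : V.1 ⊆ (U a).1) (hb : V.1 ⊆ (U b).1),
      toEqPre.res ha (s a) = toEqPre.res hb (s b)),
    ∃! t : sec W, ∀ a, toEqPre.res (hU a) t = s a
  rational : ∀ (U : S.Op) (s : sec U) (h₀ : H) (y₀ : Y), h₀⁻¹ • y₀ ∈ U.1 →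
    ∃ (H₀ : SH.Op) (V : S.Op) (n m : ℕ) (t : Fin n → sec V)
      (a : Fin n → Fin m → H → ℂ) (b : Fin n → Fin m → S.O V.1)
      (c : Fin m → H → ℂ) (d : Fin m → S.O V.1) (hy₀ : y₀ ∈ V.1),
      h₀ ∈ H₀.1 ∧ (∀ k j, ∀ h ∈ H₀.1, SH.RegAt (a k j) h) ∧ (∀ j, ∀ h ∈ H₀.1, SH.RegAt (c j) h) ∧
      (∑ j, c j h₀ * (d j).1 ⟨y₀, hy₀⟩ ≠ 0) ∧
      ∀ h ∈ H₀.1, ∀ (V' : S.Op) (hV : V'.1 ⊆ V.1) (hU : ∀ y ∈ V'.1, h⁻¹ • y ∈ U.1),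
        (∀ y : V'.1, ∑ j, c j h * (d j).1 ⟨y.1, hV y.2⟩ ≠ 0) →
          resO S hV (∑ j, c j h • d j) • map h U V' hU s =
            ∑ k, resO S hV (∑ j, a k j h • b k j) • toEqPre.res hV (t k)

variable {SH : FunSp H}

/-- Coherence, i.e. local finite presentation (the spaces in question are locally noetherian): near
each point there are finitely many sections `t` that generate, and finitely many relations `r`
between them that generate all the relations. -/
def EqSheaf.IsCoherent (F : EqSheaf SH S) : Prop :=
  ∀ y : Y, ∃ (U : S.Op) (n m : ℕ) (t : Fin n → F.sec U) (r : Fin m → Fin n → S.O U.1), y ∈ U.1 ∧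
    (∀ (V : S.Op) (_ : V.1 ⊆ U.1) (s : F.sec V), ∀ x ∈ V.1,
      ∃ (V' : S.Op) (h' : V'.1 ⊆ V.1) (hU : V'.1 ⊆ U.1) (f : Fin n → S.O V'.1), x ∈ V'.1 ∧
        F.res h' s = ∑ k, f k • F.res hU (t k)) ∧
    (∀ l, ∑ k, r l k • t k = 0) ∧
    (∀ (V : S.Op) (hV : V.1 ⊆ U.1) (f : Fin n → S.O V.1), ∑ k, f k • F.res hV (t k) = 0 →
      ∀ x ∈ V.1, ∃ (V' : S.Op) (h' : V'.1 ⊆ V.1) (hU : V'.1 ⊆ U.1) (g : Fin m → S.O V'.1),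
        x ∈ V'.1 ∧ ∀ k, resO S h' (f k) = ∑ l, g l * resO S hU (r l k))

/-- Morphisms of equivariant sheaves. -/
structure EqHom (F G : EqSheaf SH S) where
  app : ∀ U : S.Op, F.sec U →+ G.sec U
  app_smul : ∀ (U : S.Op) (f : S.O U.1) (s : F.sec U), app U (f • s) = f • app U s
  app_map : ∀ (h : H) (U V : S.Op) (hUV) (s : F.sec U),
    app V (F.map h U V hUV s) = G.map h U V hUV (app U s)

/-- Short exact sequences `0 → F' → F → F'' → 0` of equivariant sheaves. -/
def IsSES {F' F F'' : EqSheaf SH S} (i : EqHom F' F) (p : EqHom F F'') : Prop :=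
  (∀ U, Function.Injective (i.app U)) ∧
  (∀ U (s : F.sec U), p.app U s = 0 ↔ ∃ s', i.app U s' = s) ∧
  (∀ (U : S.Op) (s : F''.sec U), ∀ y ∈ U.1, ∃ (V : S.Op) (hV : V.1 ⊆ U.1) (s' : F.sec V),
    y ∈ V.1 ∧ p.app V s' = F''.res hV s)

/-- `H`-equivariant coherent sheaves. -/
abbrev EqCoh (SH : FunSp H) (S : FunSp Y) : Type 1 := {F : EqSheaf SH S // F.IsCoherent}

/-- The complexified Grothendieck group `K^H(Y)` of equivariant coherent sheaves. -/
abbrev KGroup (SH : FunSp H) (S : FunSp Y) : Type 1 :=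
  (EqCoh SH S →₀ ℂ) ⧸ Submodule.span ℂ
    {v : EqCoh SH S →₀ ℂ | ∃ (F' F F'' : EqCoh SH S) (i : EqHom F'.1 F.1) (p : EqHom F.1 F''.1),
      IsSES i p ∧ v = Finsupp.single F 1 - Finsupp.single F' 1 - Finsupp.single F'' 1}

/-- The class of an equivariant coherent sheaf. -/
def KGroup.cls (F : EqCoh SH S) : KGroup SH S := Submodule.Quotient.mk (Finsupp.single F 1)

/-- `F₂` is the transport of `F₁` along a map `Ψ : Y₁ → Y₂` and a map of groups `φ : H₁ → H₂`
(both bijective in the applications). -/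
def IsTransport {H₁ Y₁ H₂ Y₂ : Type} [Group H₁] [MulAction H₁ Y₁] [Group H₂] [MulAction H₂ Y₂]
    {SH₁ : FunSp H₁} {S₁ : FunSp Y₁} {SH₂ : FunSp H₂} {S₂ : FunSp Y₂} (Ψ : Y₁ → Y₂) (φ : H₁ → H₂)
    (F₁ : EqSheaf SH₁ S₁) (F₂ : EqSheaf SH₂ S₂) : Prop :=
  ∃ e : ∀ (U₁ : S₁.Op) (U₂ : S₂.Op), U₁.1 = Ψ ⁻¹' U₂.1 → (F₁.sec U₁ ≃+ F₂.sec U₂),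
    (∀ U₁ U₂ hU (f₁ : S₁.O U₁.1) (f₂ : S₂.O U₂.1) (s : F₁.sec U₁),
      (∀ (y : Y₁) (h₁ : y ∈ U₁.1) (h₂ : Ψ y ∈ U₂.1), f₁.1 ⟨y, h₁⟩ = f₂.1 ⟨Ψ y, h₂⟩) →
        e U₁ U₂ hU (f₁ • s) = f₂ • e U₁ U₂ hU s) ∧
    (∀ (h : H₁) U₁ U₂ hU V₁ V₂ hV hUV₁ hUV₂ (s : F₁.sec U₁),
      e V₁ V₂ hV (F₁.map h U₁ V₁ hUV₁ s) = F₂.map (φ h) U₂ V₂ hUV₂ (e U₁ U₂ hU s))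

/-! ### Rational representations and induced sheaves -/

/-- A finite dimensional rational representation of the group `K`. -/
structure RatRep {K : Type} [Group K] (SK : FunSp K) where
  n : ℕ
  ρ : K →* GL (Fin n) ℂ
  rational : ∀ (i j : Fin n) (k : K), SK.RegAt (fun k' => (ρ k' : Matrix (Fin n) (Fin n) ℂ) i j) k

/-- Short exact sequences of representations. -/
def RatRep.IsSES {K : Type} [Group K] {SK : FunSp K} (V' V V'' : RatRep SK)
    (i : (Fin V'.n → ℂ) →ₗ[ℂ] (Fin V.n → ℂ)) (p : (Fin V.n → ℂ) →ₗ[ℂ] (Fin V''.n → ℂ)) : Prop :=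
  (∀ k v, i ((V'.ρ k).1.mulVec v) = (V.ρ k).1.mulVec (i v)) ∧
  (∀ k v, p ((V.ρ k).1.mulVec v) = (V''.ρ k).1.mulVec (p v)) ∧
  Function.Injective i ∧ Function.Surjective p ∧ LinearMap.range i = LinearMap.ker p

/-- The complexified representation ring `R_K` (as a vector space): the complexified Grothendieck
group of finite dimensional rational representations. -/
abbrev RepRing {K : Type} [Group K] (SK : FunSp K) : Type :=
  (RatRep SK →₀ ℂ) ⧸ Submodule.span ℂ
    {v : RatRep SK →₀ ℂ | ∃ (V' V V'' : RatRep SK) (i : _) (p : _), RatRep.IsSES V' V V'' i p ∧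
      v = Finsupp.single V 1 - Finsupp.single V' 1 - Finsupp.single V'' 1}

/-- The class of a representation. -/
def RepRing.cls {K : Type} [Group K] {SK : FunSp K} (V : RatRep SK) : RepRing SK :=
  Submodule.Quotient.mk (Finsupp.single V 1)

/-- `F` is (isomorphic to) the equivariant sheaf induced from the representation `V` of `K`, for a
principal `K`-bundle `q : P → Y`. Here `ka k p p'` means `p' = k · p` for the action of the
structure group `K`, and `ha h p p'` means `p' = h · p` for the action of `H` on `P`.
The sections of the vector bundle `P ×_K V` over `U` are the regular maps `s : q⁻¹(U) → V` with
`s (k · p) = k · s(p)`, and `H` acts on them by `(h · s) (p) = s (h⁻¹ · p)`. -/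
def IsInduced {K P : Type} [Group K] {SK : FunSp K} (SP : FunSp P) (q : P → Y)
    (ka : K → P → P → Prop) (ha : H → P → P → Prop) (V : RatRep SK) (F : EqSheaf SH S) : Prop :=
  ∃ e : ∀ U : S.Op, F.sec U → (q ⁻¹' U.1 → Fin V.n → ℂ),
    (∀ U, Function.Injective (e U)) ∧
    (∀ (U : S.Op) (s : q ⁻¹' U.1 → Fin V.n → ℂ), s ∈ Set.range (e U) ↔
      (∀ j, (fun p => s p j) ∈ SP.O (q ⁻¹' U.1)) ∧
      ∀ (k : K) (p p' : q ⁻¹' U.1), ka k p p' → s p' = (V.ρ k).1.mulVec (s p)) ∧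
    (∀ U s s', e U (s + s') = e U s + e U s') ∧
    (∀ (U : S.Op) (f : S.O U.1) (s : F.sec U) (p : q ⁻¹' U.1),
      e U (f • s) p = f.1 ⟨q p.1, p.2⟩ • e U s p) ∧
    (∀ (h : H) (U W : S.Op) hUW (s : F.sec U) (p : q ⁻¹' U.1) (p' : q ⁻¹' W.1), ha h p p' →
      e W (F.map h U W hUW s) p' = e U s p)

end Sheaves

/-! ### Laurent series, loop rotation, and general linear groups over them -/

/-- The field `ℂ((z))`. -/
abbrev LS : Type := LaurentSeries ℂ

/-- `ℂ((z))ⁿ`. -/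
abbrev KV (n : ℕ) : Type := Fin n → LS

/-- The series `f(c z)`. -/
def rotFun (c : ℂˣ) (f : LS) : LS where
  coeff n := ((c ^ n : ℂˣ) : ℂ) * f.coeff n
  isPWO_support' := f.isPWO_support.mono fun n hn => by
    simp only [Function.mem_support] at hn
    exact right_ne_zero_of_mul hn

@[simp] theorem rotFun_coeff (c : ℂˣ) (f : LS) (n : ℤ) :
    (rotFun c f).coeff n = ((c ^ n : ℂˣ) : ℂ) * f.coeff n := rfl

theorem rotFun_support (c : ℂˣ) (f : LS) : (rotFun c f).support = f.support := by
  ext n; simp [HahnSeries.mem_support, zpow_ne_zero]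

theorem rotFun_mul (c : ℂˣ) (f g : LS) : rotFun c (f * g) = rotFun c f * rotFun c g := by
  ext n
  rw [rotFun_coeff, HahnSeries.coeff_mul, HahnSeries.coeff_mul, Finset.mul_sum]
  simp only [rotFun_support]
  refine Finset.sum_congr rfl fun ij hij => ?_
  rw [Finset.mem_antidiagonal] at hij
  rw [rotFun_coeff, rotFun_coeff, ← hij.2.2, zpow_add, Units.val_mul]
  ring

/-- The loop rotation `f(z) ↦ f(c z)` on `ℂ((z))`. -/
def rot : ℂˣ →* RingAut LS where
  toFun c :=
    { toFun := rotFun c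
      invFun := rotFun c⁻¹
      left_inv := fun f => by
        ext n
        rw [rotFun_coeff, rotFun_coeff, ← mul_assoc, ← Units.val_mul, ← mul_zpow]
        simp
      right_inv := fun f => by
        ext n
        rw [rotFun_coeff, rotFun_coeff, ← mul_assoc, ← Units.val_mul, ← mul_zpow]
        simp
      map_mul' := rotFun_mul c
      map_add' := fun f g => by
        ext n
        simp only [rotFun_coeff, HahnSeries.coeff_add, mul_add] }
  map_one' := by
    ext f n
    change (rotFun 1 f).coeff n = f.coeff n
    simp
  map_mul' c c' := by
    ext f n
    change (rotFun (c * c') f).coeff n = (rotFun c (rotFun c' f)).coeff n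
    simp only [rotFun_coeff, mul_zpow, Units.val_mul, mul_assoc]

@[simp] theorem rot_coeff (c : ℂˣ) (f : LS) (n : ℤ) :
    (rot c f).coeff n = ((c ^ n : ℂˣ) : ℂ) * f.coeff n := rfl

/-- The embedding `f(z) ↦ f(z ^ p)`, for `p > 0`. -/
def powEmb (p : ℤ) (hp : 0 < p) : LS →+* LS :=
  HahnSeries.embDomainRingHom (AddMonoidHom.mulLeft p)
    (fun a b h => by simpa [hp.ne'] using h)
    (fun a b => by simp [hp])

theorem powEmb_coeff_mul (p : ℤ) (hp : 0 < p) (f : LS) (m : ℤ) :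
    (powEmb p hp f).coeff (p * m) = f.coeff m :=
  HahnSeries.embDomain_coeff

theorem powEmb_coeff_of_ne (p : ℤ) (hp : 0 < p) (f : LS) (n : ℤ) (h : ¬ ∃ m, p * m = n) :
    (powEmb p hp f).coeff n = 0 :=
  HahnSeries.embDomain_of_notMem_range (by rintro ⟨m, hm⟩; exact h ⟨m, hm⟩)

theorem rot_powEmb (c : ℂˣ) (p : ℤ) (hp : 0 < p) (f : LS) :
    rot c (powEmb p hp f) = powEmb p hp (rot (c ^ p) f) := by
  ext n
  by_cases h : ∃ m, p * m = n
  · obtain ⟨m, rfl⟩ := h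
    rw [rot_coeff, powEmb_coeff_mul, powEmb_coeff_mul, rot_coeff, zpow_mul]
  · rw [rot_coeff, powEmb_coeff_of_ne p hp _ n h, powEmb_coeff_of_ne p hp _ n h, mul_zero]

/-- The uniformizer `z` as a unit. -/
def zU : LSˣ where
  val := HahnSeries.single 1 1
  inv := HahnSeries.single (-1) 1
  val_inv := by simp
  inv_val := by simp

/-- Nonzero constants as units of `ℂ((z))`. -/
def constU : ℂˣ →* LSˣ := Units.map ((HahnSeries.C : ℂ →+* LS) : ℂ →* LS)

/-- Diagonal matrices. -/
def diagGL {n R : Type} [Fintype n] [DecidableEq n] [CommRing R] : (n → Rˣ) →* GL n R :=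
  (Units.map (Matrix.diagonalRingHom n R : (n → R) →* Matrix n n R)).comp
    (MulEquiv.piUnits (M := fun _ : n => R)).symm.toMonoidHom

theorem smul_eq_C_mul (c : ℂ) (f : LS) : c • f = HahnSeries.C c * f := by
  ext n; simp

/-- The tautological action of `GL_n(ℂ((z)))` on `ℂ((z))ⁿ`, as `ℂ`-linear maps. -/
def glAct (n : ℕ) : GL (Fin n) LS →* (KV n ≃ₗ[ℂ] KV n) where
  toFun g :=
    { toFun := fun v => (g : Matrix (Fin n) (Fin n) LS).mulVec v
      invFun := fun v => ((g⁻¹ : GL (Fin n) LS) : Matrix (Fin n) (Fin n) LS).mulVec v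
      left_inv := fun v => by simp [Matrix.mulVec_mulVec]
      right_inv := fun v => by simp [Matrix.mulVec_mulVec]
      map_add' := fun v w => Matrix.mulVec_add _ v w
      map_smul' := fun c v => by
        have h : ∀ w : KV n, c • w = (HahnSeries.C c : LS) • w := fun w => by
          funext k; exact smul_eq_C_mul c (w k)
        simp only [h, Matrix.mulVec_smul, RingHom.id_apply] }
  map_one' := by ext1 v; exact Matrix.one_mulVec v
  map_mul' g h := by ext1 v; exact (Matrix.mulVec_mulVec v _ _).symm

theorem glAct_apply (n : ℕ) (g : GL (Fin n) LS) (v : KV n) :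
    glAct n g v = (g : Matrix (Fin n) (Fin n) LS).mulVec v := rfl

/-- The loop rotation on `ℂ((z))ⁿ` with a shift `s`: `τ` acts on `ℂⁿ ⊗ z ^ m` by
`τ ^ (s + m e)`. -/
def rotV (s e : ℤ) (n : ℕ) : ℂˣ →* (KV n ≃ₗ[ℂ] KV n) where
  toFun τ :=
    { toFun := fun v k => ((τ ^ s : ℂˣ) : ℂ) • rot (τ ^ e) (v k)
      invFun := fun v k => ((τ⁻¹ ^ s : ℂˣ) : ℂ) • rot (τ⁻¹ ^ e) (v k)
      left_inv := fun v => by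
        funext k; ext m
        simp only [HahnSeries.coeff_smul, rot_coeff, smul_eq_mul, inv_zpow, Units.val_inv_eq_inv_val]
        have h1 := (τ ^ s).ne_zero
        have h2 := ((τ ^ e) ^ m).ne_zero
        field_simp
      right_inv := fun v => by
        funext k; ext m
        simp only [HahnSeries.coeff_smul, rot_coeff, smul_eq_mul, inv_zpow, Units.val_inv_eq_inv_val]
        have h1 := (τ ^ s).ne_zero
        have h2 := ((τ ^ e) ^ m).ne_zero
        field_simp
      map_add' := fun v w => by funext k; simp
      map_smul' := fun c v => by
        funext k; ext m
        simp only [Pi.smul_apply, HahnSeries.coeff_smul, rot_coeff, smul_eq_mul, RingHom.id_apply]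
        ring }
  map_one' := by ext1 v; funext k; ext m; simp
  map_mul' τ τ' := by
    ext1 v; funext k; ext m
    simp only [LinearEquiv.coe_mk, LinearMap.coe_mk, AddHom.coe_mk, LinearEquiv.mul_apply,
      HahnSeries.coeff_smul, rot_coeff, smul_eq_mul, mul_zpow, Units.val_mul]
    ring

theorem rotV_apply (s e : ℤ) (n : ℕ) (τ : ℂˣ) (v : KV n) (k : Fin n) :
    rotV s e n τ v k = ((τ ^ s : ℂˣ) : ℂ) • rot (τ ^ e) (v k) := rfl

/-- The loop rotation on `GL_n(ℂ((z)))`. -/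
def rotGL (n : ℕ) (c : ℂˣ) : GL (Fin n) LS ≃* GL (Fin n) LS :=
  Units.mapEquiv ((RingEquiv.mapMatrix (rot c))).toMulEquiv

theorem rotGL_apply (n : ℕ) (c : ℂˣ) (g : GL (Fin n) LS) (s t : Fin n) :
    (rotGL n c g : Matrix (Fin n) (Fin n) LS) s t =
      rot c ((g : Matrix (Fin n) (Fin n) LS) s t) := rfl

theorem rotV_glAct (s e : ℤ) (n : ℕ) (τ : ℂˣ) (g : GL (Fin n) LS) :
    rotV s e n τ * glAct n g = glAct n (rotGL n (τ ^ e) g) * rotV s e n τ := by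
  ext1 v
  funext k
  simp only [LinearEquiv.mul_apply, rotV_apply, glAct_apply, Matrix.mulVec, dotProduct, rotGL_apply,
    map_sum, map_mul, Finset.smul_sum, smul_eq_C_mul, mul_left_comm]

/-! ### Cartan data and quivers -/

/-- An indecomposable Cartan matrix of finite type with a symmetrizer without common factor. -/
structure CartanDatum (I : Type) [Fintype I] [DecidableEq I] where
  c : Matrix I I ℤ
  d : I → ℕ
  c_diag : ∀ i, c i i = 2
  c_offdiag : ∀ i j, i ≠ j → c i j ≤ 0
  d_pos : ∀ i, 0 < d i
  symm : ∀ i j, (d i : ℤ) * c i j = (d j : ℤ) * c j i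
  finite_type : (Matrix.of fun i j => ((d i : ℝ) * (c i j : ℝ))).PosDef
  indecomposable : ∀ s : Set I, s.Nonempty → sᶜ.Nonempty → ∃ i ∈ s, ∃ j ∈ sᶜ, c i j ≠ 0
  coprime : Finset.univ.gcd d = 1

/-- The data fixed throughout: a Cartan datum; a parity of the vertices for which the Dynkin diagram
is bipartite, such that the arrows of the quiver, which point from even to odd vertices, never
point from a vertex `i` to a vertex `j` with `d j < d i`; a base point of the equivalence class
`⁰I`; the numbers `2 σ_i`, used to twist the loop rotation; the dimension vectors `a` and `l` of
`V` and `W`. -/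
structure Datum (I : Type) [Fintype I] [DecidableEq I] extends CartanDatum I where
  odd : I → Prop
  bipartite : ∀ i j, c i j < 0 → (odd i ↔ ¬ odd j)
  oriented : ∀ i j, c i j < 0 → ¬ odd i → odd j → d i ≤ d j
  base : I × ℤ
  twoσ : I → ℤ
  twoσ_eq : ∀ i j, c i j < 0 → ¬ odd i → odd j →
    (d i : ℤ) * c i j = twoσ i - twoσ j - 2 * (d i : ℤ) + 2 * (d j : ℤ)
  a : I → ℕ
  l : I → ℕ

variable {I : Type} [Fintype I] [DecidableEq I]

namespace Datum

variable (D : Datum I)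

/-- The symmetrized Cartan matrix `b_{ij} = d_i c_{ij}`. -/
def b (i j : I) : ℤ := (D.d i : ℤ) * D.c i j

/-- The arrows `i → j` of the quiver `Q`. -/
def E (i j : I) : Prop := D.c i j < 0 ∧ ¬ D.odd i ∧ D.odd j

/-- The type of arrows of `Q`. -/
abbrev Arr : Type := {e : I × I // D.E e.1 e.2}

theorem E.neg_c {D : Datum I} {i j : I} (h : D.E i j) : 0 < - D.c i j := by have := h.1; omega

theorem E.neg_c' {D : Datum I} {i j : I} (h : D.E i j) : 0 < - D.c j i := by
  have h1 := h.neg_c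
  have h2 := D.symm i j
  have hi : (0 : ℤ) < D.d i := by exact_mod_cast D.d_pos i
  have hj : (0 : ℤ) < D.d j := by exact_mod_cast D.d_pos j
  by_contra hc
  have : 0 ≤ (D.d j : ℤ) * D.c j i := mul_nonneg hj.le (by omega)
  nlinarith

/-! ### The BFN space -/

/-- `G_K`. -/
abbrev GK : Type := ∀ i, GL (Fin (D.a i)) LS

/-- The subgroup `G_O`. -/
def GO : Subgroup D.GK :=
  Subgroup.pi Set.univ fun i =>
    (Matrix.GeneralLinearGroup.map (n := Fin (D.a i)) (HahnSeries.ofPowerSeries ℤ ℂ)).range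

/-- The loop rotation on `G_K`: `τ` acts by `z_i ↦ τ ^ (2 d_i) z_i`. Here and below the rotation
group `𝔾_m` is parametrized by the coordinate `τ` of its double cover, the point of the rotation
group being `τ ^ 2`; this makes sense of the half-integral weights `σ_i`. -/
def rotGK : ℂˣ →* MulAut D.GK where
  toFun τ := MulEquiv.piCongrRight fun i => rotGL (D.a i) (τ ^ (2 * (D.d i : ℤ)))
  map_one' := by
    refine MulEquiv.ext fun g => funext fun i => Units.ext (Matrix.ext fun s t => ?_)
    change rot _ _ = _
    rw [one_zpow, map_one]
    rfl
  map_mul' τ τ' := by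
    refine MulEquiv.ext fun g => funext fun i => Units.ext (Matrix.ext fun s t => ?_)
    change rot _ _ = rot _ (rot _ _)
    rw [mul_zpow, map_mul]
    rfl

/-- `G̃_K`, the semidirect product of `G_K` and the rotation group. -/
abbrev GKt : Type := D.GK ⋊[D.rotGK] ℂˣ

/-- The torus `T_W`. -/
abbrev TW : Type := ∀ i, Fin (D.l i) → ℂˣ

/-- `Ġ_K = G̃_K × T_W`. -/
abbrev Gdot : Type := D.GKt × D.TW

/-- The action of `G̃_K` on `V_{i,K}`; the rotation acts on `V_i ⊗ z_i ^ n` by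
`τ ^ (2 (σ_i + n d_i))`. -/
def LV (i : I) : D.GKt →* (KV (D.a i) ≃ₗ[ℂ] KV (D.a i)) :=
  SemidirectProduct.lift ((glAct (D.a i)).comp (Pi.evalMonoidHom _ i))
    (rotV (D.twoσ i) (2 * (D.d i : ℤ)) (D.a i)) (by
      intro τ
      ext1 g
      change glAct _ (rotGL (D.a i) (τ ^ (2 * (D.d i : ℤ))) (g i)) = _ * glAct _ (g i) * _⁻¹
      rw [rotV_glAct, mul_inv_cancel_right])

/-- The action of the rotation group and of `T_W` on `W_{i,K}`. -/
def LW (i : I) : D.Gdot →* (KV (D.l i) ≃ₗ[ℂ] KV (D.l i)) where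
  toFun x := glAct (D.l i) (diagGL fun s => constU (x.2 i s)) *
    rotV (D.twoσ i) (2 * (D.d i : ℤ)) (D.l i) x.1.right
  map_one' := by
    have : (fun s => constU ((1 : D.Gdot).2 i s)) = (1 : Fin (D.l i) → LSˣ) := by
      funext s; simp
    rw [this, map_one, map_one, one_mul]
    exact map_one _
  map_mul' x y := by
    have h1 : (fun s => constU ((x * y).2 i s)) =
        (fun s => constU (x.2 i s)) * (fun s => constU (y.2 i s)) := by
      funext s; simp
    have h2 : ∀ c : ℂˣ, rotGL (D.l i) c (diagGL fun s => constU (y.2 i s)) =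
        diagGL fun s => constU (y.2 i s) := by
      intro c
      ext s t : 2
      rw [rotGL_apply]
      change rot c (Matrix.diagonal (fun s => ((constU (y.2 i s) : LSˣ) : LS)) s t) =
        Matrix.diagonal (fun s => ((constU (y.2 i s) : LSˣ) : LS)) s t
      rcases eq_or_ne s t with rfl | hst
      · rw [Matrix.diagonal_apply_eq]
        ext n
        rw [rot_coeff]
        change _ * (HahnSeries.C _ : LS).coeff n = (HahnSeries.C _ : LS).coeff n
        rcases eq_or_ne n 0 with rfl | hn
        · simp
        · simp [HahnSeries.C_apply, HahnSeries.coeff_single_of_ne hn]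
      · rw [Matrix.diagonal_apply_ne _ hst, map_zero]
    have h3 : (x * y).1.right = x.1.right * y.1.right := rfl
    rw [h1, map_mul, map_mul, h3, map_mul, mul_assoc, mul_assoc]
    congr 1
    rw [← mul_assoc, ← mul_assoc, rotV_glAct, h2]

end Datum

/-- Compatibility of a `ℂ`-linear map with the loop rotation of scalars. -/
def IsSemi {n : ℕ} (L : KV n ≃ₗ[ℂ] KV n) (c : ℂˣ) : Prop :=
  ∀ (f : LS) (v : KV n), L (f • v) = rot c f • L v

theorem isSemi_glAct {n : ℕ} (g : GL (Fin n) LS) : IsSemi (glAct n g) 1 := by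
  intro f v
  rw [glAct_apply, glAct_apply, Matrix.mulVec_smul, map_one]
  rfl

theorem isSemi_rotV (s e : ℤ) {n : ℕ} (τ : ℂˣ) : IsSemi (rotV s e n τ) (τ ^ e) := by
  intro f v
  funext k
  simp only [rotV_apply, Pi.smul_apply, smul_eq_mul, map_mul, smul_eq_C_mul]
  ring

theorem IsSemi.mul {n : ℕ} {L M : KV n ≃ₗ[ℂ] KV n} {c c' : ℂˣ} (hL : IsSemi L c)
    (hM : IsSemi M c') : IsSemi (L * M) (c * c') := by
  intro f v
  rw [LinearEquiv.mul_apply, hM, hL, map_mul]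
  rfl

theorem IsSemi.inv_apply {n : ℕ} {L : KV n ≃ₗ[ℂ] KV n} {c : ℂˣ} (hL : IsSemi L c) (f : LS)
    (v : KV n) : L⁻¹ (f • v) = rot c⁻¹ f • L⁻¹ v := by
  apply L.injective
  rw [hL]
  have h : ∀ w, L (L⁻¹ w) = w := fun w => L.apply_symm_apply w
  rw [h, h, map_inv]
  congr 1
  exact ((rot c).apply_symm_apply f).symm

/-- The space of `ℂ((z))`-linear maps from `ℂ((x))ᵐ` to `ℂ((y))ⁿ`, where `z = x ^ p = y ^ q`. -/
def HomZ (p q : ℤ) (hp : 0 < p) (hq : 0 < q) (m n : ℕ) : Submodule ℂ (KV m →ₗ[ℂ] KV n) where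
  carrier := {B | ∀ (f : LS) (v : KV m), B (powEmb p hp f • v) = powEmb q hq f • B v}
  add_mem' := by
    intro B B' h h' f v
    rw [LinearMap.add_apply, LinearMap.add_apply, h, h']
    funext k
    exact (mul_add _ _ _).symm
  zero_mem' := by intro f v; simp
  smul_mem' := by
    intro c B h f v
    rw [LinearMap.smul_apply, LinearMap.smul_apply, h]
    funext k
    simp only [Pi.smul_apply, smul_eq_mul, smul_eq_C_mul]
    ring

theorem conj_mem_HomZ {p q : ℤ} {hp : 0 < p} {hq : 0 < q} {m n : ℕ} {B : KV m →ₗ[ℂ] KV n}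
    (hB : B ∈ HomZ p q hp hq m n) {L : KV n ≃ₗ[ℂ] KV n} {M : KV m ≃ₗ[ℂ] KV m} {c c' : ℂˣ}
    (hL : IsSemi L c) (hM : IsSemi M c') (h : c ^ q = c' ^ p) :
    L.toLinearMap ∘ₗ B ∘ₗ (M⁻¹).toLinearMap ∈ HomZ p q hp hq m n := by
  intro f v
  simp only [LinearMap.comp_apply, LinearEquiv.coe_coe]
  rw [hM.inv_apply, rot_powEmb, hB, hL, rot_powEmb, h, inv_zpow, map_inv]
  congr 2
  exact (rot (c' ^ p)).apply_symm_apply f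

/-- `f ∈ z⁻ᴺ ℂ[[z]]`. -/
def IsBdd (N : ℕ) (f : LS) : Prop := ∀ n : ℤ, n < - (N : ℤ) → f.coeff n = 0

/-- A linear map that maps integral vectors into `z⁻ᴺ` times integral vectors. -/
def HomBdd (N : ℕ) {m n : ℕ} (B : KV m →ₗ[ℂ] KV n) : Prop :=
  ∀ v, (∀ t, IsBdd 0 (v t)) → ∀ s, IsBdd N (B v s)

namespace Datum

variable (D : Datum I)

theorem isSemi_LV (i : I) (x : D.GKt) : IsSemi (D.LV i x) (x.right ^ (2 * (D.d i : ℤ))) := by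
  have := (isSemi_glAct (x.left i)).mul
    (isSemi_rotV (D.twoσ i) (2 * (D.d i : ℤ)) (n := D.a i) x.right)
  rwa [one_mul] at this

theorem isSemi_LW (i : I) (x : D.Gdot) : IsSemi (D.LW i x) (x.1.right ^ (2 * (D.d i : ℤ))) := by
  have := (isSemi_glAct (diagGL fun s => constU (x.2 i s))).mul
    (isSemi_rotV (D.twoσ i) (2 * (D.d i : ℤ)) (n := D.l i) x.1.right)
  rwa [one_mul] at this

/-- `N_K`: pairs `(A, B)` with `A_i : W_{i,K} → V_{i,K}` linear over `ℂ((z_i))`, and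
`B_{ji} : V_{i,K} → V_{j,K}` linear over `ℂ((z))`, `z = z_i ^ (-c_{ij}) = z_j ^ (-c_{ji})`, for each
arrow `i → j`. -/
@[ext] structure NK where
  A : ∀ i, HomZ 1 1 one_pos one_pos (D.l i) (D.a i)
  B : ∀ e : D.Arr, HomZ (- D.c e.1.1 e.1.2) (- D.c e.1.2 e.1.1) e.2.neg_c e.2.neg_c'
    (D.a e.1.1) (D.a e.1.2)

/-- `z⁻ᴺ N_O`. -/
def NObdd (N : ℕ) : Set D.NK :=
  {n | (∀ i, HomBdd N (n.A i).1) ∧ ∀ e, HomBdd N (n.B e).1}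

/-- `N_O`: the maps that preserve the standard lattices. -/
def NO : Set D.NK := D.NObdd 0

/-- The action of `Ġ_K` on `N_K` by conjugation. -/
def actNK (x : D.Gdot) (n : D.NK) : D.NK where
  A i := ⟨(D.LV i x.1).toLinearMap ∘ₗ (n.A i).1 ∘ₗ ((D.LW i x)⁻¹).toLinearMap,
    conj_mem_HomZ (n.A i).2 (D.isSemi_LV i x.1) (D.isSemi_LW i x) rfl⟩
  B e := ⟨(D.LV e.1.2 x.1).toLinearMap ∘ₗ (n.B e).1 ∘ₗ ((D.LV e.1.1 x.1)⁻¹).toLinearMap,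
    conj_mem_HomZ (n.B e).2 (D.isSemi_LV e.1.2 x.1) (D.isSemi_LV e.1.1 x.1) (by
      rw [← zpow_mul, ← zpow_mul]
      congr 1
      linear_combination 2 * D.symm e.1.1 e.1.2)⟩

theorem actNK_A (x : D.Gdot) (n : D.NK) (i : I) (v : KV (D.l i)) :
    ((D.actNK x n).A i).1 v = D.LV i x.1 ((n.A i).1 ((D.LW i x)⁻¹ v)) := rfl

theorem actNK_B (x : D.Gdot) (n : D.NK) (e : D.Arr) (v : KV (D.a e.1.1)) :
    ((D.actNK x n).B e).1 v = D.LV e.1.2 x.1 ((n.B e).1 ((D.LV e.1.1 x.1)⁻¹ v)) := rfl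

instance : MulAction D.Gdot D.NK where
  smul := D.actNK
  one_smul n := by
    change D.actNK 1 n = n
    refine NK.ext (funext fun i => Subtype.ext (LinearMap.ext fun v => ?_))
      (funext fun e => Subtype.ext (LinearMap.ext fun v => ?_))
    · rw [actNK_A, Prod.fst_one, map_one, map_one, inv_one]
      rfl
    · rw [actNK_B, Prod.fst_one, map_one, map_one, inv_one]
      rfl
  mul_smul x y n := by
    change D.actNK (x * y) n = D.actNK x (D.actNK y n)
    refine NK.ext (funext fun i => Subtype.ext (LinearMap.ext fun v => ?_))
      (funext fun e => Subtype.ext (LinearMap.ext fun v => ?_))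
    · rw [actNK_A, actNK_A, actNK_A, Prod.fst_mul, map_mul, map_mul, mul_inv_rev,
        LinearEquiv.mul_apply, LinearEquiv.mul_apply]
    · rw [actNK_B, actNK_B, actNK_B, Prod.fst_mul, map_mul, map_mul, mul_inv_rev,
        LinearEquiv.mul_apply, LinearEquiv.mul_apply]

/-- The inclusion of `G̃_K` in `Ġ_K`. -/
def incl : D.GKt →* D.Gdot := MonoidHom.inl _ _

/-- The inclusion of `G_K` in `Ġ_K`. -/
def inclGK : D.GK →* D.Gdot := D.incl.comp SemidirectProduct.inl

theorem rot_isBdd {N : ℕ} {f : LS} (h : IsBdd N f) (c : ℂˣ) : IsBdd N (rot c f) := fun n hn => by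
  rw [rot_coeff, h n hn, mul_zero]

theorem rotV_isBdd (s e : ℤ) {n N : ℕ} (τ : ℂˣ) {v : KV n} (h : ∀ t, IsBdd N (v t)) (t : Fin n) :
    IsBdd N (rotV s e n τ v t) := fun k hk => by
  rw [rotV_apply, HahnSeries.coeff_smul, rot_isBdd (h t) _ k hk, smul_zero]

theorem diag_isBdd {n N : ℕ} (u : Fin n → ℂˣ) {v : KV n} (h : ∀ t, IsBdd N (v t)) (t : Fin n) :
    IsBdd N (glAct n (diagGL fun s => constU (u s)) v t) := fun k hk => by
  change ((Matrix.diagonal fun s => ((constU (u s) : LSˣ) : LS)).mulVec v t).coeff k = 0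
  rw [Matrix.mulVec_diagonal]
  change ((HahnSeries.C _ : LS) * _).coeff k = 0
  rw [← smul_eq_C_mul, HahnSeries.coeff_smul, h t k hk, smul_zero]

/-- The rotation group and `T_W` preserve `N_O`. -/
theorem smul_mem_NO (τ : ℂˣ) (u : D.TW) {n : D.NK} (hn : n ∈ D.NO) :
    ((SemidirectProduct.inr τ, u) : D.Gdot) • n ∈ D.NO := by
  have hV : ∀ i (v : KV (D.a i)), D.LV i (SemidirectProduct.inr τ) v =
      rotV (D.twoσ i) (2 * (D.d i : ℤ)) (D.a i) τ v := by
    intro i v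
    rw [LV, SemidirectProduct.lift_inr]
  have hVi : ∀ i (v : KV (D.a i)), (D.LV i (SemidirectProduct.inr τ))⁻¹ v =
      rotV (D.twoσ i) (2 * (D.d i : ℤ)) (D.a i) τ⁻¹ v := by
    intro i v
    rw [← map_inv, ← map_inv, LV, SemidirectProduct.lift_inr]
  have hWi : ∀ i (v : KV (D.l i)), (∀ t, IsBdd 0 (v t)) →
      ∀ t, IsBdd 0 ((D.LW i (SemidirectProduct.inr τ, u))⁻¹ v t) := by
    intro i v hv t
    have : ((SemidirectProduct.inr τ, u) : D.Gdot)⁻¹ = (SemidirectProduct.inr τ⁻¹, u⁻¹) := by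
      rw [map_inv]; rfl
    rw [← map_inv, this]
    exact diag_isBdd (u⁻¹ i) (rotV_isBdd _ _ _ hv) t
  refine ⟨fun i v hv s => ?_, fun e v hv s => ?_⟩
  · change IsBdd 0 (D.LV i (SemidirectProduct.inr τ) ((n.A i).1 (_)) s)
    rw [hV]
    exact rotV_isBdd _ _ _ (hn.1 i _ (hWi i v hv)) s
  · change IsBdd 0 (D.LV _ (SemidirectProduct.inr τ) ((n.B e).1
      ((D.LV _ (SemidirectProduct.inr τ))⁻¹ v)) s)
    rw [hV, hVi]
    exact rotV_isBdd _ _ _ (hn.2 e _ (rotV_isBdd _ _ _ hv)) s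

theorem rotGK_mem_GO (τ : ℂˣ) {g : D.GK} (hg : g ∈ D.GO) : D.rotGK τ g ∈ D.GO := by
  intro i hi
  obtain ⟨h, hh⟩ := hg i hi
  refine ⟨Matrix.GeneralLinearGroup.map (PowerSeries.rescale ((τ ^ (2 * (D.d i : ℤ)) : ℂˣ) : ℂ)) h,
    ?_⟩
  change _ = rotGL (D.a i) _ (g i)
  rw [← hh]
  ext s t : 2
  rw [rotGL_apply]
  change HahnSeries.ofPowerSeries ℤ ℂ (PowerSeries.rescale _ _) =
    rot _ (HahnSeries.ofPowerSeries ℤ ℂ _)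
  ext n
  rw [rot_coeff]
  by_cases hn : 0 ≤ n
  · lift n to ℕ using hn
    have key := fun f : PowerSeries ℂ => HahnSeries.ofPowerSeries_apply_coeff (Γ := ℤ) f n
    rw [key, key, PowerSeries.coeff_rescale]
    simp
  · have key : ∀ f : PowerSeries ℂ, (HahnSeries.ofPowerSeries ℤ ℂ f).coeff n = 0 := fun f => by
      rw [HahnSeries.ofPowerSeries_apply]
      refine HahnSeries.embDomain_of_notMem_range ?_
      rintro ⟨m, hm⟩
      exact hn (by rw [← hm]; exact Int.natCast_nonneg m)
    rw [key, key, mul_zero]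

/-- The affine Grassmannian. -/
abbrev Gr : Type := D.GK ⧸ D.GO

instance : MulAction D.GKt D.Gr where
  smul x := Quotient.map' (fun g => x.left * D.rotGK x.right g) fun g h hgh => by
    rw [QuotientGroup.leftRel_apply] at hgh ⊢
    have := D.rotGK_mem_GO x.right hgh
    simpa [mul_assoc] using this
  one_smul t := by
    induction t using QuotientGroup.induction_on with
    | H g =>
      change (((1 : D.GK) * D.rotGK 1 g : D.GK) : D.Gr) = _
      rw [map_one, one_mul]
      rfl
  mul_smul x y t := by
    induction t using QuotientGroup.induction_on with
    | H g =>
      change (((x * y).left * D.rotGK (x * y).right g : D.GK) : D.Gr) =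
        ((x.left * D.rotGK x.right (y.left * D.rotGK y.right g) : D.GK) : D.Gr)
      rw [SemidirectProduct.mul_left, SemidirectProduct.mul_right, map_mul, map_mul, mul_assoc]
      rfl

theorem smul_mk (x : D.GKt) (g : D.GK) :
    x • (g : D.Gr) = ((x.left * D.rotGK x.right g : D.GK) : D.Gr) := rfl

/-- The space `𝒯 = G_K ×_{G_O} N_O`, identified with the set of pairs `([g], n)` in `Gr × N_K` such
that `n ∈ g · N_O`. Its algebraic structure is defined further below through the quotient map
`G_K × N_O → 𝒯`. -/
abbrev T : Type := {t : D.Gr × D.NK // ∃ g : D.GK, (g : D.Gr) = t.1 ∧ (D.inclGK g)⁻¹ • t.2 ∈ D.NO}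

instance : MulAction D.Gdot D.T where
  smul x t := ⟨(x.1 • t.1.1, x • t.1.2), by
    obtain ⟨g, hg, hn⟩ := t.2
    refine ⟨x.1.left * D.rotGK x.1.right g, by rw [← hg, smul_mk], ?_⟩
    have e : (D.inclGK (x.1.left * D.rotGK x.1.right g))⁻¹ * x =
        ((SemidirectProduct.inr x.1.right, x.2) : D.Gdot) * (D.inclGK g)⁻¹ := by
      rw [inv_mul_eq_iff_eq_mul, ← mul_assoc, eq_mul_inv_iff_mul_eq]
      refine Prod.ext ?_ ?_
      · refine SemidirectProduct.ext ?_ ?_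
        · simp [inclGK, incl]
        · simp [inclGK, incl]
      · simp [inclGK, incl]
    rw [← mul_smul, e, mul_smul]
    exact D.smul_mem_NO _ _ hn⟩
  one_smul t := Subtype.ext (Prod.ext (one_smul _ t.1.1) (one_smul _ t.1.2))
  mul_smul x y t := Subtype.ext (Prod.ext (mul_smul x.1 y.1 t.1.1) (mul_smul x y t.1.2))

/-- The map `π : 𝒯 → N_K`. -/
def π (t : D.T) : D.NK := t.1.2

/-- The quotient map `G_K × N_O → 𝒯`. -/
def qT (p : D.GK × D.NO) : D.T :=
  ⟨((p.1 : D.Gr), D.inclGK p.1 • p.2.1), p.1, rfl, by rw [inv_smul_smul]; exact p.2.2⟩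

/-! ### Even coweights and the fixed loci -/

/-- The equivalence class `⁰I ⊂ I × ℤ` of the base point. -/
def I0 : Set (I × ℤ) :=
  {y | Relation.EqvGen (fun x y : I × ℤ => D.b x.1 y.1 ≠ 0 ∧ y.2 = x.2 + D.b x.1 y.1) D.base y}

/-- Rational coweights of the diagonal torus of `∏ GL_{n i}`. -/
abbrev Cow (n : I → ℕ) : Type := ∀ i, Fin (n i) → ℚ

/-- Even coweights: the pairs `(i, 2 d_i γ_{i,s})` belong to `⁰I`. -/
def IsEven {n : I → ℕ} (γ : Cow n) : Prop :=
  ∀ i s, ∃ k : ℤ, (k : ℚ) = 2 * D.d i * γ i s ∧ (i, k) ∈ D.I0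

/-- The integer `2 d_i γ_{i,s}` (for `γ` even). -/
def wt {n : I → ℕ} (γ : Cow n) (i : I) (s : Fin (n i)) : ℤ := ⌊2 * D.d i * γ i s⌋

/-- The representative in `[1, 2 d_i]` of an integer modulo `2 d_i`. -/
def rep (i : I) (k : ℤ) : ℤ := (k - 1) % (2 * D.d i) + 1

/-- The integer `γ_{i,s} - r / (2 d_i)`, where `r` is the element of `[1, 2 d_i]` congruent to
`2 d_i γ_{i,s}` modulo `2 d_i`. -/
def hat {n : I → ℕ} (γ : Cow n) (i : I) (s : Fin (n i)) : ℤ :=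
  ⌊γ i s - (D.rep i (D.wt γ i s) : ℚ) / (2 * D.d i)⌋

/-- Constant diagonal matrices in `G_K`. -/
def constGK (u : ∀ i, Fin (D.a i) → ℂˣ) : D.GK := fun i => diagGL fun s => constU (u i s)

/-- The element `z ^ m` of `G_K` for a cocharacter `m`. -/
def zPow (m : ∀ i, Fin (D.a i) → ℤ) : D.GK := fun i => diagGL fun s => zU ^ m i s

/-- The element `τ ^ (2 γ̃) = (τ ^ (2 γ), τ ^ 2)` of `G̃_K`. -/
def gTil (γ : Cow D.a) (τ : ℂˣ) : D.GKt := ⟨D.constGK fun i s => τ ^ D.wt γ i s, τ⟩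

/-- The element `τ ^ (2 γ̇) = (τ ^ (2 γ̃), τ ^ (2 ρ))` of `Ġ_K`. -/
def gDot (γ : Cow D.a) (ρ : Cow D.l) (τ : ℂˣ) : D.Gdot := (D.gTil γ τ, fun i s => τ ^ D.wt ρ i s)

/-- `(G̃_K)^γ̃`. -/
def GKtFix (γ : Cow D.a) : Subgroup D.GKt := Subgroup.centralizer (Set.range (D.gTil γ))

/-- `(G_K)^γ̃`. -/
def GKFix (γ : Cow D.a) : Subgroup D.GK := (D.GKtFix γ).comap SemidirectProduct.inl

/-- `(G_O)^γ̃`. -/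
def GOFix (γ : Cow D.a) : Subgroup D.GK := D.GO ⊓ D.GKFix γ

/-- `(N_K)^γ̇`. -/
def NKFix (γ : Cow D.a) (ρ : Cow D.l) : Set D.NK := {n | ∀ τ, D.gDot γ ρ τ • n = n}

/-- `Gr^{γ̃,η}`, the orbit of the point `[η̂ - γ̂]` under `(G_K)^γ̃`. -/
def GrFix (γ η : Cow D.a) : Set D.Gr :=
  {x | ∃ k ∈ D.GKFix γ, x = ((k * D.zPow fun i s => D.hat η i s - D.hat γ i s : D.GK) : D.Gr)}

/-- `𝒯^{γ̇,η}`: the points of `𝒯` fixed by `γ̇` lying over `Gr^{γ̃,η}`. -/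
def TFix (γ η : Cow D.a) (ρ : Cow D.l) : Set D.T :=
  {t | (∀ τ, D.gDot γ ρ τ • t = t) ∧ t.1.1 ∈ D.GrFix γ η}

/-- `ℛ^{γ̇,η}`, where `ℛ = 𝒯 ×_{N_K} N_O`. -/
def RFix (γ η : Cow D.a) (ρ : Cow D.l) : Set (D.TFix γ η ρ) := {t | D.π t.1 ∈ D.NO}

theorem rotGK_constGK (τ : ℂˣ) (u : ∀ i, Fin (D.a i) → ℂˣ) :
    D.rotGK τ (D.constGK u) = D.constGK u := by
  refine funext fun i => Units.ext (Matrix.ext fun s t => ?_)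
  change rot _ (Matrix.diagonal (fun s => ((constU (u i s) : LSˣ) : LS)) s t) =
    Matrix.diagonal (fun s => ((constU (u i s) : LSˣ) : LS)) s t
  rcases eq_or_ne s t with rfl | hst
  · rw [Matrix.diagonal_apply_eq]
    ext n
    rw [rot_coeff]
    change _ * (HahnSeries.C _ : LS).coeff n = (HahnSeries.C _ : LS).coeff n
    rcases eq_or_ne n 0 with rfl | hn
    · simp
    · simp [HahnSeries.C_apply, HahnSeries.coeff_single_of_ne hn]
  · rw [Matrix.diagonal_apply_ne _ hst, map_zero]

theorem constGK_mem_GO (u : ∀ i, Fin (D.a i) → ℂˣ) : D.constGK u ∈ D.GO := by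
  intro i _
  refine ⟨diagGL fun s => Units.map ((PowerSeries.C : ℂ →+* PowerSeries ℂ) : ℂ →* _) (u i s),
    Units.ext (Matrix.ext fun s t => ?_)⟩
  change HahnSeries.ofPowerSeries ℤ ℂ (Matrix.diagonal (fun s => PowerSeries.C (u i s : ℂ)) s t) =
    Matrix.diagonal (fun s => (HahnSeries.C (u i s : ℂ) : LS)) s t
  rcases eq_or_ne s t with rfl | hst
  · rw [Matrix.diagonal_apply_eq, Matrix.diagonal_apply_eq, HahnSeries.ofPowerSeries_C]
  · rw [Matrix.diagonal_apply_ne _ hst, Matrix.diagonal_apply_ne _ hst, map_zero]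

theorem zU_zpow (m : ℤ) : ((zU ^ m : LSˣ) : LS) = HahnSeries.single m 1 := by
  have h : ∀ n : ℕ, ((zU ^ n : LSˣ) : LS) = HahnSeries.single (n : ℤ) 1 := fun n => by
    simp [zU]
  rcases m with n | n
  · simpa using h n
  · rw [zpow_negSucc]
    refine Units.inv_eq_of_mul_eq_one_right ?_
    rw [h, HahnSeries.single_mul_single, Int.negSucc_eq]
    simp

theorem rotGK_zPow (τ : ℂˣ) (m : ∀ i, Fin (D.a i) → ℤ) :
    D.rotGK τ (D.zPow m) =
      D.zPow m * D.constGK fun i s => (τ ^ (2 * (D.d i : ℤ))) ^ m i s := by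
  have : D.zPow m * D.constGK (fun i s => (τ ^ (2 * (D.d i : ℤ))) ^ m i s) =
      fun i => diagGL fun s => zU ^ m i s * constU ((τ ^ (2 * (D.d i : ℤ))) ^ m i s) := by
    funext i
    exact (map_mul diagGL _ _).symm
  rw [this]
  refine funext fun i => Units.ext (Matrix.ext fun s t => ?_)
  change rot _ (Matrix.diagonal (fun s => ((zU ^ m i s : LSˣ) : LS)) s t) =
    Matrix.diagonal (fun s => ((zU ^ m i s : LSˣ) : LS) * HahnSeries.C _) s t
  rcases eq_or_ne s t with rfl | hst
  · rw [Matrix.diagonal_apply_eq, Matrix.diagonal_apply_eq, zU_zpow]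
    ext n
    rw [rot_coeff, mul_comm (HahnSeries.single _ _), ← smul_eq_C_mul, HahnSeries.coeff_smul,
      smul_eq_mul]
    rcases eq_or_ne n (m i s) with rfl | hn
    · simp
    · simp [HahnSeries.coeff_single_of_ne hn]
  · rw [Matrix.diagonal_apply_ne _ hst, Matrix.diagonal_apply_ne _ hst, map_zero]

variable {D} in
theorem commute_gDot {γ : Cow D.a} {x : D.GKt} (hx : x ∈ D.GKtFix γ) (ρ : Cow D.l) (τ : ℂˣ) :
    D.gDot γ ρ τ * D.incl x = D.incl x * D.gDot γ ρ τ := by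
  refine Prod.ext (Subgroup.mem_centralizer_iff.mp hx _ ⟨τ, rfl⟩) ?_
  change _ * 1 = 1 * _
  rw [mul_one, one_mul]

theorem inr_mem_GKtFix (γ : Cow D.a) (τ : ℂˣ) : SemidirectProduct.inr τ ∈ D.GKtFix γ := by
  rw [GKtFix, Subgroup.mem_centralizer_iff]
  rintro _ ⟨τ', rfl⟩
  refine SemidirectProduct.ext ?_ ?_
  · rw [SemidirectProduct.mul_left, SemidirectProduct.mul_left, SemidirectProduct.left_inr,
      SemidirectProduct.right_inr, map_one, mul_one, one_mul]
    exact (D.rotGK_constGK τ _).symm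
  · rw [SemidirectProduct.mul_right, SemidirectProduct.mul_right, SemidirectProduct.right_inr,
      mul_comm]

variable {D} in
theorem smul_mem_GrFix {γ η : Cow D.a} {x : D.GKt} (hx : x ∈ D.GKtFix γ) {y : D.Gr}
    (hy : y ∈ D.GrFix γ η) : x • y ∈ D.GrFix γ η := by
  obtain ⟨k, hk, rfl⟩ := hy
  refine ⟨x.left * D.rotGK x.right k, ?_, ?_⟩
  · have e : (SemidirectProduct.inl (x.left * D.rotGK x.right k) : D.GKt) =
        x * SemidirectProduct.inl k * (SemidirectProduct.inr x.right)⁻¹ := by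
      rw [eq_mul_inv_iff_mul_eq]
      refine SemidirectProduct.ext ?_ ?_ <;> simp
    change SemidirectProduct.inl _ ∈ D.GKtFix γ
    rw [e]
    exact mul_mem (mul_mem hx hk) (inv_mem (D.inr_mem_GKtFix γ _))
  · rw [smul_mk, map_mul, rotGK_zPow, ← mul_assoc, ← mul_assoc]
    refine (QuotientGroup.eq.mpr ?_).symm
    rw [inv_mul_cancel_left]
    exact D.constGK_mem_GO _

instance (γ η : Cow D.a) (ρ : Cow D.l) : MulAction (D.GKtFix γ) (D.TFix γ η ρ) where
  smul x t := ⟨D.incl x.1 • t.1, fun τ => by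
    rw [← mul_smul, commute_gDot x.2, mul_smul, t.2.1], smul_mem_GrFix x.2 t.2.2⟩
  one_smul t := Subtype.ext (by
    change D.incl 1 • t.1 = t.1
    rw [map_one, one_smul])
  mul_smul x y t := Subtype.ext (by
    change D.incl (x.1 * y.1) • t.1 = D.incl x.1 • D.incl y.1 • t.1
    rw [map_mul, mul_smul])

instance (γ : Cow D.a) (ρ : Cow D.l) : MulAction (D.GKtFix γ) (D.NKFix γ ρ) where
  smul x n := ⟨D.incl x.1 • n.1, fun τ => by rw [← mul_smul, commute_gDot x.2, mul_smul, n.2]⟩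
  one_smul n := Subtype.ext (by
    change D.incl 1 • n.1 = n.1
    rw [map_one, one_smul])
  mul_smul x y n := Subtype.ext (by
    change D.incl (x.1 * y.1) • n.1 = D.incl x.1 • D.incl y.1 • n.1
    rw [map_mul, mul_smul])

/-- The inclusion of `(G_O)^γ̃` in `(G̃_K)^γ̃`. -/
def inclGOFix (γ : Cow D.a) : D.GOFix γ →* D.GKtFix γ :=
  ((SemidirectProduct.inl : D.GK →* D.GKt).comp (D.GOFix γ).subtype).codRestrict (D.GKtFix γ)
    fun k => k.2.2

instance (γ η : Cow D.a) (ρ : Cow D.l) : MulAction (D.GOFix γ) (D.TFix γ η ρ) :=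
  MulAction.compHom _ (D.inclGOFix γ)

/-- The map `𝒯^{γ̇,η} → (N_K)^γ̇` induced by `π`. -/
def πFix (γ η : Cow D.a) (ρ : Cow D.l) (t : D.TFix γ η ρ) : D.NKFix γ ρ :=
  ⟨D.π t.1, fun τ => congrArg D.π (t.2.1 τ)⟩

/-! ### The algebraic structures on the loop side -/

/-- Coordinates on `G_K`: the coefficients of the entries of a matrix and of its inverse. -/
def coordGK (g : D.GK) : (Σ i, Fin (D.a i) × Fin (D.a i) × ℤ × Bool) → ℂ
  | ⟨i, s, t, n, true⟩ => ((g i : Matrix _ _ LS) s t).coeff n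
  | ⟨i, s, t, n, false⟩ => (((g i)⁻¹ : GL _ LS).1 s t).coeff n

/-- Coordinates on `N_K`: the coefficients of the components of the images of `z ^ m e_t`. -/
def coordNK (n : D.NK) : (Σ i, Fin (D.l i) × ℤ × Fin (D.a i) × ℤ) ⊕
    (Σ e : D.Arr, Fin (D.a e.1.1) × ℤ × Fin (D.a e.1.2) × ℤ) → ℂ
  | Sum.inl ⟨i, t, m, s, k⟩ => ((n.A i).1 (Pi.single t (HahnSeries.single m 1)) s).coeff k
  | Sum.inr ⟨e, t, m, s, k⟩ => ((n.B e).1 (Pi.single t (HahnSeries.single m 1)) s).coeff k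

/-- The closed piece of `G_K` of matrices with poles of order at most `N`, as well as their
inverses. -/
def GKbdd (N : ℕ) : Set D.GK :=
  {g | ∀ i s t, IsBdd N ((g i : Matrix _ _ LS) s t) ∧ IsBdd N (((g i)⁻¹ : GL _ LS).1 s t)}

/-- The coordinates on `G_K × N_O`. -/
def coordGN (p : D.GK × D.NO) := Sum.elim (D.coordGK p.1) (D.coordNK p.2.1)

/-- The algebraic group `G_O`. -/
def funGO : FunSp D.GO := FunSp.coord fun g => D.coordGK g.1

/-- The algebraic group `(G_O)^γ̃`. -/
def funGOFix (γ : Cow D.a) : FunSp (D.GOFix γ) := FunSp.coord fun g => D.coordGK g.1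

/-- The closed pieces of `𝒯`. -/
abbrev TN (N : ℕ) : Type := {t : D.T // ∃ p : D.GK × D.NO, p.1 ∈ D.GKbdd N ∧ D.qT p = t}

/-- The algebraic structure on a piece of `𝒯`: a quotient of a piece of `G_K × N_O` by `G_O`. -/
def funTN (N : ℕ) : FunSp (D.TN N) :=
  FunSp.quotient (fun p : {p : D.GK × D.NO // p.1 ∈ D.GKbdd N} => (⟨D.qT p.1, p.1, p.2, rfl⟩ : D.TN N))
    (FunSp.coord fun p => D.coordGN p.1)

/-- The (reduced) algebraic structure on a subspace of the ind-variety `𝒯`: the colimit of its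
intersections with the closed pieces. -/
def funTSub (Y : Set D.T) : FunSp Y :=
  FunSp.coinduced (ι := ℕ) (X := fun N => {t : D.TN N // t.1 ∈ Y}) (fun _ t => ⟨t.1.1, t.2⟩)
    fun N => FunSp.induced Subtype.val (D.funTN N)

/-- The algebraic structure on a subspace of `N_K`. -/
def funNKSub (Y : Set D.NK) : FunSp Y :=
  FunSp.coinduced (ι := ℕ) (X := fun N => {n : Y // n.1 ∈ D.NObdd N}) (fun _ n => n.1)
    fun _ => FunSp.coord fun n => D.coordNK n.1.1

/-- The preimage of `𝒯^{γ̇,η}` in `G_K × N_O`. -/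
abbrev PT (γ η : Cow D.a) (ρ : Cow D.l) : Type := {p : D.GK × D.NO // D.qT p ∈ D.TFix γ η ρ}

/-- Its algebraic structure. -/
def funPT (γ η : Cow D.a) (ρ : Cow D.l) : FunSp (D.PT γ η ρ) :=
  FunSp.coinduced (ι := ℕ) (X := fun N => {p : D.PT γ η ρ // p.1.1 ∈ D.GKbdd N}) (fun _ p => p.1)
    fun _ => FunSp.coord fun p => D.coordGN p.1.1

/-- An equivariant sheaf `F` on `𝒯^{γ̇,η}` is the restriction of the sheaf induced from the
representation `V` of `G_O`, i.e., of `G_K ×_{G_O} (V ⊗ 𝒪_{N_O})`. The group `G_O` acts on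
`G_K × N_O` by `k · (g, n) = (g k⁻¹, k n)`. -/
def IsIndT (γ η : Cow D.a) (ρ : Cow D.l) (V : RatRep D.funGO)
    (F : EqSheaf (D.funGOFix γ) (D.funTSub (D.TFix γ η ρ))) : Prop :=
  IsInduced (D.funPT γ η ρ) (fun p => ⟨D.qT p.1, p.2⟩)
    (fun (k : D.GO) p p' => p'.1.1 = p.1.1 * k.1⁻¹ ∧ p'.1.2.1 = D.inclGK k.1 • p.1.2.1)
    (fun (h : D.GOFix γ) p p' => p'.1.1 = h.1 * p.1.1 ∧ p'.1.2 = p.1.2) V F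

/-! ### The unfolded quiver -/

/-- The vertices of `Q̲`. -/
abbrev Iu : Type := {x : I × ℤ // x ∈ D.I0 ∧ 1 ≤ x.2 ∧ x.2 ≤ 2 * D.d x.1}

/-- The arrows of `Q̲`. -/
def Eu (x y : D.Iu) : Prop :=
  D.E x.1.1 y.1.1 ∧
    (2 * (Nat.gcd (D.d x.1.1) (D.d y.1.1) : ℤ)) ∣ y.1.2 - x.1.2 + D.b x.1.1 y.1.1

/-- The type of arrows of `Q̲`. -/
abbrev Arru : Type := {e : D.Iu × D.Iu // D.Eu e.1 e.2}

/-- The basis of `V̲_{γ,x}`, for `x = (i, r)`: the kernel of `ε ^ (2 d_i γ_i) - ε ^ r`, where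
`ε = exp (π √-1 / d_i)`, is spanned by the basis vectors `e_s` of `V_i` such that `2 d_i γ_{i,s}` is
congruent to `r` modulo `2 d_i`. -/
abbrev J {n : I → ℕ} (γ : Cow n) (x : D.Iu) : Type :=
  {s : Fin (n x.1.1) // D.wt γ x.1.1 s ≡ x.1.2 [ZMOD 2 * D.d x.1.1]}

/-- `η ∈ ⁰Λ_{V̲}`, where `V̲ = V̲_γ`: the coweight `η` is even and `V̲_η = V̲_γ`. -/
def IsEvenFor (γ η : Cow D.a) : Prop :=
  D.IsEven η ∧ ∀ (x : D.Iu) (s : Fin (D.a x.1.1)),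
    D.wt η x.1.1 s ≡ x.1.2 [ZMOD 2 * D.d x.1.1] ↔ D.wt γ x.1.1 s ≡ x.1.2 [ZMOD 2 * D.d x.1.1]

/-- `η` is `G̲`-dominant: each `η̂_x` is a dominant cocharacter of `GL(V̲_x)`. -/
def IsDom (γ η : Cow D.a) : Prop :=
  ∀ (x : D.Iu) (s t : D.J γ x), s ≤ t → D.hat η x.1.1 t.1 ≤ D.hat η x.1.1 s.1

/-- The group `G̲ = ∏ GL(V̲_x)`, for `V̲ = V̲_γ`. -/
abbrev Gu (γ : Cow D.a) : Type := ∀ x : D.Iu, GL (D.J γ x) ℂ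

/-- The torus element `τ ^ (-2 γ)` in `G̲`. -/
def tU (γ : Cow D.a) : ℂˣ →* D.Gu γ where
  toFun τ x := diagGL fun s => τ ^ (- D.wt γ x.1.1 s.1)
  map_one' := by
    funext x
    simp only [one_zpow]
    exact map_one diagGL
  map_mul' τ τ' := by
    funext x
    simp only [mul_zpow]
    exact map_mul diagGL _ _

/-- The semidirect product of `G̲` and the rotation group, where `τ ^ 2` acts by conjugation by
`τ ^ (-2 γ)` (see `rotGK` for the use of `τ` as a coordinate). -/
abbrev Gut (γ : Cow D.a) : Type := D.Gu γ ⋊[MulAut.conj.comp (D.tU γ)] ℂˣ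

/-- The torus element `τ ^ (- η̂)` in `G̲`. -/
def hatU (γ η : Cow D.a) (τ : ℂˣ) : D.Gu γ := fun x => diagGL fun s => τ ^ (- D.hat η x.1.1 s.1)

/-- The parabolic subgroup `P̲_η` of `G̲`: the elements `g` such that `Ad (τ ^ (- η̂)) g` has a limit
in `G̲` as `τ → 0`. -/
def Pu (γ η : Cow D.a) : Subgroup (D.Gu γ) where
  carrier := {g | ∃ g₀ : D.Gu γ, Filter.Tendsto
    (fun τ : ℂˣ => D.hatU γ η τ * g * (D.hatU γ η τ)⁻¹)
    (Filter.comap (Units.val : ℂˣ → ℂ) (𝓝 0)) (𝓝 g₀)}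
  one_mem' := ⟨1, by simpa using tendsto_const_nhds⟩
  mul_mem' := by
    rintro g h ⟨g₀, hg⟩ ⟨h₀, hh⟩
    refine ⟨g₀ * h₀, ?_⟩
    have := hg.mul hh
    simpa [mul_assoc] using this
  inv_mem' := by
    rintro g ⟨g₀, hg⟩
    refine ⟨g₀⁻¹, ?_⟩
    have := hg.inv
    simpa [mul_assoc] using this

/-- The representation space `N̲ = Rep_{Q̲}(V̲, W̲)` of the framed quiver of `Q̲`, for `V̲ = V̲_γ` and
`W̲ = W̲_ρ`. -/
@[ext] structure Nu (γ : Cow D.a) (ρ : Cow D.l) where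
  A : ∀ x : D.Iu, Matrix (D.J γ x) (D.J ρ x) ℂ
  B : ∀ e : D.Arru, Matrix (D.J γ e.1.2) (D.J γ e.1.1) ℂ

variable {γ : Cow D.a} {ρ : Cow D.l}

instance : MulAction (D.Gu γ) (D.Nu γ ρ) where
  smul g n := ⟨fun x => (g x).1 * n.A x, fun e => (g e.1.2).1 * n.B e * (g e.1.1)⁻¹.1⟩
  one_smul n := by
    refine Nu.ext (funext fun x => ?_) (funext fun e => ?_)
    · exact Matrix.one_mul _
    · change 1 * n.B e * (1 : GL _ ℂ)⁻¹.1 = _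
      simp
  mul_smul g h n := by
    refine Nu.ext (funext fun x => ?_) (funext fun e => ?_)
    · exact Matrix.mul_assoc _ _ _
    · change (g e.1.2 * h e.1.2).1 * n.B e * (g e.1.1 * h e.1.1)⁻¹.1 =
        (g e.1.2).1 * ((h e.1.2).1 * n.B e * (h e.1.1)⁻¹.1) * (g e.1.1)⁻¹.1
      simp only [mul_inv_rev, Units.val_mul, Matrix.mul_assoc]

/-- The action of `τ ^ (-2 ρ)` on `N̲`. -/
def wAct (τ : ℂˣ) (n : D.Nu γ ρ) : D.Nu γ ρ :=
  ⟨fun x => Matrix.of fun s t => n.A x s t * ((τ ^ D.wt ρ x.1.1 t.1 : ℂˣ) : ℂ), n.B⟩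

theorem wAct_one (n : D.Nu γ ρ) : D.wAct 1 n = n := by
  refine Nu.ext (funext fun x => ?_) rfl
  ext s t
  simp [wAct]

theorem wAct_mul (τ τ' : ℂˣ) (n : D.Nu γ ρ) : D.wAct (τ * τ') n = D.wAct τ (D.wAct τ' n) := by
  refine Nu.ext (funext fun x => ?_) rfl
  ext s t
  simp only [wAct, Matrix.of_apply, mul_zpow, Units.val_mul]
  ring

theorem wAct_smul (τ : ℂˣ) (g : D.Gu γ) (n : D.Nu γ ρ) : D.wAct τ (g • n) = g • D.wAct τ n := by
  refine Nu.ext (funext fun x => ?_) rfl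
  ext s t
  change ((g x).1 * n.A x) s t * _ = ((g x).1 * ((D.wAct τ n).A x)) s t
  simp only [wAct, Matrix.mul_apply, Matrix.of_apply, Finset.sum_mul, mul_assoc]

/-- The action of the semidirect product on `N̲`: `τ ^ 2` acts by `(τ ^ (-2 γ), τ ^ (-2 ρ))`. -/
instance : MulAction (D.Gut γ) (D.Nu γ ρ) where
  smul x n := (x.left * D.tU γ x.right) • D.wAct x.right n
  one_smul n := by
    change (1 * D.tU γ 1) • D.wAct 1 n = n
    rw [map_one, one_mul, one_smul, wAct_one]
  mul_smul x y n := by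
    change ((x * y).left * D.tU γ (x * y).right) • D.wAct (x * y).right n =
      (x.left * D.tU γ x.right) • D.wAct x.right ((y.left * D.tU γ y.right) • D.wAct y.right n)
    rw [wAct_smul, ← mul_smul, ← wAct_mul, SemidirectProduct.mul_left, SemidirectProduct.mul_right,
      map_mul]
    congr 1
    simp [mul_assoc]

/-- The grading shift: it is nonzero only in type `G₂`, at the short vertex. -/
def shift (i : I) : ℤ := if ∃ j, D.c i j = -3 then 2 else 0

/-- The degree of a basis vector of `V̲` or `W̲` in the (shifted) `ℤ`-grading defined by a
coweight. -/
def deg {n : I → ℕ} (η : Cow n) (i : I) (s : Fin (n i)) : ℤ := D.wt η i s - D.shift i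

/-- Sequences of `I̲`-graded subspaces of `V̲ = V̲_γ`. -/
abbrev Seq (γ : Cow D.a) : Type := ∀ (_ : ℤ) (x : D.Iu), Submodule ℂ (D.J γ x → ℂ)

instance : MulAction (D.Gu γ) (D.Seq γ) where
  smul g F := fun k x => (F k x).map (Matrix.mulVecLin (g x).1)
  one_smul F := by
    funext k x
    change (F k x).map (Matrix.mulVecLin 1) = F k x
    rw [Matrix.mulVecLin_one, Submodule.map_id]
  mul_smul g h F := by
    funext k x
    change (F k x).map (Matrix.mulVecLin ((g x).1 * (h x).1)) = _
    rw [Matrix.mulVecLin_mul, Submodule.map_comp]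
    rfl

/-- The flag `(V̲_η^{≤ k})`. -/
def stdFlag (γ η : Cow D.a) : D.Seq γ := fun k x =>
  { carrier := {v | ∀ s, v s ≠ 0 → D.deg η x.1.1 s.1 ≤ k}
    add_mem' := by
      intro v w hv hw s hs
      by_cases h : v s = 0
      · exact hw s fun h' => hs (by simp [h, h'])
      · exact hv s h
    zero_mem' := by intro s hs; simp at hs
    smul_mem' := by
      intro c v hv s hs
      exact hv s fun h => hs (by simp [h]) }

/-- The dimension vector `v_η` of the graded space `(V̲_η^k)`. -/
def dimSeq (γ η : Cow D.a) (k : ℤ) (x : D.Iu) : ℕ :=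
  Nat.card {s : D.J γ x // D.deg η x.1.1 s.1 = k}

/-- `ℤ`-weighted flags of `I̲`-graded subspaces of `V̲` with dimension sequence `v`. -/
structure IsFlag (F : D.Seq γ) (v : ℤ → D.Iu → ℕ) : Prop where
  mono : ∀ k x, F k x ≤ F (k + 1) x
  bot : ∃ k₀ : ℤ, ∀ k ≤ k₀, ∀ x, F k x = ⊥
  top : ∃ k₁ : ℤ, ∀ k ≥ k₁, ∀ x, F k x = ⊤
  dim : ∀ k x, Module.finrank ℂ (F k x) = Module.finrank ℂ (F (k - 1) x) + v k x

/-- `A (W̲^{≤ k}) ⊆ F^{≤ k}` and `B (F^{≤ k}) ⊆ F^{< k}` for all `k`. -/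
def IsCompat (F : D.Seq γ) (n : D.Nu γ ρ) : Prop :=
  (∀ k x (w : D.J ρ x → ℂ), (∀ t, w t ≠ 0 → D.deg ρ x.1.1 t.1 ≤ k) → (n.A x).mulVec w ∈ F k x) ∧
  ∀ k (e : D.Arru), ∀ v ∈ F k e.1.1, (n.B e).mulVec v ∈ F (k - 1) e.1.2

/-- The variety `𝒳_η^ρ` of triples `(F, A, B)`. -/
abbrev X (γ η : Cow D.a) (ρ : Cow D.l) : Type :=
  {p : D.Seq γ × D.Nu γ ρ // D.IsFlag p.1 (D.dimSeq γ η) ∧ D.IsCompat p.1 p.2}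

/-- `N_η^ρ`: the pairs `(A, B)` with `A (W̲_ρ^k) ⊆ V̲_η^{≤ k}` and `B (V̲_η^{≤ k}) ⊆ V̲_η^{< k}` for
all `k`. -/
def Nη (γ η : Cow D.a) (ρ : Cow D.l) : Set (D.Nu γ ρ) :=
  {n | (∀ k x (w : D.J ρ x → ℂ), (∀ t, w t ≠ 0 → D.deg ρ x.1.1 t.1 = k) →
      (n.A x).mulVec w ∈ D.stdFlag γ η k x) ∧
    ∀ k (e : D.Arru), ∀ v ∈ D.stdFlag γ η k e.1.1, (n.B e).mulVec v ∈ D.stdFlag γ η (k - 1) e.1.2}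

theorem wAct_A_mulVec (τ : ℂˣ) (n : D.Nu γ ρ) (x : D.Iu) (w : D.J ρ x → ℂ) :
    ((D.wAct τ n).A x).mulVec w =
      (n.A x).mulVec fun t => ((τ ^ D.wt ρ x.1.1 t.1 : ℂˣ) : ℂ) * w t := by
  funext s
  simp only [wAct, Matrix.mulVec, dotProduct, Matrix.of_apply, mul_assoc]

theorem wAct_mem_Nη {η : Cow D.a} (τ : ℂˣ) {n : D.Nu γ ρ} (hn : n ∈ D.Nη γ η ρ) :
    D.wAct τ n ∈ D.Nη γ η ρ := by
  refine ⟨fun k x w hw => ?_, hn.2⟩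
  rw [wAct_A_mulVec]
  exact hn.1 k x _ fun t ht => hw t fun h => ht (by simp [h])

theorem IsFlag.smul {D : Datum I} {γ : Cow D.a} {F : D.Seq γ} {v : ℤ → D.Iu → ℕ}
    (hF : D.IsFlag F v) (g : D.Gu γ) : D.IsFlag (g • F) v where
  mono k x := Submodule.map_mono (hF.mono k x)
  bot := by
    obtain ⟨k₀, h⟩ := hF.bot
    exact ⟨k₀, fun k hk x => by
      change (F k x).map _ = ⊥
      rw [h k hk x, Submodule.map_bot]⟩
  top := by
    obtain ⟨k₁, h⟩ := hF.top
    refine ⟨k₁, fun k hk x => ?_⟩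
    change (F k x).map _ = ⊤
    rw [h k hk x, Submodule.map_top, LinearMap.range_eq_top]
    intro w
    exact ⟨(g x)⁻¹.1.mulVec w, by simp [Matrix.mulVec_mulVec]⟩
  dim k x := by
    have h : ∀ p : Submodule ℂ (D.J γ x → ℂ),
        Module.finrank ℂ (p.map (Matrix.mulVecLin (g x).1)) = Module.finrank ℂ p := fun p => by
      refine (Submodule.equivMapOfInjective _ ?_ p).finrank_eq.symm
      intro v w hvw
      have := congrArg ((g x)⁻¹.1.mulVec) hvw
      simpa [Matrix.mulVec_mulVec] using this
    change Module.finrank ℂ ((F k x).map _) = Module.finrank ℂ ((F (k - 1) x).map _) + _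
    rw [h, h, hF.dim]

theorem IsCompat.smul {D : Datum I} {γ : Cow D.a} {ρ : Cow D.l} {F : D.Seq γ} {n : D.Nu γ ρ}
    (h : D.IsCompat F n) (g : D.Gu γ) : D.IsCompat (g • F) (g • n) := by
  refine ⟨fun k x w hw => ⟨_, h.1 k x w hw, ?_⟩, ?_⟩
  · change (g x).1.mulVec _ = ((g x).1 * n.A x).mulVec w
    rw [Matrix.mulVec_mulVec]
  · rintro k e _ ⟨v, hv, rfl⟩
    refine ⟨_, h.2 k e v hv, ?_⟩
    change (g e.1.2).1.mulVec _ = ((g e.1.2).1 * n.B e * (g e.1.1)⁻¹.1).mulVec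
      ((g e.1.1).1.mulVec v)
    rw [Matrix.mulVec_mulVec, Matrix.mulVec_mulVec, Matrix.mul_assoc, ← Units.val_mul,
      inv_mul_cancel, Units.val_one, Matrix.mul_one]

theorem IsCompat.wAct {D : Datum I} {γ : Cow D.a} {ρ : Cow D.l} {F : D.Seq γ} {n : D.Nu γ ρ}
    (h : D.IsCompat F n) (τ : ℂˣ) : D.IsCompat F (D.wAct τ n) := by
  refine ⟨fun k x w hw => ?_, h.2⟩
  rw [wAct_A_mulVec]
  exact h.1 k x _ fun t ht => hw t fun h => ht (by simp [h])

/-- The action of the semidirect product on `𝒳_η^ρ`. -/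
instance (η : Cow D.a) : MulAction (D.Gut γ) (D.X γ η ρ) where
  smul y p := ⟨((y.left * D.tU γ y.right) • p.1.1, y • p.1.2), p.2.1.smul _,
    (p.2.2.wAct _).smul _⟩
  one_smul p := by
    refine Subtype.ext (Prod.ext ?_ (one_smul _ _))
    change (1 * D.tU γ 1) • p.1.1 = p.1.1
    rw [map_one, one_mul, one_smul]
  mul_smul y y' p := by
    refine Subtype.ext (Prod.ext ?_ (mul_smul y y' p.1.2))
    change ((y * y').left * D.tU γ (y * y').right) • p.1.1 =
      (y.left * D.tU γ y.right) • (y'.left * D.tU γ y'.right) • p.1.1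
    rw [← mul_smul, SemidirectProduct.mul_left, SemidirectProduct.mul_right, map_mul]
    congr 1
    simp [mul_assoc]

/-- The inclusion of `P̲_η` in the semidirect product. -/
def inclPu (γ η : Cow D.a) : D.Pu γ η →* D.Gut γ := SemidirectProduct.inl.comp (D.Pu γ η).subtype

instance (η : Cow D.a) : MulAction (D.Pu γ γ) (D.X γ η ρ) :=
  MulAction.compHom _ (D.inclPu γ γ)

/-- The space `G̲ × N_η^ρ`. -/
abbrev GN (γ η : Cow D.a) (ρ : Cow D.l) : Type := D.Gu γ × D.Nη γ η ρ

/-- `q = p · r` for the action of `P̲_η` on `G̲ × N_η^ρ` given by `p · (g, n) = (g p⁻¹, p n)`. -/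
def relGN (η : Cow D.a) (p : D.Pu γ η) (r q : D.GN γ η ρ) : Prop :=
  q.1 = r.1 * p.1⁻¹ ∧ q.2.1 = p.1 • r.2.1

/-- The variety `G̲ ×_{P̲_η} N_η^ρ`. -/
abbrev IndVar (γ η : Cow D.a) (ρ : Cow D.l) : Type :=
  Quot fun r q : D.GN γ η ρ => ∃ p : D.Pu γ η, D.relGN η p r q

/-- The action of the semidirect product on `G̲ ×_{P̲_η} N_η^ρ`: the group `G̲` acts by left
multiplication on `G̲`, and `τ ^ 2` acts by `τ ^ (-2 γ)` on `G̲` and by `τ ^ (-2 ρ)` on `N_η^ρ`. -/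
instance (η : Cow D.a) : MulAction (D.Gut γ) (D.IndVar γ η ρ) where
  smul y := Quot.map
    (fun r => (y.left * D.tU γ y.right * r.1, ⟨D.wAct y.right r.2.1, D.wAct_mem_Nη _ r.2.2⟩))
    (by
      rintro r q ⟨p, h1, h2⟩
      refine ⟨p, ?_, ?_⟩
      · change _ * q.1 = _ * r.1 * _
        rw [h1, mul_assoc, mul_assoc, mul_assoc]
      · change D.wAct _ q.2.1 = _
        rw [h2, wAct_smul])
  one_smul t := by
    induction t using Quot.ind with
    | mk r =>
      refine congrArg (Quot.mk _) (Prod.ext ?_ (Subtype.ext (D.wAct_one r.2.1)))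
      change 1 * D.tU γ 1 * r.1 = r.1
      rw [map_one, one_mul, one_mul]
  mul_smul y y' t := by
    induction t using Quot.ind with
    | mk r =>
      refine congrArg (Quot.mk _) (Prod.ext ?_ (Subtype.ext (D.wAct_mul _ _ r.2.1)))
      change (y * y').left * D.tU γ (y * y').right * r.1 =
        y.left * D.tU γ y.right * (y'.left * D.tU γ y'.right * r.1)
      rw [SemidirectProduct.mul_left, SemidirectProduct.mul_right, map_mul]
      simp [mul_assoc]

/-! ### The algebraic structures on the quiver side -/

/-- Coordinates on `G̲`: the entries of a matrix and of its inverse. -/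
def coordGu (g : D.Gu γ) : (Σ x, D.J γ x × D.J γ x × Bool) → ℂ
  | ⟨x, s, t, true⟩ => (g x).1 s t
  | ⟨x, s, t, false⟩ => (g x)⁻¹.1 s t

/-- Coordinates on `N̲`. -/
def coordNu (n : D.Nu γ ρ) :
    (Σ x, D.J γ x × D.J ρ x) ⊕ (Σ e : D.Arru, D.J γ e.1.2 × D.J γ e.1.1) → ℂ
  | Sum.inl ⟨x, s, t⟩ => n.A x s t
  | Sum.inr ⟨e, s, t⟩ => n.B e s t

/-- The vector space `N̲` as a variety. -/
def funNu (γ : Cow D.a) (ρ : Cow D.l) : FunSp (D.Nu γ ρ) := FunSp.coord D.coordNu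

/-- The algebraic group `P̲_η`. -/
def funPu (γ η : Cow D.a) : FunSp (D.Pu γ η) := FunSp.coord fun p => D.coordGu p.1

/-- The variety `G̲ × N_η^ρ`. -/
def funGN (γ η : Cow D.a) (ρ : Cow D.l) : FunSp (D.GN γ η ρ) :=
  FunSp.coord fun r => Sum.elim (D.coordGu r.1) (D.coordNu r.2.1)

/-- The quotient variety `G̲ ×_{P̲_η} N_η^ρ`. -/
def funIndVar (γ η : Cow D.a) (ρ : Cow D.l) : FunSp (D.IndVar γ η ρ) :=
  FunSp.quotient (Quot.mk _) (D.funGN γ η ρ)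

/-- Frames of a sequence of subspaces of prescribed dimensions, together with a point of `N̲`. -/
abbrev Frames (γ : Cow D.a) (ρ : Cow D.l) (δ : ℤ → D.Iu → ℕ) : Type :=
  {f : ∀ (k : ℤ) (x : D.Iu), Fin (δ k x) → D.J γ x → ℂ // ∀ k x, LinearIndependent ℂ (f k x)} ×
    D.Nu γ ρ

/-- The product of `N̲` with the product of the Grassmannians of `V̲`: the Grassmannian of
`δ`-dimensional subspaces is the quotient of the variety of linearly independent families of `δ`
vectors. -/
def funSeqNu (γ : Cow D.a) (ρ : Cow D.l) : FunSp (D.Seq γ × D.Nu γ ρ) :=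
  FunSp.coinduced (ι := ℤ → D.Iu → ℕ) (X := D.Frames γ ρ)
    (fun _ f => (fun k x => Submodule.span ℂ (Set.range (f.1.1 k x)), f.2))
    fun δ => FunSp.coord (κ := (Σ (k : ℤ) (x : D.Iu), Fin (δ k x) × D.J γ x) ⊕ _)
      fun f => Sum.elim (fun c => f.1.1 c.1 c.2.1 c.2.2.1 c.2.2.2) (D.coordNu f.2)

/-- The variety `𝒳_η^ρ`, as a subvariety of the product of `N̲` and of Grassmannians. -/
def funX (γ η : Cow D.a) (ρ : Cow D.l) : FunSp (D.X γ η ρ) :=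
  FunSp.induced Subtype.val (D.funSeqNu γ ρ)

/-- An equivariant sheaf `F` on `𝒳_η^ρ` is the sheaf induced from the representation `V` of `P̲_η`,
where `𝒳_η^ρ` is identified with `G̲ ×_{P̲_η} N_η^ρ` by means of `e`. -/
def IsIndX (γ η : Cow D.a) (ρ : Cow D.l) (e : D.IndVar γ η ρ → D.X γ η ρ)
    (V : RatRep (D.funPu γ η)) (F : EqSheaf (D.funPu γ γ) (D.funX γ η ρ)) : Prop :=
  IsInduced (D.funGN γ η ρ) (fun r => e (Quot.mk _ r)) (D.relGN η)
    (fun (h : D.Pu γ γ) r q => q.1 = h.1 * r.1 ∧ q.2 = r.2) V F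

/-! ### Evaluation at `z = 1` -/

/-- `h` is the value `g(1)` of `g ∈ G_K` (used for elements with finitely many nonzero
coefficients), restricted to the blocks of `G̲`. -/
def IsEv (γ : Cow D.a) (g : D.GK) (h : D.Gu γ) : Prop :=
  ∀ x (s t : D.J γ x), (h x).1 s t = ∑ᶠ n : ℤ, ((g x.1.1).1 s.1 t.1).coeff n

/-- The evaluation of an element of `N_K` with finitely many nonzero coefficients. For an arrow
`i → j`, a component of `B_{ji}` is written as a sum of terms `β z_i ^ n`, where `z_i ^ n` maps
`z_i ^ m` to `z_i ^ (m + n)` if this is a power of `z = z_i ^ (-c_{ij})`, and to zero else; the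
evaluation is the sum of the coefficients `β`. -/
def IsEvN (n : D.NK) (n' : D.Nu γ ρ) : Prop :=
  (∀ x s t, n'.A x s t =
    ∑ᶠ k : ℤ, ((n.A x.1.1).1 (Pi.single t.1 (HahnSeries.single 0 1)) s.1).coeff k) ∧
  ∀ (e : D.Arru) s t, n'.B e s t = ∑ m ∈ Finset.range (- D.c e.1.1.1.1 e.1.2.1.1).toNat,
    ∑ᶠ k : ℤ, ((n.B ⟨(e.1.1.1.1, e.1.2.1.1), e.2.1⟩).1
      (Pi.single t.1 (HahnSeries.single (m : ℤ) 1)) s.1).coeff k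

/-- `V'` is the restriction of the representation `V` of `G_O` to `(G_O)^η̃ ≅ P̲_η`. -/
def IsRestr (γ η : Cow D.a) (V : RatRep D.funGO) (V' : RatRep (D.funPu γ η)) : Prop :=
  ∃ hn : V'.n = V.n, ∀ (k : D.GO) (p : D.Pu γ η), k.1 ∈ D.GKFix η → D.IsEv γ k.1 p.1 →
    ∀ i j, (V'.ρ p).1 i j = (V.ρ k).1 (Fin.cast hn i) (Fin.cast hn j)

end Datum

end FixedLocus

end

open scoped Topology
noncomputable section
namespace FixedLocus

namespace FunSp

/-- The properties of a space with functions that hold for all varieties. -/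
structure Good {X : Type} (S : FunSp X) : Prop where
  loc : ∀ {f g : X → ℂ} {x : X} (U : Set X), IsOpen[S.top] U → x ∈ U → (∀ y ∈ U, f y = g y) →
    S.RegAt f x → S.RegAt g x
  nhds : ∀ {f : X → ℂ} {x : X}, S.RegAt f x →
    ∃ U : Set X, IsOpen[S.top] U ∧ x ∈ U ∧ ∀ y ∈ U, S.RegAt f y
  ne_zero : ∀ {f : X → ℂ} {x : X}, S.RegAt f x → f x ≠ 0 →
    ∃ U : Set X, IsOpen[S.top] U ∧ x ∈ U ∧ ∀ y ∈ U, f y ≠ 0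
  inv : ∀ {f : X → ℂ} {x : X}, S.RegAt f x → f x ≠ 0 → S.RegAt (fun y => (f y)⁻¹) x

theorem isOpen_iff_nhds {X : Type} (t : TopologicalSpace X) (U : Set X) :
    IsOpen[t] U ↔ ∀ x ∈ U, ∃ V : Set X, IsOpen[t] V ∧ x ∈ V ∧ V ⊆ U := by
  rw [@isOpen_iff_forall_mem_open]
  exact forall₂_congr fun x _ => ⟨fun ⟨V, h1, h2, h3⟩ => ⟨V, h2, h3, h1⟩,
    fun ⟨V, h1, h2, h3⟩ => ⟨V, h3, h1, h2⟩⟩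

theorem good_affine (κ : Type) : (affine κ).Good where
  loc := by
    rintro f g x U hU hx h ⟨U', hU', hx', p, q, h'⟩
    exact ⟨U ∩ U', @IsOpen.inter _ (zariski κ) _ _ hU hU', ⟨hx, hx'⟩, p, q, fun y hy =>
      ⟨(h' y hy.2).1, by rw [← h y hy.1, (h' y hy.2).2]⟩⟩
  nhds := by
    rintro f x ⟨U', hU', hx', p, q, h'⟩
    exact ⟨U', hU', hx', fun y hy => ⟨U', hU', hy, p, q, h'⟩⟩
  ne_zero := by
    rintro f x ⟨U', hU', hx', p, q, h'⟩ hf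
    refine ⟨U' ∩ {y | MvPolynomial.eval y p ≠ 0}, @IsOpen.inter _ (zariski κ) _ _ hU'
      (TopologicalSpace.isOpen_generateFrom_of_mem ⟨p, rfl⟩), ⟨hx', fun h => ?_⟩, fun y hy => ?_⟩
    · rw [(h' x hx').2, h, zero_div] at hf
      exact hf rfl
    · rw [(h' y hy.1).2]
      exact div_ne_zero hy.2 (h' y hy.1).1
  inv := by
    rintro f x ⟨U', hU', hx', p, q, h'⟩ hf
    refine ⟨U' ∩ {y | MvPolynomial.eval y p ≠ 0}, @IsOpen.inter _ (zariski κ) _ _ hU'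
      (TopologicalSpace.isOpen_generateFrom_of_mem ⟨p, rfl⟩), ⟨hx', fun h => ?_⟩, q, p,
      fun y hy => ⟨hy.2, ?_⟩⟩
    · rw [(h' x hx').2, h, zero_div] at hf
      exact hf rfl
    · beta_reduce
      rw [(h' y hy.1).2, inv_div]

theorem isOpen_induced {X Y : Type} (i : Y → X) (S : FunSp X) {U : Set X} (hU : IsOpen[S.top] U) :
    IsOpen[(induced i S).top] (i ⁻¹' U) := ⟨U, hU, rfl⟩

theorem Good.induced {X Y : Type} {S : FunSp X} (hS : S.Good) (i : Y → X) :
    (induced i S).Good where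
  loc := by
    rintro f g x _ ⟨U, hU, rfl⟩ hx h ⟨F, hF, V, hV, hxV, h'⟩
    exact ⟨F, hF, U ∩ V, @IsOpen.inter _ S.top _ _ hU hV, ⟨hx, hxV⟩, fun y hy => by
      rw [← h y hy.1, h' y hy.2]⟩
  nhds := by
    rintro f x ⟨F, hF, V, hV, hxV, h'⟩
    obtain ⟨U, hU, hxU, h⟩ := hS.nhds hF
    exact ⟨_, isOpen_induced i S (@IsOpen.inter _ S.top _ _ hU hV), ⟨hxU, hxV⟩, fun y hy =>
      ⟨F, h _ hy.1, V, hV, hy.2, h'⟩⟩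
  ne_zero := by
    rintro f x ⟨F, hF, V, hV, hxV, h'⟩ hf
    obtain ⟨U, hU, hxU, h⟩ := hS.ne_zero hF (by rwa [← h' x hxV])
    exact ⟨_, isOpen_induced i S (@IsOpen.inter _ S.top _ _ hU hV), ⟨hxU, hxV⟩, fun y hy => by
      rw [h' y hy.2]; exact h _ hy.1⟩
  inv := by
    rintro f x ⟨F, hF, V, hV, hxV, h'⟩ hf
    exact ⟨_, hS.inv hF (by rwa [← h' x hxV]), V, hV, hxV, fun y hy => by
      beta_reduce; rw [h' y hy]⟩

theorem good_coord {X κ : Type} (c : X → κ → ℂ) : (coord c).Good := (good_affine κ).induced c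

theorem isOpen_coinduced {ι : Type} {X : ι → Type} {Y : Type} (q : ∀ a, X a → Y)
    (S : ∀ a, FunSp (X a)) {U : Set Y} :
    IsOpen[(coinduced q S).top] U ↔ ∀ a, IsOpen[(S a).top] (q a ⁻¹' U) := by
  change IsOpen[⨆ a, _] U ↔ _
  simp only [isOpen_iSup_iff]
  rfl

theorem good_coinduced {ι : Type} {X : ι → Type} {Y : Type} (q : ∀ a, X a → Y)
    {S : ∀ a, FunSp (X a)} (hS : ∀ a, (S a).Good) : (coinduced q S).Good where
  loc := by
    rintro f g x U hU hx h ⟨V, hV, hxV, h'⟩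
    refine ⟨U ∩ V, @IsOpen.inter _ (coinduced q S).top _ _ hU hV, ⟨hx, hxV⟩, fun a y hy => ?_⟩
    exact (hS a).loc _ ((isOpen_coinduced q S).1 hU a) hy.1 (fun z hz => h _ hz) (h' a y hy.2)
  nhds := by
    rintro f x ⟨V, hV, hxV, h'⟩
    exact ⟨V, hV, hxV, fun y hy => ⟨V, hV, hy, h'⟩⟩
  ne_zero := by
    rintro f x ⟨V, hV, hxV, h'⟩ hf
    refine ⟨V ∩ {y | f y ≠ 0}, (isOpen_coinduced q S).2 fun a => ?_, ⟨hxV, hf⟩, fun y hy => hy.2⟩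
    rw [isOpen_iff_nhds]
    rintro y ⟨hy, hfy⟩
    obtain ⟨W, hW, hyW, h⟩ := (hS a).ne_zero (h' a y hy) hfy
    exact ⟨W ∩ q a ⁻¹' V, @IsOpen.inter _ (S a).top _ _ hW ((isOpen_coinduced q S).1 hV a),
      ⟨hyW, hy⟩, fun z hz => ⟨hz.2, h z hz.1⟩⟩
  inv := by
    rintro f x ⟨V, hV, hxV, h'⟩ hf
    refine ⟨V ∩ {y | f y ≠ 0}, (isOpen_coinduced q S).2 fun a => ?_, ⟨hxV, hf⟩, fun a y hy =>
      (hS a).inv (h' a y hy.1) hy.2⟩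
    rw [isOpen_iff_nhds]
    rintro y ⟨hy, hfy⟩
    obtain ⟨W, hW, hyW, h⟩ := (hS a).ne_zero (h' a y hy) hfy
    exact ⟨W ∩ q a ⁻¹' V, @IsOpen.inter _ (S a).top _ _ hW ((isOpen_coinduced q S).1 hV a),
      ⟨hyW, hy⟩, fun z hz => ⟨hz.2, h z hz.1⟩⟩

theorem Good.quotient {X Y : Type} {S : FunSp X} (hS : S.Good) (q : X → Y) :
    (quotient q S).Good := good_coinduced _ fun _ => hS

/-- The algebra of functions that are regular at a point. -/
def regAlg {X : Type} (S : FunSp X) (x : X) : Subalgebra ℂ (X → ℂ) where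
  carrier := {f | S.RegAt f x}
  add_mem' h h' := S.add h h'
  mul_mem' h h' := S.mul h h'
  algebraMap_mem' c := S.const c x

theorem mem_regAlg {X : Type} {S : FunSp X} {x : X} {f : X → ℂ} :
    f ∈ S.regAlg x ↔ S.RegAt f x := Iff.rfl

theorem RegAt.sum {X ι : Type} {S : FunSp X} {x : X} (s : Finset ι) {f : ι → X → ℂ}
    (h : ∀ i ∈ s, S.RegAt (f i) x) : S.RegAt (fun y => ∑ i ∈ s, f i y) x := by
  have := (S.regAlg x).sum_mem h
  rw [mem_regAlg] at this
  convert this using 1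
  ext y; simp

theorem RegAt.prod {X ι : Type} {S : FunSp X} {x : X} (s : Finset ι) {f : ι → X → ℂ}
    (h : ∀ i ∈ s, S.RegAt (f i) x) : S.RegAt (fun y => ∏ i ∈ s, f i y) x := by
  have := (S.regAlg x).prod_mem h
  rw [mem_regAlg] at this
  convert this using 1
  ext y; simp

theorem RegAt.ite {X : Type} {S : FunSp X} {x : X} (p : Prop) [Decidable p] {f g : X → ℂ}
    (hf : p → S.RegAt f x) (hg : ¬ p → S.RegAt g x) :
    S.RegAt (fun y => if p then f y else g y) x := by
  by_cases h : p
  · simpa [h] using hf h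
  · simpa [h] using hg h

theorem RegAt.eval {X κ : Type} {S : FunSp X} {x : X} {c : X → κ → ℂ}
    (h : ∀ k, S.RegAt (fun y => c y k) x) (p : MvPolynomial κ ℂ) :
    S.RegAt (fun y => MvPolynomial.eval (c y) p) x := by
  induction p using MvPolynomial.induction_on with
  | C a => simpa using S.const a x
  | add p q hp hq => simpa using S.add hp hq
  | mul_X p k hp => simpa using S.mul hp (h k)

theorem RegAt.det {X n : Type} [Fintype n] [DecidableEq n] {S : FunSp X} {x : X}
    {M : X → Matrix n n ℂ} (h : ∀ i j, S.RegAt (fun y => M y i j) x) :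
    S.RegAt (fun y => (M y).det) x := by
  simp only [Matrix.det_apply']
  refine RegAt.sum _ fun σ _ => S.mul (S.const _ x) (RegAt.prod _ fun i _ => h _ _)

theorem RegAt.matMul {X l m n : Type} [Fintype m] {S : FunSp X} {x : X}
    {M : X → Matrix l m ℂ} {N : X → Matrix m n ℂ} (hM : ∀ i j, S.RegAt (fun y => M y i j) x)
    (hN : ∀ i j, S.RegAt (fun y => N y i j) x) (i : l) (j : n) :
    S.RegAt (fun y => (M y * N y) i j) x := by
  simp only [Matrix.mul_apply]
  exact RegAt.sum _ fun k _ => S.mul (hM _ _) (hN _ _)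

theorem RegAt.mulVec {X l m : Type} [Fintype m] {S : FunSp X} {x : X}
    {M : X → Matrix l m ℂ} {v : X → m → ℂ} (hM : ∀ i j, S.RegAt (fun y => M y i j) x)
    (hv : ∀ j, S.RegAt (fun y => v y j) x) (i : l) :
    S.RegAt (fun y => (M y).mulVec (v y) i) x := by
  simp only [Matrix.mulVec, dotProduct]
  exact RegAt.sum _ fun k _ => S.mul (hM _ _) (hv _)

theorem RegAt.matInv {X n : Type} [Fintype n] [DecidableEq n] {S : FunSp X} (hS : S.Good) {x : X}
    {M : X → Matrix n n ℂ} (h : ∀ i j, S.RegAt (fun y => M y i j) x) (hx : (M x).det ≠ 0) (i j : n) :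
    S.RegAt (fun y => (M y)⁻¹ i j) x := by
  simp only [Matrix.inv_def, Ring.inverse_eq_inv', Matrix.smul_apply, smul_eq_mul]
  refine S.mul (hS.inv (RegAt.det h) hx) ?_
  simp only [Matrix.adjugate_apply]
  refine RegAt.det fun k l => ?_
  by_cases hk : k = j
  · subst hk; simpa using S.const _ x
  · simpa [Matrix.updateRow_ne hk] using h k l

/-- Morphisms defined in a neighbourhood of a point. -/
def IsMorAt {X Y : Type} (S : FunSp X) (T : FunSp Y) (f : X → Y) (x : X) : Prop :=
  (∀ V, IsOpen[T.top] V → f x ∈ V → ∃ U, IsOpen[S.top] U ∧ x ∈ U ∧ ∀ y ∈ U, f y ∈ V) ∧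
    ∀ g : Y → ℂ, T.RegAt g (f x) → S.RegAt (fun x' => g (f x')) x

theorem isMor_iff {X Y : Type} {S : FunSp X} {T : FunSp Y} {f : X → Y} :
    IsMor S T f ↔ ∀ x, IsMorAt S T f x := by
  constructor
  · exact fun h x => ⟨fun V hV hx => ⟨_, h.1 V hV, hx, fun y hy => hy⟩, fun g hg => h.2 g x hg⟩
  · refine fun h => ⟨fun V hV => ?_, fun g x hg => (h x).2 g hg⟩
    rw [isOpen_iff_nhds]
    exact fun x hx => (h x).1 V hV hx

theorem IsMor.at {X Y : Type} {S : FunSp X} {T : FunSp Y} {f : X → Y} (h : IsMor S T f) (x : X) :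
    IsMorAt S T f x := isMor_iff.1 h x

theorem IsMorAt.comp {X Y Z : Type} {S : FunSp X} {T : FunSp Y} {R : FunSp Z} {f : X → Y}
    {g : Y → Z} {x : X} (hg : IsMorAt T R g (f x)) (hf : IsMorAt S T f x) :
    IsMorAt S R (fun x => g (f x)) x := by
  refine ⟨fun V hV hx => ?_, fun F hF => hf.2 _ (hg.2 F hF)⟩
  obtain ⟨U, hU, hxU, h⟩ := hg.1 V hV hx
  obtain ⟨U', hU', hxU', h'⟩ := hf.1 U hU hxU
  exact ⟨U', hU', hxU', fun y hy => h _ (h' y hy)⟩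

theorem IsMor.comp {X Y Z : Type} {S : FunSp X} {T : FunSp Y} {R : FunSp Z} {f : X → Y}
    {g : Y → Z} (hg : IsMor T R g) (hf : IsMor S T f) : IsMor S R (fun x => g (f x)) :=
  isMor_iff.2 fun x => (hg.at _).comp (hf.at x)

theorem IsMorAt.congr {X Y : Type} {S : FunSp X} (hS : S.Good) {T : FunSp Y} {f g : X → Y} {x : X}
    (h : IsMorAt S T f x) {U : Set X} (hU : IsOpen[S.top] U) (hx : x ∈ U)
    (hfg : ∀ y ∈ U, f y = g y) : IsMorAt S T g x := by
  refine ⟨fun V hV hgx => ?_, fun F hF => ?_⟩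
  · obtain ⟨U', hU', hxU', h'⟩ := h.1 V hV (by rwa [hfg x hx])
    exact ⟨U ∩ U', @IsOpen.inter _ S.top _ _ hU hU', ⟨hx, hxU'⟩, fun y hy => by
      rw [← hfg y hy.1]; exact h' y hy.2⟩
  · rw [← hfg x hx] at hF
    exact hS.loc U hU hx (fun y hy => by rw [hfg y hy]) (h.2 F hF)

theorem isMor_induced {X Y : Type} (i : Y → X) (S : FunSp X) : IsMor (induced i S) S i :=
  ⟨fun _ hU => isOpen_induced i S hU, fun g _ hg =>
    ⟨g, hg, Set.univ, @isOpen_univ _ S.top, trivial, fun _ _ => rfl⟩⟩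

theorem isMorAt_to_induced {X Y Z : Type} {i : Y → X} {S : FunSp X} {R : FunSp Z} (hR : R.Good)
    {f : Z → Y} {z : Z} (h : IsMorAt R S (fun z => i (f z)) z) : IsMorAt R (induced i S) f z := by
  refine ⟨?_, ?_⟩
  · rintro _ ⟨V, hV, rfl⟩ hz
    exact h.1 V hV hz
  · rintro g ⟨F, hF, V, hV, hz, hgF⟩
    obtain ⟨U, hU, hzU, h'⟩ := h.1 V hV hz
    exact hR.loc U hU hzU (fun y hy => (hgF _ (h' y hy)).symm) (h.2 F hF)

theorem isMorAt_to_affine {X κ : Type} {S : FunSp X} (hS : S.Good) {f : X → κ → ℂ} {x : X}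
    (h : ∀ k, S.RegAt (fun y => f y k) x) : IsMorAt S (affine κ) f x := by
  have key : ∀ V, IsOpen[zariski κ] V → f x ∈ V → ∃ U, IsOpen[S.top] U ∧ x ∈ U ∧ ∀ y ∈ U, f y ∈ V := by
    intro V hV
    induction hV with
    | basic V hV =>
      obtain ⟨q, rfl⟩ := hV
      exact fun hx => hS.ne_zero (RegAt.eval h q) hx
    | univ => exact fun _ => ⟨Set.univ, @isOpen_univ _ S.top, trivial, fun _ _ => trivial⟩
    | inter V V' _ _ h1 h2 =>
      rintro ⟨hx, hx'⟩
      obtain ⟨U, hU, hxU, h⟩ := h1 hx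
      obtain ⟨U', hU', hxU', h'⟩ := h2 hx'
      exact ⟨U ∩ U', @IsOpen.inter _ S.top _ _ hU hU', ⟨hxU, hxU'⟩, fun y hy =>
        ⟨h y hy.1, h' y hy.2⟩⟩
    | sUnion s _ hs =>
      rintro ⟨V, hV, hx⟩
      obtain ⟨U, hU, hxU, h⟩ := hs V hV hx
      exact ⟨U, hU, hxU, fun y hy => ⟨V, hV, h y hy⟩⟩
  refine ⟨key, ?_⟩
  rintro g ⟨V, hV, hxV, p, q, hpq⟩
  obtain ⟨U, hU, hxU, hUV⟩ := key V hV hxV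
  refine hS.loc U hU hxU (fun y hy => ?_)
    (S.mul (RegAt.eval h p) (hS.inv (RegAt.eval h q) (hpq _ hxV).1))
  rw [(hpq _ (hUV y hy)).2, div_eq_mul_inv]

theorem isMorAt_to_coord {X Y κ : Type} {S : FunSp X} (hS : S.Good) {c : Y → κ → ℂ} {f : X → Y}
    {x : X} (h : ∀ k, S.RegAt (fun y => c (f y) k) x) : IsMorAt S (coord c) f x :=
  isMorAt_to_induced hS (isMorAt_to_affine hS h)

theorem isMor_to_coord {X Y κ : Type} {S : FunSp X} (hS : S.Good) {c : Y → κ → ℂ} {f : X → Y}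
    (h : ∀ k x, S.RegAt (fun y => c (f y) k) x) : IsMor S (coord c) f :=
  isMor_iff.2 fun x => isMorAt_to_coord hS fun k => h k x

theorem regAt_coord {X κ : Type} (c : X → κ → ℂ) (k : κ) (x : X) :
    (coord c).RegAt (fun y => c y k) x :=
  (isMor_induced c (affine κ)).2 (fun v => v k) x ⟨Set.univ, @isOpen_univ _ (zariski κ), trivial,
    MvPolynomial.X k, 1, fun y _ => by simp⟩

theorem isMorAt_to_coinduced {ι : Type} {X : ι → Type} {Y : Type} (q : ∀ a, X a → Y)
    (S : ∀ a, FunSp (X a)) (a : ι) : IsMor (S a) (coinduced q S) (q a) :=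
  ⟨fun _ hU => (isOpen_coinduced q S).1 hU a, fun _ x ⟨_, _, hx, h⟩ => h a x hx⟩

theorem isMor_quotient {X Y : Type} (q : X → Y) (S : FunSp X) : IsMor S (quotient q S) q :=
  isMorAt_to_coinduced (ι := Unit) (fun _ => q) (fun _ => S) ()

theorem isMor_from_coinduced {ι : Type} {X : ι → Type} {Y Z : Type} {q : ∀ a, X a → Y}
    {S : ∀ a, FunSp (X a)} {R : FunSp Z} (hR : R.Good) {f : Y → Z}
    (h : ∀ a, IsMor (S a) R (fun x => f (q a x))) : IsMor (coinduced q S) R f := by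
  have h1 : ∀ U, IsOpen[R.top] U → IsOpen[(coinduced q S).top] (f ⁻¹' U) := fun U hU =>
    (isOpen_coinduced q S).2 fun a => (h a).1 U hU
  refine ⟨h1, fun g y hg => ?_⟩
  obtain ⟨U, hU, hyU, h'⟩ := hR.nhds hg
  exact ⟨f ⁻¹' U, h1 U hU, hyU, fun a x hx => (h a).2 g x (h' _ hx)⟩

theorem isMorAt_from_coinduced {ι : Type} {X : ι → Type} {Y Z : Type} {q : ∀ a, X a → Y}
    {S : ∀ a, FunSp (X a)} {R : FunSp Z} (hR : R.Good) {f : Y → Z}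
    {U : Set Y} (hU : IsOpen[(coinduced q S).top] U)
    (h : ∀ a x, q a x ∈ U → IsMorAt (S a) R (fun x => f (q a x)) x) {y : Y} (hy : y ∈ U) :
    IsMorAt (coinduced q S) R f y := by
  have h1 : ∀ V, IsOpen[R.top] V → IsOpen[(coinduced q S).top] (U ∩ f ⁻¹' V) := fun V hV => by
    refine (isOpen_coinduced q S).2 fun a => ?_
    rw [isOpen_iff_nhds]
    rintro x ⟨hx, hxV⟩
    obtain ⟨W, hW, hxW, hWV⟩ := (h a x hx).1 V hV hxV
    exact ⟨W ∩ q a ⁻¹' U, @IsOpen.inter _ (S a).top _ _ hW ((isOpen_coinduced q S).1 hU a),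
      ⟨hxW, hx⟩, fun z hz => ⟨hz.2, hWV z hz.1⟩⟩
  refine ⟨fun V hV hyV => ⟨_, h1 V hV, ⟨hy, hyV⟩, fun z hz => hz.2⟩, fun g hg => ?_⟩
  obtain ⟨V, hV, hyV, h'⟩ := hR.nhds hg
  exact ⟨_, h1 V hV, ⟨hy, hyV⟩, fun a x hx => (h a x hx.1).2 g (h' _ hx.2)⟩

theorem regAt_coinduced {ι : Type} {X : ι → Type} {Y : Type} {q : ∀ a, X a → Y}
    {S : ∀ a, FunSp (X a)} {f : Y → ℂ} {U : Set Y} (hU : IsOpen[(coinduced q S).top] U)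
    (h : ∀ a x, q a x ∈ U → (S a).RegAt (fun x => f (q a x)) x) {y : Y} (hy : y ∈ U) :
    (coinduced q S).RegAt f y := ⟨U, hU, hy, h⟩

/-- Local regular sections of a map. -/
def HasSections {X Y : Type} (S : FunSp X) (T : FunSp Y) (q : X → Y) : Prop :=
  ∀ y, ∃ (U : Set Y) (σ : Y → X), IsOpen[T.top] U ∧ y ∈ U ∧
    ∀ y' ∈ U, q (σ y') = y' ∧ IsMorAt T S σ y'

/-- A morphism that is constant on the fibres of a morphism with local sections descends. -/
theorem HasSections.isMor_desc {X Y Z : Type} {S : FunSp X} {T : FunSp Y} (hT : T.Good)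
    {R : FunSp Z} {q : X → Y} (hq : HasSections S T q) {f : X → Z} (hf : IsMor S R f) {g : Y → Z}
    (h : ∀ x, g (q x) = f x) : IsMor T R g := by
  refine isMor_iff.2 fun y => ?_
  obtain ⟨U, σ, hU, hy, hσ⟩ := hq y
  exact IsMorAt.congr hT ((hf.at _).comp (hσ y hy).2) hU hy fun y' hy' => by
    rw [← h, (hσ y' hy').1]

end FunSp

open FunSp

/-! ### Linear equations with regular coefficients -/

section LinearEquations

variable {X m n : Type} [Fintype m] [Fintype n] [DecidableEq m] [DecidableEq n] {S : FunSp X}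

theorem exists_left_inv {M : Matrix m n ℂ} (h : ∀ v, M.mulVec v = 0 → v = 0) :
    ∃ R : Matrix n m ℂ, R * M = 1 := by
  obtain ⟨g, hg⟩ := (Matrix.toLin' M).exists_leftInverse_of_injective
    (LinearMap.ker_eq_bot'.2 fun v hv => h v (by simpa using hv))
  refine ⟨LinearMap.toMatrix' g, Matrix.toLin'.injective ?_⟩
  rw [Matrix.toLin'_mul, Matrix.toLin'_toMatrix', hg, Matrix.toLin'_one]

theorem exists_right_inv {M : Matrix m n ℂ} (h : ∀ w, ∃ v, M.mulVec v = w) :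
    ∃ R : Matrix n m ℂ, M * R = 1 := by
  obtain ⟨g, hg⟩ := (Matrix.toLin' M).exists_rightInverse_of_surjective
    (LinearMap.range_eq_top.2 fun w => by simpa using h w)
  refine ⟨LinearMap.toMatrix' g, Matrix.toLin'.injective ?_⟩
  rw [Matrix.toLin'_mul, Matrix.toLin'_toMatrix', hg, Matrix.toLin'_one]

theorem injective_nhds (hS : S.Good) {M : X → Matrix m n ℂ} {x : X}
    (hM : ∀ i j, S.RegAt (fun y => M y i j) x) (h : ∀ v, (M x).mulVec v = 0 → v = 0) :
    ∃ U, IsOpen[S.top] U ∧ x ∈ U ∧ ∀ y ∈ U, ∀ v, (M y).mulVec v = 0 → v = 0 := by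
  obtain ⟨R, hR⟩ := exists_left_inv h
  obtain ⟨U, hU, hx, hne⟩ := hS.ne_zero (RegAt.det (M := fun y => R * M y)
    (RegAt.matMul (fun _ _ => S.const _ x) hM)) (by simp [hR])
  refine ⟨U, hU, hx, fun y hy v hv => ?_⟩
  have h1 : (R * M y).mulVec v = 0 := by rw [← Matrix.mulVec_mulVec, hv, Matrix.mulVec_zero]
  exact Matrix.eq_zero_of_mulVec_eq_zero (hne y hy) h1

theorem surjective_nhds (hS : S.Good) {M : X → Matrix m n ℂ} {x : X}
    (hM : ∀ i j, S.RegAt (fun y => M y i j) x) (h : ∀ w, ∃ v, (M x).mulVec v = w) :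
    ∃ U, IsOpen[S.top] U ∧ x ∈ U ∧ ∀ y ∈ U, ∀ w, ∃ v, (M y).mulVec v = w := by
  obtain ⟨R, hR⟩ := exists_right_inv h
  obtain ⟨U, hU, hx, hne⟩ := hS.ne_zero (RegAt.det (M := fun y => M y * R)
    (RegAt.matMul hM (fun _ _ => S.const _ x))) (by simp [hR])
  refine ⟨U, hU, hx, fun y hy w => ⟨R.mulVec ((M y * R)⁻¹.mulVec w), ?_⟩⟩
  rw [Matrix.mulVec_mulVec, Matrix.mulVec_mulVec, Matrix.mul_nonsing_inv _ (hne y hy).isUnit,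
    Matrix.one_mulVec]

theorem solution_regAt (hS : S.Good) {M : X → Matrix m n ℂ} {x : X}
    (hM : ∀ i j, S.RegAt (fun y => M y i j) x) (h : ∀ v, (M x).mulVec v = 0 → v = 0)
    {b : X → m → ℂ} (hb : ∀ i, S.RegAt (fun y => b y i) x) {a : X → n → ℂ} {U : Set X}
    (hU : IsOpen[S.top] U) (hx : x ∈ U) (hab : ∀ y ∈ U, (M y).mulVec (a y) = b y) (j : n) :
    S.RegAt (fun y => a y j) x := by
  obtain ⟨R, hR⟩ := exists_left_inv h
  have hreg : ∀ i j, S.RegAt (fun y => (R * M y) i j) x :=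
    RegAt.matMul (M := fun _ => R) (fun _ _ => S.const _ x) hM
  obtain ⟨V, hV, hxV, hne⟩ := hS.ne_zero (RegAt.det hreg) (by simp [hR])
  refine hS.loc (U ∩ V) (@IsOpen.inter _ S.top _ _ hU hV) ⟨hx, hxV⟩ (fun y hy => ?_)
    (RegAt.mulVec (M := fun y => (R * M y)⁻¹) (v := fun y => R.mulVec (b y))
      (RegAt.matInv hS hreg (by simp [hR])) (RegAt.mulVec (fun _ _ => S.const _ x) hb) j)
  rw [← hab y hy.1, Matrix.mulVec_mulVec, Matrix.mulVec_mulVec,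
    Matrix.mul_assoc, Matrix.nonsing_inv_mul _ (hne y hy.2).isUnit, Matrix.one_mulVec]

end LinearEquations

/-! ### Isomorphic sheaves have the same class -/

section Iso

variable {H Y : Type} [Group H] [MulAction H Y] {SH : FunSp H} {S : FunSp Y}

theorem EqPre.map_congr (F : EqPre H S) {h h' : H} (e : h = h') {U V : S.Op} (hUV hUV') (s : F.sec U) :
    F.map h U V hUV s = F.map h' U V hUV' s := by
  subst e; rfl

/-- The zero sheaf. -/
def zeroSheaf (SH : FunSp H) (S : FunSp Y) : EqSheaf SH S where
  sec _ := PUnit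
  map _ _ _ _ := 0
  map_one _ _ _ := rfl
  map_map _ _ _ _ _ _ _ _ _ := rfl
  map_smul _ _ _ _ _ _ _ _ := rfl
  glue _ _ _ _ _ _ _ := ⟨PUnit.unit, fun _ => rfl, fun _ _ => rfl⟩
  rational _ _ h₀ y₀ _ := ⟨⟨Set.univ, @isOpen_univ _ SH.top⟩, ⟨Set.univ, @isOpen_univ _ S.top⟩, 0, 1,
    fun _ => PUnit.unit, fun _ _ _ => 0, fun _ _ => 0, fun _ _ => 1, fun _ => 1, trivial, trivial,
    fun k => k.elim0, fun _ h _ => SH.const 1 h, by simp, fun _ _ _ _ _ _ => rfl⟩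

theorem zeroSheaf_isCoherent : (zeroSheaf SH S).IsCoherent := fun _ =>
  ⟨⟨Set.univ, @isOpen_univ _ S.top⟩, 0, 0, fun k => k.elim0, fun k => k.elim0, trivial,
    fun V _ _ _ hx => ⟨V, subset_rfl, fun _ _ => trivial, fun k => k.elim0, hx, rfl⟩,
    fun k => k.elim0,
    fun V _ _ _ _ hx => ⟨V, subset_rfl, fun _ _ => trivial, fun k => k.elim0, hx,
      fun k => k.elim0⟩⟩

/-- The zero morphism to the zero sheaf. -/
def toZero (F : EqSheaf SH S) : EqHom F (zeroSheaf SH S) where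
  app _ := 0
  app_smul _ _ _ := rfl
  app_map _ _ _ _ _ := rfl

theorem KGroup.cls_eq_add {F' F F'' : EqCoh SH S} {i : EqHom F'.1 F.1} {p : EqHom F.1 F''.1}
    (h : IsSES i p) : KGroup.cls F = KGroup.cls F' + KGroup.cls F'' := by
  refine sub_eq_zero.1 ?_
  rw [← sub_sub]
  exact (Submodule.Quotient.mk_eq_zero _).2 (Submodule.subset_span ⟨F', F, F'', i, p, h, rfl⟩)

theorem KGroup.cls_eq_of_iso {F G : EqCoh SH S} (i : EqHom F.1 G.1)
    (h : ∀ U, Function.Bijective (i.app U)) : KGroup.cls F = KGroup.cls G := by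
  have h0 : KGroup.cls (⟨zeroSheaf SH S, zeroSheaf_isCoherent⟩ : EqCoh SH S) = 0 := by
    have := KGroup.cls_eq_add (F' := ⟨zeroSheaf SH S, zeroSheaf_isCoherent⟩)
      (F := ⟨zeroSheaf SH S, zeroSheaf_isCoherent⟩) (F'' := ⟨zeroSheaf SH S, zeroSheaf_isCoherent⟩)
      (i := toZero _) (p := toZero _) ⟨fun U _ _ _ => rfl, fun U s => ⟨fun _ => ⟨s, rfl⟩, fun _ => rfl⟩,
        fun U s y hy => ⟨U, subset_rfl, s, hy, rfl⟩⟩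
    simpa using this
  have := KGroup.cls_eq_add (F' := F) (F := G) (F'' := ⟨zeroSheaf SH S, zeroSheaf_isCoherent⟩)
    (i := i) (p := toZero _) ⟨fun U => (h U).1, fun U s => ⟨fun _ => (h U).2 s, fun _ => rfl⟩,
      fun U s y hy => ⟨U, subset_rfl, 0, hy, rfl⟩⟩
  rw [this, h0, add_zero]

/-- Sheaves induced from the same representation have the same class. -/
theorem IsInduced.cls_eq {K P : Type} [Group K] {SK : FunSp K} {SP : FunSp P} {q : P → Y}
    {ka : K → P → P → Prop} {ha : H → P → P → Prop} {V : RatRep SK}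
    (hq : ∀ h p p', ha h p p' → q p' = h • q p) (hex : ∀ h p', ∃ p, ha h p p') {F G : EqCoh SH S}
    (hF : IsInduced SP q ka ha V F.1) (hG : IsInduced SP q ka ha V G.1) :
    KGroup.cls F = KGroup.cls G := by
  obtain ⟨e, e_inj, e_range, e_add, e_smul, e_map⟩ := hF
  obtain ⟨e', e_inj', e_range', e_add', e_smul', e_map'⟩ := hG
  have ex : ∀ U (s : F.1.sec U), ∃ t : G.1.sec U, e' U t = e U s := fun U s =>
    (e_range' U _).2 ((e_range U _).1 ⟨s, rfl⟩)
  have ex' : ∀ U (s : G.1.sec U), ∃ t : F.1.sec U, e U t = e' U s := fun U s =>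
    (e_range U _).2 ((e_range' U _).1 ⟨s, rfl⟩)
  choose f hf using ex
  have hadd : ∀ U s t, f U (s + t) = f U s + f U t := fun U s t => e_inj' U <| by
    rw [hf, e_add, e_add', hf, hf]
  refine KGroup.cls_eq_of_iso (F := F) (G := G)
    { app := fun U => AddMonoidHom.mk' (f U) (hadd U)
      app_smul := fun U c s => e_inj' U <| by
        funext p
        change e' U (f U (c • s)) p = e' U (c • f U s) p
        rw [hf, e_smul, e_smul', hf]
      app_map := fun h U W hUW s => e_inj' W <| by
        funext p'
        change e' W (f W _) p' = e' W (G.1.map h U W hUW (f U s)) p'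
        obtain ⟨p, hp⟩ := hex h p'.1
        have hpU : q p ∈ U.1 := by
          have := hUW _ p'.2
          rwa [hq h p p'.1 hp, inv_smul_smul] at this
        rw [hf, e_map h U W hUW s ⟨p, hpU⟩ p' hp, e_map' h U W hUW _ ⟨p, hpU⟩ p' hp, hf] }
    fun U => ⟨fun s t hst => ?_, fun s => ?_⟩
  · have : f U s = f U t := hst
    exact e_inj U (by rw [← hf, ← hf, this])
  · obtain ⟨t, ht⟩ := ex' U s
    exact ⟨t, e_inj' U (by rw [← ht]; exact hf U t)⟩

end Iso

/-! ### Transport of sheaves along equivariant isomorphisms -/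

/-- An isomorphism of varieties that is equivariant for an isomorphism of algebraic groups. -/
structure EqIso {H₁ Y₁ H₂ Y₂ : Type} [Group H₁] [MulAction H₁ Y₁] [Group H₂] [MulAction H₂ Y₂]
    (SH₁ : FunSp H₁) (S₁ : FunSp Y₁) (SH₂ : FunSp H₂) (S₂ : FunSp Y₂) where
  Ψ : Y₁ ≃ Y₂
  φ : H₁ ≃* H₂
  hΨ : IsIso S₁ S₂ Ψ
  hφ : IsIso SH₁ SH₂ φ.toEquiv
  eqv : ∀ h y, Ψ (h • y) = φ h • Ψ y

section Transport

variable {H₁ Y₁ H₂ Y₂ : Type} [Group H₁] [MulAction H₁ Y₁] [Group H₂] [MulAction H₂ Y₂]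
  {SH₁ : FunSp H₁} {S₁ : FunSp Y₁} {SH₂ : FunSp H₂} {S₂ : FunSp Y₂}

namespace EqIso

/-- The inverse. -/
def symm (E : EqIso SH₁ S₁ SH₂ S₂) : EqIso SH₂ S₂ SH₁ S₁ where
  Ψ := E.Ψ.symm
  φ := E.φ.symm
  hΨ := ⟨E.hΨ.2, E.hΨ.1⟩
  hφ := ⟨E.hφ.2, E.hφ.1⟩
  eqv h y := by
    rw [Equiv.symm_apply_eq, E.eqv, Equiv.apply_symm_apply, MulEquiv.apply_symm_apply]

variable (E : EqIso SH₁ S₁ SH₂ S₂)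

/-- Preimages of open sets. -/
def pre (U : S₂.Op) : S₁.Op := ⟨E.Ψ ⁻¹' U.1, E.hΨ.1.1 _ U.2⟩

theorem coe_pre (U : S₂.Op) : (E.pre U).1 = E.Ψ ⁻¹' U.1 := rfl

theorem exists_pre (V : S₁.Op) : ∃ U : S₂.Op, E.pre U = V :=
  ⟨⟨E.Ψ.symm ⁻¹' V.1, E.hΨ.2.1 _ V.2⟩, Subtype.ext (by ext; simp [pre])⟩

theorem pre_subset {U V : S₂.Op} : (E.pre U).1 ⊆ (E.pre V).1 ↔ U.1 ⊆ V.1 :=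
  ⟨fun h y hy => by simpa [pre] using @h (E.Ψ.symm y) (by simpa [pre] using hy),
    fun h y hy => h hy⟩

theorem symm_smul (h : H₂) (y : Y₁) : E.φ.symm h • y = E.Ψ.symm (h • E.Ψ y) := by
  rw [Equiv.eq_symm_apply, E.eqv, MulEquiv.apply_symm_apply]

/-- Pullback of regular functions. -/
def pullO (U : S₂.Op) : S₂.O U.1 →+* S₁.O (E.pre U).1 where
  toFun f := ⟨fun y => f.1 ⟨E.Ψ y.1, y.2⟩, by
    obtain ⟨F, hF, hf⟩ := f.2
    exact ⟨fun y => F (E.Ψ y), fun x hx => E.hΨ.1.2 _ _ (hF _ hx), fun x => hf _⟩⟩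
  map_one' := rfl
  map_mul' _ _ := rfl
  map_zero' := rfl
  map_add' _ _ := rfl

/-- Pushforward of regular functions. -/
def pushO (U : S₂.Op) (f : S₁.O (E.pre U).1) : S₂.O U.1 :=
  ⟨fun y => f.1 ⟨E.Ψ.symm y.1, by simp [pre]⟩, by
    obtain ⟨F, hF, hf⟩ := f.2
    exact ⟨fun y => F (E.Ψ.symm y), fun x hx => E.hΨ.2.2 _ _ (hF _ (by simpa [pre] using hx)),
      fun x => hf _⟩⟩

theorem pull_push (U : S₂.Op) (f : S₁.O (E.pre U).1) : E.pullO U (E.pushO U f) = f := by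
  ext y
  exact congrArg f.1 (Subtype.ext (E.Ψ.symm_apply_apply _))

theorem pull_res {U V : S₂.Op} (h : V.1 ⊆ U.1) (f : S₂.O U.1) :
    E.pullO V (resO S₂ h f) = resO S₁ (E.pre_subset.2 h) (E.pullO U f) := rfl

theorem pull_smul (U : S₂.Op) (c : ℂ) (f : S₂.O U.1) : E.pullO U (c • f) = c • E.pullO U f := rfl

/-- The presheaf transported along an equivariant isomorphism. -/
abbrev transPre (F : EqPre H₁ S₁) : EqPre H₂ S₂ where
  sec U := F.sec (E.pre U)
  mod U := Module.compHom _ (E.pullO U)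
  map h U V hUV := F.map (E.φ.symm h) (E.pre U) (E.pre V) fun y hy => by
    have := hUV _ hy
    rw [← map_inv, symm_smul]
    simpa [pre] using this
  map_one U hU s := by
    rw [F.map_congr (map_one _) _ (fun y hy => by simpa using hy), F.map_one]
  map_map h k U V W hUV hVW hUW s := by
    rw [F.map_map _ _ _ _ _ _ _ (by
      intro y hy
      have := hUW _ hy
      rw [← map_mul, ← map_inv, symm_smul]
      simpa [pre] using this)]
    exact F.map_congr (map_mul _ _ _).symm _ _ _
  map_smul h U V hUV f f' s hf := by
    refine F.map_smul _ _ _ _ (E.pullO U f) (E.pullO V f') s fun y => ?_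
    refine (hf ⟨E.Ψ y.1, y.2⟩).trans (congrArg f.1 (Subtype.ext ?_))
    change h⁻¹ • E.Ψ y.1 = E.Ψ ((E.φ.symm h)⁻¹ • y.1)
    rw [E.eqv, ← map_inv, MulEquiv.apply_symm_apply]

theorem transPre_res (F : EqPre H₁ S₁) {U V : S₂.Op} (h : V.1 ⊆ U.1)
    (s : F.sec (E.pre U)) : (E.transPre F).res h s = F.res (E.pre_subset.2 h) s :=
  F.map_congr (map_one _) _ _ _

theorem transPre_smul (F : EqPre H₁ S₁) {U : S₂.Op} (f : S₂.O U.1) (s : (E.transPre F).sec U) :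
    f • s = (E.pullO U f • (show F.sec (E.pre U) from s) : F.sec (E.pre U)) := rfl

/-- The sheaf transported along an equivariant isomorphism. -/
abbrev trans (F : EqSheaf SH₁ S₁) : EqSheaf SH₂ S₂ where
  toEqPre := E.transPre F.toEqPre
  glue ι U W hU hcov s hs := by
    have := F.glue ι (fun a => E.pre (U a)) (E.pre W) (fun a => E.pre_subset.2 (hU a))
      (fun y hy => hcov _ hy) s fun a b V ha hb => by
        obtain ⟨V, rfl⟩ := E.exists_pre V
        exact (E.transPre_res F.toEqPre _ (s a)).symm.trans
          ((hs a b V (E.pre_subset.1 ha) (E.pre_subset.1 hb)).trans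
            (E.transPre_res F.toEqPre _ (s b)))
    obtain ⟨t, ht, hu⟩ := this
    exact ⟨t, fun a => (E.transPre_res F.toEqPre _ t).trans (ht a), fun t' ht' =>
      hu t' fun a => (E.transPre_res F.toEqPre _ t').symm.trans (ht' a)⟩
  rational U s h₀ y₀ hy₀ := by
    have hmem : (E.φ.symm h₀)⁻¹ • E.Ψ.symm y₀ ∈ (E.pre U).1 := by
      rw [← map_inv, symm_smul]
      simpa [pre] using hy₀
    obtain ⟨H₀, V, n, m, t, a, b, c, d, hyV, hh, ha, hc, hne, key⟩ :=
      F.rational (E.pre U) s (E.φ.symm h₀) (E.Ψ.symm y₀) hmem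
    obtain ⟨V, rfl⟩ := E.exists_pre V
    refine ⟨⟨E.φ.symm ⁻¹' H₀.1, E.hφ.2.1 _ H₀.2⟩, V, n, m, t, fun k j h => a k j (E.φ.symm h),
      fun k j => E.pushO V (b k j), fun j h => c j (E.φ.symm h), fun j => E.pushO V (d j),
      by simpa [pre] using hyV, hh, fun k j h hh => E.hφ.2.2 _ _ (ha k j _ hh),
      fun j h hh => E.hφ.2.2 _ _ (hc j _ hh), hne, fun h hh V' hV hU hne' => ?_⟩
    have := key (E.φ.symm h) hh (E.pre V') (E.pre_subset.2 hV) (by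
      intro y hy
      have := hU _ hy
      rw [← map_inv, symm_smul]
      simpa [pre] using this) (fun y => by
        have := hne' ⟨E.Ψ y.1, y.2⟩
        simpa only [pushO, Equiv.symm_apply_apply] using this)
    have aux : ∀ (u : Fin m → ℂ) (f : Fin m → S₁.O (E.pre V).1),
        E.pullO V' (resO S₂ hV (∑ j, u j • E.pushO V (f j))) =
          resO S₁ (E.pre_subset.2 hV) (∑ j, u j • f j) := fun u f => by
      rw [pull_res, map_sum]
      simp only [pull_smul, pull_push]
    refine (E.transPre_smul F.toEqPre _ _).trans ?_
    rw [aux]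
    refine this.trans (Finset.sum_congr rfl fun k _ => ?_)
    refine Eq.trans ?_ (E.transPre_smul F.toEqPre _ _).symm
    rw [aux]
    exact congrArg _ (E.transPre_res F.toEqPre _ (t k)).symm

theorem trans_isCoherent {F : EqSheaf SH₁ S₁} (hF : F.IsCoherent) : (E.trans F).IsCoherent := by
  intro y
  obtain ⟨U, n, m, t, r, hy, h1, h2, h3⟩ := hF (E.Ψ.symm y)
  obtain ⟨U, rfl⟩ := E.exists_pre U
  refine ⟨U, n, m, t, fun l k => E.pushO U (r l k), by simpa [pre] using hy, ?_, ?_, ?_⟩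
  · intro V hV s x hx
    obtain ⟨V', h', hU, f, hx', hf⟩ := h1 (E.pre V) (E.pre_subset.2 hV) s (E.Ψ.symm x)
      (by simpa [pre] using hx)
    obtain ⟨V', rfl⟩ := E.exists_pre V'
    refine ⟨V', E.pre_subset.1 h', E.pre_subset.1 hU, fun k => E.pushO V' (f k),
      by simpa [pre] using hx', ?_⟩
    refine (E.transPre_res F.toEqPre _ s).trans (hf.trans (Finset.sum_congr rfl fun k _ => ?_))
    refine Eq.trans ?_ (E.transPre_smul F.toEqPre _ _).symm
    rw [pull_push]
    exact congrArg _ (E.transPre_res F.toEqPre _ _).symm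
  · intro l
    refine (Finset.sum_congr rfl fun k _ => ?_).trans (h2 l)
    refine (E.transPre_smul F.toEqPre _ _).trans ?_
    rw [pull_push]
  · intro V hV f hf x hx
    obtain ⟨V', h', hU, g, hx', hg⟩ := h3 (E.pre V) (E.pre_subset.2 hV) (fun k => E.pullO V (f k))
      (by
        refine (Finset.sum_congr rfl fun k _ => ?_).trans hf
        refine Eq.trans ?_ (E.transPre_smul F.toEqPre _ _).symm
        exact congrArg _ (E.transPre_res F.toEqPre _ _).symm) (E.Ψ.symm x) (by simpa [pre] using hx)
    obtain ⟨V', rfl⟩ := E.exists_pre V'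
    refine ⟨V', E.pre_subset.1 h', E.pre_subset.1 hU, fun k => E.pushO V' (g k),
      by simpa [pre] using hx', fun k => ?_⟩
    ext z
    have := congrArg (fun f => f.1 ⟨E.Ψ.symm z.1, by simp [pre]⟩) (hg k)
    simp only [AddSubmonoidClass.coe_finsetSum, Finset.sum_apply, MulMemClass.coe_mul,
      Pi.mul_apply] at this ⊢
    refine Eq.trans ?_ this
    exact congrArg (f k).1 (Subtype.ext (E.Ψ.apply_symm_apply _).symm)

theorem isTransport_trans (F : EqSheaf SH₁ S₁) : IsTransport E.Ψ E.φ F (E.trans F) := by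
  refine ⟨fun U₁ U₂ hU => (Subtype.ext hU : U₁ = E.pre U₂) ▸ AddEquiv.refl _, ?_, ?_⟩
  · intro U₁ U₂ hU f₁ f₂ s hf
    obtain rfl : U₁ = E.pre U₂ := Subtype.ext hU
    have : f₁ = E.pullO U₂ f₂ := by
      ext y
      exact hf y.1 y.2 y.2
    rw [this]
    rfl
  · intro h U₁ U₂ hU V₁ V₂ hV hUV₁ hUV₂ s
    obtain rfl : U₁ = E.pre U₂ := Subtype.ext hU
    obtain rfl : V₁ = E.pre V₂ := Subtype.ext hV
    exact F.map_congr (E.φ.symm_apply_apply h).symm _ _ _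

variable {E}

theorem isTransport_symm {F : EqSheaf SH₁ S₁} {G : EqSheaf SH₂ S₂} (h : IsTransport E.Ψ E.φ F G) :
    IsTransport E.symm.Ψ E.symm.φ G F := by
  obtain ⟨e, h1, h2⟩ := h
  have aux : ∀ {U₂ : S₂.Op} {U₁ : S₁.Op}, U₂.1 = E.symm.Ψ ⁻¹' U₁.1 → U₁.1 = E.Ψ ⁻¹' U₂.1 := by
    intro U₂ U₁ hU
    rw [hU]
    ext y
    simp [symm]
  refine ⟨fun U₂ U₁ hU => (e U₁ U₂ (aux hU)).symm, ?_, ?_⟩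
  · intro U₂ U₁ hU f₂ f₁ s hf
    rw [AddEquiv.symm_apply_eq, h1 _ _ _ f₁ f₂, AddEquiv.apply_symm_apply]
    intro y hy₁ hy₂
    rw [hf (E.Ψ y) hy₂ (by simpa [symm] using hy₁)]
    exact congrArg f₁.1 (Subtype.ext (E.Ψ.symm_apply_apply y).symm)
  · intro h U₂ U₁ hU V₂ V₁ hV hUV₂ hUV₁ s
    rw [AddEquiv.symm_apply_eq, h2 _ U₁ U₂ (aux hU) V₁ V₂ (aux hV) hUV₁
      (by simpa [symm] using hUV₂), AddEquiv.apply_symm_apply]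
    exact G.map_congr (E.φ.apply_symm_apply h).symm _ _ _

theorem isTransport_cls_eq {F : EqSheaf SH₁ S₁} {G G' : EqCoh SH₂ S₂}
    (h : IsTransport E.Ψ E.φ F G.1) (h' : IsTransport E.Ψ E.φ F G'.1) :
    KGroup.cls G = KGroup.cls G' := by
  obtain ⟨e, h1, h2⟩ := h
  obtain ⟨e', h1', h2'⟩ := h'
  refine KGroup.cls_eq_of_iso (F := G) (G := G')
    { app := fun U => ((e (E.pre U) U (E.coe_pre U)).symm.trans (e' (E.pre U) U (E.coe_pre U))).toAddMonoidHom
      app_smul := fun U f s => ?_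
      app_map := fun h U V hUV s => ?_ } fun U => AddEquiv.bijective _
  · change e' _ _ _ ((e _ _ _).symm (f • s)) = f • e' _ _ _ ((e _ _ _).symm s)
    rw [← h1' _ _ _ (E.pullO U f) f _ fun _ _ _ => rfl]
    congr 1
    rw [AddEquiv.symm_apply_eq, h1 _ _ _ (E.pullO U f) f _ fun _ _ _ => rfl,
      AddEquiv.apply_symm_apply]
  · obtain ⟨h, rfl⟩ := E.φ.surjective h
    have hUV' : ∀ y ∈ (E.pre V).1, h⁻¹ • y ∈ (E.pre U).1 := fun y hy => by
      have := hUV _ hy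
      rwa [← map_inv, ← E.eqv] at this
    change e' _ _ _ ((e _ _ _).symm _) = G'.1.map _ _ _ _ (e' _ _ _ ((e _ _ _).symm s))
    rw [← h2' h (E.pre U) U (E.coe_pre U) (E.pre V) V (E.coe_pre V) hUV' hUV]
    congr 1
    rw [AddEquiv.symm_apply_eq, h2 h (E.pre U) U (E.coe_pre U) (E.pre V) V (E.coe_pre V) hUV' hUV,
      AddEquiv.apply_symm_apply]

variable (E)

/-- Transport of morphisms. -/
def transHom {F G : EqSheaf SH₁ S₁} (i : EqHom F G) : EqHom (E.trans F) (E.trans G) where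
  app U := i.app (E.pre U)
  app_smul U f s := i.app_smul _ (E.pullO U f) s
  app_map _ _ _ _ s := i.app_map _ _ _ _ s

theorem isSES_transHom {F' F F'' : EqSheaf SH₁ S₁} {i : EqHom F' F} {p : EqHom F F''}
    (h : IsSES i p) : IsSES (E.transHom i) (E.transHom p) := by
  refine ⟨fun U => h.1 _, fun U s => h.2.1 _ s, fun U s y hy => ?_⟩
  obtain ⟨V, hV, s', hyV, hs'⟩ := h.2.2 (E.pre U) s (E.Ψ.symm y) (by simpa [pre] using hy)
  obtain ⟨V, rfl⟩ := E.exists_pre V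
  exact ⟨V, E.pre_subset.1 hV, s', by simpa [pre] using hyV,
    hs'.trans (E.transPre_res F''.toEqPre _ s).symm⟩

/-- Transport of coherent sheaves. -/
def transCoh (F : EqCoh SH₁ S₁) : EqCoh SH₂ S₂ := ⟨E.trans F.1, E.trans_isCoherent F.2⟩

/-- The map of Grothendieck groups given by transport. -/
def kMap : KGroup SH₁ S₁ →ₗ[ℂ] KGroup SH₂ S₂ :=
  Submodule.liftQ _ (Finsupp.linearCombination ℂ fun F => KGroup.cls (E.transCoh F)) (by
    rw [Submodule.span_le]
    rintro _ ⟨F', F, F'', i, p, h, rfl⟩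
    rw [SetLike.mem_coe, LinearMap.mem_ker, map_sub, map_sub]
    simp only [Finsupp.linearCombination_single, one_smul]
    rw [KGroup.cls_eq_add (F' := E.transCoh F') (F := E.transCoh F) (F'' := E.transCoh F'')
      (E.isSES_transHom h)]
    simp)

theorem kMap_cls (F : EqCoh SH₁ S₁) : E.kMap (KGroup.cls F) = KGroup.cls (E.transCoh F) := by
  refine (Submodule.liftQ_apply _ _ _).trans ?_
  rw [Finsupp.linearCombination_single, one_smul]

theorem kGroup_hom_ext {A : Type*} [AddCommGroup A] [Module ℂ A] {f g : KGroup SH₁ S₁ →ₗ[ℂ] A}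
    (h : ∀ F, f (KGroup.cls F) = g (KGroup.cls F)) : f = g := by
  refine Submodule.linearMap_qext _ (Finsupp.lhom_ext' fun F => LinearMap.ext_ring ?_)
  exact h F

theorem symm_kMap_kMap (v : KGroup SH₁ S₁) : E.symm.kMap (E.kMap v) = v := by
  suffices h : E.symm.kMap.comp E.kMap = LinearMap.id from LinearMap.congr_fun h v
  refine kGroup_hom_ext fun F => ?_
  rw [LinearMap.comp_apply, kMap_cls, kMap_cls]
  exact isTransport_cls_eq (E := E.symm) (E.symm.isTransport_trans _)
    (isTransport_symm (E.isTransport_trans _))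

/-- The isomorphism of Grothendieck groups given by transport. -/
def kEquiv : KGroup SH₁ S₁ ≃ₗ[ℂ] KGroup SH₂ S₂ :=
  LinearEquiv.ofLinearMap E.kMap E.symm.kMap
    (LinearMap.ext fun v => E.symm.symm_kMap_kMap v) (LinearMap.ext fun v => E.symm_kMap_kMap v)

theorem kEquiv_cls {F₁ : EqCoh SH₁ S₁} {F₂ : EqCoh SH₂ S₂} (h : IsTransport E.Ψ E.φ F₁.1 F₂.1) :
    E.kEquiv (KGroup.cls F₁) = KGroup.cls F₂ :=
  (E.kMap_cls F₁).trans (isTransport_cls_eq (E.isTransport_trans _) h)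

end EqIso

end Transport

/-! ### Representations -/

section Reps

variable {K : Type} [Group K] {SK : FunSp K}

theorem RepRing.cls_eq_add {V' V V'' : RatRep SK} {i p} (h : RatRep.IsSES V' V V'' i p) :
    RepRing.cls V = RepRing.cls V' + RepRing.cls V'' := by
  refine sub_eq_zero.1 ?_
  rw [← sub_sub]
  exact (Submodule.Quotient.mk_eq_zero _).2 (Submodule.subset_span ⟨V', V, V'', i, p, h, rfl⟩)

/-- The zero representation. -/
def zeroRep (SK : FunSp K) : RatRep SK := ⟨0, 1, fun i => i.elim0⟩

theorem RepRing.cls_zeroRep : RepRing.cls (zeroRep SK) = 0 := by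
  have := RepRing.cls_eq_add (V' := zeroRep SK) (V := zeroRep SK) (V'' := zeroRep SK) (i := 0) (p := 0)
    ⟨fun _ _ => Subsingleton.elim (α := Fin 0 → ℂ) _ _,
      fun _ _ => Subsingleton.elim (α := Fin 0 → ℂ) _ _,
      fun _ _ _ => Subsingleton.elim (α := Fin 0 → ℂ) _ _,
      fun _ => ⟨0, Subsingleton.elim (α := Fin 0 → ℂ) _ _⟩,
      Submodule.ext fun v => ⟨fun _ => rfl, fun _ => ⟨0, Subsingleton.elim (α := Fin 0 → ℂ) _ _⟩⟩⟩
  simpa using this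

theorem RepRing.cls_eq_of_iso {V V' : RatRep SK} (i : (Fin V.n → ℂ) ≃ₗ[ℂ] (Fin V'.n → ℂ))
    (h : ∀ k v, i ((V.ρ k).1.mulVec v) = (V'.ρ k).1.mulVec (i v)) :
    RepRing.cls V = RepRing.cls V' := by
  have := RepRing.cls_eq_add (V' := V) (V := V') (V'' := zeroRep SK) (i := i.toLinearMap) (p := 0)
    ⟨h, fun _ _ => Subsingleton.elim (α := Fin 0 → ℂ) _ _, i.injective,
      fun _ => ⟨0, Subsingleton.elim (α := Fin 0 → ℂ) _ _⟩,
      Submodule.ext fun v => ⟨fun _ => rfl, fun _ => i.surjective v⟩⟩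
  rw [this, RepRing.cls_zeroRep, add_zero]

/-- A linear map from the representation ring defined by an additive function. -/
def RepRing.lift {A : Type*} [AddCommGroup A] [Module ℂ A] (f : RatRep SK → A)
    (hf : ∀ V' V V'' i p, RatRep.IsSES V' V V'' i p → f V = f V' + f V'') : RepRing SK →ₗ[ℂ] A :=
  Submodule.liftQ _ (Finsupp.linearCombination ℂ f) (by
    rw [Submodule.span_le]
    rintro _ ⟨V', V, V'', i, p, h, rfl⟩
    rw [SetLike.mem_coe, LinearMap.mem_ker, map_sub, map_sub]
    simp only [Finsupp.linearCombination_single, one_smul]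
    rw [hf _ _ _ _ _ h]
    abel)

theorem RepRing.lift_cls {A : Type*} [AddCommGroup A] [Module ℂ A] (f : RatRep SK → A)
    (hf : ∀ V' V V'' i p, RatRep.IsSES V' V V'' i p → f V = f V' + f V'') (V : RatRep SK) :
    RepRing.lift f hf (RepRing.cls V) = f V := by
  refine (Submodule.liftQ_apply _ _ _).trans ?_
  rw [Finsupp.linearCombination_single, one_smul]

/-- Restriction of a rational representation along a homomorphism of algebraic groups. -/
abbrev RatRep.comap {K' : Type} [Group K'] {SK' : FunSp K'} (f : K' →* K) (hf : IsMor SK' SK f)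
    (V : RatRep SK) : RatRep SK' :=
  ⟨V.n, V.ρ.comp f, fun i j k => hf.2 _ k (V.rational i j (f k))⟩

/-- Restriction of the representation ring along a homomorphism of algebraic groups. -/
def RepRing.comap {K' : Type} [Group K'] {SK' : FunSp K'} (f : K' →* K) (hf : IsMor SK' SK f) :
    RepRing SK →ₗ[ℂ] RepRing SK' :=
  RepRing.lift (fun V => RepRing.cls (V.comap f hf)) fun V' V V'' i p h =>
    RepRing.cls_eq_add (V' := V'.comap f hf) (V := V.comap f hf) (V'' := V''.comap f hf) (i := i)
      (p := p) ⟨fun _ => h.1 _, fun _ => h.2.1 _, h.2.2⟩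

end Reps

/-! ### Sums of products of regular functions -/

section BiReg

variable {H P : Type} (SH : FunSp H) (SP : FunSp P)

/-- Functions on a product that are sums of products of regular functions. -/
def BiReg (f : H → P → ℂ) : Prop :=
  ∃ (m : ℕ) (a : Fin m → H → ℂ) (b : Fin m → P → ℂ), (∀ j h, SH.RegAt (a j) h) ∧
    (∀ j p, SP.RegAt (b j) p) ∧ ∀ h p, f h p = ∑ j, a j h * b j p

variable {SH SP}

theorem BiReg.of_fintype {ι : Type} [Fintype ι] {f : H → P → ℂ} (a : ι → H → ℂ) (b : ι → P → ℂ)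
    (ha : ∀ j h, SH.RegAt (a j) h) (hb : ∀ j p, SP.RegAt (b j) p)
    (hf : ∀ h p, f h p = ∑ j, a j h * b j p) : BiReg SH SP f := by
  refine ⟨Fintype.card ι, fun j => a ((Fintype.equivFin ι).symm j),
    fun j => b ((Fintype.equivFin ι).symm j), fun j => ha _, fun j => hb _, fun h p => ?_⟩
  rw [hf]
  exact (Equiv.sum_comp (Fintype.equivFin ι).symm fun j => a j h * b j p).symm

theorem BiReg.const (c : ℂ) : BiReg SH SP fun _ _ => c :=
  BiReg.of_fintype (ι := Unit) (fun _ _ => c) (fun _ _ => 1) (fun _ => SH.const c)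
    (fun _ => SP.const 1) (by simp)

theorem BiReg.add {f g : H → P → ℂ} (hf : BiReg SH SP f) (hg : BiReg SH SP g) :
    BiReg SH SP fun h p => f h p + g h p := by
  obtain ⟨m, a, b, ha, hb, hf⟩ := hf
  obtain ⟨n, a', b', ha', hb', hg⟩ := hg
  refine BiReg.of_fintype (ι := Fin m ⊕ Fin n) (Sum.elim a a') (Sum.elim b b') ?_ ?_ ?_
  · rintro (j | j) h <;> simp [ha, ha']
  · rintro (j | j) h <;> simp [hb, hb']
  · intro h p
    simp [hf, hg]

theorem BiReg.mul {f g : H → P → ℂ} (hf : BiReg SH SP f) (hg : BiReg SH SP g) :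
    BiReg SH SP fun h p => f h p * g h p := by
  obtain ⟨m, a, b, ha, hb, hf⟩ := hf
  obtain ⟨n, a', b', ha', hb', hg⟩ := hg
  refine BiReg.of_fintype (ι := Fin m × Fin n) (fun j h => a j.1 h * a' j.2 h)
    (fun j p => b j.1 p * b' j.2 p) (fun j h => SH.mul (ha _ _) (ha' _ _))
    (fun j p => SP.mul (hb _ _) (hb' _ _)) fun h p => ?_
  rw [hf, hg, Finset.sum_mul_sum, Fintype.sum_prod_type]
  exact Finset.sum_congr rfl fun i _ => Finset.sum_congr rfl fun j _ => by ring

theorem BiReg.eval {κ : Type} {c : H → P → κ → ℂ} (h : ∀ k, BiReg SH SP fun x p => c x p k)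
    (Q : MvPolynomial κ ℂ) : BiReg SH SP fun x p => MvPolynomial.eval (c x p) Q := by
  induction Q using MvPolynomial.induction_on with
  | C a => simpa using BiReg.const a
  | add p q hp hq => simpa using hp.add hq
  | mul_X p k hp => simpa using hp.mul (h k)

theorem BiReg.family {n : ℕ} {f : Fin n → H → P → ℂ} (hf : ∀ k, BiReg SH SP (f k)) :
    ∃ (m : ℕ) (a : Fin n → Fin m → H → ℂ) (b : Fin n → Fin m → P → ℂ),
      (∀ k j h, SH.RegAt (a k j) h) ∧ (∀ k j p, SP.RegAt (b k j) p) ∧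
        ∀ k h p, f k h p = ∑ j, a k j h * b k j p := by
  choose m a b ha hb hf using hf
  let e := (Fintype.equivFin (Σ k, Fin (m k)))
  refine ⟨_, fun k j h => if (e.symm j).1 = k then a (e.symm j).1 (e.symm j).2 h else 0,
    fun k j => b (e.symm j).1 (e.symm j).2, fun k j h => ?_, fun k j p => hb _ _ _, fun k h p => ?_⟩
  · exact RegAt.ite _ (fun _ => ha _ _ _) fun _ => SH.const 0 h
  · rw [Equiv.sum_comp e.symm fun j : (Σ k, Fin (m k)) =>
      (if j.1 = k then a j.1 j.2 h else 0) * b j.1 j.2 p, Fintype.sum_sigma, hf]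
    rw [Finset.sum_eq_single k]
    · simp
    · intro l _ hl
      simp [hl]
    · simp

end BiReg

/-! ### Principal bundles and induced sheaves -/

/-- A locally trivial principal bundle `P → Y` with structure group `K`, where `P` is embedded in
an affine space by the coordinates `c`, together with a lift to `P` of an action of `H` on `Y`. -/
structure Bundle {K H P Y κ : Type} [Group K] [Group H] [MulAction H Y] (SK : FunSp K)
    (SH : FunSp H) (S : FunSp Y) (c : P → κ → ℂ) where
  q : P → Y
  ka : K → P → P
  ha : H → P → P
  q_mor : IsMor (coord c) S q
  q_ka : ∀ k p, q (ka k p) = q p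
  q_ha : ∀ h p, q (ha h p) = h • q p
  ka_ha : ∀ k h p, ka k (ha h p) = ha h (ka k p)
  ka_mul : ∀ k k' p, ka (k * k') p = ka k (ka k' p)
  ha_one : ∀ p, ha 1 p = p
  ha_mul : ∀ h h' p, ha (h * h') p = ha h (ha h' p)
  free : ∀ k k' p, ka k p = ka k' p → k = k'
  triv : ∀ y, ∃ (U : S.Op) (σ : Y → P) (κ : P → K), y ∈ U.1 ∧
    (∀ y' ∈ U.1, q (σ y') = y' ∧ IsMorAt S (coord c) σ y') ∧
    ∀ p, q p ∈ U.1 → ka (κ p) (σ (q p)) = p ∧ IsMorAt (coord c) SK κ p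
  ha_reg : ∀ j, BiReg SH (coord c) fun h p => c (ha h⁻¹ p) j

namespace Bundle

variable {K H P Y κ : Type} [Group K] [Group H] [MulAction H Y] {SK : FunSp K}
  {SH : FunSp H} {S : FunSp Y} {c : P → κ → ℂ} (X : Bundle SK SH S c)

theorem ha_mor (h : H) : IsMor (coord c) (coord c) (X.ha h) := by
  refine isMor_to_coord (good_coord c) fun j p => ?_
  obtain ⟨m, a, b, -, hb, hf⟩ := X.ha_reg j
  have : (fun y => c (X.ha h y) j) = fun y => ∑ i, a i h⁻¹ * b i y := by
    funext y
    rw [← hf]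
    beta_reduce
    rw [inv_inv]
  rw [this]
  exact RegAt.sum _ fun i _ => (coord c).mul ((coord c).const _ _) (hb _ _)

theorem isOpen_preim (U : S.Op) : IsOpen[(coord c).top] (X.q ⁻¹' U.1) := X.q_mor.1 _ U.2

/-- The sections of the induced bundle. -/
def Sec (V : RatRep SK) (U : S.Op) : AddSubgroup (X.q ⁻¹' U.1 → Fin V.n → ℂ) where
  carrier := {s | (∀ j, (fun p => s p j) ∈ (coord c).O (X.q ⁻¹' U.1)) ∧
    ∀ (k : K) (p p' : X.q ⁻¹' U.1), p'.1 = X.ka k p.1 → s p' = (V.ρ k).1.mulVec (s p)}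
  zero_mem' := ⟨fun _ => Subalgebra.zero_mem _, fun _ _ _ _ => (Matrix.mulVec_zero _).symm⟩
  add_mem' hs ht := ⟨fun j => Subalgebra.add_mem _ (hs.1 j) (ht.1 j), fun k p p' h => by
    rw [Pi.add_apply, Pi.add_apply, hs.2 k p p' h, ht.2 k p p' h, Matrix.mulVec_add]⟩
  neg_mem' hs := ⟨fun j => Subalgebra.neg_mem _ (hs.1 j), fun k p p' h => by
    rw [Pi.neg_apply, Pi.neg_apply, hs.2 k p p' h, Matrix.mulVec_neg]⟩

theorem comp_q_mem {U : S.Op} (f : S.O U.1) :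
    (fun p : X.q ⁻¹' U.1 => f.1 ⟨X.q p.1, p.2⟩) ∈ (coord c).O (X.q ⁻¹' U.1) := by
  obtain ⟨F, hF, hf⟩ := f.2
  exact ⟨fun p => F (X.q p), fun p hp => X.q_mor.2 _ _ (hF _ hp), fun p => hf _⟩

instance (V : RatRep SK) (U : S.Op) : Module (S.O U.1) (X.Sec V U) where
  smul f s := ⟨fun p => f.1 ⟨X.q p.1, p.2⟩ • s.1 p, fun j =>
    Subalgebra.mul_mem _ (X.comp_q_mem f) (s.2.1 j), fun k p p' h => by
      have : (⟨X.q p'.1, p'.2⟩ : U.1) = ⟨X.q p.1, p.2⟩ := Subtype.ext ((congrArg X.q h).trans (X.q_ka _ _))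
      beta_reduce
      rw [this, s.2.2 k p p' h, Matrix.mulVec_smul]⟩
  one_smul s := Subtype.ext (funext fun p => one_smul ℂ _)
  mul_smul f g s := Subtype.ext (funext fun p => mul_smul (f.1 _) (g.1 _) (s.1 p))
  smul_zero f := Subtype.ext (funext fun p => smul_zero (f.1 _))
  smul_add f s t := Subtype.ext (funext fun p => smul_add (f.1 _) (s.1 p) (t.1 p))
  add_smul f g s := Subtype.ext (funext fun p => add_smul (f.1 _) (g.1 _) (s.1 p))
  zero_smul s := Subtype.ext (funext fun p => zero_smul ℂ (s.1 p))

theorem smul_apply {V : RatRep SK} {U : S.Op} (f : S.O U.1) (s : X.Sec V U) (p : X.q ⁻¹' U.1) :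
    (f • s).1 p = f.1 ⟨X.q p.1, p.2⟩ • s.1 p := rfl

theorem inv_mem {h : H} {U W : S.Op} (hUW : ∀ y ∈ W.1, h⁻¹ • y ∈ U.1) (p : X.q ⁻¹' W.1) :
    X.ha h⁻¹ p.1 ∈ X.q ⁻¹' U.1 := by
  rw [Set.mem_preimage, X.q_ha]
  exact hUW _ p.2

/-- The presheaf of sections of the induced bundle. -/
abbrev indPre (V : RatRep SK) : EqPre H S where
  sec U := X.Sec V U
  map h U W hUW :=
    { toFun := fun s => ⟨fun p => s.1 ⟨X.ha h⁻¹ p.1, X.inv_mem hUW p⟩, fun j => by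
        obtain ⟨F, hF, hf⟩ := s.2.1 j
        exact ⟨fun p => F (X.ha h⁻¹ p), fun p hp => (X.ha_mor h⁻¹).2 _ _
          (hF _ (X.inv_mem hUW ⟨p, hp⟩)), fun p => hf _⟩, fun k p p' hp => by
          refine s.2.2 k _ _ ?_
          change X.ha h⁻¹ p'.1 = X.ka k (X.ha h⁻¹ p.1)
          rw [hp, X.ka_ha]⟩
      map_zero' := rfl
      map_add' := fun _ _ => rfl }
  map_one U hU s := by
    refine Subtype.ext (funext fun p => congrArg s.1 (Subtype.ext ?_))
    change X.ha 1⁻¹ p.1 = p.1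
    rw [inv_one, X.ha_one]
  map_map h k U V W hUV hVW hUW s := by
    refine Subtype.ext (funext fun p => congrArg s.1 (Subtype.ext ?_))
    change X.ha k⁻¹ (X.ha h⁻¹ p.1) = X.ha (h * k)⁻¹ p.1
    rw [mul_inv_rev, X.ha_mul]
  map_smul h U V hUV f f' s hf := by
    refine Subtype.ext (funext fun p => ?_)
    change f.1 _ • s.1 _ = f'.1 _ • s.1 _
    rw [hf]
    exact congrArg (f.1 · • _) (Subtype.ext (X.q_ha _ _))

theorem res_apply {V : RatRep SK} {U W : S.Op} (h : W.1 ⊆ U.1) (s : X.Sec V U) (p : X.q ⁻¹' W.1) :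
    ((X.indPre V).res h s).1 p = s.1 ⟨p.1, h p.2⟩ :=
  congrArg s.1 (Subtype.ext (by
    change X.ha 1⁻¹ p.1 = p.1
    rw [inv_one, X.ha_one]))

theorem map_apply {V : RatRep SK} {h : H} {U W : S.Op} (hUW : ∀ y ∈ W.1, h⁻¹ • y ∈ U.1)
    (s : X.Sec V U) (p : X.q ⁻¹' W.1) :
    ((X.indPre V).map h U W hUW s).1 p = s.1 ⟨X.ha h⁻¹ p.1, X.inv_mem hUW p⟩ := rfl

theorem mem_O_of_local {U : Set P} {f : U → ℂ}
    (h : ∀ p ∈ U, ∃ (W : Set P) (F : P → ℂ), IsOpen[(coord c).top] W ∧ p ∈ W ∧ W ⊆ U ∧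
      (coord c).RegAt F p ∧ ∀ p' : U, p'.1 ∈ W → f p' = F p') : f ∈ (coord c).O U := by
  classical
  refine ⟨fun p => if hp : p ∈ U then f ⟨p, hp⟩ else 0, fun p hp => ?_, fun p => by simp⟩
  obtain ⟨W, F, hW, hpW, hWU, hF, hfF⟩ := h p hp
  exact (good_coord c).loc W hW hpW (fun y hy => by
    rw [dif_pos (hWU hy)]; exact (hfF ⟨y, hWU hy⟩ hy).symm) hF

theorem sum_apply {V : RatRep SK} {U : S.Op} {ι : Type} (t : Finset ι) (s : ι → X.Sec V U)
    (p : X.q ⁻¹' U.1) : (∑ k ∈ t, s k).1 p = ∑ k ∈ t, (s k).1 p := by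
  rw [AddSubgroup.val_finsetSum, Finset.sum_apply]

theorem κ_mul {U : S.Op} {σ : Y → P} {κ' : P → K}
    (hκ : ∀ p, X.q p ∈ U.1 → X.ka (κ' p) (σ (X.q p)) = p) {k : K} {p p' : P}
    (hp : X.q p ∈ U.1) (h : p' = X.ka k p) : κ' p' = k * κ' p := by
  have hq : X.q p' = X.q p := by rw [h, X.q_ka]
  refine X.free _ _ (σ (X.q p)) ?_
  rw [X.ka_mul, hκ p hp, ← h, ← hq, hκ p' (by rwa [hq])]

/-- The equivariant section of the induced bundle that is given on a local section of the principal
bundle by a regular map. -/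
def mkSec (V : RatRep SK) {U : S.Op} {σ : Y → P} {κ' : P → K}
    (hκ : ∀ p, X.q p ∈ U.1 → X.ka (κ' p) (σ (X.q p)) = p ∧ IsMorAt (coord c) SK κ' p)
    (v : P → Fin V.n → ℂ) (hv : ∀ j p, X.q p ∈ U.1 → (coord c).RegAt (fun p => v p j) p)
    (hv' : ∀ k p, v (X.ka k p) = v p) : X.Sec V U :=
  ⟨fun p => (V.ρ (κ' p.1)).1.mulVec (v p.1), fun j =>
    ⟨fun p => (V.ρ (κ' p)).1.mulVec (v p) j, fun p hp => RegAt.mulVec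
      (M := fun p => (V.ρ (κ' p)).1) (fun i j => (hκ p hp).2.2 _ (V.rational i j _))
      (fun j => hv j p hp) j, fun _ => rfl⟩, fun k p p' hp => by
      beta_reduce
      rw [X.κ_mul (fun p hp => (hκ p hp).1) p.2 hp, map_mul, Units.val_mul, ← Matrix.mulVec_mulVec,
        hp, hv']⟩

/-- A regular function on `P` near a fibre as a quotient of polynomials, simultaneously for all the
components. -/
theorem exists_fraction {V : RatRep SK} {U : S.Op} (s : X.Sec V U) (p₀ : P) (hp₀ : X.q p₀ ∈ U.1) :
    ∃ (N : Fin V.n → MvPolynomial κ ℂ) (Q : MvPolynomial κ ℂ), MvPolynomial.eval (c p₀) Q ≠ 0 ∧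
      ∀ p : X.q ⁻¹' U.1, MvPolynomial.eval (c p.1) Q ≠ 0 →
        ∀ k, MvPolynomial.eval (c p.1) Q * s.1 p k = MvPolynomial.eval (c p.1) (N k) := by
  have h1 : ∀ k, ∃ N Q : MvPolynomial κ ℂ, MvPolynomial.eval (c p₀) Q ≠ 0 ∧
      ∀ p : X.q ⁻¹' U.1, MvPolynomial.eval (c p.1) Q ≠ 0 →
        MvPolynomial.eval (c p.1) Q * s.1 p k = MvPolynomial.eval (c p.1) N := by
    intro k
    obtain ⟨F, hF, hf⟩ := s.2.1 k
    obtain ⟨G, ⟨W, hW, hpW, N, Q, hNQ⟩, W', hW', hpW', hFG⟩ := hF p₀ hp₀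
    have hbasis : TopologicalSpace.IsTopologicalBasis (t := zariski κ)
        {U | ∃ q : MvPolynomial κ ℂ, U = {x | MvPolynomial.eval x q ≠ 0}} := by
      refine @TopologicalSpace.IsTopologicalBasis.mk _ (zariski κ) _ ?_ ?_ rfl
      · rintro _ ⟨q, rfl⟩ _ ⟨q', rfl⟩ x hx
        refine ⟨_, ⟨q * q', rfl⟩, by simpa using hx, fun y hy => by simpa using hy⟩
      · exact Set.eq_univ_of_forall fun x => ⟨_, ⟨1, rfl⟩, by simp⟩
    obtain ⟨_, ⟨R, rfl⟩, hR, hRW⟩ := @TopologicalSpace.IsTopologicalBasis.exists_subset_of_mem_open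
      _ (zariski κ) _ hbasis (c p₀) (W ∩ W') ⟨hpW, hpW'⟩ (@IsOpen.inter _ (zariski κ) _ _ hW hW')
    refine ⟨N * R, Q * R, by simpa using ⟨(hNQ _ hpW).1, hR⟩, fun p hp => ?_⟩
    rw [map_mul] at hp
    have hpR := hRW (right_ne_zero_of_mul hp)
    rw [show s.1 p k = F p.1 from hf p, hFG _ hpR.2, (hNQ _ hpR.1).2, map_mul, map_mul]
    field_simp [(hNQ _ hpR.1).1]
  choose N Q hQ hNQ using h1
  refine ⟨fun k => N k * ∏ l ∈ Finset.univ.erase k, Q l, ∏ l, Q l, ?_, fun p hp k => ?_⟩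
  · rw [map_prod]
    exact Finset.prod_ne_zero_iff.2 fun l _ => hQ l
  · rw [map_prod] at hp ⊢
    rw [map_mul, map_prod, ← hNQ k p (Finset.prod_ne_zero_iff.1 hp k (Finset.mem_univ _)),
      ← Finset.mul_prod_erase _ _ (Finset.mem_univ k)]
    ring

theorem mulVec_single_sum {n : ℕ} (M : Matrix (Fin n) (Fin n) ℂ) (v : Fin n → ℂ) :
    M.mulVec v = ∑ k, v k • M.mulVec (Pi.single k 1) := by
  conv_lhs => rw [pi_eq_sum_univ' v]
  rw [Matrix.mulVec_sum]
  exact Finset.sum_congr rfl fun k _ => by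
    rw [Matrix.mulVec_smul]

/-- The induced sheaf. -/
abbrev ind (V : RatRep SK) : EqSheaf SH S where
  toEqPre := X.indPre V
  glue ι U W hU hcov s hs := by
    have hcov' : ∀ p : X.q ⁻¹' W.1, ∃ a, X.q p.1 ∈ (U a).1 := fun p => hcov _ p.2
    choose a ha using hcov'
    have key : ∀ (p : X.q ⁻¹' W.1) (b : ι) (hb : X.q p.1 ∈ (U b).1),
        (s (a p)).1 ⟨p.1, ha p⟩ = (s b).1 ⟨p.1, hb⟩ := by
      intro p b hb
      let W' : S.Op := ⟨(U (a p)).1 ∩ (U b).1, @IsOpen.inter _ S.top _ _ (U (a p)).2 (U b).2⟩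
      have := hs (a p) b W' Set.inter_subset_left Set.inter_subset_right
      have := congrArg (fun t : X.Sec V W' => t.1 ⟨p.1, ha p, hb⟩) this
      exact (X.res_apply _ _ _).symm.trans (this.trans (X.res_apply _ _ _))
    refine ⟨⟨fun p => (s (a p)).1 ⟨p.1, ha p⟩, fun j => ?_, fun k p p' h => ?_⟩, fun b => ?_,
      fun t ht => ?_⟩
    · refine mem_O_of_local fun p hp => ?_
      obtain ⟨F, hF, hf⟩ := (s (a ⟨p, hp⟩)).2.1 j
      refine ⟨X.q ⁻¹' (U (a ⟨p, hp⟩)).1, F, X.isOpen_preim _, ha ⟨p, hp⟩,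
        fun y hy => hU _ hy, hF _ (ha ⟨p, hp⟩), fun p' hp' => ?_⟩
      rw [← hf ⟨p'.1, hp'⟩]
      exact congrFun (key p' _ hp') j
    · have hp : X.q p.1 ∈ (U (a p')).1 := by
        rw [← X.q_ka k, ← h]
        exact ha p'
      beta_reduce
      rw [key p _ hp]
      exact (s (a p')).2.2 k ⟨p.1, hp⟩ ⟨p'.1, ha p'⟩ h
    · refine Subtype.ext (funext fun p => (X.res_apply _ _ _).trans (key ⟨p.1, hU b p.2⟩ b p.2))
    · refine Subtype.ext (funext fun p => ?_)
      have := congrArg (fun t : X.Sec V _ => t.1 ⟨p.1, ha p⟩) (ht (a p))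
      exact (X.res_apply (hU (a p)) t ⟨p.1, ha p⟩).symm.trans this
  rational U s h₀ y₀ hy₀ := by
    obtain ⟨V₀, σ, κ', hy, hσ, hκ⟩ := X.triv y₀
    obtain ⟨N, Q, hQ, hNQ⟩ := X.exists_fraction s (X.ha h₀⁻¹ (σ y₀)) (by
      rw [X.q_ha, (hσ y₀ hy).1]; exact hy₀)
    obtain ⟨m, a, b, ha, hb, hab⟩ := BiReg.family (n := V.n + 1)
      (f := Fin.snoc (fun k h p => MvPolynomial.eval (c (X.ha h⁻¹ p)) (N k))
        (fun h p => MvPolynomial.eval (c (X.ha h⁻¹ p)) Q)) (by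
        intro k
        refine Fin.lastCases ?_ (fun k => ?_) k
        · simpa only [Fin.snoc_last] using BiReg.eval X.ha_reg Q
        · simpa only [Fin.snoc_castSucc] using BiReg.eval X.ha_reg (N k))
    have habN : ∀ (k : Fin V.n) h p, MvPolynomial.eval (c (X.ha h⁻¹ p)) (N k) =
        ∑ j, a k.castSucc j h * b k.castSucc j p := fun k h p => by
      rw [← hab, Fin.snoc_castSucc]
    have habQ : ∀ h p, MvPolynomial.eval (c (X.ha h⁻¹ p)) Q =
        ∑ j, a (Fin.last _) j h * b (Fin.last _) j p := fun h p => by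
      rw [← hab, Fin.snoc_last]
    have hbO : ∀ k j, (fun y : V₀.1 => b k j (σ y.1)) ∈ S.O V₀.1 := fun k j =>
      ⟨fun y => b k j (σ y), fun y hy => (hσ y hy).2.2 _ (hb k j _), fun _ => rfl⟩
    refine ⟨⟨Set.univ, @isOpen_univ _ SH.top⟩, V₀, V.n, m,
      fun k => X.mkSec V hκ (fun _ => Pi.single k 1) (fun j p _ => (coord c).const _ p)
        (fun _ _ => rfl),
      fun k j => a k.castSucc j, fun k j => ⟨_, hbO k.castSucc j⟩, fun j => a (Fin.last _) j,
      fun j => ⟨_, hbO (Fin.last _) j⟩, hy, trivial, fun k j h _ => ha _ _ _, fun j h _ => ha _ _ _,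
      ?_, fun h _ V' hV hU hne => ?_⟩
    · change ∑ j, a (Fin.last _) j h₀ * b (Fin.last _) j (σ y₀) ≠ 0
      rwa [← habQ]
    · refine Subtype.ext (funext fun p => ?_)
      have hpV : X.q p.1 ∈ V₀.1 := hV p.2
      rw [X.sum_apply]
      have hr : ∀ (u : Fin m → ℂ) k, (resO S hV (∑ j, u j • (⟨_, hbO k j⟩ : S.O V₀.1))).1
          ⟨X.q p.1, p.2⟩ = ∑ j, u j * b k j (σ (X.q p.1)) := fun u k => by
        change (∑ j, u j • (⟨_, hbO k j⟩ : S.O V₀.1)).1 ⟨X.q p.1, hpV⟩ = _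
        rw [AddSubmonoidClass.coe_finsetSum, Finset.sum_apply]
        rfl
      have hq0 : X.ha h⁻¹ (σ (X.q p.1)) ∈ X.q ⁻¹' U.1 := by
        rw [Set.mem_preimage, X.q_ha, (hσ _ hpV).1]
        exact hU _ p.2
      have h1 : s.1 ⟨X.ha h⁻¹ p.1, X.inv_mem hU p⟩ =
          (V.ρ (κ' p.1)).1.mulVec (s.1 ⟨X.ha h⁻¹ (σ (X.q p.1)), hq0⟩) := by
        refine s.2.2 (κ' p.1) _ _ ?_
        change X.ha h⁻¹ p.1 = _
        rw [X.ka_ha, (hκ p.1 hpV).1]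
      refine (X.smul_apply _ _ p).trans ?_
      rw [hr, X.map_apply, h1, mulVec_single_sum, Finset.smul_sum]
      refine Finset.sum_congr rfl fun k _ => ?_
      refine Eq.trans ?_ (X.smul_apply _ _ p).symm
      rw [hr, X.res_apply, ← habN, ← habQ, smul_smul]
      congr 1
      refine hNQ ⟨_, hq0⟩ ?_ k
      have := hne ⟨X.q p.1, p.2⟩
      rwa [habQ]

theorem ind_isCoherent (V : RatRep SK) : (X.ind V).IsCoherent := by
  intro y
  obtain ⟨U, σ, κ', hy, hσ, hκ⟩ := X.triv y
  let t : Fin V.n → X.Sec V U := fun k => X.mkSec V hκ (fun _ => Pi.single k 1)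
    (fun j p _ => (coord c).const _ p) (fun _ _ => rfl)
  refine ⟨U, V.n, 0, t, fun k => k.elim0, hy, fun W hW s x hx => ?_, fun k => k.elim0,
    fun W hW f hf x hx => ⟨W, subset_rfl, hW, fun k => k.elim0, hx, fun k => ?_⟩⟩
  · have hq : ∀ y : W.1, X.q (σ y.1) ∈ W.1 := fun y => by rw [(hσ _ (hW y.2)).1]; exact y.2
    refine ⟨W, subset_rfl, hW, fun k => ⟨fun y => s.1 ⟨σ y.1, hq y⟩ k, ?_⟩, hx, ?_⟩
    · obtain ⟨F, hF, hf⟩ := s.2.1 k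
      exact ⟨fun y => F (σ y), fun y hy => (hσ y (hW hy)).2.2 _ (hF _ (hq ⟨y, hy⟩)), fun y => hf _⟩
    · refine Subtype.ext (funext fun p => ?_)
      rw [X.sum_apply]
      refine (X.res_apply _ _ _).trans ?_
      rw [s.2.2 (κ' p.1) ⟨σ (X.q p.1), hq ⟨_, p.2⟩⟩ ⟨p.1, p.2⟩ (hκ p.1 (hW p.2)).1.symm,
        mulVec_single_sum]
      refine Finset.sum_congr rfl fun k _ => ?_
      refine Eq.trans ?_ (X.smul_apply _ _ p).symm
      rw [X.res_apply]
      rfl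
  · ext y
    have hq : X.q (σ y.1) ∈ W.1 := by rw [(hσ _ (hW y.2)).1]; exact y.2
    have h1 := congrArg (fun s : X.Sec V W => s.1 ⟨σ y.1, hq⟩) hf
    beta_reduce at h1
    rw [X.sum_apply] at h1
    have h2 : (V.ρ (κ' (σ y.1))).1.mulVec (fun k => (f k).1 y) = 0 := by
      rw [mulVec_single_sum]
      refine Eq.trans (Finset.sum_congr rfl fun k _ => ?_) h1
      refine Eq.trans ?_ (X.smul_apply _ _ _).symm
      rw [X.res_apply]
      have : (⟨X.q (σ y.1), hq⟩ : W.1) = y := Subtype.ext (hσ _ (hW y.2)).1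
      rw [this]
      rfl
    have h3 := congrArg ((V.ρ (κ' (σ y.1)))⁻¹.1.mulVec) h2
    rw [Matrix.mulVec_mulVec, ← Units.val_mul, inv_mul_cancel, Units.val_one, Matrix.one_mulVec,
      Matrix.mulVec_zero] at h3
    simpa [resO] using congrFun h3 k

/-- The induced coherent sheaf. -/
def indCoh (V : RatRep SK) : EqCoh SH S := ⟨X.ind V, X.ind_isCoherent V⟩

theorem ind_isInduced (V : RatRep SK) : IsInduced (coord c) X.q (fun k p p' => p' = X.ka k p)
    (fun h p p' => p' = X.ha h p) V (X.ind V) := by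
  refine ⟨fun U s => s.1, fun U => Subtype.val_injective, fun U s => ?_, fun U s s' => rfl,
    fun U f s p => rfl, fun h U W hUW s p p' hp => congrArg s.1 (Subtype.ext ?_)⟩
  · exact ⟨fun ⟨t, ht⟩ => ht ▸ t.2, fun h => ⟨⟨s, h⟩, rfl⟩⟩
  · change X.ha h⁻¹ p'.1 = p.1
    rw [hp, ← X.ha_mul, inv_mul_cancel, X.ha_one]

/-- Functoriality of the induced sheaf. -/
def indHom {V V' : RatRep SK} (f : (Fin V.n → ℂ) →ₗ[ℂ] (Fin V'.n → ℂ))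
    (hf : ∀ k v, f ((V.ρ k).1.mulVec v) = (V'.ρ k).1.mulVec (f v)) :
    EqHom (X.ind V) (X.ind V') where
  app U :=
    { toFun := fun s => ⟨fun p => f (s.1 p), fun j => by
        have : (fun p => f (s.1 p) j) = ∑ k, LinearMap.toMatrix' f j k • fun p => s.1 p k := by
          funext p
          rw [← LinearMap.toMatrix'_mulVec]
          simp [Matrix.mulVec, dotProduct]
        rw [this]
        exact Subalgebra.sum_mem _ fun k _ => Subalgebra.smul_mem _ (s.2.1 k) _, fun k p p' h => by
          beta_reduce
          rw [s.2.2 k p p' h, hf]⟩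
      map_zero' := Subtype.ext (funext fun _ => map_zero f)
      map_add' := fun s t => Subtype.ext (funext fun _ => map_add f _ _) }
  app_smul U g s := Subtype.ext (funext fun _ => map_smul f _ _)
  app_map h U W hUW s := rfl

theorem indHom_apply {V V' : RatRep SK} (f : (Fin V.n → ℂ) →ₗ[ℂ] (Fin V'.n → ℂ)) (hf)
    {U : S.Op} (s : X.Sec V U) (p : X.q ⁻¹' U.1) :
    ((X.indHom (V := V) (V' := V') f hf).app U s).1 p = f (s.1 p) := rfl

theorem regAt_linear {n n' : ℕ} (f : (Fin n → ℂ) →ₗ[ℂ] (Fin n' → ℂ)) {v : P → Fin n → ℂ} {p : P}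
    (hv : ∀ j, (coord c).RegAt (fun p => v p j) p) (j : Fin n') :
    (coord c).RegAt (fun p => f (v p) j) p := by
  have : (fun p => f (v p) j) = fun p => (LinearMap.toMatrix' f).mulVec (v p) j := by
    funext p
    rw [LinearMap.toMatrix'_mulVec]
  rw [this]
  exact RegAt.mulVec (M := fun _ => LinearMap.toMatrix' f) (fun _ _ => (coord c).const _ p) hv j

theorem isSES_indHom {V' V V'' : RatRep SK} {i : (Fin V'.n → ℂ) →ₗ[ℂ] (Fin V.n → ℂ)}
    {p : (Fin V.n → ℂ) →ₗ[ℂ] (Fin V''.n → ℂ)} (h : RatRep.IsSES V' V V'' i p) :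
    IsSES (X.indHom i h.1) (X.indHom p h.2.1) := by
  obtain ⟨hi, hp, i_inj, p_surj, hexact⟩ := h
  obtain ⟨r, hr⟩ := i.exists_leftInverse_of_injective (LinearMap.ker_eq_bot.2 i_inj)
  obtain ⟨l, hl⟩ := p.exists_rightInverse_of_surjective (LinearMap.range_eq_top.2 p_surj)
  refine ⟨fun U s t hst => ?_, fun U s => ⟨fun hs => ?_, ?_⟩, fun U s y hy => ?_⟩
  · refine Subtype.ext (funext fun q => i_inj ?_)
    exact congrArg (fun t : X.Sec V U => t.1 q) hst
  · have h1 : ∀ q, i (r (s.1 q)) = s.1 q := fun q => by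
      have : s.1 q ∈ LinearMap.range i := by
        rw [hexact]
        exact congrArg (fun t : X.Sec V'' U => t.1 q) hs
      obtain ⟨v, hv⟩ := this
      rw [← hv]
      exact congrArg i (LinearMap.congr_fun hr v)
    refine ⟨⟨fun q => r (s.1 q), fun j => ?_, fun k q q' hq => i_inj ?_⟩,
      Subtype.ext (funext fun q => h1 q)⟩
    · have : (fun p => r (s.1 p) j) = ∑ k, LinearMap.toMatrix' r j k • fun p => s.1 p k := by
        funext p
        rw [← LinearMap.toMatrix'_mulVec]
        simp [Matrix.mulVec, dotProduct]
      rw [this]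
      exact Subalgebra.sum_mem _ fun k _ => Subalgebra.smul_mem _ (s.2.1 k) _
    · rw [h1, hi, h1, s.2.2 k q q' hq]
  · rintro ⟨t, rfl⟩
    refine Subtype.ext (funext fun q => ?_)
    change p (i (t.1 q)) = 0
    rw [← LinearMap.mem_ker, ← hexact]
    exact ⟨_, rfl⟩
  · obtain ⟨W, σ, κ', hyW, hσ, hκ⟩ := X.triv y
    let W' : S.Op := ⟨U.1 ∩ W.1, @IsOpen.inter _ S.top _ _ U.2 W.2⟩
    have hκ' : ∀ p, X.q p ∈ W'.1 → X.ka (κ' p) (σ (X.q p)) = p ∧ IsMorAt (coord c) SK κ' p :=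
      fun p hp => hκ p hp.2
    choose F hF hf using s.2.1
    have hq : ∀ p : X.q ⁻¹' W'.1, X.q (σ (X.q p.1)) ∈ U.1 := fun p => by
      rw [(hσ _ p.2.2).1]; exact p.2.1
    refine ⟨W', Set.inter_subset_left, X.mkSec V hκ' (fun q => l fun j => F j (σ (X.q q)))
      (fun j q hq' => ?_) (fun k q => by rw [X.q_ka]), ⟨hy, hyW⟩, Subtype.ext (funext fun q => ?_)⟩
    · refine regAt_linear l (v := fun q j => F j (σ (X.q q))) (fun j => ?_) j
      exact ((hσ _ hq'.2).2.comp (X.q_mor.at q)).2 (F j) (hF j _ (by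
        rw [Set.mem_preimage, (hσ _ hq'.2).1]; exact hq'.1))
    · refine Eq.trans ?_ (X.res_apply _ _ _).symm
      refine (X.indHom_apply _ _ _ _).trans ?_
      change p ((V.ρ (κ' q.1)).1.mulVec (l fun j => F j (σ (X.q q.1)))) = _
      rw [hp, ← LinearMap.comp_apply, hl, LinearMap.id_apply,
        s.2.2 (κ' q.1) ⟨σ (X.q q.1), hq q⟩ ⟨q.1, q.2.1⟩ (hκ q.1 q.2.2).1.symm]
      congr 1
      funext j
      exact (hf j ⟨_, hq q⟩).symm

/-- The induction map. -/
def indMap : RepRing SK →ₗ[ℂ] KGroup SH S :=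
  RepRing.lift (fun V => KGroup.cls (X.indCoh V)) fun _ _ _ _ _ h =>
    KGroup.cls_eq_add (X.isSES_indHom h)

theorem indMap_cls {V : RatRep SK} {F : EqCoh SH S} (hF : IsInduced (coord c) X.q
    (fun k p p' => p' = X.ka k p) (fun h p p' => p' = X.ha h p) V F.1) :
    X.indMap (RepRing.cls V) = KGroup.cls F := by
  refine (RepRing.lift_cls _ _ V).trans (IsInduced.cls_eq ?_ ?_ (X.ind_isInduced V) hF)
  · rintro h p _ rfl
    exact X.q_ha h p
  · exact fun h p' => ⟨X.ha h⁻¹ p', by rw [← X.ha_mul, mul_inv_cancel, X.ha_one]⟩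

end Bundle

/-! ### Reduction of the structure group -/

/-- A reduction of the principal bundle `P' → Y₁` with structure group `K'` to the principal bundle
`X : P → Y₂` with structure group `K`, where `Y₁` and `Y₂` are identified by `E`. -/
structure Reduction {K H₁ H₂ P Y₁ Y₂ κ K' P' : Type} [Group K] [Group H₁] [Group H₂]
    [MulAction H₁ Y₁] [MulAction H₂ Y₂] [Group K'] {SK : FunSp K} {SH₁ : FunSp H₁} {SH₂ : FunSp H₂}
    {S₁ : FunSp Y₁} {S₂ : FunSp Y₂} {c : P → κ → ℂ} (X : Bundle SK SH₂ S₂ c)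
    (E : EqIso SH₁ S₁ SH₂ S₂) (SK' : FunSp K') (SP' : FunSp P') (q' : P' → Y₁)
    (ka' : K' → P' → P' → Prop) (ha' : H₁ → P' → P' → Prop) where
  ι : P → P'
  j : K →* K'
  good : SP'.Good
  ι_mor : IsMor (coord c) SP' ι
  j_mor : IsMor SK SK' j
  q_ι : ∀ p, E.Ψ (q' (ι p)) = X.q p
  ka_mul : ∀ k k' p p' p'', ka' k p p' → ka' k' p' p'' → ka' (k' * k) p p''
  ka_inv : ∀ k p p', ka' k p p' → ka' k⁻¹ p' p
  q_ka : ∀ k p p', ka' k p p' → q' p' = q' p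
  ka_ι : ∀ k p, ka' (j k) (ι p) (ι (X.ka k p))
  of_ι : ∀ k' p p', ka' k' (ι p) (ι p') → ∃ k, j k = k' ∧ p' = X.ka k p
  ha_ι : ∀ h k r p p', ha' h p p' → ka' k (ι r) p → ka' k (ι (X.ha (E.φ h) r)) p'
  triv : ∀ p, ∃ (W : Set P') (σ : P' → P) (κ' : P' → K'), IsOpen[SP'.top] W ∧ p ∈ W ∧
    ∀ p' ∈ W, ka' (κ' p') (ι (σ p')) p' ∧ IsMorAt SP' (coord c) σ p' ∧ IsMorAt SP' SK' κ' p'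

namespace Reduction

variable {K H₁ H₂ P Y₁ Y₂ κ K' P' : Type} [Group K] [Group H₁] [Group H₂]
    [MulAction H₁ Y₁] [MulAction H₂ Y₂] [Group K'] {SK : FunSp K} {SH₁ : FunSp H₁} {SH₂ : FunSp H₂}
    {S₁ : FunSp Y₁} {S₂ : FunSp Y₂} {c : P → κ → ℂ} {X : Bundle SK SH₂ S₂ c}
    {E : EqIso SH₁ S₁ SH₂ S₂} {SK' : FunSp K'} {SP' : FunSp P'} {q' : P' → Y₁}
    {ka' : K' → P' → P' → Prop} {ha' : H₁ → P' → P' → Prop}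

theorem trans_ind_isInduced (R : Reduction X E SK' SP' q' ka' ha') (V : RatRep SK') :
    IsInduced SP' q' ka' ha' V (E.symm.trans (X.ind (V.comap R.j R.j_mor))) := by
  classical
  have hex : ∀ p, ∃ k r, ka' k (R.ι r) p := fun p => by
    obtain ⟨W, σ, κ', -, hp, h⟩ := R.triv p
    exact ⟨_, _, (h p hp).1⟩
  choose k r hkr using hex
  have hq : ∀ p, X.q (r p) = E.Ψ (q' p) := fun p => by
    rw [R.q_ka _ _ _ (hkr p), R.q_ι]
  have hmem : ∀ (U : S₁.Op) (p : q' ⁻¹' U.1), r p.1 ∈ X.q ⁻¹' (E.symm.pre U).1 := fun U p => by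
    change E.Ψ.symm (X.q (r p.1)) ∈ U.1
    rw [hq, Equiv.symm_apply_apply]
    exact p.2
  have hmem' : ∀ (U : S₁.Op) (p : P), X.q p ∈ (E.symm.pre U).1 ↔ q' (R.ι p) ∈ U.1 := fun U p => by
    change E.Ψ.symm (X.q p) ∈ U.1 ↔ _
    rw [← R.q_ι, Equiv.symm_apply_apply]
  let e : ∀ U : S₁.Op, X.Sec (V.comap R.j R.j_mor) (E.symm.pre U) → (q' ⁻¹' U.1 → Fin V.n → ℂ) := fun U s p =>
    (V.ρ (k p.1)).1.mulVec (s.1 ⟨r p.1, hmem U p⟩)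
  have key : ∀ (U : S₁.Op) (s : X.Sec (V.comap R.j R.j_mor) (E.symm.pre U)) (p : q' ⁻¹' U.1) (k' : K') (r' : P)
      (hr' : X.q r' ∈ (E.symm.pre U).1), ka' k' (R.ι r') p.1 →
        e U s p = (V.ρ k').1.mulVec (s.1 ⟨r', hr'⟩) := by
    intro U s p k' r' hr' h
    obtain ⟨l, hl, hr⟩ := R.of_ι _ _ _ (R.ka_mul _ _ _ _ _ h (R.ka_inv _ _ _ (hkr p.1)))
    have h1 := s.2.2 l ⟨r', hr'⟩ ⟨r p.1, hmem U p⟩ hr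
    change (V.ρ (k p.1)).1.mulVec (s.1 ⟨r p.1, hmem U p⟩) = _
    rw [h1]
    change (V.ρ (k p.1)).1.mulVec ((V.ρ (R.j l)).1.mulVec _) = _
    rw [Matrix.mulVec_mulVec, ← Units.val_mul, ← map_mul, hl, mul_inv_cancel_left]
  have key_ι : ∀ (U : S₁.Op) (s : X.Sec (V.comap R.j R.j_mor) (E.symm.pre U)) (p : P) (hp : X.q p ∈ (E.symm.pre U).1),
      e U s ⟨R.ι p, (hmem' U p).1 hp⟩ = s.1 ⟨p, hp⟩ := by
    intro U s p hp
    have h1 : ka' 1 (R.ι p) (R.ι p) := by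
      have := R.ka_mul _ _ _ _ _ (R.ka_ι 1 p) (R.ka_inv _ _ _ (R.ka_ι 1 p))
      rwa [inv_mul_cancel] at this
    rw [key U s _ 1 p hp h1, map_one, Units.val_one, Matrix.one_mulVec]
  refine ⟨e, fun U s t hst => ?_, fun U s => ⟨?_, fun hs => ?_⟩, fun U s s' => ?_, fun U f s p => ?_,
    fun h U W hUW s p p' hp => ?_⟩
  · refine Subtype.ext (funext fun p => ?_)
    rw [← key_ι U s p.1 p.2, hst, key_ι]
  · rintro ⟨s, rfl⟩
    refine ⟨fun i => ⟨fun p => if hp : q' p ∈ U.1 then e U s ⟨p, hp⟩ i else 0, fun p hp => ?_,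
      fun p => by
        beta_reduce
        rw [dif_pos (show q' p.1 ∈ U.1 from p.2)]⟩, fun k' p p' h => ?_⟩
    · obtain ⟨W, σ, κ', hW, hpW, h⟩ := R.triv p
      choose F hF hf using s.2.1
      have hσq : ∀ p ∈ W, q' p ∈ U.1 → X.q (σ p) ∈ (E.symm.pre U).1 := fun p hp hpU => by
        rw [hmem', ← R.q_ka _ _ _ (h p hp).1]
        exact hpU
      have hreg : SP'.RegAt (fun p => (V.ρ (κ' p)).1.mulVec (fun j => F j (σ p)) i) p :=
        RegAt.mulVec (M := fun p => (V.ρ (κ' p)).1) (v := fun p j => F j (σ p))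
          (fun a b => (h p hpW).2.2.2 _ (V.rational a b _))
          (fun b => (h p hpW).2.1.2 (F b) (hF b _ (hσq p hpW hp))) i
      obtain ⟨W', hW', hpW', hW'U⟩ := (h p hpW).2.1.1 (X.q ⁻¹' (E.symm.pre U).1)
        (X.isOpen_preim _) (hσq p hpW hp)
      refine R.good.loc (W ∩ W') (@IsOpen.inter _ SP'.top _ _ hW hW') ⟨hpW, hpW'⟩
        (fun y hy => ?_) hreg
      have hyU : q' y ∈ U.1 := by
        have := hW'U y hy.2
        rw [Set.mem_preimage, hmem', ← R.q_ka _ _ _ (h y hy.1).1] at this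
        exact this
      rw [dif_pos hyU, key U s ⟨y, hyU⟩ _ _ (hσq y hy.1 hyU) (h y hy.1).1]
      exact congrArg (fun v => (V.ρ (κ' y)).1.mulVec v i)
        (funext fun b => (hf b ⟨σ y, hσq y hy.1 hyU⟩).symm)
    · rw [key U s p' _ _ (hmem U p) (R.ka_mul _ _ _ _ _ (hkr p.1) h), map_mul, Units.val_mul,
        ← Matrix.mulVec_mulVec]
  · refine ⟨⟨fun p => s ⟨R.ι p.1, (hmem' U _).1 p.2⟩, fun i => ?_, fun l p p' h => ?_⟩, ?_⟩
    · obtain ⟨F, hF, hf⟩ := hs.1 i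
      exact ⟨fun p => F (R.ι p), fun p hp => R.ι_mor.2 _ _ (hF _ ((hmem' U p).1 hp)),
        fun p => hf _⟩
    · refine hs.2 (R.j l) _ _ ?_
      change ka' _ (R.ι p.1) (R.ι p'.1)
      rw [h]
      exact R.ka_ι _ _
    · funext p
      exact (hs.2 _ ⟨R.ι (r p.1), (hmem' U _).1 (hmem U p)⟩ p (hkr p.1)).symm
  · funext p
    exact Matrix.mulVec_add _ _ _
  · refine (Matrix.mulVec_smul _ _ _).trans ?_
    refine congrArg (f.1 · • _) (Subtype.ext ?_)
    change E.Ψ.symm (X.q (r p.1)) = q' p.1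
    rw [hq, Equiv.symm_apply_apply]
  · have h1 := R.ha_ι h _ _ _ _ hp (hkr p.1)
    have hq1 : X.q (X.ha (E.φ h) (r p.1)) ∈ (E.symm.pre W).1 := by
      rw [hmem', ← R.q_ka _ _ _ h1]
      exact p'.2
    refine (key W _ p' _ _ hq1 h1).trans (congrArg _ ?_)
    refine congrArg s.1 (Subtype.ext ?_)
    change X.ha (E.φ h)⁻¹ (X.ha (E.φ h) (r p.1)) = r p.1
    rw [← X.ha_mul, inv_mul_cancel, X.ha_one]

end Reduction

/-! ### Consequences of finite type -/

variable {I : Type} [Fintype I] [DecidableEq I]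

namespace CartanDatum

variable (D : CartanDatum I)

theorem form_pos (i j k : I) (x y w : ℤ)
    (h : (Pi.single i (x : ℝ) + Pi.single j (y : ℝ) + Pi.single k (w : ℝ) : I → ℝ) ≠ 0) :
    0 < x * x * (D.d i * D.c i i) + y * y * (D.d j * D.c j j) + w * w * (D.d k * D.c k k) +
      2 * x * y * (D.d i * D.c i j) + 2 * x * w * (D.d i * D.c i k) +
      2 * y * w * (D.d j * D.c j k) := by
  have h0 := D.finite_type.dotProduct_mulVec_pos h
  have e1 : ∀ (a b : I) (s t : ℝ), (Pi.single a s : I → ℝ) ⬝ᵥ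
      (Matrix.of fun i j => ((D.d i : ℝ) * (D.c i j : ℝ))).mulVec (Pi.single b t) =
        s * t * (D.d a * D.c a b) := fun a b s t => by
    rw [single_dotProduct, Matrix.mulVec_single]
    simp
    ring
  have hs : ∀ a b, (D.d a : ℝ) * D.c a b = D.d b * D.c b a := fun a b => by
    exact_mod_cast D.symm a b
  simp only [star_trivial, Matrix.mulVec_add, add_dotProduct, dotProduct_add, e1] at h0
  rw [hs j i, hs k i, hs k j] at h0
  have : (0 : ℝ) < ((x * x * (D.d i * D.c i i) + y * y * (D.d j * D.c j j) +
      w * w * (D.d k * D.c k k) + 2 * x * y * (D.d i * D.c i j) + 2 * x * w * (D.d i * D.c i k) +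
      2 * y * w * (D.d j * D.c j k) : ℤ) : ℝ) := by
    push_cast
    linarith
  exact_mod_cast this

theorem mul_lt_four {i j : I} (h : D.c i j < 0) : D.c i j * D.c j i < 4 := by
  have hij : i ≠ j := by
    rintro rfl
    rw [D.c_diag] at h
    omega
  have hi : (0 : ℤ) < D.d i := by exact_mod_cast D.d_pos i
  have hj : (0 : ℤ) < D.d j := by exact_mod_cast D.d_pos j
  have h1 := D.form_pos i j j (-(D.d i * D.c i j)) (2 * D.d i) 0 (fun h0 => by
    have := congrFun h0 j
    simp [hij.symm, (D.d_pos i).ne'] at this)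
  rw [D.c_diag, D.c_diag] at h1
  have hs := D.symm i j
  have h2 : 0 < (2 * D.d i * D.d i * D.d j : ℤ) * (4 - D.c i j * D.c j i) := by
    have : (2 * D.d i * D.d i * D.d j : ℤ) * (4 - D.c i j * D.c j i) =
      2 * D.d i * (4 * (D.d i * D.d j) - (D.d i * D.c i j) * (D.d j * D.c j i)) := by ring
    rw [this, ← hs]
    linarith
  have h3 : (0 : ℤ) < 2 * D.d i * D.d i * D.d j := by positivity
  have := pos_of_mul_pos_right h2 h3.le
  omega

theorem neg_symm {i j : I} (h : D.c i j < 0) : D.c j i < 0 := by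
  have hi : (0 : ℤ) < D.d i := by exact_mod_cast D.d_pos i
  have hj : (0 : ℤ) < D.d j := by exact_mod_cast D.d_pos j
  have hs := D.symm i j
  by_contra hc
  have : 0 ≤ (D.d j : ℤ) * D.c j i := mul_nonneg hj.le (by omega)
  nlinarith

theorem triple_eq {i j : I} (h : D.c i j = -3) :
    D.c j i = -1 ∧ (∀ k, k = i ∨ k = j) ∧ D.d i = 1 := by
  have h1 := D.mul_lt_four (i := i) (j := j) (by omega)
  have h2 := D.neg_symm (i := i) (j := j) (by omega)
  rw [h] at h1
  have hq : D.c j i = -1 := by omega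
  have hs := D.symm i j
  rw [h, hq] at hs
  have hi : (0 : ℤ) < D.d i := by exact_mod_cast D.d_pos i
  have hij : i ≠ j := by
    rintro rfl
    rw [D.c_diag] at h
    omega
  have bound : ∀ a b, D.c a b < 0 → (D.d a : ℤ) * D.c a b ≤ - D.d a ∧
      (D.d a : ℤ) * D.c a b ≤ - D.d b := by
    intro a b hab
    have ha : (0 : ℤ) < D.d a := by exact_mod_cast D.d_pos a
    have hb : (0 : ℤ) < D.d b := by exact_mod_cast D.d_pos b
    have := D.neg_symm hab
    refine ⟨by nlinarith, ?_⟩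
    rw [D.symm]
    nlinarith
  have nonpos : ∀ a b, a ≠ b → (D.d a : ℤ) * D.c a b ≤ 0 := fun a b hab =>
    mul_nonpos_of_nonneg_of_nonpos (by positivity) (D.c_offdiag a b hab)
  have hall : ∀ k, k = i ∨ k = j := by
    by_contra! hne
    obtain ⟨k₀, hk₀⟩ := hne
    obtain ⟨a, ha, k, hk, hak⟩ := D.indecomposable {i, j} ⟨i, by simp⟩ ⟨k₀, by simp [hk₀]⟩
    simp only [Set.mem_compl_iff, Set.mem_insert_iff, Set.mem_singleton_iff, not_or] at ha hk
    have hne : ∀ x y : ℤ, (Pi.single i (x : ℝ) + Pi.single j (y : ℝ) +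
        Pi.single k ((1 : ℤ) : ℝ) : I → ℝ) ≠ 0 := fun x y h0 => by
      have := congrFun h0 k
      simp [hk.1, hk.2] at this
    have n1 := nonpos i k (Ne.symm hk.1)
    have n2 := nonpos j k (Ne.symm hk.2)
    rcases ha with rfl | rfl
    · have hneg : D.c a k < 0 := lt_of_le_of_ne (D.c_offdiag a k (Ne.symm hk.1)) hak
      have := D.form_pos a j k 2 1 1 (hne 2 1)
      rw [D.c_diag, D.c_diag, D.c_diag, h] at this
      have := bound a k hneg
      omega
    · have hneg : D.c a k < 0 := lt_of_le_of_ne (D.c_offdiag a k (Ne.symm hk.2)) hak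
      have := D.form_pos i a k 3 2 1 (hne 3 2)
      rw [D.c_diag, D.c_diag, D.c_diag, h] at this
      have := bound a k hneg
      omega
  refine ⟨hq, hall, ?_⟩
  have : D.d i ∣ Finset.univ.gcd D.d := Finset.dvd_gcd fun k _ => by
    rcases hall k with rfl | rfl
    · exact dvd_rfl
    · exact ⟨3, by zify; linarith⟩
  rw [D.coprime] at this
  exact Nat.dvd_one.1 this

end CartanDatum

namespace Datum

variable {D : Datum I}

theorem E.c_symm {i j : I} (h : D.E i j) : D.c j i = -1 := by
  have h1 := D.mul_lt_four h.1
  have h2 := D.neg_symm h.1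
  have h3 := D.oriented i j h.1 h.2.1 h.2.2
  have hs := D.symm i j
  have hi : (0 : ℤ) < D.d i := by exact_mod_cast D.d_pos i
  have h3' : (D.d i : ℤ) ≤ D.d j := by exact_mod_cast h3
  have hle : D.c i j ≤ D.c j i := by
    by_contra hc
    push Not at hc
    nlinarith
  by_contra hne
  have : D.c j i ≤ -2 := by omega
  nlinarith

theorem E.d_eq {i j : I} (h : D.E i j) : (D.d j : ℤ) = - D.c i j * D.d i := by
  have hs := D.symm i j
  rw [h.c_symm] at hs
  linarith

theorem E.le_three {i j : I} (h : D.E i j) : - D.c i j ≤ 3 := by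
  have h1 := D.mul_lt_four h.1
  rw [h.c_symm] at h1
  omega

/-- The relation between the order defined by the shifted grading and the lattices. -/
theorem E.lt_shift_iff {i j : I} (h : D.E i j) {x : ℤ} (hx : 2 * (D.d i : ℤ) ∣ x + D.b i j) :
    D.d i * (- D.c i j - 2) < x ↔ D.shift i - D.shift j < x := by
  have hi : (0 : ℤ) < D.d i := by exact_mod_cast D.d_pos i
  have hq := h.c_symm
  have h3 := h.le_three
  have h0 := h.1
  obtain ⟨u, hu⟩ := hx
  rw [b] at hu
  by_cases hc : D.c i j = -3
  · obtain ⟨-, hall, hd⟩ := D.triple_eq hc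
    have s1 : D.shift i = 2 := if_pos ⟨j, hc⟩
    have s2 : D.shift j = 0 := if_neg (by
      rintro ⟨k, hk⟩
      rcases hall k with rfl | rfl
      · omega
      · rw [D.c_diag] at hk
        omega)
    rw [s1, s2, hc, hd]
    rw [hc, hd] at hu
    push_cast at *
    omega
  · have s1 : D.shift i = 0 := if_neg (by
      rintro ⟨k, hk⟩
      obtain ⟨-, hall, -⟩ := D.triple_eq hk
      rcases hall j with rfl | rfl
      · rw [D.c_diag] at h0
        omega
      · exact hc hk)
    have s2 : D.shift j = 0 := if_neg (by
      rintro ⟨k, hk⟩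
      obtain ⟨-, hall, -⟩ := D.triple_eq hk
      rcases hall i with rfl | rfl
      · rw [D.c_diag] at h0
        omega
      · omega)
    rw [s1, s2]
    have hx : x = D.d i * (2 * u - D.c i j) := by linarith
    have : D.c i j = -1 ∨ D.c i j = -2 := by omega
    rw [hx, sub_zero, mul_lt_mul_iff_right₀ hi, mul_pos_iff_of_pos_left hi]
    omega

end Datum

end FixedLocus
end

open scoped Topology
noncomputable section
namespace FixedLocus
open FunSp

/-! ### Laurent series -/

theorem exists_isBdd (f : LS) : ∃ N : ℕ, IsBdd N f := by
  by_cases hf : f = 0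
  · exact ⟨0, fun n _ => by rw [hf]; rfl⟩
  · refine ⟨(f.order).natAbs, fun n hn => HahnSeries.coeff_eq_zero_of_lt_order ?_⟩
    omega

theorem IsBdd.mono {N M : ℕ} {f : LS} (h : IsBdd N f) (hNM : N ≤ M) : IsBdd M f :=
  fun n hn => h n (by omega)

theorem IsBdd.le {N : ℕ} {f : LS} (h : IsBdd N f) {n : ℤ} (hn : f.coeff n ≠ 0) : -(N : ℤ) ≤ n := by
  by_contra hc
  exact hn (h n (by omega))

/-- A Laurent series with prescribed coefficients. -/
def mkLS (f : ℤ → ℂ) (N : ℤ) (h : ∀ n < N, f n = 0) : LS :=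
  HahnSeries.ofSuppBddBelow f ⟨N, fun n hn => by
    by_contra hc
    exact hn (h n (by omega))⟩

theorem mkLS_coeff (f : ℤ → ℂ) (N : ℤ) (h) (n : ℤ) : (mkLS f N h).coeff n = f n := rfl

theorem coeff_mul_eq_sum {f g : LS} {k : ℤ} (S : Finset ℤ)
    (hS : ∀ a, f.coeff a ≠ 0 → g.coeff (k - a) ≠ 0 → a ∈ S) :
    (f * g).coeff k = ∑ a ∈ S, f.coeff a * g.coeff (k - a) := by
  rw [HahnSeries.coeff_mul]
  refine Finset.sum_of_injOn Prod.fst ?_ ?_ ?_ ?_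
  · intro x hx y hy hxy
    simp only [Finset.mem_coe, Finset.mem_antidiagonal] at hx hy
    exact Prod.ext hxy (by have h1 := hx.2.2; have h2 := hy.2.2; rw [hxy] at h1; omega)
  · intro x hx
    simp only [Finset.mem_coe, Finset.mem_antidiagonal] at hx
    refine hS _ hx.1 ?_
    have : k - x.1 = x.2 := by have := hx.2.2; omega
    rw [this]
    exact hx.2.1
  · intro a _ ha
    by_contra hne
    refine ha ⟨(a, k - a), ?_, rfl⟩
    simp only [Finset.mem_coe, Finset.mem_antidiagonal]
    exact ⟨left_ne_zero_of_mul hne, right_ne_zero_of_mul hne, by ring⟩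
  · intro x hx
    rw [Finset.mem_antidiagonal] at hx
    have : k - x.1 = x.2 := by have := hx.2.2; omega
    rw [this]

theorem coeff_mul_Icc {f g : LS} {N M : ℕ} (hf : IsBdd N f) (hg : IsBdd M g) (k : ℤ) :
    (f * g).coeff k = ∑ a ∈ Finset.Icc (-(N : ℤ)) (k + M), f.coeff a * g.coeff (k - a) :=
  coeff_mul_eq_sum _ fun a ha hb => by
    have := hf.le ha
    have := hg.le hb
    rw [Finset.mem_Icc]
    omega

theorem IsBdd.mul {N M : ℕ} {f g : LS} (hf : IsBdd N f) (hg : IsBdd M g) : IsBdd (N + M) (f * g) := by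
  intro k hk
  rw [coeff_mul_Icc hf hg, Finset.Icc_eq_empty (by push_cast at hk; omega), Finset.sum_empty]

theorem IsBdd.sum {ι : Type} {N : ℕ} {s : Finset ι} {f : ι → LS} (h : ∀ i ∈ s, IsBdd N (f i)) :
    IsBdd N (∑ i ∈ s, f i) := by
  intro k hk
  rw [HahnSeries.coeff_sum]
  exact Finset.sum_eq_zero fun i hi => h i hi k hk

theorem isBdd_single {N : ℕ} {n : ℤ} (h : -(N : ℤ) ≤ n) (c : ℂ) :
    IsBdd N (HahnSeries.single n c : LS) := fun k hk => by
  rw [HahnSeries.coeff_single_of_ne (by omega)]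

theorem coeff_single_mul' (m k : ℤ) (b : ℂ) (f : LS) :
    (HahnSeries.single m b * f : LS).coeff k = b * f.coeff (k - m) := by
  rw [coeff_mul_eq_sum {m} fun a ha _ => ?_]
  · simp
  · rw [Finset.mem_singleton]
    by_contra hne
    exact ha (HahnSeries.coeff_single_of_ne hne)

/-- The series `∑ f_{p k + c} z ^ k`. -/
def decim (p : ℤ) (hp : 0 < p) (c : ℤ) : LS →ₗ[ℂ] LS where
  toFun f := mkLS (fun k => f.coeff (p * k + c)) (-(exists_isBdd f).choose - |c|) fun k hk => by
    refine (exists_isBdd f).choose_spec _ ?_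
    have h1 := neg_abs_le c
    have h2 := le_abs_self c
    have h3 := abs_nonneg c
    have : p * k ≤ 1 * k := by
      have : k ≤ 0 := by omega
      nlinarith
    omega
  map_add' f g := by ext k; simp [mkLS_coeff]
  map_smul' a f := by ext k; simp [mkLS_coeff]

@[simp] theorem decim_coeff (p : ℤ) (hp : 0 < p) (c : ℤ) (f : LS) (k : ℤ) :
    (decim p hp c f).coeff k = f.coeff (p * k + c) := rfl

theorem decim_powEmb_mul (p : ℤ) (hp : 0 < p) (c : ℤ) (g f : LS) :
    decim p hp c (powEmb p hp g * f) = g * decim p hp c f := by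
  ext k
  obtain ⟨N, hN⟩ := exists_isBdd g
  obtain ⟨M, hM⟩ := exists_isBdd f
  have hb : ∀ b : ℤ, g.coeff b ≠ 0 → f.coeff (p * (k - b) + c) ≠ 0 →
      b ∈ Finset.Icc (-(N : ℤ)) |p * k + c + M| := fun b h1 h2 => by
    have h3 := hN.le h1
    have h4 := hM.le h2
    rw [Finset.mem_Icc]
    refine ⟨h3, ?_⟩
    by_contra hc
    push Not at hc
    have h5 := abs_nonneg (p * k + c + M)
    have h6 := le_abs_self (p * k + c + M)
    nlinarith
  rw [decim_coeff, coeff_mul_eq_sum (f := g) (Finset.Icc (-(N : ℤ)) |p * k + c + M|)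
    fun b h1 h2 => hb b h1 h2,
    coeff_mul_eq_sum ((Finset.Icc (-(N : ℤ)) |p * k + c + M|).image (p * ·)) fun a h1 h2 => ?_,
    Finset.sum_image fun x _ y _ h => mul_left_cancel₀ hp.ne' h]
  · refine Finset.sum_congr rfl fun b _ => ?_
    rw [powEmb_coeff_mul, decim_coeff]
    congr 2
    ring
  · by_cases ha : ∃ m, p * m = a
    · obtain ⟨b, rfl⟩ := ha
      rw [powEmb_coeff_mul] at h1
      refine Finset.mem_image_of_mem _ (hb b h1 ?_)
      convert h2 using 2
      ring
    · exact absurd (powEmb_coeff_of_ne p hp g a ha) h1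

theorem powEmb_one (q : ℤ) (hq : 0 < q) (h : q = 1) (f : LS) : powEmb q hq f = f := by
  subst h
  ext k
  have := powEmb_coeff_mul 1 hq f k
  rwa [one_mul] at this

theorem eq_sum_decim (p : ℤ) (hp : 0 < p) (f : LS) :
    f = ∑ r ∈ Finset.range p.toNat, powEmb p hp (decim p hp r f) * HahnSeries.single (r : ℤ) 1 := by
  ext n
  rw [HahnSeries.coeff_sum]
  have hm := Int.emod_nonneg n hp.ne'
  have hm' := Int.emod_lt_of_pos n hp
  rw [Finset.sum_eq_single (n % p).toNat]
  · rw [mul_comm, coeff_single_mul', one_mul, Int.toNat_of_nonneg hm]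
    have : n - n % p = p * (n / p) := by have := Int.mul_ediv_add_emod n p; omega
    rw [this, powEmb_coeff_mul, decim_coeff, Int.mul_ediv_add_emod]
  · intro r hr hne
    rw [mul_comm, coeff_single_mul', one_mul]
    refine powEmb_coeff_of_ne _ _ _ _ ?_
    rintro ⟨m, hm⟩
    apply hne
    rw [Finset.mem_range] at hr
    have h1 : n = r + p * m := by omega
    have h2 : n % p = r := by
      rw [h1, Int.add_mul_emod_self_left, Int.emod_eq_of_lt] <;> omega
    omega
  · intro h
    exfalso
    apply h
    rw [Finset.mem_range]
    omega

/-- The vector `z ^ m e_t`. -/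
abbrev zvec {n : ℕ} (t : Fin n) (m : ℤ) : KV n := Pi.single t (HahnSeries.single m 1)

theorem zvec_same {n : ℕ} (t : Fin n) (m : ℤ) : zvec t m t = HahnSeries.single m 1 :=
  Pi.single_eq_same (M := fun _ : Fin n => LS) t _

theorem zvec_ne {n : ℕ} {t s : Fin n} (h : s ≠ t) (m : ℤ) : zvec t m s = 0 :=
  Pi.single_eq_of_ne (M := fun _ : Fin n => LS) h _

theorem HomZ_apply {p q : ℤ} {hp : 0 < p} {hq : 0 < q} {m n : ℕ} {B : KV m →ₗ[ℂ] KV n}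
    (hB : B ∈ HomZ p q hp hq m n) (v : KV m) :
    B v = ∑ t, ∑ r ∈ Finset.range p.toNat, powEmb q hq (decim p hp r (v t)) • B (zvec t r) := by
  have h1 : v = ∑ t, ∑ r ∈ Finset.range p.toNat, powEmb p hp (decim p hp r (v t)) • zvec t (r : ℤ) := by
    funext s
    rw [Finset.sum_apply, Finset.sum_eq_single s]
    · rw [Finset.sum_apply]
      refine (eq_sum_decim p hp (v s)).trans (Finset.sum_congr rfl fun r _ => ?_)
      rw [Pi.smul_apply, zvec_same, smul_eq_mul]
    · intro t _ hne
      rw [Finset.sum_apply]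
      refine Finset.sum_eq_zero fun r _ => ?_
      rw [Pi.smul_apply, zvec_ne hne.symm, smul_eq_mul, mul_zero]
    · simp
  conv_lhs => rw [h1]
  simp only [map_sum]
  exact Finset.sum_congr rfl fun t _ => Finset.sum_congr rfl fun r _ => hB _ _

theorem HomZ_ext {p q : ℤ} {hp : 0 < p} {hq : 0 < q} {m n : ℕ} {B B' : KV m →ₗ[ℂ] KV n}
    (hB : B ∈ HomZ p q hp hq m n) (hB' : B' ∈ HomZ p q hp hq m n)
    (h : ∀ t r, B (zvec t r) = B' (zvec t r)) : B = B' := by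
  refine LinearMap.ext fun v => ?_
  rw [HomZ_apply hB, HomZ_apply hB']
  simp only [h]

/-! ### Homogeneous maps -/

/-- The map `KV m → KV n` with matrix entries `β_{st} z ^ (-c_{st})`, where a monomial maps `z ^ a` to
a power of `z` if the exponent is divisible by `p`, and to zero else. -/
def monoMap (p : ℤ) (hp : 0 < p) {m n : ℕ} (β : Matrix (Fin n) (Fin m) ℂ) (c : Fin n → Fin m → ℤ) :
    KV m →ₗ[ℂ] KV n :=
  LinearMap.pi fun s => ∑ t, β s t • (decim p hp (c s t) ∘ₗ LinearMap.proj t)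

theorem monoMap_apply (p : ℤ) (hp : 0 < p) {m n : ℕ} (β : Matrix (Fin n) (Fin m) ℂ)
    (c : Fin n → Fin m → ℤ) (v : KV m) (s : Fin n) :
    monoMap p hp β c v s = ∑ t, β s t • decim p hp (c s t) (v t) := by
  simp [monoMap, LinearMap.sum_apply]

theorem monoMap_coeff (p : ℤ) (hp : 0 < p) {m n : ℕ} (β : Matrix (Fin n) (Fin m) ℂ)
    (c : Fin n → Fin m → ℤ) (v : KV m) (s : Fin n) (k : ℤ) :
    (monoMap p hp β c v s).coeff k = ∑ t, β s t * (v t).coeff (p * k + c s t) := by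
  rw [monoMap_apply, HahnSeries.coeff_sum]
  simp

theorem monoMap_zvec (p : ℤ) (hp : 0 < p) {m n : ℕ} (β : Matrix (Fin n) (Fin m) ℂ)
    (c : Fin n → Fin m → ℤ) (t : Fin m) (r : ℤ) (s : Fin n) (k : ℤ) :
    (monoMap p hp β c (zvec t r) s).coeff k = if p * k + c s t = r then β s t else 0 := by
  rw [monoMap_coeff, Finset.sum_eq_single t]
  · rw [zvec_same]
    by_cases h : p * k + c s t = r
    · rw [h, if_pos rfl, HahnSeries.coeff_single_same, mul_one]
    · rw [if_neg h, HahnSeries.coeff_single_of_ne h, mul_zero]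
  · intro t' _ hne
    rw [zvec_ne hne, HahnSeries.coeff_zero, mul_zero]
  · simp

theorem monoMap_mem_HomZ {p q : ℤ} (hp : 0 < p) (hq : 0 < q) (hq1 : q = 1) {m n : ℕ}
    (β : Matrix (Fin n) (Fin m) ℂ) (c : Fin n → Fin m → ℤ) :
    monoMap p hp β c ∈ HomZ p q hp hq m n := by
  intro f v
  funext s
  rw [monoMap_apply, powEmb_one q hq hq1, Pi.smul_apply, monoMap_apply, smul_eq_mul, Finset.mul_sum]
  refine Finset.sum_congr rfl fun t _ => ?_
  rw [Pi.smul_apply, smul_eq_mul, decim_powEmb_mul, smul_eq_C_mul, smul_eq_C_mul, mul_left_comm]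

/-- Matrices whose entries are compatible with the weights. -/
def Adapted (δ : ℤ) {m n : ℕ} (W : Fin m → ℤ) (W' : Fin n → ℤ) (β : Matrix (Fin n) (Fin m) ℂ) :
    Prop := ∀ s t, β s t ≠ 0 → δ ∣ W' s - W t

/-- The homogeneous map with coefficients `β`, where `z ^ a e_t` has weight `W t + δ a` and
`z ^ a e_s` has weight `W' s + p δ a`. -/
def wMap (p : ℤ) (hp : 0 < p) (δ : ℤ) {m n : ℕ} (W : Fin m → ℤ) (W' : Fin n → ℤ)
    (β : Matrix (Fin n) (Fin m) ℂ) : KV m →ₗ[ℂ] KV n :=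
  monoMap p hp β fun s t => (W' s - W t) / δ

section wMap

variable {p δ : ℤ} {hp : 0 < p} {m n l : ℕ} {W : Fin m → ℤ} {W' : Fin n → ℤ} {W'' : Fin l → ℤ}
  {β : Matrix (Fin n) (Fin m) ℂ}

theorem wMap_comp {p' p'' δ' : ℤ} {hp' : 0 < p'} {hp'' : 0 < p''} (hδ : δ ≠ 0)
    (hβ : Adapted δ W W' β) {β' : Matrix (Fin l) (Fin n) ℂ} (hβ' : Adapted δ' W' W'' β')
    (hδ' : δ' = p * δ) (hpp : p'' = p * p') (v : KV m) :
    wMap p' hp' δ' W' W'' β' (wMap p hp δ W W' β v) = wMap p'' hp'' δ W W'' (β' * β) v := by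
  funext r
  ext k
  simp only [wMap, monoMap_coeff, Matrix.mul_apply, Finset.mul_sum, Finset.sum_mul]
  rw [Finset.sum_comm]
  refine Finset.sum_congr rfl fun t _ => Finset.sum_congr rfl fun s _ => ?_
  by_cases h1 : β' r s = 0
  · simp [h1]
  by_cases h2 : β s t = 0
  · simp [h2]
  obtain ⟨x, hx⟩ := hβ' r s h1
  obtain ⟨y, hy⟩ := hβ s t h2
  have hδ'0 : δ' ≠ 0 := by rw [hδ']; exact mul_ne_zero hp.ne' hδ
  have h3 : W'' r - W t = δ * (p * x + y) := by
    rw [hδ'] at hx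
    linear_combination hx + hy
  rw [hx, hy, h3, Int.mul_ediv_cancel_left _ hδ'0, Int.mul_ediv_cancel_left _ hδ,
    Int.mul_ediv_cancel_left _ hδ, ← mul_assoc, hpp]
  congr 2
  ring

theorem adapted_mul {δ' : ℤ} (hβ : Adapted δ W W' β) {β' : Matrix (Fin l) (Fin n) ℂ}
    (hβ' : Adapted δ' W' W'' β') (hδ' : δ ∣ δ') : Adapted δ W W'' (β' * β) := by
  intro r t h
  rw [Matrix.mul_apply] at h
  obtain ⟨s, -, hs⟩ := Finset.exists_ne_zero_of_sum_ne_zero h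
  have h1 := hδ'.trans (hβ' r s (left_ne_zero_of_mul hs))
  have h2 := hβ s t (right_ne_zero_of_mul hs)
  have := dvd_add h1 h2
  rwa [sub_add_sub_cancel] at this

/-- A map of weight zero is homogeneous. -/
theorem eq_wMap {q : ℤ} {hq : 0 < q} (hq1 : q = 1) {δ' : ℤ} (hδ : δ ≠ 0) (hδ' : δ' = p * δ)
    {B : KV m →ₗ[ℂ] KV n} (hB : B ∈ HomZ p q hp hq m n)
    (h : ∀ t r s k, (B (zvec t r) s).coeff k ≠ 0 → W t + δ * r = W' s + δ' * k) :
    Adapted δ W W' (Matrix.of fun s t => if δ ∣ W' s - W t then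
      (B (zvec t ((W' s - W t) / δ)) s).coeff 0 else 0) ∧
    B = wMap p hp δ W W' (Matrix.of fun s t => if δ ∣ W' s - W t then
      (B (zvec t ((W' s - W t) / δ)) s).coeff 0 else 0) := by
  refine ⟨fun s t hst => ?_, HomZ_ext hB (monoMap_mem_HomZ hp hq hq1 _ _) fun t r => ?_⟩
  · by_contra hc
    simp [hc] at hst
  · funext s
    ext k
    rw [wMap, monoMap_zvec, Matrix.of_apply]
    have shift : ∀ a : ℤ, (B (zvec t (p * k + a)) s).coeff k = (B (zvec t a) s).coeff 0 := by
      intro a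
      have h1 : zvec t (p * k + a) = powEmb p hp (HahnSeries.single k 1) • zvec t a := by
        funext j
        rw [Pi.smul_apply]
        rcases eq_or_ne j t with rfl | hj
        · rw [zvec_same, zvec_same, smul_eq_mul]
          have : powEmb p hp (HahnSeries.single k 1) = HahnSeries.single (p * k) 1 :=
            HahnSeries.embDomain_single
          rw [this, HahnSeries.single_mul_single, one_mul]
        · rw [zvec_ne hj, zvec_ne hj, smul_eq_mul, mul_zero]
      rw [h1, hB, powEmb_one q hq hq1, Pi.smul_apply, smul_eq_mul, coeff_single_mul', one_mul,
        sub_self]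
    by_cases hr : δ ∣ W' s - W t
    · rw [if_pos hr]
      by_cases hk : p * k + (W' s - W t) / δ = r
      · rw [if_pos hk, ← hk, shift]
      · rw [if_neg hk]
        by_contra hne
        apply hk
        have h2 := h t r s k hne
        obtain ⟨x, hx⟩ := hr
        rw [hx, Int.mul_ediv_cancel_left _ hδ]
        rw [hδ'] at h2
        have : δ * (p * k + x) = δ * r := by linear_combination -h2 - hx
        exact mul_left_cancel₀ hδ this
    · rw [if_neg hr, ite_self]
      by_contra hne
      apply hr
      have h2 := h t r s k hne
      exact ⟨r - p * k, by rw [hδ'] at h2; linear_combination -h2⟩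

theorem wMap_zvec (t : Fin m) (r : ℤ) (s : Fin n) (k : ℤ) :
    (wMap p hp δ W W' β (zvec t r) s).coeff k =
      if p * k + (W' s - W t) / δ = r then β s t else 0 := monoMap_zvec _ _ _ _ _ _ _ _

theorem homBdd_wMap : HomBdd 0 (wMap p hp δ W W' β) ↔ ∀ s t, β s t ≠ 0 → (W' s - W t) / δ < p := by
  constructor
  · intro h s t hβ
    by_contra hc
    push Not at hc
    have h1 := h (zvec t (p * (-1) + (W' s - W t) / δ)) (fun t' => ?_) s (-1) (by simp)
    · rw [wMap_zvec, if_pos rfl] at h1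
      exact hβ h1
    · rcases eq_or_ne t' t with rfl | ht
      · rw [zvec_same]
        exact isBdd_single (by push_cast; omega) 1
      · rw [zvec_ne ht]
        exact fun _ _ => rfl
  · intro h v hv s k hk
    rw [wMap, monoMap_coeff]
    refine Finset.sum_eq_zero fun t _ => ?_
    by_cases hβ : β s t = 0
    · rw [hβ, zero_mul]
    · have := h s t hβ
      rw [hv t, mul_zero]
      push_cast at hk ⊢
      nlinarith

theorem wMap_homBdd (N : ℕ) (hN : ∀ s t, (W' s - W t) / δ ≤ N) :
    HomBdd N (wMap p hp δ W W' β) := by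
  intro v hv s k hk
  rw [wMap, monoMap_coeff]
  refine Finset.sum_eq_zero fun t _ => ?_
  have := hN s t
  rw [hv t, mul_zero]
  push_cast at hk ⊢
  nlinarith

/-- The invertible matrix with entries `b_{st} z ^ ((W t - W s) / δ)`. -/
def wMat (δ : ℤ) {n : ℕ} (W : Fin n → ℤ) (b : Matrix (Fin n) (Fin n) ℂ) :
    Matrix (Fin n) (Fin n) LS := Matrix.of fun s t => HahnSeries.single (-((W s - W t) / δ)) (b s t)

theorem wMat_mulVec (δ : ℤ) {n : ℕ} (W : Fin n → ℤ) (b : Matrix (Fin n) (Fin n) ℂ) (v : KV n) :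
    (wMat δ W b).mulVec v = wMap 1 one_pos δ W W b v := by
  funext s
  ext k
  rw [wMap, monoMap_coeff, Matrix.mulVec, dotProduct, HahnSeries.coeff_sum]
  refine Finset.sum_congr rfl fun t _ => ?_
  rw [wMat, Matrix.of_apply, coeff_single_mul']
  congr 2
  ring

theorem wMat_mul {δ : ℤ} (hδ : δ ≠ 0) {n : ℕ} {W : Fin n → ℤ} {b b' : Matrix (Fin n) (Fin n) ℂ}
    (hb : Adapted δ W W b) (hb' : Adapted δ W W b') :
    wMat δ W b * wMat δ W b' = wMat δ W (b * b') := by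
  refine Matrix.ext_of_mulVec_single fun t => ?_
  rw [← Matrix.mulVec_mulVec, wMat_mulVec, wMat_mulVec, wMat_mulVec,
    wMap_comp (p'' := 1) (hp'' := one_pos) hδ hb' hb (one_mul δ).symm (one_mul 1).symm]

theorem wMat_one {δ : ℤ} {n : ℕ} {W : Fin n → ℤ} : wMat δ W 1 = 1 := by
  ext s t : 1
  rw [wMat, Matrix.of_apply]
  rcases eq_or_ne s t with rfl | h
  · rw [Matrix.one_apply_eq, Matrix.one_apply_eq]
    simp
  · rw [Matrix.one_apply_ne h, Matrix.one_apply_ne h]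
    simp

end wMap

end FixedLocus
end

open scoped Topology
noncomputable section
namespace FixedLocus
open FunSp

variable {I : Type} [Fintype I] [DecidableEq I]

namespace Datum

variable {D : Datum I}

/-! ### Even coweights and blocks -/

theorem two_d_pos (D : Datum I) (i : I) : (0 : ℤ) < 2 * D.d i := by
  have := D.d_pos i
  omega

theorem I0_add {i : I} {k : ℤ} (h : (i, k) ∈ D.I0) : (i, k + 2 * D.d i) ∈ D.I0 := by
  refine Relation.EqvGen.trans _ _ _ h (Relation.EqvGen.rel _ _ ⟨?_, ?_⟩)
  · simp only [b, D.c_diag]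
    have := D.d_pos i
    omega
  · simp only [b, D.c_diag]
    ring

theorem I0_add_mul {i : I} {k : ℤ} (h : (i, k) ∈ D.I0) (m : ℤ) : (i, k + 2 * D.d i * m) ∈ D.I0 := by
  induction m using Int.induction_on with
  | zero => simpa using h
  | succ m ih =>
    have := I0_add ih
    convert this using 2
    ring
  | pred m ih =>
    refine Relation.EqvGen.trans _ _ _ ih (Relation.EqvGen.symm _ _ (Relation.EqvGen.rel _ _ ⟨?_, ?_⟩))
    · simp only [b, D.c_diag]
      have := D.d_pos i
      omega
    · simp only [b, D.c_diag]
      ring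

variable {n n' n'' : I → ℕ} {γ : Cow n} {γ' : Cow n'} {γ'' : Cow n''}

theorem IsEven.wt_mem (hγ : D.IsEven γ) (i : I) (s : Fin (n i)) : (i, D.wt γ i s) ∈ D.I0 := by
  obtain ⟨k, hk, h⟩ := hγ i s
  rw [wt, ← hk, Int.floor_intCast]
  exact h

theorem IsEven.wt_cast (hγ : D.IsEven γ) (i : I) (s : Fin (n i)) :
    (D.wt γ i s : ℚ) = 2 * D.d i * γ i s := by
  obtain ⟨k, hk, h⟩ := hγ i s
  rw [wt, ← hk, Int.floor_intCast]

theorem rep_modEq (D : Datum I) (i : I) (k : ℤ) : k ≡ D.rep i k [ZMOD 2 * D.d i] := by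
  have h : k - 1 ≡ (k - 1) % (2 * D.d i) [ZMOD 2 * D.d i] := (Int.mod_modEq _ _).symm
  have := h.add_right 1
  rwa [sub_add_cancel] at this

theorem rep_eq {i : I} {k r : ℤ} (h : k ≡ r [ZMOD 2 * D.d i]) (h1 : 1 ≤ r) (h2 : r ≤ 2 * D.d i) :
    D.rep i k = r := by
  have h3 : k - 1 ≡ r - 1 [ZMOD 2 * D.d i] := h.sub_right 1
  rw [rep, h3, Int.emod_eq_of_lt (by omega) (by omega)]
  ring

theorem rep_congr {i : I} {k r : ℤ} (h : k ≡ r [ZMOD 2 * D.d i]) : D.rep i k = D.rep i r := by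
  have h3 : k - 1 ≡ r - 1 [ZMOD 2 * D.d i] := h.sub_right 1
  rw [rep, rep, h3]

theorem IsEven.hat_spec (hγ : D.IsEven γ) (i : I) (s : Fin (n i)) :
    D.wt γ i s = 2 * D.d i * D.hat γ i s + D.rep i (D.wt γ i s) := by
  have h0 := D.two_d_pos i
  obtain ⟨m, hm⟩ := (Int.modEq_iff_dvd.mp (D.rep_modEq i (D.wt γ i s)).symm)
  have h1 : D.hat γ i s = m := by
    rw [hat]
    have : γ i s - (D.rep i (D.wt γ i s) : ℚ) / (2 * D.d i) = m := by
      have h2 := hγ.wt_cast i s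
      have h3 : ((2 * D.d i : ℤ) : ℚ) ≠ 0 := by exact_mod_cast h0.ne'
      have h4 : (D.wt γ i s : ℚ) - D.rep i (D.wt γ i s) = 2 * D.d i * m := by exact_mod_cast hm
      push_cast at h3
      have h5 : γ i s = D.wt γ i s / (2 * D.d i) := by rw [h2, mul_div_cancel_left₀ _ h3]
      rw [h5, ← sub_div, h4, mul_div_cancel_left₀ _ h3]
    rw [this, Int.floor_intCast]
  rw [h1]
  linarith

/-- The vertex of the unfolded quiver to which a basis vector belongs. -/
def blockOf (hγ : D.IsEven γ) (i : I) (s : Fin (n i)) : D.Iu :=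
  ⟨(i, D.rep i (D.wt γ i s)), by
    obtain ⟨m, hm⟩ := (Int.modEq_iff_dvd.mp (D.rep_modEq i (D.wt γ i s)))
    have := I0_add_mul (hγ.wt_mem i s) m
    rwa [← hm, add_sub_cancel] at this, by
    have h1 := Int.emod_nonneg (D.wt γ i s - 1) (D.two_d_pos i).ne'
    have h2 := Int.emod_lt_of_pos (D.wt γ i s - 1) (D.two_d_pos i)
    simp only [rep]
    omega⟩

/-- A basis vector as an element of its block. -/
abbrev inBlock (hγ : D.IsEven γ) (i : I) (s : Fin (n i)) : D.J γ (blockOf hγ i s) :=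
  ⟨s, D.rep_modEq i _⟩

theorem blockOf_eq (hγ : D.IsEven γ) (x : D.Iu) (s : D.J γ x) : blockOf hγ x.1.1 s.1 = x :=
  Subtype.ext (Prod.ext rfl (rep_eq s.2 x.2.2.1 x.2.2.2))

theorem J_congr {x : D.Iu} (s : D.J γ x) (t : D.J γ' x) :
    D.wt γ x.1.1 s.1 ≡ D.wt γ' x.1.1 t.1 [ZMOD 2 * D.d x.1.1] := s.2.trans t.2.symm

theorem mem_J_iff {x : D.Iu} (s : D.J γ x) (t : Fin (n' x.1.1)) :
    D.wt γ' x.1.1 t ≡ x.1.2 [ZMOD 2 * D.d x.1.1] ↔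
      D.wt γ x.1.1 s.1 ≡ D.wt γ' x.1.1 t [ZMOD 2 * D.d x.1.1] :=
  ⟨fun h => s.2.trans h.symm, fun h => h.symm.trans s.2⟩

open Classical in
/-- The block diagonal matrices with given blocks. -/
def blk (hγ : D.IsEven γ) (γ' : Cow n') (M : ∀ x, Matrix (D.J γ x) (D.J γ' x) ℂ) (i : I) :
    Matrix (Fin (n i)) (Fin (n' i)) ℂ := Matrix.of fun s t =>
  if h : D.wt γ' i t ≡ D.rep i (D.wt γ i s) [ZMOD 2 * D.d i] then
    M (blockOf hγ i s) (inBlock hγ i s) ⟨t, h⟩ else 0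

/-- The blocks of a matrix. -/
def unblk (γ : Cow n) (γ' : Cow n') (β : ∀ i, Matrix (Fin (n i)) (Fin (n' i)) ℂ) (x : D.Iu) :
    Matrix (D.J γ x) (D.J γ' x) ℂ := (β x.1.1).submatrix Subtype.val Subtype.val

theorem blk_apply (hγ : D.IsEven γ) (M : ∀ x, Matrix (D.J γ x) (D.J γ' x) ℂ) (x : D.Iu)
    (s : D.J γ x) (t : D.J γ' x) : blk hγ γ' M x.1.1 s.1 t.1 = M x s t := by
  have key : ∀ (i : I) (s : Fin (n i)) (t : Fin (n' i)) (r : ℤ) (hx hs ht),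
      D.rep i (D.wt γ i s) = r → blk hγ γ' M i s t = M ⟨(i, r), hx⟩ ⟨s, hs⟩ ⟨t, ht⟩ := by
    rintro i s t r hx hs ht rfl
    change (if h : _ then _ else _) = _
    rw [dif_pos ht]
    rfl
  exact key _ _ _ _ x.2 s.2 t.2 (rep_eq s.2 x.2.2.1 x.2.2.2)

theorem blk_ne_zero {hγ : D.IsEven γ} {M : ∀ x, Matrix (D.J γ x) (D.J γ' x) ℂ} {i : I}
    {s : Fin (n i)} {t : Fin (n' i)} (h : blk hγ γ' M i s t ≠ 0) :
    D.wt γ i s ≡ D.wt γ' i t [ZMOD 2 * D.d i] := by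
  by_contra hc
  apply h
  change (if h : _ then _ else _) = _
  rw [dif_neg]
  exact fun h' => hc ((D.rep_modEq i _).trans h'.symm)

/-- Matrices that are block diagonal. -/
def IsBlk (D : Datum I) (γ : Cow n) (γ' : Cow n') (β : ∀ i, Matrix (Fin (n i)) (Fin (n' i)) ℂ) :
    Prop := ∀ i s t, β i s t ≠ 0 → D.wt γ i s ≡ D.wt γ' i t [ZMOD 2 * D.d i]

theorem isBlk_blk (hγ : D.IsEven γ) (M : ∀ x, Matrix (D.J γ x) (D.J γ' x) ℂ) :
    D.IsBlk γ γ' (blk hγ γ' M) := fun _ _ _ h => blk_ne_zero h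

theorem blk_unblk (hγ : D.IsEven γ) {β : ∀ i, Matrix (Fin (n i)) (Fin (n' i)) ℂ}
    (hβ : D.IsBlk γ γ' β) : blk hγ γ' (unblk γ γ' β) = β := by
  funext i
  ext s t
  change (if h : _ then _ else _) = _
  by_cases h : D.wt γ' i t ≡ D.rep i (D.wt γ i s) [ZMOD 2 * D.d i]
  · rw [dif_pos h]
    rfl
  · rw [dif_neg h]
    by_contra hne
    exact h ((hβ i s t (Ne.symm hne)).symm.trans (D.rep_modEq i _))

theorem unblk_blk (hγ : D.IsEven γ) (M : ∀ x, Matrix (D.J γ x) (D.J γ' x) ℂ) :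
    unblk γ γ' (blk hγ γ' M) = M := by
  funext x
  ext s t
  exact blk_apply hγ M x s t

theorem IsBlk.sum_eq {β : ∀ i, Matrix (Fin (n i)) (Fin (n' i)) ℂ} (hβ : D.IsBlk γ γ' β) (x : D.Iu)
    (s : D.J γ x) (F : Fin (n' x.1.1) → ℂ) :
    ∑ u, β x.1.1 s.1 u * F u = ∑ u : D.J γ' x, β x.1.1 s.1 u.1 * F u.1 := by
  classical
  refine Eq.trans ?_ (Finset.sum_subtype
    (Finset.univ.filter fun u => D.wt γ' x.1.1 u ≡ x.1.2 [ZMOD 2 * D.d x.1.1]) (by simp)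
    fun u => β x.1.1 s.1 u * F u)
  rw [Finset.sum_filter]
  refine Finset.sum_congr rfl fun u _ => ?_
  by_cases h : D.wt γ' x.1.1 u ≡ x.1.2 [ZMOD 2 * D.d x.1.1]
  · rw [if_pos h]
  · rw [if_neg h]
    by_contra hne
    exact h ((mem_J_iff s u).mpr (hβ _ _ _ (left_ne_zero_of_mul hne)))

theorem IsBlk.mul {β : ∀ i, Matrix (Fin (n i)) (Fin (n' i)) ℂ}
    {β' : ∀ i, Matrix (Fin (n' i)) (Fin (n'' i)) ℂ} (hβ : D.IsBlk γ γ' β) (hβ' : D.IsBlk γ' γ'' β') :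
    D.IsBlk γ γ'' (fun i => β i * β' i) := by
  intro i s t h
  change (β i * β' i) s t ≠ 0 at h
  rw [Matrix.mul_apply] at h
  obtain ⟨u, -, hu⟩ := Finset.exists_ne_zero_of_sum_ne_zero h
  exact (hβ i s u (left_ne_zero_of_mul hu)).trans (hβ' i u t (right_ne_zero_of_mul hu))

theorem unblk_mul {β : ∀ i, Matrix (Fin (n i)) (Fin (n' i)) ℂ}
    {β' : ∀ i, Matrix (Fin (n' i)) (Fin (n'' i)) ℂ} (hβ : D.IsBlk γ γ' β) (x : D.Iu) :
    unblk γ γ'' (fun i => β i * β' i) x = unblk γ γ' β x * unblk γ' γ'' β' x := by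
  ext s t
  rw [Matrix.mul_apply]
  exact hβ.sum_eq x s _

theorem blk_mul (hγ : D.IsEven γ) (hγ' : D.IsEven γ') (M : ∀ x, Matrix (D.J γ x) (D.J γ' x) ℂ)
    (M' : ∀ x, Matrix (D.J γ' x) (D.J γ'' x) ℂ) (i : I) :
    blk hγ γ'' (fun x => M x * M' x) i = blk hγ γ' M i * blk hγ' γ'' M' i := by
  have h := blk_unblk hγ ((isBlk_blk hγ M).mul (isBlk_blk hγ' M'))
  have h2 : (fun x => M x * M' x) =
      unblk γ γ'' (fun i => blk hγ γ' M i * blk hγ' γ'' M' i) := by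
    funext x
    rw [unblk_mul (isBlk_blk hγ M), unblk_blk, unblk_blk]
  rw [h2, h]

theorem blk_diagonal (hγ : D.IsEven γ) (u : ∀ i, Fin (n i) → ℂ) (i : I) :
    blk hγ γ (fun x => Matrix.diagonal fun s => u x.1.1 s.1) i = Matrix.diagonal (u i) := by
  have h : D.IsBlk γ γ (fun i => Matrix.diagonal (u i)) := by
    intro i s t h
    rcases eq_or_ne s t with rfl | hne
    · rfl
    · exact absurd (Matrix.diagonal_apply_ne _ hne) h
  have h2 := congrFun (blk_unblk hγ h) i
  convert h2 using 2
  funext x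
  ext s t
  simp only [unblk, Matrix.submatrix_apply, Matrix.diagonal_apply, Subtype.ext_iff]

theorem blk_one (hγ : D.IsEven γ) (i : I) : blk hγ γ (fun _ => 1) i = 1 := by
  have := blk_diagonal hγ (fun _ _ => 1) i
  rwa [Matrix.diagonal_one] at this

/-! ### Change of coweight -/

section Cow

variable {γ η : Cow D.a}

theorem IsEvenFor.wt_congr (hγ : D.IsEven γ) (hη : D.IsEvenFor γ η) (i : I) (s : Fin (D.a i)) :
    D.wt η i s ≡ D.wt γ i s [ZMOD 2 * D.d i] :=
  ((hη.2 (blockOf hγ i s) s).mpr (D.rep_modEq i _)).trans (D.rep_modEq i _).symm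

theorem IsEvenFor.hat_sub (hγ : D.IsEven γ) (hη : D.IsEvenFor γ η) (i : I) (s : Fin (D.a i)) :
    D.wt η i s - D.wt γ i s = 2 * D.d i * (D.hat η i s - D.hat γ i s) := by
  have h1 := hγ.hat_spec i s
  have h2 := hη.1.hat_spec i s
  rw [rep_congr (hη.wt_congr hγ i s)] at h2
  linarith

theorem isEvenFor_self (hγ : D.IsEven γ) : D.IsEvenFor γ γ := ⟨hγ, fun _ _ => Iff.rfl⟩

theorem IsEvenFor.hat_sub_hat (hγ : D.IsEven γ) (hη : D.IsEvenFor γ η) {i : I} {s t : Fin (D.a i)}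
    (h : D.wt γ i s ≡ D.wt γ i t [ZMOD 2 * D.d i]) :
    D.wt η i s - D.wt η i t = 2 * D.d i * (D.hat η i s - D.hat η i t) := by
  have h1 := hη.1.hat_spec i s
  have h2 := hη.1.hat_spec i t
  rw [rep_congr ((hη.wt_congr hγ i s).trans (h.trans (hη.wt_congr hγ i t).symm))] at h1
  linarith

end Cow

end Datum

end FixedLocus
end

open scoped Topology
noncomputable section
namespace FixedLocus
open FunSp

variable {I : Type} [Fintype I] [DecidableEq I]

namespace Datum

variable {D : Datum I}

/-- The weight of a basis vector under the twisted rotation. -/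
def tw (D : Datum I) {n : I → ℕ} (η : Cow n) (i : I) (s : Fin (n i)) : ℤ := D.wt η i s + D.twoσ i

theorem tw_sub {n n' : I → ℕ} (η : Cow n) (η' : Cow n') (i : I) (s : Fin (n i)) (t : Fin (n' i)) :
    D.tw η i s - D.tw η' i t = D.wt η i s - D.wt η' i t := by
  simp only [tw]
  ring

theorem IsBlk.adapted {n n' : I → ℕ} {γ : Cow n} {γ' : Cow n'}
    {β : ∀ i, Matrix (Fin (n i)) (Fin (n' i)) ℂ} (hβ : D.IsBlk γ γ' β) (i : I) :
    Adapted (2 * D.d i) (D.tw γ' i) (D.tw γ i) (β i) := by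
  intro s t h
  rw [tw_sub]
  exact Int.modEq_iff_dvd.mp (hβ i s t h).symm

variable {γ η η' : Cow D.a}

theorem IsBlk.congr_left {n : I → ℕ} {γ' : Cow n} {β : ∀ i, Matrix (Fin (D.a i)) (Fin (n i)) ℂ}
    (hγ : D.IsEven γ) (hη : D.IsEvenFor γ η) (hβ : D.IsBlk γ γ' β) : D.IsBlk η γ' β :=
  fun i s t h => (hη.wt_congr hγ i s).trans (hβ i s t h)

theorem IsBlk.congr_right {n : I → ℕ} {γ' : Cow n} {β : ∀ i, Matrix (Fin (n i)) (Fin (D.a i)) ℂ}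
    (hγ : D.IsEven γ) (hη : D.IsEvenFor γ η) (hβ : D.IsBlk γ' γ β) : D.IsBlk γ' η β :=
  fun i s t h => (hβ i s t h).trans (hη.wt_congr hγ i t).symm

theorem blk_adapted (hγ : D.IsEven γ) (hη : D.IsEvenFor γ η)
    (hη' : D.IsEvenFor γ η') (M : ∀ x, Matrix (D.J γ x) (D.J γ x) ℂ)
    (i : I) : Adapted (2 * D.d i) (D.tw η i) (D.tw η' i) (blk hγ γ M i) :=
  (((isBlk_blk hγ M).congr_left hγ hη').congr_right hγ hη).adapted i

theorem mkG_aux (hγ : D.IsEven γ) (hη : D.IsEvenFor γ η) {M M' : ∀ x, Matrix (D.J γ x) (D.J γ x) ℂ}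
    (i : I) : wMat (2 * D.d i) (D.tw η i) (blk hγ γ M i) * wMat (2 * D.d i) (D.tw η i) (blk hγ γ M' i) =
      wMat (2 * D.d i) (D.tw η i) (blk hγ γ (fun x => M x * M' x) i) := by
  rw [wMat_mul (D.two_d_pos i).ne' (blk_adapted hγ hη hη M i) (blk_adapted hγ hη hη M' i), blk_mul hγ hγ]

/-- The homogeneous element of `G_K` with given value at `z = 1`. -/
def mkG (hγ : D.IsEven γ) (hη : D.IsEvenFor γ η) : D.Gu γ →* D.GK where
  toFun β i :=
    { val := wMat (2 * D.d i) (D.tw η i) (blk hγ γ (fun x => (β x).1) i)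
      inv := wMat (2 * D.d i) (D.tw η i) (blk hγ γ (fun x => (β x)⁻¹.1) i)
      val_inv := by
        rw [mkG_aux hγ hη, ← wMat_one (δ := 2 * D.d i) (W := D.tw η i), ← blk_one hγ]
        simp only [← Units.val_mul, mul_inv_cancel, Units.val_one]
      inv_val := by
        rw [mkG_aux hγ hη, ← wMat_one (δ := 2 * D.d i) (W := D.tw η i), ← blk_one hγ]
        simp only [← Units.val_mul, inv_mul_cancel, Units.val_one] }
  map_one' := by
    funext i
    refine Units.ext ?_
    change wMat _ _ (blk hγ γ (fun x => 1) i) = 1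
    rw [blk_one, wMat_one]
  map_mul' β β' := by
    funext i
    refine Units.ext ?_
    exact (mkG_aux hγ hη i).symm

theorem mkG_val (hγ : D.IsEven γ) (hη : D.IsEvenFor γ η) (β : D.Gu γ) (i : I) :
    (mkG hγ hη β i).1 = wMat (2 * D.d i) (D.tw η i) (blk hγ γ (fun x => (β x).1) i) := rfl

theorem mkG_coeff (hγ : D.IsEven γ) (hη : D.IsEvenFor γ η) (β : D.Gu γ) (i : I) (s t : Fin (D.a i))
    (k : ℤ) : ((mkG hγ hη β i).1 s t).coeff k =
      if 2 * D.d i * k = D.wt η i t - D.wt η i s then blk hγ γ (fun x => (β x).1) i s t else 0 := by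
  rw [mkG_val, wMat, Matrix.of_apply, tw_sub]
  by_cases hb : blk hγ γ (fun x => (β x).1) i s t = 0
  · rw [hb, ite_self]
    simp
  have h2 := hη.hat_sub_hat hγ (blk_ne_zero hb)
  rw [h2, Int.mul_ediv_cancel_left _ (D.two_d_pos i).ne']
  by_cases hk : k = -(D.hat η i s - D.hat η i t)
  · rw [if_pos (by rw [hk]; linarith), hk, HahnSeries.coeff_single_same]
  · rw [if_neg, HahnSeries.coeff_single_of_ne hk]
    intro h
    apply hk
    have : 2 * (D.d i : ℤ) * k = 2 * (D.d i : ℤ) * -(D.hat η i s - D.hat η i t) := by linarith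
    exact mul_left_cancel₀ (D.two_d_pos i).ne' this

theorem mkG_coeff_J (hγ : D.IsEven γ) (hη : D.IsEvenFor γ η) (β : D.Gu γ) (x : D.Iu)
    (s t : D.J γ x) (k : ℤ) : ((mkG hγ hη β x.1.1).1 s.1 t.1).coeff k =
      if k = D.hat η x.1.1 t.1 - D.hat η x.1.1 s.1 then (β x).1 s t else 0 := by
  rw [mkG_coeff, blk_apply hγ (fun x => (β x).1)]
  congr 1
  rw [hη.hat_sub_hat hγ (J_congr t s)]
  exact propext ⟨fun h => mul_left_cancel₀ (D.two_d_pos _).ne' h, fun h => by rw [h]⟩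

theorem isEv_mkG (hγ : D.IsEven γ) (hη : D.IsEvenFor γ η) (β : D.Gu γ) :
    D.IsEv γ (mkG hγ hη β) β := by
  intro x s t
  rw [finsum_eq_single _ (D.hat η x.1.1 t.1 - D.hat η x.1.1 s.1)]
  · rw [mkG_coeff_J, if_pos rfl]
  · intro k hk
    rw [mkG_coeff_J, if_neg hk]

theorem IsEv.unique {g : D.GK} {h h' : D.Gu γ} (h1 : D.IsEv γ g h) (h2 : D.IsEv γ g h') : h = h' := by
  funext x
  refine Units.ext (Matrix.ext fun s t => ?_)
  rw [h1 x s t, h2 x s t]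

theorem mkG_injective (hγ : D.IsEven γ) (hη : D.IsEvenFor γ η) : Function.Injective (mkG hγ hη) := by
  intro β β' h
  refine (isEv_mkG hγ hη β).unique ?_
  rw [h]
  exact isEv_mkG hγ hη β'

/-! ### The fixed subgroup -/

/-- Two is an element of infinite order. -/
def twoU : ℂˣ := Units.mk0 2 two_ne_zero

theorem twoU_zpow_injective {m k : ℤ} (h : ((twoU ^ m : ℂˣ) : ℂ) = ((twoU ^ k : ℂˣ) : ℂ)) : m = k := by
  rw [Units.val_zpow_eq_zpow_val, Units.val_zpow_eq_zpow_val] at h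
  have h2 := congrArg (fun z : ℂ => ‖z‖) h
  simp only [norm_zpow, twoU, Units.val_mk0, Complex.norm_ofNat] at h2
  exact zpow_right_injective₀ (by norm_num) (by norm_num) h2

theorem constGK_mul_apply (u : ∀ i, Fin (D.a i) → ℂˣ) (g : D.GK) (i : I) (s t : Fin (D.a i)) (k : ℤ) :
    (((D.constGK u * g) i).1 s t).coeff k = (u i s : ℂ) * ((g i).1 s t).coeff k := by
  change ((Matrix.diagonal (fun s => (HahnSeries.C (u i s : ℂ) : LS)) * (g i).1) s t).coeff k = _
  rw [Matrix.diagonal_mul, ← smul_eq_C_mul, HahnSeries.coeff_smul, smul_eq_mul]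

theorem mul_constGK_apply (u : ∀ i, Fin (D.a i) → ℂˣ) (g : D.GK) (i : I) (s t : Fin (D.a i)) (k : ℤ) :
    (((g * D.constGK u) i).1 s t).coeff k = ((g i).1 s t).coeff k * (u i t : ℂ) := by
  change (((g i).1 * Matrix.diagonal (fun s => (HahnSeries.C (u i s : ℂ) : LS))) s t).coeff k = _
  rw [Matrix.mul_diagonal, mul_comm, ← smul_eq_C_mul, HahnSeries.coeff_smul, smul_eq_mul, mul_comm]

theorem GK_ext {g h : D.GK} (H : ∀ i s t k, ((g i).1 s t).coeff k = ((h i).1 s t).coeff k) : g = h :=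
  funext fun i => Units.ext (Matrix.ext fun s t => HahnSeries.ext (funext fun k => H i s t k))

theorem rotGK_coeff (τ : ℂˣ) (g : D.GK) (i : I) (s t : Fin (D.a i)) (k : ℤ) :
    ((D.rotGK τ g i).1 s t).coeff k =
      ((τ ^ (2 * (D.d i : ℤ) * k) : ℂˣ) : ℂ) * ((g i).1 s t).coeff k := by
  rw [zpow_mul]
  rfl

theorem mem_GKFix_iff {g : D.GK} :
    g ∈ D.GKFix γ ↔ ∀ i s t k, ((g i).1 s t).coeff k ≠ 0 → 2 * D.d i * k = D.wt γ i t - D.wt γ i s := by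
  have h1 : g ∈ D.GKFix γ ↔ ∀ τ : ℂˣ, (D.constGK fun i s => τ ^ D.wt γ i s) * D.rotGK τ g =
      g * D.constGK fun i s => τ ^ D.wt γ i s := by
    rw [GKFix, Subgroup.mem_comap, GKtFix, Subgroup.mem_centralizer_iff, Set.forall_mem_range]
    refine forall_congr' fun τ => ?_
    rw [SemidirectProduct.ext_iff]
    simp [gTil]
  rw [h1]
  constructor
  · intro h i s t k hk
    have h2 := congrArg (fun g : D.GK => ((g i).1 s t).coeff k) (h twoU)
    simp only [constGK_mul_apply, mul_constGK_apply, rotGK_coeff] at h2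
    rw [← mul_assoc, mul_comm _ (HahnSeries.coeff _ _)] at h2
    have h3 := mul_left_cancel₀ hk h2
    rw [← Units.val_mul, ← zpow_add] at h3
    have := twoU_zpow_injective h3
    linarith
  · intro h τ
    refine GK_ext fun i s t k => ?_
    rw [constGK_mul_apply, mul_constGK_apply, rotGK_coeff]
    by_cases hk : ((g i).1 s t).coeff k = 0
    · simp [hk]
    · rw [h i s t k hk, ← mul_assoc, ← Units.val_mul, ← zpow_add, mul_comm]
      congr 4
      ring

theorem exists_blk_of_mem_GKFix (hγ : D.IsEven γ) {g : D.GK} (hg : g ∈ D.GKFix γ) :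
    ∃ M : ∀ x, Matrix (D.J γ x) (D.J γ x) ℂ, ∀ i, (g i).1 =
      wMat (2 * D.d i) (D.tw γ i) (blk hγ γ M i) := by
  rw [mem_GKFix_iff] at hg
  let β : ∀ i, Matrix (Fin (D.a i)) (Fin (D.a i)) ℂ := fun i => Matrix.of fun s t =>
    if (2 * D.d i : ℤ) ∣ D.wt γ i t - D.wt γ i s then
      ((g i).1 s t).coeff (-((D.tw γ i s - D.tw γ i t) / (2 * D.d i))) else 0
  have hβ : D.IsBlk γ γ β := by
    intro i s t h
    by_contra hc
    apply h
    exact if_neg fun h => hc (Int.modEq_iff_dvd.mpr h)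
  refine ⟨unblk γ γ β, fun i => Matrix.ext fun s t => HahnSeries.ext (funext fun k => ?_)⟩
  rw [blk_unblk hγ hβ]
  change _ = (HahnSeries.single _ (if _ then _ else _) : LS).coeff k
  rw [tw_sub]
  by_cases hd : (2 * D.d i : ℤ) ∣ D.wt γ i t - D.wt γ i s
  · rw [if_pos hd]
    by_cases hk : k = -((D.wt γ i s - D.wt γ i t) / (2 * D.d i))
    · rw [hk, HahnSeries.coeff_single_same]
    · rw [HahnSeries.coeff_single_of_ne hk]
      by_contra hne
      apply hk
      have : D.wt γ i s - D.wt γ i t = 2 * D.d i * (-k) := by linarith [hg i s t k hne]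
      rw [this, Int.mul_ediv_cancel_left _ (D.two_d_pos i).ne', neg_neg]
  · rw [if_neg hd, HahnSeries.single_eq_zero, HahnSeries.coeff_zero]
    by_contra hne
    exact hd ⟨k, (hg i s t k hne).symm⟩

theorem wMat_blk_injective (hγ : D.IsEven γ) {M M' : ∀ x, Matrix (D.J γ x) (D.J γ x) ℂ}
    (h : ∀ i, wMat (2 * D.d i) (D.tw γ i) (blk hγ γ M i) =
      wMat (2 * D.d i) (D.tw γ i) (blk hγ γ M' i)) : M = M' := by
  rw [← unblk_blk hγ M, ← unblk_blk hγ M']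
  congr 1
  funext i
  ext s t
  have := congrArg (fun A : Matrix _ _ LS => (A s t).coeff (-((D.tw γ i s - D.tw γ i t) / (2 * D.d i)))) (h i)
  simpa [wMat] using this

theorem range_mkG (hγ : D.IsEven γ) : (mkG hγ (isEvenFor_self hγ)).range = D.GKFix γ := by
  ext g
  constructor
  · rintro ⟨β, rfl⟩
    rw [mem_GKFix_iff]
    intro i s t k h
    rw [mkG_coeff] at h
    by_contra hc
    exact h (if_neg hc)
  · intro hg
    obtain ⟨M, hM⟩ := exists_blk_of_mem_GKFix hγ hg
    obtain ⟨M', hM'⟩ := exists_blk_of_mem_GKFix hγ (inv_mem hg)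
    have h1 : (fun x => M x * M' x) = fun x => 1 := wMat_blk_injective hγ fun i => by
      rw [← mkG_aux hγ (isEvenFor_self hγ), ← hM, ← hM', blk_one, wMat_one]
      exact Units.mul_inv (g i)
    have h2 : (fun x => M' x * M x) = fun x => 1 := wMat_blk_injective hγ fun i => by
      rw [← mkG_aux hγ (isEvenFor_self hγ), ← hM, ← hM', blk_one, wMat_one]
      exact Units.inv_mul (g i)
    exact ⟨fun x => ⟨M x, M' x, congrFun h1 x, congrFun h2 x⟩, funext fun i => Units.ext (hM i).symm⟩

theorem mkG_mem_GKFix (hγ : D.IsEven γ) (hη : D.IsEvenFor γ η) (β : D.Gu γ) :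
    mkG hγ hη β ∈ D.GKFix η := by
  rw [mem_GKFix_iff]
  intro i s t k h
  rw [mkG_coeff] at h
  by_contra hc
  exact h (if_neg hc)

theorem exists_mkG_eq (hγ : D.IsEven γ) {g : D.GK} (hg : g ∈ D.GKFix γ) :
    ∃ β, mkG hγ (isEvenFor_self hγ) β = g := by
  rw [← range_mkG hγ] at hg
  exact hg

/-! ### Parabolic subgroups -/

theorem mem_GO_iff {g : D.GK} : g ∈ D.GO ↔ g ∈ D.GKbdd 0 := by
  constructor
  · intro hg i s t
    obtain ⟨h, hh⟩ := hg i trivial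
    have key : ∀ (f : PowerSeries ℂ), IsBdd 0 (HahnSeries.ofPowerSeries ℤ ℂ f) := fun f n hn => by
      rw [HahnSeries.ofPowerSeries_apply]
      refine HahnSeries.embDomain_of_notMem_range ?_
      rintro ⟨m, hm⟩
      have : (m : ℤ) = n := hm
      push_cast at hn
      omega
    rw [← hh, ← map_inv]
    exact ⟨key _, key _⟩
  · intro hg i _
    have key : ∀ f : LS, IsBdd 0 f → ∃ p : PowerSeries ℂ, HahnSeries.ofPowerSeries ℤ ℂ p = f := by
      intro f hf
      refine ⟨PowerSeries.mk fun n => f.coeff n, ?_⟩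
      ext n
      by_cases hn : 0 ≤ n
      · lift n to ℕ using hn
        have := HahnSeries.ofPowerSeries_apply_coeff (Γ := ℤ) (PowerSeries.mk fun n => f.coeff n) n
        rw [PowerSeries.coeff_mk] at this
        exact this
      · rw [hf n (by push_cast; omega), HahnSeries.ofPowerSeries_apply]
        refine HahnSeries.embDomain_of_notMem_range ?_
        rintro ⟨m, hm⟩
        have : (m : ℤ) = n := hm
        omega
    choose a ha using fun s t => key _ (hg i s t).1
    choose b hb using fun s t => key _ (hg i s t).2
    have h1 : (HahnSeries.ofPowerSeries ℤ ℂ).mapMatrix (Matrix.of a) = (g i).1 := Matrix.ext ha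
    have h2 : (HahnSeries.ofPowerSeries ℤ ℂ).mapMatrix (Matrix.of b) = (g i)⁻¹.1 := Matrix.ext hb
    have inj : Function.Injective ((HahnSeries.ofPowerSeries ℤ ℂ).mapMatrix (m := Fin (D.a i))) := by
      intro A B h
      ext s t : 1
      exact HahnSeries.ofPowerSeries_injective (congrFun (congrFun h s) t)
    refine ⟨⟨Matrix.of a, Matrix.of b, inj ?_, inj ?_⟩, Units.ext h1⟩
    · rw [map_mul, h1, h2, map_one, Units.mul_inv]
    · rw [map_mul, h1, h2, map_one, Units.inv_mul]

/-- The entries of `Ad (τ ^ (- η̂)) g`. -/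
theorem hatU_conj_apply (β : D.Gu γ) (τ : ℂˣ) (x : D.Iu) (s t : D.J γ x) :
    ((D.hatU γ η τ * β * (D.hatU γ η τ)⁻¹) x).1 s t =
      ((τ ^ (D.hat η x.1.1 t.1 - D.hat η x.1.1 s.1) : ℂˣ) : ℂ) * (β x).1 s t := by
  have hinv : (D.hatU γ η τ)⁻¹ = fun x => diagGL fun s => τ ^ D.hat η x.1.1 s.1 := by
    refine inv_eq_of_mul_eq_one_right (funext fun x => ?_)
    change diagGL _ * diagGL _ = 1
    rw [← map_mul]
    convert map_one diagGL
    funext s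
    rw [Pi.mul_apply, Pi.one_apply, ← zpow_add, neg_add_cancel, zpow_zero]
  rw [hinv]
  change ((Matrix.diagonal (fun s : D.J γ x => ((τ ^ (- D.hat η x.1.1 s.1) : ℂˣ) : ℂ)) * (β x).1) *
    Matrix.diagonal (fun s : D.J γ x => ((τ ^ (D.hat η x.1.1 s.1) : ℂˣ) : ℂ))) s t = _
  rw [Matrix.mul_diagonal, Matrix.diagonal_mul, mul_right_comm, ← Units.val_mul, ← zpow_add,
    neg_add_eq_sub]

instance : (Filter.comap (Units.val : ℂˣ → ℂ) (𝓝 0)).NeBot := by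
  rw [Filter.comap_neBot_iff]
  intro t ht
  have h1 : (𝓝[≠] (0 : ℂ)).NeBot := inferInstance
  have h2 : t ∩ {0}ᶜ ∈ 𝓝[≠] (0 : ℂ) := Filter.inter_mem (mem_nhdsWithin_of_mem_nhds ht) self_mem_nhdsWithin
  obtain ⟨z, hz1, hz2⟩ := h1.nonempty_of_mem h2
  exact ⟨Units.mk0 z hz2, hz1⟩

theorem tendsto_zpow_nonneg {m : ℤ} (hm : 0 ≤ m) (b : ℂ) :
    Filter.Tendsto (fun τ : ℂˣ => ((τ ^ m : ℂˣ) : ℂ) * b)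
      (Filter.comap (Units.val : ℂˣ → ℂ) (𝓝 0)) (𝓝 (0 ^ m.toNat * b)) := by
  lift m to ℕ using hm
  simp only [zpow_natCast, Units.val_pow_eq_pow_val, Int.toNat_natCast]
  exact (Filter.tendsto_comap.pow m).mul_const b

theorem mem_Pu_iff {β : D.Gu γ} : β ∈ D.Pu γ η ↔
    ∀ x (s t : D.J γ x), (β x).1 s t ≠ 0 → D.hat η x.1.1 s.1 ≤ D.hat η x.1.1 t.1 := by
  constructor
  · rintro ⟨g₀, hg⟩ x s t hst
    by_contra hc
    push Not at hc
    have h1 : Filter.Tendsto (fun τ : ℂˣ => ((D.hatU γ η τ * β * (D.hatU γ η τ)⁻¹) x).1 s t)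
        (Filter.comap (Units.val : ℂˣ → ℂ) (𝓝 0)) (𝓝 ((g₀ x).1 s t)) := by
      have c : Continuous fun g : D.Gu γ => (g x).1 s t :=
        (Units.continuous_val.comp (continuous_apply x)).matrix_elem s t
      exact (c.tendsto g₀).comp hg
    simp only [hatU_conj_apply] at h1
    have h2 := (tendsto_zpow_nonneg (m := D.hat η x.1.1 s.1 - D.hat η x.1.1 t.1) (by omega) 1).mul h1
    have h3 : (D.hat η x.1.1 s.1 - D.hat η x.1.1 t.1).toNat ≠ 0 := by omega
    rw [zero_pow h3, zero_mul, zero_mul] at h2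
    have h4 : ∀ τ : ℂˣ, ((τ ^ (D.hat η x.1.1 s.1 - D.hat η x.1.1 t.1) : ℂˣ) : ℂ) * 1 *
        (((τ ^ (D.hat η x.1.1 t.1 - D.hat η x.1.1 s.1) : ℂˣ) : ℂ) * (β x).1 s t) = (β x).1 s t := by
      intro τ
      rw [mul_one, ← mul_assoc, ← Units.val_mul, ← zpow_add]
      simp
    simp only [h4] at h2
    exact hst (tendsto_nhds_unique tendsto_const_nhds h2)
  · intro h
    classical
    have tri : ∀ x, ((β x).1).BlockTriangular (fun s => D.hat η x.1.1 s.1) := fun x s t hst => by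
      by_contra hc
      exact absurd (h x s t hc) (by simpa using hst)
    have tri' : ∀ x, ((β x)⁻¹.1).BlockTriangular (fun s => D.hat η x.1.1 s.1) := fun x => by
      rw [Matrix.coe_units_inv]
      let _ : Invertible (β x).1 := (β x).invertible
      exact Matrix.blockTriangular_inv_of_blockTriangular (tri x)
    have h' : ∀ x (s t : D.J γ x), (β x)⁻¹.1 s t ≠ 0 → D.hat η x.1.1 s.1 ≤ D.hat η x.1.1 t.1 := by
      intro x s t hst
      by_contra hc
      push Not at hc
      exact hst (tri' x hc)
    have lim : ∀ β : D.Gu γ, (∀ x (s t : D.J γ x), (β x).1 s t ≠ 0 →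
        D.hat η x.1.1 s.1 ≤ D.hat η x.1.1 t.1) → ∃ L : ∀ x, Matrix (D.J γ x) (D.J γ x) ℂ,
        ∀ x, Filter.Tendsto (fun τ : ℂˣ => ((D.hatU γ η τ * β * (D.hatU γ η τ)⁻¹) x).1)
          (Filter.comap (Units.val : ℂˣ → ℂ) (𝓝 0)) (𝓝 (L x)) := by
      intro β h
      refine ⟨fun x => Matrix.of fun s t => 0 ^ (D.hat η x.1.1 t.1 - D.hat η x.1.1 s.1).toNat *
        (β x).1 s t, fun x => ?_⟩
      refine tendsto_pi_nhds.mpr fun s => tendsto_pi_nhds.mpr fun t => ?_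
      simp only [hatU_conj_apply]
      by_cases hst : (β x).1 s t = 0
      · simp [hst]
      · exact tendsto_zpow_nonneg (by have := h x s t hst; omega) _
    obtain ⟨L, hL⟩ := lim β h
    obtain ⟨L', hL'⟩ := lim β⁻¹ h'
    have e : ∀ τ, D.hatU γ η τ * β⁻¹ * (D.hatU γ η τ)⁻¹ = (D.hatU γ η τ * β * (D.hatU γ η τ)⁻¹)⁻¹ := by
      intro τ
      simp [mul_assoc]
    simp only [e] at hL'
    have hLL : ∀ x, L x * L' x = 1 := fun x => by
      refine tendsto_nhds_unique ((hL x).mul (hL' x)) ?_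
      simp only [Pi.inv_apply, Units.mul_inv]
      exact tendsto_const_nhds
    have hLL' : ∀ x, L' x * L x = 1 := fun x => by
      refine tendsto_nhds_unique ((hL' x).mul (hL x)) ?_
      simp only [Pi.inv_apply, Units.inv_mul]
      exact tendsto_const_nhds
    refine ⟨fun x => ⟨L x, L' x, hLL x, hLL' x⟩, tendsto_pi_nhds.mpr fun x => ?_⟩
    rw [Units.isInducing_embedProduct.tendsto_nhds_iff]
    exact (hL x).prodMk_nhds ((MulOpposite.continuous_op.tendsto _).comp (hL' x))

theorem mkG_mem_GO_iff (hγ : D.IsEven γ) (hη : D.IsEvenFor γ η) {β : D.Gu γ} :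
    mkG hγ hη β ∈ D.GO ↔ β ∈ D.Pu γ η := by
  rw [mem_GO_iff, mem_Pu_iff]
  constructor
  · intro h x s t hst
    by_contra hc
    have := (h x.1.1 s.1 t.1).1 (D.hat η x.1.1 t.1 - D.hat η x.1.1 s.1) (by push_cast; omega)
    rw [mkG_coeff_J, if_pos rfl] at this
    exact hst this
  · intro h i s t
    have key : ∀ β ∈ D.Pu γ η, IsBdd 0 ((mkG hγ hη β i).1 s t) := by
      intro β h k hk
      rw [mem_Pu_iff] at h
      by_contra hne
      rw [mkG_coeff] at hne
      have h1 : 2 * D.d i * k = D.wt η i t - D.wt η i s := by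
        by_contra hc
        exact hne (if_neg hc)
      rw [if_pos h1] at hne
      have hs := blk_ne_zero hne
      have h2 := hη.hat_sub_hat hγ hs.symm
      have h3 := h (blockOf hγ i s) (inBlock hγ i s) ⟨t, hs.symm.trans (D.rep_modEq i _)⟩ (by
        rwa [← blk_apply hγ (fun x => (β x).1)])
      rw [h2] at h1
      have h4 := mul_left_cancel₀ (D.two_d_pos i).ne' h1
      change D.hat η i s ≤ D.hat η i t at h3
      push_cast at hk
      omega
    refine ⟨key β (mem_Pu_iff.mpr h), ?_⟩
    have := key β⁻¹ (inv_mem (mem_Pu_iff.mpr h))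
    rw [map_inv] at this
    exact this

/-! ### The identifications of groups -/

theorem rotGK_mkG (hγ : D.IsEven γ) (τ : ℂˣ) (β : D.Gu γ) :
    D.rotGK τ (mkG hγ (isEvenFor_self hγ) β) =
      mkG hγ (isEvenFor_self hγ) (D.tU γ τ * β * (D.tU γ τ)⁻¹) := by
  have hinv : (D.tU γ τ)⁻¹ = fun x => diagGL fun s => τ ^ D.wt γ x.1.1 s.1 := by
    rw [← map_inv]
    funext x
    change diagGL _ = _
    simp
  have h2 : ∀ i, blk hγ γ (fun x => ((D.tU γ τ * β * (D.tU γ τ)⁻¹) x).1) i =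
      Matrix.diagonal (fun s => ((τ ^ (- D.wt γ i s) : ℂˣ) : ℂ)) * blk hγ γ (fun x => (β x).1) i *
        Matrix.diagonal (fun s => ((τ ^ D.wt γ i s : ℂˣ) : ℂ)) := by
    intro i
    rw [← blk_diagonal hγ (fun i s => ((τ ^ (- D.wt γ i s) : ℂˣ) : ℂ)),
      ← blk_diagonal hγ (fun i s => ((τ ^ D.wt γ i s : ℂˣ) : ℂ)), ← blk_mul hγ hγ,
      ← blk_mul hγ hγ, hinv]
    rfl
  refine GK_ext fun i s t k => ?_
  rw [rotGK_coeff, mkG_coeff, mkG_coeff, h2, Matrix.mul_diagonal, Matrix.diagonal_mul]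
  by_cases hk : 2 * D.d i * k = D.wt γ i t - D.wt γ i s
  · rw [if_pos hk, if_pos hk, hk, mul_right_comm, ← Units.val_mul, ← zpow_add]
    congr 4
    ring
  · rw [if_neg hk, if_neg hk, mul_zero]

/-- The inverse of the evaluation map. -/
def evInv (hγ : D.IsEven γ) : D.Gut γ →* D.GKt :=
  SemidirectProduct.map (mkG hγ (isEvenFor_self hγ)) (MonoidHom.id _) (by
    intro τ
    ext1 β
    exact (rotGK_mkG hγ τ β).symm)

theorem evInv_left (hγ : D.IsEven γ) (y : D.Gut γ) :
    (evInv hγ y).left = mkG hγ (isEvenFor_self hγ) y.left := rfl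

theorem mem_GKtFix_iff {x : D.GKt} : x ∈ D.GKtFix γ ↔ x.left ∈ D.GKFix γ := by
  change _ ↔ SemidirectProduct.inl x.left ∈ D.GKtFix γ
  rw [← SemidirectProduct.inl_left_mul_inr_right x]
  simp only [SemidirectProduct.mul_left, SemidirectProduct.left_inl, SemidirectProduct.right_inl,
    SemidirectProduct.left_inr, map_one, mul_one]
  exact Subgroup.mul_mem_cancel_right _ (D.inr_mem_GKtFix γ _)

/-- Evaluation at `z = 1` on `(G̃_K)^γ̃`. -/
def evEquiv (hγ : D.IsEven γ) : D.GKtFix γ ≃* D.Gut γ :=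
  (MulEquiv.ofBijective ((evInv hγ).codRestrict (D.GKtFix γ) fun y => by
      rw [mem_GKtFix_iff, evInv_left]
      exact mkG_mem_GKFix hγ _ _) ⟨by
    intro y y' h
    have h1 := congrArg Subtype.val h
    refine SemidirectProduct.ext (mkG_injective hγ (isEvenFor_self hγ) ?_) ?_
    · exact congrArg (fun x : D.GKt => x.left) h1
    · exact congrArg (fun x : D.GKt => x.right) h1, by
    rintro ⟨x, hx⟩
    obtain ⟨β, hβ⟩ := exists_mkG_eq hγ (mem_GKtFix_iff.mp hx)
    exact ⟨⟨β, x.right⟩, Subtype.ext (SemidirectProduct.ext hβ rfl)⟩⟩).symm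

theorem mkG_evEquiv_left (hγ : D.IsEven γ) (x : D.GKtFix γ) :
    mkG hγ (isEvenFor_self hγ) (evEquiv hγ x).left = x.1.left := by
  have := (evEquiv hγ).symm_apply_apply x
  exact congrArg (fun y : D.GKtFix γ => y.1.left) this

theorem evEquiv_right (hγ : D.IsEven γ) (x : D.GKtFix γ) : (evEquiv hγ x).right = x.1.right := by
  have := (evEquiv hγ).symm_apply_apply x
  exact congrArg (fun y : D.GKtFix γ => y.1.right) this

theorem isEv_evEquiv (hγ : D.IsEven γ) (x : D.GKtFix γ) : D.IsEv γ x.1.left (evEquiv hγ x).left := by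
  rw [← mkG_evEquiv_left hγ]
  exact isEv_mkG hγ _ _

theorem mem_GO_iff_evEquiv (hγ : D.IsEven γ) (x : D.GKtFix γ) :
    x.1.left ∈ D.GO ↔ (evEquiv hγ x).left ∈ D.Pu γ γ := by
  rw [← mkG_evEquiv_left hγ, mkG_mem_GO_iff]

/-- Evaluation at `z = 1` on `(G_O)^γ̃`. -/
def evGO (hγ : D.IsEven γ) : D.GOFix γ ≃* D.Pu γ γ :=
  (MulEquiv.ofBijective (((mkG hγ (isEvenFor_self hγ)).comp (D.Pu γ γ).subtype).codRestrict (D.GOFix γ)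
    fun β => ⟨(mkG_mem_GO_iff hγ (isEvenFor_self hγ)).mpr β.2,
      mkG_mem_GKFix hγ (isEvenFor_self hγ) β.1⟩) ⟨by
      intro y y' h
      exact Subtype.ext (mkG_injective hγ (isEvenFor_self hγ) (congrArg Subtype.val h)), by
      rintro ⟨x, hx1, hx2⟩
      obtain ⟨β, rfl⟩ := exists_mkG_eq hγ hx2
      exact ⟨⟨β, (mkG_mem_GO_iff hγ _).mp hx1⟩, rfl⟩⟩).symm

theorem mkG_evGO (hγ : D.IsEven γ) (k : D.GOFix γ) :
    mkG hγ (isEvenFor_self hγ) (evGO hγ k).1 = k.1 := by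
  have := (evGO hγ).symm_apply_apply k
  exact congrArg Subtype.val this

theorem isEv_evGO (hγ : D.IsEven γ) (k : D.GOFix γ) : D.IsEv γ k.1 (evGO hγ k).1 := by
  rw [← mkG_evGO hγ]
  exact isEv_mkG hγ _ _

theorem evEquiv_inclGOFix (hγ : D.IsEven γ) (k : D.GOFix γ) :
    evEquiv hγ (D.inclGOFix γ k) = D.inclPu γ γ (evGO hγ k) := by
  refine SemidirectProduct.ext ?_ (evEquiv_right hγ _)
  refine mkG_injective hγ (isEvenFor_self hγ) ?_
  rw [mkG_evEquiv_left]
  exact (mkG_evGO hγ k).symm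

end Datum

end FixedLocus
end

open scoped Topology
noncomputable section
namespace FixedLocus
open FunSp

variable {I : Type} [Fintype I] [DecidableEq I]

namespace Datum

variable {D : Datum I} {γ η η' : Cow D.a} {ρ : Cow D.l}

/-! ### Blocks of the arrows -/

theorem tw_sub_arrow (η : Cow D.a) {i j : I} (h : D.E i j) (s : Fin (D.a j)) (t : Fin (D.a i)) :
    D.tw η j s - D.tw η i t =
      D.wt η j s - D.wt η i t + D.d i * (- D.c i j - 2) + 2 * D.d i * (- D.c i j) := by
  have h1 := D.twoσ_eq i j h.1 h.2.1 h.2.2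
  have h2 := h.d_eq
  simp only [tw]
  rw [h2] at h1
  linear_combination h1

theorem dvd_tw_iff (hγ : D.IsEven γ) (hη : D.IsEvenFor γ η) {x y : D.Iu} (h : D.E x.1.1 y.1.1)
    (s : D.J γ y) (t : D.J γ x) :
    (2 * D.d x.1.1 : ℤ) ∣ D.tw η y.1.1 s.1 - D.tw η x.1.1 t.1 ↔ D.Eu x y := by
  have hd := h.d_eq
  have hg : Nat.gcd (D.d x.1.1) (D.d y.1.1) = D.d x.1.1 := by
    refine Nat.gcd_eq_left ?_
    have : (D.d x.1.1 : ℤ) ∣ D.d y.1.1 := ⟨_, by rw [hd, mul_comm]⟩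
    exact_mod_cast this
  have h1 : (2 * D.d x.1.1 : ℤ) ∣ y.1.2 - D.wt η y.1.1 s.1 := by
    refine Dvd.dvd.trans ⟨- D.c x.1.1 y.1.1, ?_⟩
      (Int.modEq_iff_dvd.mp ((hη.wt_congr hγ y.1.1 s.1).trans s.2))
    rw [hd]
    ring
  have h2 : (2 * D.d x.1.1 : ℤ) ∣ x.1.2 - D.wt η x.1.1 t.1 :=
    Int.modEq_iff_dvd.mp ((hη.wt_congr hγ x.1.1 t.1).trans t.2)
  have h3 : (2 * D.d x.1.1 : ℤ) ∣ (y.1.2 - x.1.2 + D.b x.1.1 y.1.1) -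
      (D.tw η y.1.1 s.1 - D.tw η x.1.1 t.1) := by
    rw [tw_sub_arrow η h]
    obtain ⟨a, ha⟩ := h1
    obtain ⟨b', hb⟩ := h2
    refine ⟨a - b' + 2 * D.c x.1.1 y.1.1 + 1, ?_⟩
    simp only [b]
    linear_combination ha - hb
  rw [Eu, and_iff_right h, hg]
  constructor
  · intro h4
    have := dvd_add h3 h4
    rwa [sub_add_cancel] at this
  · intro h4
    have := dvd_sub h4 h3
    rwa [sub_sub_cancel] at this

open Classical in
/-- The matrices assembled from the matrices for the arrows of the unfolded quiver. -/
def blkB (hγ : D.IsEven γ) (M : ∀ e : D.Arru, Matrix (D.J γ e.1.2) (D.J γ e.1.1) ℂ) (e : D.Arr) :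
    Matrix (Fin (D.a e.1.2)) (Fin (D.a e.1.1)) ℂ := Matrix.of fun s t =>
  if h : D.Eu (blockOf hγ e.1.1 t) (blockOf hγ e.1.2 s) then
    M ⟨(blockOf hγ e.1.1 t, blockOf hγ e.1.2 s), h⟩ (inBlock hγ e.1.2 s) (inBlock hγ e.1.1 t) else 0

/-- The arrow of the quiver below an arrow of the unfolded quiver. -/
abbrev arrOf (e : D.Arru) : D.Arr := ⟨(e.1.1.1.1, e.1.2.1.1), e.2.1⟩

theorem blkB_apply (hγ : D.IsEven γ) (M : ∀ e : D.Arru, Matrix (D.J γ e.1.2) (D.J γ e.1.1) ℂ)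
    (e : D.Arru) (s : D.J γ e.1.2) (t : D.J γ e.1.1) :
    blkB hγ M (arrOf e) s.1 t.1 = M e s t := by
  have key : ∀ (x y : D.Iu) (h : D.Eu x y) (s : D.J γ y) (t : D.J γ x) (x' y' : D.Iu)
      (h' : D.Eu x' y') (s' : D.J γ y') (t' : D.J γ x'), x' = x → y' = y → HEq s' s → HEq t' t →
      M ⟨(x', y'), h'⟩ s' t' = M ⟨(x, y), h⟩ s t := by
    rintro x y h s t x' y' h' s' t' rfl rfl hs ht
    rw [eq_of_heq hs, eq_of_heq ht]
  have hsub : ∀ (i : I) (r r' : ℤ) (hx hx') (s : Fin (D.a i)) (hs hs'), r' = r →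
      HEq (⟨s, hs'⟩ : D.J γ ⟨(i, r'), hx'⟩) (⟨s, hs⟩ : D.J γ ⟨(i, r), hx⟩) := by
    rintro i r r' hx hx' s hs hs' rfl
    rfl
  have h1 := blockOf_eq hγ e.1.1 t
  have h2 := blockOf_eq hγ e.1.2 s
  have he : D.Eu (blockOf hγ e.1.1.1.1 t.1) (blockOf hγ e.1.2.1.1 s.1) := by
    rw [h1, h2]
    exact e.2
  refine (dif_pos he).trans ?_
  exact key _ _ e.2 _ _ _ _ he _ _ h1 h2
    (hsub _ _ _ e.1.2.2 _ s.1 s.2 _ (congrArg (fun x : D.Iu => x.1.2) h2))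
    (hsub _ _ _ e.1.1.2 _ t.1 t.2 _ (congrArg (fun x : D.Iu => x.1.2) h1))

/-- Matrices compatible with the blocks, for the arrows. -/
def IsBlkB (γ : Cow D.a) (β : ∀ e : D.Arr, Matrix (Fin (D.a e.1.2)) (Fin (D.a e.1.1)) ℂ) : Prop :=
  ∀ e, Adapted (2 * D.d e.1.1) (D.tw γ e.1.1) (D.tw γ e.1.2) (β e)

theorem IsBlkB.congr (hγ : D.IsEven γ) (hη : D.IsEvenFor γ η)
    {β : ∀ e : D.Arr, Matrix (Fin (D.a e.1.2)) (Fin (D.a e.1.1)) ℂ} (h : IsBlkB γ β) :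
    IsBlkB η β := by
  intro e s t hst
  exact (dvd_tw_iff (x := blockOf hγ e.1.1 t) (y := blockOf hγ e.1.2 s) hγ hη e.2 (inBlock hγ e.1.2 s)
    (inBlock hγ e.1.1 t)).mpr ((dvd_tw_iff (x := blockOf hγ e.1.1 t) (y := blockOf hγ e.1.2 s) hγ
    (isEvenFor_self hγ) e.2 (inBlock hγ e.1.2 s) (inBlock hγ e.1.1 t)).mp (h e s t hst))

theorem blkB_isBlkB (hγ : D.IsEven γ) (M : ∀ e : D.Arru, Matrix (D.J γ e.1.2) (D.J γ e.1.1) ℂ) :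
    IsBlkB γ (blkB hγ M) := by
  intro e s t hst
  refine (dvd_tw_iff (x := blockOf hγ e.1.1 t) (y := blockOf hγ e.1.2 s) hγ
    (isEvenFor_self hγ) e.2 (inBlock hγ e.1.2 s) (inBlock hγ e.1.1 t)).mpr ?_
  by_contra hc
  exact hst (dif_neg hc)

/-- The blocks of matrices for the arrows. -/
def unblkB (γ : Cow D.a) (β : ∀ e : D.Arr, Matrix (Fin (D.a e.1.2)) (Fin (D.a e.1.1)) ℂ)
    (e : D.Arru) : Matrix (D.J γ e.1.2) (D.J γ e.1.1) ℂ :=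
  (β (arrOf e)).submatrix Subtype.val Subtype.val

theorem blkB_unblkB (hγ : D.IsEven γ)
    {β : ∀ e : D.Arr, Matrix (Fin (D.a e.1.2)) (Fin (D.a e.1.1)) ℂ} (h : IsBlkB γ β) :
    blkB hγ (unblkB γ β) = β := by
  funext e
  ext s t
  by_cases he : D.Eu (blockOf hγ e.1.1 t) (blockOf hγ e.1.2 s)
  · exact dif_pos he
  · refine (dif_neg he).trans ?_
    by_contra hne
    exact he ((dvd_tw_iff (x := blockOf hγ e.1.1 t) (y := blockOf hγ e.1.2 s) hγ
      (isEvenFor_self hγ) e.2 (inBlock hγ e.1.2 s) (inBlock hγ e.1.1 t)).mp (h e s t (Ne.symm hne)))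

theorem blkB_mul (hγ : D.IsEven γ) (M : ∀ e : D.Arru, Matrix (D.J γ e.1.2) (D.J γ e.1.1) ℂ)
    (g g' : ∀ x, Matrix (D.J γ x) (D.J γ x) ℂ) (e : D.Arr) :
    blkB hγ (fun e => g e.1.2 * M e * g' e.1.1) e =
      blk hγ γ g e.1.2 * blkB hγ M e * blk hγ γ g' e.1.1 := by
  have h1 : IsBlkB γ (fun e => blk hγ γ g e.1.2 * blkB hγ M e * blk hγ γ g' e.1.1) := by
    intro e
    refine adapted_mul ((isBlk_blk hγ g').adapted e.1.1) (adapted_mul (blkB_isBlkB hγ M e)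
      ((isBlk_blk hγ g).adapted e.1.2) ⟨- D.c e.1.1 e.1.2, ?_⟩) dvd_rfl
    rw [e.2.d_eq]
    ring
  have h2 : (fun e : D.Arru => g e.1.2 * M e * g' e.1.1) = unblkB γ
      (fun e => blk hγ γ g e.1.2 * blkB hγ M e * blk hγ γ g' e.1.1) := by
    funext e
    ext s t
    change _ = (blk hγ γ g e.1.2.1.1 * blkB hγ M (arrOf e) * blk hγ γ g' e.1.1.1.1) s.1 t.1
    rw [Matrix.mul_assoc, Matrix.mul_assoc, Matrix.mul_apply, Matrix.mul_apply,
      (isBlk_blk hγ g).sum_eq e.1.2 s]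
    refine Finset.sum_congr rfl fun u _ => ?_
    rw [blk_apply, Matrix.mul_apply, Matrix.mul_apply]
    congr 1
    have h3 : D.IsBlk γ γ fun i => (blk hγ γ g' i).transpose := fun i s t h =>
      (isBlk_blk hγ g' i t s h).symm
    have h4 := h3.sum_eq e.1.1 t (fun v => blkB hγ M (arrOf e) u.1 v)
    simp only [Matrix.transpose_apply] at h4
    simp only [mul_comm (blkB hγ M (arrOf e) _ _)]
    rw [h4]
    refine Finset.sum_congr rfl fun v _ => ?_
    rw [blkB_apply, blk_apply, mul_comm]
  rw [h2, blkB_unblkB hγ h1]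

/-! ### The fixed points in `N_K` -/

theorem wMap_mem_HomZ {p q : ℤ} (hp : 0 < p) (hq : 0 < q) (hq1 : q = 1) {m n : ℕ} (δ : ℤ)
    (W : Fin m → ℤ) (W' : Fin n → ℤ) (β : Matrix (Fin n) (Fin m) ℂ) :
    wMap p hp δ W W' β ∈ HomZ p q hp hq m n := monoMap_mem_HomZ hp hq hq1 _ _

theorem E.neg_c'_eq {i j : I} (h : D.E i j) : - D.c j i = 1 := by rw [h.c_symm, neg_neg]

/-- The homogeneous element of `N_K` with given value at `z = 1`. -/
def mkN (hγ : D.IsEven γ) (η : Cow D.a) (n : D.Nu γ ρ) : D.NK where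
  A i := ⟨wMap 1 one_pos (2 * D.d i) (D.tw ρ i) (D.tw η i) (blk hγ ρ n.A i),
    wMap_mem_HomZ _ _ rfl _ _ _ _⟩
  B e := ⟨wMap (- D.c e.1.1 e.1.2) e.2.neg_c (2 * D.d e.1.1) (D.tw η e.1.1) (D.tw η e.1.2)
    (blkB hγ n.B e), wMap_mem_HomZ _ _ e.2.neg_c'_eq _ _ _ _⟩

theorem two_d_arrow {i j : I} (h : D.E i j) : (2 * D.d j : ℤ) = - D.c i j * (2 * D.d i) := by
  rw [h.d_eq]
  ring

theorem finsum_wMap_zvec {p δ : ℤ} {hp : 0 < p} {m n : ℕ} {W : Fin m → ℤ} {W' : Fin n → ℤ}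
    {β : Matrix (Fin n) (Fin m) ℂ} (s : Fin n) (t : Fin m) :
    ∑ r ∈ Finset.range p.toNat, ∑ᶠ k : ℤ, (wMap p hp δ W W' β (zvec t (r : ℤ)) s).coeff k = β s t := by
  simp only [wMap_zvec]
  have h1 := Int.mul_ediv_add_emod ((W' s - W t) / δ) p
  have h2 := Int.emod_nonneg ((W' s - W t) / δ) hp.ne'
  have h3 := Int.emod_lt_of_pos ((W' s - W t) / δ) hp
  generalize (W' s - W t) / δ = c at *
  rw [Finset.sum_eq_single (c % p).toNat]
  · rw [Int.toNat_of_nonneg h2, finsum_eq_single _ (-(c / p))]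
    · rw [if_pos (by linarith)]
    · intro k hk
      rw [if_neg]
      intro h
      apply hk
      have : p * k = p * -(c / p) := by linarith
      exact mul_left_cancel₀ hp.ne' this
  · intro r hr hne
    rw [Finset.mem_range] at hr
    refine (finsum_congr fun k => if_neg ?_).trans finsum_zero
    intro h
    apply hne
    have : c % p = r := by
      rw [← Int.emod_eq_of_lt (a := (r : ℤ)) (b := p) (by omega) (by omega), ← h,
        Int.mul_add_emod_self_left]
    omega
  · intro h
    exfalso
    apply h
    rw [Finset.mem_range]
    omega

theorem isEvN_mkN (hγ : D.IsEven γ) (η : Cow D.a) (n : D.Nu γ ρ) : D.IsEvN (mkN hγ η n) n := by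
  constructor
  · intro x s t
    have := finsum_wMap_zvec (p := 1) (hp := one_pos) (δ := 2 * D.d x.1.1) (W := D.tw ρ x.1.1)
      (W' := D.tw η x.1.1) (β := blk hγ ρ n.A x.1.1) s.1 t.1
    rw [blk_apply, show (1 : ℤ).toNat = 1 from rfl, Finset.sum_range_one, Nat.cast_zero] at this
    exact this.symm
  · intro e s t
    have := finsum_wMap_zvec (p := - D.c e.1.1.1.1 e.1.2.1.1) (hp := e.2.1.neg_c)
      (δ := 2 * D.d e.1.1.1.1) (W := D.tw η e.1.1.1.1)
      (W' := D.tw η e.1.2.1.1) (β := blkB hγ n.B (arrOf e)) s.1 t.1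
    rw [blkB_apply] at this
    exact this.symm

theorem IsEvN.unique {n : D.NK} {m m' : D.Nu γ ρ} (h : D.IsEvN n m) (h' : D.IsEvN n m') : m = m' := by
  refine Nu.ext (funext fun x => Matrix.ext fun s t => ?_) (funext fun e => Matrix.ext fun s t => ?_)
  · rw [h.1, h'.1]
  · rw [h.2, h'.2]

theorem mkN_injective (hγ : D.IsEven γ) (η : Cow D.a) :
    Function.Injective (mkN hγ η : D.Nu γ ρ → D.NK) := by
  intro n n' h
  refine (isEvN_mkN hγ η n).unique ?_
  rw [h]
  exact isEvN_mkN hγ η n'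

theorem LV_gTil_coeff (γ : Cow D.a) (τ : ℂˣ) (i : I) (v : KV (D.a i)) (s : Fin (D.a i)) (k : ℤ) :
    (D.LV i (D.gTil γ τ) v s).coeff k =
      ((τ ^ (D.tw γ i s + 2 * D.d i * k) : ℂˣ) : ℂ) * (v s).coeff k := by
  change ((Matrix.diagonal fun s => (HahnSeries.C ((τ ^ D.wt γ i s : ℂˣ) : ℂ) : LS)).mulVec
    (rotV _ _ _ τ v) s).coeff k = _
  rw [Matrix.mulVec_diagonal, ← smul_eq_C_mul, HahnSeries.coeff_smul, rotV_apply,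
    HahnSeries.coeff_smul, rot_coeff]
  simp only [smul_eq_mul, ← zpow_mul, tw, zpow_add, Units.val_mul]
  ring

theorem LW_gDot_coeff (γ : Cow D.a) (ρ : Cow D.l) (τ : ℂˣ) (i : I) (v : KV (D.l i))
    (s : Fin (D.l i)) (k : ℤ) :
    (D.LW i (D.gDot γ ρ τ) v s).coeff k =
      ((τ ^ (D.tw ρ i s + 2 * D.d i * k) : ℂˣ) : ℂ) * (v s).coeff k := by
  change ((Matrix.diagonal fun s => (HahnSeries.C ((τ ^ D.wt ρ i s : ℂˣ) : ℂ) : LS)).mulVec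
    (rotV _ _ _ τ v) s).coeff k = _
  rw [Matrix.mulVec_diagonal, ← smul_eq_C_mul, HahnSeries.coeff_smul, rotV_apply,
    HahnSeries.coeff_smul, rot_coeff]
  simp only [smul_eq_mul, ← zpow_mul, tw, zpow_add, Units.val_mul]
  ring

theorem smul_eq_iff (x : D.Gdot) (n n' : D.NK) : x • n = n' ↔
    (∀ i v, D.LV i x.1 ((n.A i).1 v) = (n'.A i).1 (D.LW i x v)) ∧
    ∀ e v, D.LV e.1.2 x.1 ((n.B e).1 v) = (n'.B e).1 (D.LV e.1.1 x.1 v) := by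
  constructor
  · rintro rfl
    refine ⟨fun i v => ?_, fun e v => ?_⟩
    · change _ = D.LV i x.1 ((n.A i).1 ((D.LW i x)⁻¹ (D.LW i x v)))
      rw [← LinearEquiv.mul_apply, inv_mul_cancel]
      rfl
    · change _ = D.LV e.1.2 x.1 ((n.B e).1 ((D.LV e.1.1 x.1)⁻¹ (D.LV e.1.1 x.1 v)))
      rw [← LinearEquiv.mul_apply, inv_mul_cancel]
      rfl
  · rintro ⟨h1, h2⟩
    refine NK.ext (funext fun i => Subtype.ext (LinearMap.ext fun v => ?_))
      (funext fun e => Subtype.ext (LinearMap.ext fun v => ?_))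
    · exact (h1 i _).trans (congrArg _ ((D.LW i x).apply_symm_apply v))
    · exact (h2 e _).trans (congrArg _ ((D.LV e.1.1 x.1).apply_symm_apply v))

theorem wMap_homogeneous {p δ δ' : ℤ} {hp : 0 < p} (hδ0 : δ ≠ 0) (hδ : δ' = p * δ) {m n : ℕ}
    {W : Fin m → ℤ}
    {W' : Fin n → ℤ} {β : Matrix (Fin n) (Fin m) ℂ} (hβ : Adapted δ W W' β) (τ : ℂˣ) {v v' : KV m}
    {w : KV n} (hv : ∀ t k, (v' t).coeff k = ((τ ^ (W t + δ * k) : ℂˣ) : ℂ) * (v t).coeff k)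
    (hw : ∀ s k, (w s).coeff k =
      ((τ ^ (W' s + δ' * k) : ℂˣ) : ℂ) * (wMap p hp δ W W' β v s).coeff k) :
    w = wMap p hp δ W W' β v' := by
  funext s
  ext k
  rw [hw, wMap, monoMap_coeff, monoMap_coeff, Finset.mul_sum]
  refine Finset.sum_congr rfl fun t _ => ?_
  by_cases h : β s t = 0
  · simp [h]
  obtain ⟨c, hc⟩ := hβ s t h
  rw [hv, hc, Int.mul_ediv_cancel_left _ hδ0, mul_left_comm]
  congr 4
  rw [hδ]
  linear_combination hc

theorem isBlk_blk_A (hγ : D.IsEven γ) (hη : D.IsEvenFor γ η) (n : D.Nu γ ρ) :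
    D.IsBlk η ρ (blk hγ ρ n.A) := (isBlk_blk hγ n.A).congr_left hγ hη

theorem mkN_mem_NKFix (hγ : D.IsEven γ) (hη : D.IsEvenFor γ η) (n : D.Nu γ ρ) :
    mkN hγ η n ∈ D.NKFix η ρ := by
  intro τ
  rw [smul_eq_iff]
  refine ⟨fun i v => ?_, fun e v => ?_⟩
  · exact wMap_homogeneous (D.two_d_pos i).ne' (one_mul _).symm ((isBlk_blk_A hγ hη n).adapted i) τ
      (fun t k => LW_gDot_coeff η ρ τ i v t k) fun s k => LV_gTil_coeff η τ i _ s k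
  · exact wMap_homogeneous (D.two_d_pos e.1.1).ne' (two_d_arrow e.2)
      ((blkB_isBlkB hγ n.B).congr hγ hη e) τ
      (fun t k => LV_gTil_coeff η τ e.1.1 v t k) fun s k => LV_gTil_coeff η τ e.1.2 _ s k

theorem zvec_coeff {n : ℕ} (t : Fin n) (r : ℤ) (s : Fin n) (k : ℤ) :
    (zvec t r s).coeff k = if s = t ∧ k = r then 1 else 0 := by
  rcases eq_or_ne s t with rfl | h
  · rw [zvec_same]
    rcases eq_or_ne k r with rfl | h'
    · rw [HahnSeries.coeff_single_same, if_pos ⟨rfl, rfl⟩]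
    · rw [HahnSeries.coeff_single_of_ne h', if_neg fun h => h' h.2]
  · rw [zvec_ne h, if_neg fun h' => h h'.1, HahnSeries.coeff_zero]

theorem weight_eq_of_comm {m n : ℕ} {B : KV m →ₗ[ℂ] KV n} {L : KV m → KV m} {L' : KV n → KV n}
    {W : Fin m → ℤ} {W' : Fin n → ℤ} {δ δ' : ℤ}
    (hL : ∀ v t k, (L v t).coeff k = ((twoU ^ (W t + δ * k) : ℂˣ) : ℂ) * (v t).coeff k)
    (hL' : ∀ v s k, (L' v s).coeff k = ((twoU ^ (W' s + δ' * k) : ℂˣ) : ℂ) * (v s).coeff k)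
    (h : ∀ v, L' (B v) = B (L v)) (t : Fin m) (r : ℤ) (s : Fin n) (k : ℤ)
    (hne : (B (zvec t r) s).coeff k ≠ 0) : W t + δ * r = W' s + δ' * k := by
  have h1 : L (zvec t r) = ((twoU ^ (W t + δ * r) : ℂˣ) : ℂ) • zvec t r := by
    funext s
    ext k
    rw [hL, Pi.smul_apply, HahnSeries.coeff_smul, smul_eq_mul, zvec_coeff]
    by_cases hs : s = t ∧ k = r
    · rw [if_pos hs, hs.1, hs.2]
    · rw [if_neg hs, mul_zero, mul_zero]
  have h2 := congrArg (fun w : KV n => (w s).coeff k) (h (zvec t r))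
  simp only [hL', h1, map_smul, Pi.smul_apply, HahnSeries.coeff_smul, smul_eq_mul] at h2
  exact (twoU_zpow_injective (mul_right_cancel₀ hne h2)).symm

theorem exists_mkN_eq (hγ : D.IsEven γ) {n : D.NK} (hn : n ∈ D.NKFix γ ρ) :
    ∃ m : D.Nu γ ρ, mkN hγ γ m = n := by
  have h := (smul_eq_iff _ _ _).mp (hn twoU)
  have hA : ∀ i, ∃ β, Adapted (2 * D.d i) (D.tw ρ i) (D.tw γ i) β ∧ (n.A i).1 =
      wMap 1 one_pos (2 * D.d i) (D.tw ρ i) (D.tw γ i) β := fun i =>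
    ⟨_, eq_wMap (p := 1) rfl (D.two_d_pos i).ne' (one_mul _).symm (n.A i).2
      (weight_eq_of_comm (fun v t k => LW_gDot_coeff γ ρ twoU i v t k)
        (fun v s k => LV_gTil_coeff γ twoU i v s k) (h.1 i))⟩
  have hB : ∀ e : D.Arr, ∃ β, Adapted (2 * D.d e.1.1) (D.tw γ e.1.1) (D.tw γ e.1.2) β ∧ (n.B e).1 =
      wMap (- D.c e.1.1 e.1.2) e.2.neg_c (2 * D.d e.1.1) (D.tw γ e.1.1) (D.tw γ e.1.2) β := fun e =>
    ⟨_, eq_wMap e.2.neg_c'_eq (D.two_d_pos e.1.1).ne' (two_d_arrow e.2) (n.B e).2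
      (weight_eq_of_comm (fun v t k => LV_gTil_coeff γ twoU e.1.1 v t k)
        (fun v s k => LV_gTil_coeff γ twoU e.1.2 v s k) (h.2 e))⟩
  choose a ha ha' using hA
  choose b hb hb' using hB
  refine ⟨⟨unblk γ ρ a, unblkB γ b⟩, NK.ext (funext fun i => Subtype.ext
    (Eq.trans ?_ (ha' i).symm)) (funext fun e => Subtype.ext (Eq.trans ?_ (hb' e).symm))⟩
  · change wMap _ _ _ _ _ (blk hγ ρ (unblk γ ρ a) i) = _
    rw [blk_unblk hγ]
    intro i s t hst
    have := ha i s t hst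
    rw [tw_sub] at this
    exact (Int.modEq_iff_dvd.mpr this).symm
  · change wMap _ _ _ _ _ (blkB hγ (unblkB γ b) e) = _
    rw [blkB_unblkB hγ hb]

/-- Evaluation at `z = 1` on `(N_K)^γ̇`. -/
def evN (hγ : D.IsEven γ) : D.NKFix γ ρ ≃ D.Nu γ ρ :=
  (Equiv.ofBijective (fun n : D.Nu γ ρ =>
      (⟨mkN hγ γ n, mkN_mem_NKFix hγ (isEvenFor_self hγ) n⟩ : D.NKFix γ ρ))
    ⟨fun _ _ h => mkN_injective hγ γ (congrArg Subtype.val h), fun n => by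
      obtain ⟨m, hm⟩ := exists_mkN_eq hγ n.2
      exact ⟨m, Subtype.ext hm⟩⟩).symm

theorem mkN_evN (hγ : D.IsEven γ) (n : D.NKFix γ ρ) : mkN hγ γ (evN hγ n) = n.1 :=
  congrArg Subtype.val ((evN hγ).symm_apply_apply n)

theorem isEvN_evN (hγ : D.IsEven γ) (n : D.NKFix γ ρ) : D.IsEvN n.1 (evN hγ n) := by
  rw [← mkN_evN hγ n]
  exact isEvN_mkN hγ γ _

/-! ### Equivariance -/

theorem LV_inclGK (g : D.GK) (i : I) (v : KV (D.a i)) : D.LV i (D.inclGK g).1 v = (g i).1.mulVec v := by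
  change D.LV i (SemidirectProduct.inl g) v = _
  rw [LV, SemidirectProduct.lift_inl]
  rfl

theorem LW_inclGK (g : D.GK) (i : I) (v : KV (D.l i)) : D.LW i (D.inclGK g) v = v := by
  have : (D.inclGK g) = (SemidirectProduct.inl g, 1) := rfl
  rw [this]
  change (glAct (D.l i) (diagGL fun s => constU (1 : ℂˣ)) *
    rotV (D.twoσ i) (2 * (D.d i : ℤ)) (D.l i) 1 : KV (D.l i) ≃ₗ[ℂ] KV (D.l i)) v = v
  have h : (fun _ : Fin (D.l i) => constU 1) = 1 := funext fun s => map_one _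
  rw [h, map_one, map_one, map_one]
  rfl

theorem inclGK_smul_eq_iff (g : D.GK) (n n' : D.NK) : D.inclGK g • n = n' ↔
    (∀ i v, (g i).1.mulVec ((n.A i).1 v) = (n'.A i).1 v) ∧
    ∀ e v, (g e.1.2).1.mulVec ((n.B e).1 v) = (n'.B e).1 ((g e.1.1).1.mulVec v) := by
  rw [smul_eq_iff]
  simp only [LV_inclGK, LW_inclGK]

theorem mkG_smul_mkN (hγ : D.IsEven γ) (hη : D.IsEvenFor γ η) (β : D.Gu γ) (n : D.Nu γ ρ) :
    D.inclGK (mkG hγ hη β) • mkN hγ η n = mkN hγ η (β • n) := by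
  rw [inclGK_smul_eq_iff]
  refine ⟨fun i v => ?_, fun e v => ?_⟩
  · rw [mkG_val, wMat_mulVec]
    refine (wMap_comp (p'' := 1) (hp'' := one_pos) (D.two_d_pos i).ne'
      ((isBlk_blk_A hγ hη n).adapted i) (blk_adapted hγ hη hη _ i) (one_mul _).symm (one_mul _).symm
      v).trans ?_
    rw [← blk_mul hγ hγ]
    rfl
  · rw [mkG_val, mkG_val, wMat_mulVec, wMat_mulVec]
    refine (wMap_comp (p'' := - D.c e.1.1 e.1.2) (hp'' := e.2.neg_c) (D.two_d_pos e.1.1).ne'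
      ((blkB_isBlkB hγ n.B).congr hγ hη e) (blk_adapted hγ hη hη _ e.1.2) (two_d_arrow e.2)
      (mul_one _).symm v).trans ?_
    refine Eq.trans ?_ (wMap_comp (p'' := - D.c e.1.1 e.1.2) (hp'' := e.2.neg_c)
      (D.two_d_pos e.1.1).ne' (blk_adapted hγ hη hη _ e.1.1)
      ((blkB_isBlkB hγ (β • n).B).congr hγ hη e) (one_mul _).symm (one_mul _).symm v).symm
    have h : blkB hγ (β • n).B e = _ := blkB_mul hγ n.B (fun x => (β x).1) (fun x => (β x)⁻¹.1) e
    rw [h, Matrix.mul_assoc _ _ (blk hγ γ (fun x => (β x).1) e.1.1), ← blk_mul hγ hγ]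
    simp only [← Units.val_mul, inv_mul_cancel, Units.val_one]
    rw [blk_one, Matrix.mul_one]

theorem wAct_smul_mkN (hγ : D.IsEven γ) (τ : ℂˣ) (n : D.Nu γ ρ) :
    ((1, fun i s => τ⁻¹ ^ D.wt ρ i s) : D.Gdot) • mkN hγ η n = mkN hγ η (D.wAct τ n) := by
  rw [smul_eq_iff]
  have hV : ∀ i v, D.LV i (1 : D.GKt) v = v := fun i v => by rw [map_one]; rfl
  have hW : ∀ i (v : KV (D.l i)) t k, (D.LW i ((1, fun i s => τ⁻¹ ^ D.wt ρ i s) : D.Gdot) v t).coeff k =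
      ((τ⁻¹ ^ D.wt ρ i t : ℂˣ) : ℂ) * (v t).coeff k := by
    intro i v t k
    change ((Matrix.diagonal fun s => (HahnSeries.C ((τ⁻¹ ^ D.wt ρ i s : ℂˣ) : ℂ) : LS)).mulVec
      (rotV _ _ _ 1 v) t).coeff k = _
    rw [Matrix.mulVec_diagonal, ← smul_eq_C_mul, HahnSeries.coeff_smul, map_one]
    rfl
  refine ⟨fun i v => ?_, fun e v => ?_⟩
  · rw [hV]
    funext s
    ext k
    change (wMap _ _ _ _ _ _ _ _).coeff k = (wMap _ _ _ _ _ _ _ _).coeff k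
    rw [wMap, monoMap_coeff, wMap, monoMap_coeff]
    refine Finset.sum_congr rfl fun t _ => ?_
    rw [hW]
    have : blk hγ ρ (D.wAct τ n).A i s t = blk hγ ρ n.A i s t * ((τ ^ D.wt ρ i t : ℂˣ) : ℂ) := by
      change (if h : _ then _ else _) = (if h : _ then _ else _) * _
      by_cases h : D.wt ρ i t ≡ D.rep i (D.wt γ i s) [ZMOD 2 * D.d i]
      · rw [dif_pos h, dif_pos h]
        rfl
      · rw [dif_neg h, dif_neg h, zero_mul]
    rw [this, mul_assoc, ← mul_assoc ((τ ^ D.wt ρ i t : ℂˣ) : ℂ), ← Units.val_mul, ← mul_zpow]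
    simp
  · rw [hV, hV]
    rfl

theorem constGK_eq_mkG (hγ : D.IsEven γ) (τ : ℂˣ) :
    D.constGK (fun i s => τ⁻¹ ^ D.wt γ i s) = mkG hγ (isEvenFor_self hγ) (D.tU γ τ) := by
  refine GK_ext fun i s t k => ?_
  rw [mkG_coeff]
  have h := blk_diagonal hγ (fun i s => ((τ ^ (- D.wt γ i s) : ℂˣ) : ℂ)) i
  have h' : blk hγ γ (fun x => (D.tU γ τ x).1) i = _ := h
  rw [h']
  change ((Matrix.diagonal fun s => (HahnSeries.C ((τ⁻¹ ^ D.wt γ i s : ℂˣ) : ℂ) : LS)) s t).coeff k = _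
  rcases eq_or_ne s t with rfl | hst
  · rw [Matrix.diagonal_apply_eq, Matrix.diagonal_apply_eq, inv_zpow', sub_self]
    rcases eq_or_ne k 0 with rfl | hk
    · rw [mul_zero, if_pos rfl, HahnSeries.C_apply, HahnSeries.coeff_single_same]
    · rw [if_neg (mul_ne_zero (D.two_d_pos i).ne' hk), HahnSeries.C_apply,
        HahnSeries.coeff_single_of_ne hk]
  · rw [Matrix.diagonal_apply_ne _ hst, Matrix.diagonal_apply_ne _ hst, ite_self, HahnSeries.coeff_zero]

theorem smul_mkN (hγ : D.IsEven γ) (x : D.GKtFix γ) (n : D.Nu γ ρ) :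
    D.incl x.1 • mkN hγ γ n = mkN hγ γ (evEquiv hγ x • n) := by
  have h1 := mkN_mem_NKFix hγ (isEvenFor_self hγ) n x.1.right⁻¹
  have h2 : D.incl x.1 * D.gDot γ ρ x.1.right⁻¹ =
      D.inclGK (mkG hγ (isEvenFor_self hγ) ((evEquiv hγ x).left * D.tU γ (evEquiv hγ x).right)) *
        ((1, fun i s => x.1.right⁻¹ ^ D.wt ρ i s) : D.Gdot) := by
    rw [map_mul, mkG_evEquiv_left, evEquiv_right, ← constGK_eq_mkG hγ]
    refine Prod.ext (SemidirectProduct.ext ?_ ?_) ?_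
    · change x.1.left * D.rotGK x.1.right (D.constGK _) = _ * D.rotGK 1 1
      rw [rotGK_constGK, map_one, mul_one]
      rfl
    · change x.1.right * x.1.right⁻¹ = 1 * 1
      simp
    · change 1 * _ = 1 * _
      rfl
  conv_lhs => rw [← h1]
  rw [← mul_smul, h2, mul_smul, wAct_smul_mkN, mkG_smul_mkN]
  change _ = mkN hγ γ (((evEquiv hγ x).left * D.tU γ (evEquiv hγ x).right) •
    D.wAct (evEquiv hγ x).right n)
  rw [evEquiv_right]

theorem evN_smul (hγ : D.IsEven γ) (x : D.GKtFix γ) (n : D.NKFix γ ρ) :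
    evN hγ (x • n) = evEquiv hγ x • evN hγ n := by
  apply mkN_injective hγ γ
  rw [mkN_evN, ← smul_mkN, mkN_evN]
  rfl

/-! ### The cocharacter `η̂ - γ̂` -/

/-- The element `z ^ (η̂ - γ̂)`. -/
def zη (γ η : Cow D.a) : D.GK := D.zPow fun i s => D.hat η i s - D.hat γ i s

theorem zη_mulVec (hγ : D.IsEven γ) (hη : D.IsEvenFor γ η) (i : I) (v : KV (D.a i)) :
    (zη γ η i).1.mulVec v = wMap 1 one_pos (2 * D.d i) (D.tw η i) (D.tw γ i) 1 v := by
  funext s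
  ext k
  change ((Matrix.diagonal fun s => ((zU ^ (D.hat η i s - D.hat γ i s) : LSˣ) : LS)).mulVec v s).coeff k
    = _
  rw [Matrix.mulVec_diagonal, zU_zpow, coeff_single_mul', wMap, monoMap_coeff,
    Finset.sum_eq_single s]
  · rw [Matrix.one_apply_eq, tw_sub]
    have := hη.hat_sub hγ i s
    rw [show D.wt γ i s - D.wt η i s = 2 * D.d i * (-(D.hat η i s - D.hat γ i s)) by linarith,
      Int.mul_ediv_cancel_left _ (D.two_d_pos i).ne']
    congr 2
    ring
  · intro t _ hne
    rw [Matrix.one_apply_ne hne.symm, zero_mul]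
  · simp

theorem one_adapted (hγ : D.IsEven γ) (hη : D.IsEvenFor γ η) (i : I) :
    Adapted (2 * D.d i) (D.tw η i) (D.tw γ i) 1 := by
  intro s t h
  rcases eq_or_ne s t with rfl | hne
  · rw [tw_sub]
    exact Int.modEq_iff_dvd.mp (hη.wt_congr hγ i s)
  · exact absurd (Matrix.one_apply_ne hne) h

theorem zη_smul_mkN (hγ : D.IsEven γ) (hη : D.IsEvenFor γ η) (n : D.Nu γ ρ) :
    D.inclGK (zη γ η) • mkN hγ η n = mkN hγ γ n := by
  rw [inclGK_smul_eq_iff]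
  refine ⟨fun i v => ?_, fun e v => ?_⟩
  · rw [zη_mulVec hγ hη]
    refine (wMap_comp (p'' := 1) (hp'' := one_pos) (D.two_d_pos i).ne'
      ((isBlk_blk_A hγ hη n).adapted i) (one_adapted hγ hη i) (one_mul _).symm (one_mul _).symm
      v).trans ?_
    rw [Matrix.one_mul]
    rfl
  · rw [zη_mulVec hγ hη, zη_mulVec hγ hη]
    refine (wMap_comp (p'' := - D.c e.1.1 e.1.2) (hp'' := e.2.neg_c) (D.two_d_pos e.1.1).ne'
      ((blkB_isBlkB hγ n.B).congr hγ hη e) (one_adapted hγ hη e.1.2) (two_d_arrow e.2)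
      (mul_one _).symm v).trans ?_
    refine Eq.trans ?_ (wMap_comp (p'' := - D.c e.1.1 e.1.2) (hp'' := e.2.neg_c)
      (D.two_d_pos e.1.1).ne' (one_adapted hγ hη e.1.1)
      (blkB_isBlkB hγ n.B e) (one_mul _).symm (one_mul _).symm v).symm
    rw [Matrix.mul_one, Matrix.one_mul]

theorem mkG_mul_zη (hγ : D.IsEven γ) (hη : D.IsEvenFor γ η) (β : D.Gu γ) :
    mkG hγ (isEvenFor_self hγ) β * zη γ η = zη γ η * mkG hγ hη β := by
  refine GK_ext fun i s t k => ?_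
  change (((mkG hγ (isEvenFor_self hγ) β i).1 *
    Matrix.diagonal fun s => ((zU ^ (D.hat η i s - D.hat γ i s) : LSˣ) : LS)) s t).coeff k =
    (((Matrix.diagonal fun s => ((zU ^ (D.hat η i s - D.hat γ i s) : LSˣ) : LS)) *
    (mkG hγ hη β i).1) s t).coeff k
  rw [Matrix.mul_diagonal, Matrix.diagonal_mul, zU_zpow, zU_zpow, mul_comm, coeff_single_mul',
    coeff_single_mul', mkG_coeff, mkG_coeff]
  congr 2
  have h1 := hη.hat_sub hγ i s
  have h2 := hη.hat_sub hγ i t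
  rw [eq_iff_iff]
  constructor <;> intro h <;> linarith

/-! ### Integrality -/

theorem mem_Nη_iff {n : D.Nu γ ρ} : n ∈ D.Nη γ η ρ ↔
    (∀ x s t, n.A x s t ≠ 0 → D.deg η x.1.1 s.1 ≤ D.deg ρ x.1.1 t.1) ∧
    ∀ (e : D.Arru) s t, n.B e s t ≠ 0 → D.deg η e.1.2.1.1 s.1 < D.deg η e.1.1.1.1 t.1 := by
  classical
  constructor
  · rintro ⟨h1, h2⟩
    refine ⟨fun x s t hst => ?_, fun e s t hst => ?_⟩
    · refine h1 _ x (Pi.single t 1) (fun t' ht' => ?_) s (by simpa using hst)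
      by_contra hc
      exact ht' (Pi.single_eq_of_ne (by rintro rfl; exact hc rfl) _)
    · have := h2 (D.deg η e.1.1.1.1 t.1) e (Pi.single t 1) (fun t' ht' => ?_) s (by simpa using hst)
      · omega
      · by_contra hc
        exact ht' (Pi.single_eq_of_ne (by rintro rfl; exact hc le_rfl) _)
  · rintro ⟨h1, h2⟩
    refine ⟨fun k x w hw s hs => ?_, fun k e v hv s hs => ?_⟩
    · obtain ⟨t, -, ht⟩ := Finset.exists_ne_zero_of_sum_ne_zero (s := Finset.univ)
        (f := fun t => n.A x s t * w t) hs
      rw [← hw t (right_ne_zero_of_mul ht)]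
      exact h1 x s t (left_ne_zero_of_mul ht)
    · obtain ⟨t, -, ht⟩ := Finset.exists_ne_zero_of_sum_ne_zero (s := Finset.univ)
        (f := fun t => n.B e s t * v t) hs
      have h3 := hv t (right_ne_zero_of_mul ht)
      have h4 := h2 e s t (left_ne_zero_of_mul ht)
      omega

theorem ediv_lt_iff_of_dvd {δ a p : ℤ} (hδ : 0 < δ) (h : δ ∣ a) : a / δ < p ↔ a < δ * p := by
  obtain ⟨c, rfl⟩ := h
  rw [Int.mul_ediv_cancel_left _ hδ.ne']
  exact (mul_lt_mul_iff_right₀ hδ).symm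

theorem mkN_mem_NO_iff (hγ : D.IsEven γ) (hη : D.IsEvenFor γ η) {n : D.Nu γ ρ} :
    mkN hγ η n ∈ D.NO ↔ n ∈ D.Nη γ η ρ := by
  have hA : ∀ i, HomBdd 0 ((mkN hγ η n).A i).1 ↔ ∀ s t, blk hγ ρ n.A i s t ≠ 0 →
      D.deg η i s ≤ D.deg ρ i t := by
    intro i
    refine homBdd_wMap.trans (forall_congr' fun s => forall_congr' fun t => imp_congr_right fun h => ?_)
    obtain ⟨c, hc⟩ := (isBlk_blk_A hγ hη n).adapted i s t h
    have h0 := D.two_d_pos i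
    rw [hc, Int.mul_ediv_cancel_left _ h0.ne']
    rw [tw_sub] at hc
    simp only [deg]
    constructor
    · intro h1
      have : 2 * (D.d i : ℤ) * c ≤ 0 := mul_nonpos_of_nonneg_of_nonpos h0.le (by omega)
      linarith
    · intro h1
      by_contra h2
      have : 0 < 2 * (D.d i : ℤ) * c := mul_pos h0 (by omega)
      linarith
  have hB : ∀ e : D.Arr, HomBdd 0 ((mkN hγ η n).B e).1 ↔ ∀ s t, blkB hγ n.B e s t ≠ 0 →
      D.deg η e.1.2 s < D.deg η e.1.1 t := by
    intro e
    refine homBdd_wMap.trans (forall_congr' fun s => forall_congr' fun t => imp_congr_right fun h => ?_)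
    have h0 := D.two_d_pos e.1.1
    have hd := (blkB_isBlkB hγ n.B).congr hγ hη e s t h
    rw [ediv_lt_iff_of_dvd h0 hd]
    rw [tw_sub_arrow η e.2] at hd ⊢
    have h1 := e.2.lt_shift_iff (x := D.wt η e.1.1 t - D.wt η e.1.2 s) (by
      obtain ⟨c, hc⟩ := hd
      refine ⟨-c + (- D.c e.1.1 e.1.2) - 1, ?_⟩
      simp only [b]
      linear_combination -hc)
    simp only [deg]
    constructor
    · intro h2
      have := h1.mp (by linarith)
      linarith
    · intro h2
      have := h1.mpr (by linarith)
      linarith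
  rw [mem_Nη_iff]
  refine and_congr ⟨fun h x s t hst => ?_, fun h i => (hA i).mpr fun s t hst => ?_⟩
    ⟨fun h e s t hst => ?_, fun h e => (hB e).mpr fun s t hst => ?_⟩
  · exact (hA x.1.1).mp (h _) s.1 t.1 (by rwa [blk_apply])
  · have hs := blk_ne_zero hst
    exact h (blockOf hγ i s) (inBlock hγ i s) ⟨t, hs.symm.trans (D.rep_modEq i _)⟩ fun h' =>
      hst ((blk_apply hγ n.A (blockOf hγ i s) (inBlock hγ i s)
        ⟨t, hs.symm.trans (D.rep_modEq i _)⟩).trans h')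
  · exact (hB (arrOf e)).mp (h _) s.1 t.1 (by rwa [blkB_apply])
  · have he : D.Eu (blockOf hγ e.1.1 t) (blockOf hγ e.1.2 s) := by
      by_contra hc
      exact hst (dif_neg hc)
    exact h ⟨(_, _), he⟩ (inBlock hγ e.1.2 s) (inBlock hγ e.1.1 t) fun h' =>
      hst ((blkB_apply hγ n.B ⟨(_, _), he⟩ (inBlock hγ e.1.2 s) (inBlock hγ e.1.1 t)).trans h')

theorem mem_NO_iff_evN (hγ : D.IsEven γ) (n : D.NKFix γ ρ) :
    n.1 ∈ D.NO ↔ evN hγ n ∈ D.Nη γ γ ρ := by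
  rw [← mkN_mem_NO_iff hγ (isEvenFor_self hγ), mkN_evN]

instance : Finite D.Iu := by
  have h : Set.Finite {x : I × ℤ | x ∈ D.I0 ∧ 1 ≤ x.2 ∧ x.2 ≤ 2 * D.d x.1} := by
    refine Set.Finite.subset (s := Set.univ ×ˢ Set.Icc 1 (∑ i, 2 * (D.d i : ℤ)))
      (Set.finite_univ.prod (Set.finite_Icc _ _)) ?_
    rintro ⟨i, r⟩ ⟨-, h1, h2⟩
    refine ⟨trivial, h1, h2.trans ?_⟩
    exact Finset.single_le_sum (f := fun i => 2 * (D.d i : ℤ)) (fun _ _ => by positivity)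
      (Finset.mem_univ i)
  exact h.to_subtype

/-! ### The standard flag -/

theorem deg_bdd (D : Datum I) (η : Cow D.a) : ∃ N : ℤ, ∀ i s, |D.deg η i s| ≤ N := by
  refine ⟨∑ i, ∑ s, |D.deg η i s|, fun i s => ?_⟩
  refine (Finset.single_le_sum (f := fun s => |D.deg η i s|) (fun _ _ => abs_nonneg _)
    (Finset.mem_univ s)).trans ?_
  exact Finset.single_le_sum (f := fun i => ∑ s, |D.deg η i s|)
    (fun _ _ => Finset.sum_nonneg fun _ _ => abs_nonneg _) (Finset.mem_univ i)

/-- The dimensions of the members of the standard flag. -/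
def flagDim (γ η : Cow D.a) (k : ℤ) (x : D.Iu) : ℕ :=
  Nat.card {s : D.J γ x // D.deg η x.1.1 s.1 ≤ k}

theorem finrank_stdFlag (k : ℤ) (x : D.Iu) :
    Module.finrank ℂ (D.stdFlag γ η k x) = flagDim γ η k x := by
  classical
  let f : D.stdFlag γ η k x →ₗ[ℂ] ({s : D.J γ x // D.deg η x.1.1 s.1 ≤ k} → ℂ) :=
    { toFun := fun v s => v.1 s.1
      map_add' := fun _ _ => rfl
      map_smul' := fun _ _ => rfl }
  have hf : Function.Bijective f := by
    constructor
    · intro v w h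
      refine Subtype.ext (funext fun s => ?_)
      by_cases hs : D.deg η x.1.1 s.1 ≤ k
      · exact congrFun h ⟨s, hs⟩
      · have hv : v.1 s = 0 := by
          by_contra hc
          exact hs (v.2 s hc)
        have hw : w.1 s = 0 := by
          by_contra hc
          exact hs (w.2 s hc)
        rw [hv, hw]
    · intro w
      refine ⟨⟨fun s => if h : D.deg η x.1.1 s.1 ≤ k then w ⟨s, h⟩ else 0, fun s hs => ?_⟩, ?_⟩
      · by_contra hc
        exact hs (dif_neg hc)
      · funext s
        exact dif_pos s.2
  rw [(LinearEquiv.ofBijective f hf).finrank_eq, Module.finrank_fintype_fun_eq_card, flagDim,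
    Nat.card_eq_fintype_card]

theorem flagDim_eq (k : ℤ) (x : D.Iu) :
    flagDim γ η k x = flagDim γ η (k - 1) x + D.dimSeq γ η k x := by
  classical
  simp only [flagDim, dimSeq, Nat.card_eq_fintype_card, Fintype.card_subtype]
  rw [← Finset.card_union_of_disjoint]
  · congr 1
    ext s
    simp only [Finset.mem_filter, Finset.mem_univ, true_and, Finset.mem_union]
    omega
  · rw [Finset.disjoint_filter]
    intro s _ h
    omega

theorem isFlag_stdFlag : D.IsFlag (D.stdFlag γ η) (D.dimSeq γ η) where
  mono k x v hv s hs := (hv s hs).trans (by omega)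
  bot := by
    obtain ⟨N, hN⟩ := D.deg_bdd η
    refine ⟨-N - 1, fun k hk x => (Submodule.eq_bot_iff _).mpr fun v hv => funext fun s => ?_⟩
    by_contra hc
    have h1 := hv s hc
    have h2 := neg_le_of_abs_le (hN x.1.1 s.1)
    omega
  top := by
    obtain ⟨N, hN⟩ := D.deg_bdd η
    exact ⟨N, fun k hk x => (Submodule.eq_top_iff').mpr fun v s _ =>
      (le_of_abs_le (hN x.1.1 s.1)).trans hk⟩
  dim k x := by rw [finrank_stdFlag, finrank_stdFlag, flagDim_eq]

theorem isCompat_stdFlag_iff {n : D.Nu γ ρ} :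
    D.IsCompat (D.stdFlag γ η) n ↔ n ∈ D.Nη γ η ρ := by
  constructor
  · exact fun h => ⟨fun k x w hw => h.1 k x w fun t ht => (hw t ht).le, h.2⟩
  · intro h
    refine ⟨fun k x w hw s hs => ?_, h.2⟩
    obtain ⟨t, -, ht⟩ := Finset.exists_ne_zero_of_sum_ne_zero (s := Finset.univ)
      (f := fun t => n.A x s t * w t) hs
    exact ((mem_Nη_iff.mp h).1 x s t (left_ne_zero_of_mul ht)).trans (hw t (right_ne_zero_of_mul ht))

theorem deg_le_iff (hγ : D.IsEven γ) (hη : D.IsEvenFor γ η) {x : D.Iu} (s t : D.J γ x) :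
    D.deg η x.1.1 s.1 ≤ D.deg η x.1.1 t.1 ↔ D.hat η x.1.1 s.1 ≤ D.hat η x.1.1 t.1 := by
  have h := hη.hat_sub_hat hγ (J_congr s t)
  have h0 := D.two_d_pos x.1.1
  simp only [deg]
  constructor
  · intro h1
    by_contra hc
    have : 0 < 2 * (D.d x.1.1 : ℤ) * (D.hat η x.1.1 s.1 - D.hat η x.1.1 t.1) := mul_pos h0 (by omega)
    linarith
  · intro h1
    have : 2 * (D.d x.1.1 : ℤ) * (D.hat η x.1.1 s.1 - D.hat η x.1.1 t.1) ≤ 0 :=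
      mul_nonpos_of_nonneg_of_nonpos h0.le (by omega)
    linarith

theorem smul_seq_apply (g : D.Gu γ) (F : D.Seq γ) (k : ℤ) (x : D.Iu) :
    (g • F) k x = (F k x).map (Matrix.mulVecLin (g x).1) := rfl

theorem mem_Pu_iff_stdFlag (hγ : D.IsEven γ) (hη : D.IsEvenFor γ η) {g : D.Gu γ} :
    g ∈ D.Pu γ η ↔ g • D.stdFlag γ η = D.stdFlag γ η := by
  classical
  constructor
  · have key : ∀ g ∈ D.Pu γ η, ∀ k x, (g • D.stdFlag γ η) k x ≤ D.stdFlag γ η k x := by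
      rintro g hg k x _ ⟨v, hv, rfl⟩ s hs
      obtain ⟨t, -, ht⟩ := Finset.exists_ne_zero_of_sum_ne_zero (s := Finset.univ)
        (f := fun t => (g x).1 s t * v t) hs
      exact ((deg_le_iff hγ hη s t).mpr (mem_Pu_iff.mp hg x s t (left_ne_zero_of_mul ht))).trans
        (hv t (right_ne_zero_of_mul ht))
    intro hg
    refine funext fun k => funext fun x => le_antisymm (key g hg k x) ?_
    have h1 := key g⁻¹ (inv_mem hg) k x
    have h2 := Submodule.map_mono (f := Matrix.mulVecLin (g x).1) h1
    have h3 : (g • g⁻¹ • D.stdFlag γ η) k x ≤ (g • D.stdFlag γ η) k x := h2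
    rwa [smul_inv_smul] at h3
  · intro h
    rw [mem_Pu_iff]
    intro x s t hst
    rw [← deg_le_iff hγ hη]
    have h1 : (g x).1.mulVec (Pi.single t 1) ∈ (g • D.stdFlag γ η) (D.deg η x.1.1 t.1) x := by
      refine ⟨Pi.single t 1, fun t' ht' => ?_, rfl⟩
      by_contra hc
      exact ht' (Pi.single_eq_of_ne (by rintro rfl; exact hc le_rfl) _)
    rw [h] at h1
    exact h1 s (by simpa using hst)

/-! ### Transitivity on flags -/

theorem IsFlag.finrank_eq {F F' : D.Seq γ} {v : ℤ → D.Iu → ℕ} (h : D.IsFlag F v) (h' : D.IsFlag F' v)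
    (k : ℤ) (x : D.Iu) : Module.finrank ℂ (F k x) = Module.finrank ℂ (F' k x) := by
  obtain ⟨k₀, hk⟩ := h.bot
  obtain ⟨k₁, hk'⟩ := h'.bot
  have key : ∀ m : ℕ, Module.finrank ℂ (F (min k₀ k₁ + m) x) =
      Module.finrank ℂ (F' (min k₀ k₁ + m) x) := by
    intro m
    induction m with
    | zero => rw [hk _ (by omega), hk' _ (by omega)]
    | succ m ih =>
      rw [h.dim, h'.dim]
      have : min k₀ k₁ + ((m + 1 : ℕ) : ℤ) - 1 = min k₀ k₁ + m := by push_cast; ring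
      rw [this, ih]
  by_cases hkm : k ≤ min k₀ k₁
  · rw [hk _ (by omega), hk' _ (by omega)]
  · have := key (k - min k₀ k₁).toNat
    rwa [Int.toNat_of_nonneg (by omega), add_sub_cancel] at this

theorem IsFlag.le {F : D.Seq γ} {v : ℤ → D.Iu → ℕ} (h : D.IsFlag F v) {k l : ℤ} (hkl : k ≤ l)
    (x : D.Iu) : F k x ≤ F l x := by
  induction l, hkl using Int.leInduction with
  | base => exact le_rfl
  | succ l _ ih => exact ih.trans (h.mono l x)

theorem stdFlag_eq_span [∀ x : D.Iu, DecidableEq (D.J γ x)] (k : ℤ) (x : D.Iu) :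
    D.stdFlag γ η k x = Submodule.span ℂ (Set.range fun s : {s : D.J γ x // D.deg η x.1.1 s.1 ≤ k} =>
      (Pi.single s.1 1 : D.J γ x → ℂ)) := by
  apply le_antisymm
  · intro v hv
    rw [pi_eq_sum_univ' v]
    refine Submodule.sum_mem _ fun s _ => ?_
    by_cases hs : v s = 0
    · rw [hs, zero_smul]
      exact Submodule.zero_mem _
    · refine Submodule.smul_mem _ _ (Submodule.subset_span ⟨⟨s, hv s hs⟩, ?_⟩)
      funext t
      simp [Pi.single_apply, eq_comm]
  · rw [Submodule.span_le]
    rintro _ ⟨s, rfl⟩ t ht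
    have : t = s.1 := by
      by_contra hc
      exact ht (Pi.single_eq_of_ne hc _)
    rw [this]
    exact s.2

theorem smul_stdFlag_eq_span (g : D.Gu γ) (k : ℤ) (x : D.Iu) :
    (g • D.stdFlag γ η) k x =
      Submodule.span ℂ (Set.range fun s : {s : D.J γ x // D.deg η x.1.1 s.1 ≤ k} =>
        fun t => (g x).1 t s.1) := by
  classical
  rw [smul_seq_apply, stdFlag_eq_span, Submodule.map_span, ← Set.range_comp]
  congr 2
  funext s t
  simp

/-- A matrix whose columns are adapted to a flag moves the standard flag to it. -/
theorem IsFlag.smul_stdFlag_eq {F : D.Seq γ} (h : D.IsFlag F (D.dimSeq γ η)) {g : D.Gu γ}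
    (hg : ∀ x (s : D.J γ x), (fun t => (g x).1 t s) ∈ F (D.deg η x.1.1 s.1) x) :
    g • D.stdFlag γ η = F := by
  refine funext fun k => funext fun x => ?_
  refine Submodule.eq_of_le_of_finrank_eq ?_ ((isFlag_stdFlag.smul g).finrank_eq h k x)
  rw [smul_stdFlag_eq_span, Submodule.span_le]
  rintro _ ⟨s, rfl⟩
  exact h.le s.2 x (hg x s.1)

theorem exists_spanning_family {V ι : Type} [AddCommGroup V] [Module ℂ V] [FiniteDimensional ℂ V]
    [Fintype ι] {A B : Submodule ℂ V} (hAB : A ≤ B)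
    (h : Module.finrank ℂ B = Module.finrank ℂ A + Fintype.card ι) :
    ∃ v : ι → V, (∀ i, v i ∈ B) ∧ B ≤ A ⊔ Submodule.span ℂ (Set.range v) := by
  obtain ⟨C, hC⟩ := Submodule.exists_isCompl A
  have h1 : A ⊔ C ⊓ B = B := by rw [← sup_inf_assoc_of_le C hAB, hC.sup_eq_top, top_inf_eq]
  have h2 : A ⊓ (C ⊓ B) = ⊥ := by rw [← inf_assoc, hC.inf_eq_bot, bot_inf_eq]
  have h3 := Submodule.finrank_sup_add_finrank_inf_eq A (C ⊓ B)
  rw [h1, h2, finrank_bot, h] at h3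
  let e : Module.Basis ι ℂ (C ⊓ B : Submodule ℂ V) :=
    (Module.finBasisOfFinrankEq ℂ (C ⊓ B : Submodule ℂ V) (n := Fintype.card ι) (by omega)).reindex
      (Fintype.equivFin ι).symm
  refine ⟨fun i => (e i).1, fun i => (e i).2.2, ?_⟩
  have h4 : Submodule.span ℂ (Set.range fun i => (e i).1) = C ⊓ B := by
    have h5 := congrArg (Submodule.map (C ⊓ B).subtype) e.span_eq
    rw [Submodule.map_span, ← Set.range_comp, Submodule.map_top, Submodule.range_subtype] at h5
    exact h5
  rw [h4, h1]

theorem IsFlag.exists_smul_stdFlag {F : D.Seq γ} (h : D.IsFlag F (D.dimSeq γ η)) :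
    ∃ g : D.Gu γ, g • D.stdFlag γ η = F := by
  classical
  have h1 : ∀ k x, ∃ v : {s : D.J γ x // D.deg η x.1.1 s.1 = k} → (D.J γ x → ℂ),
      (∀ s, v s ∈ F k x) ∧ F k x ≤ F (k - 1) x ⊔ Submodule.span ℂ (Set.range v) := by
    intro k x
    refine exists_spanning_family (h.le (by omega) x) ?_
    rw [h.dim k x, ← Nat.card_eq_fintype_card]
    rfl
  choose v hv hF using h1
  let M : ∀ x, Matrix (D.J γ x) (D.J γ x) ℂ := fun x => Matrix.of fun t s => v _ x ⟨s, rfl⟩ t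
  have hspan : ∀ k x, F k x ≤ LinearMap.range (M x).mulVecLin := by
    intro k x
    obtain ⟨k₀, hk⟩ := h.bot
    have key : ∀ m : ℕ, F (k₀ + m) x ≤ LinearMap.range (M x).mulVecLin := by
      intro m
      induction m with
      | zero =>
        rw [hk _ (by omega)]
        exact bot_le
      | succ m ih =>
        refine (hF _ x).trans (sup_le ?_ ?_)
        · have : k₀ + ((m + 1 : ℕ) : ℤ) - 1 = k₀ + m := by push_cast; ring
          rw [this]
          exact ih
        · rw [Submodule.span_le]
          rintro _ ⟨⟨s, hs⟩, rfl⟩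
          refine ⟨Pi.single s 1, ?_⟩
          generalize k₀ + ((m + 1 : ℕ) : ℤ) = k' at hs
          subst hs
          funext t
          simp [M]
    by_cases hkm : k ≤ k₀
    · rw [hk _ hkm]
      exact bot_le
    · have := key (k - k₀).toNat
      rwa [Int.toNat_of_nonneg (by omega), add_sub_cancel] at this
  have hunit : ∀ x, IsUnit (M x) := by
    intro x
    obtain ⟨k₁, hk⟩ := h.top
    have h2 : Function.Surjective (M x).mulVec := by
      intro w
      have : w ∈ F k₁ x := by
        rw [hk k₁ le_rfl]
        trivial
      exact hspan k₁ x this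
    exact Matrix.mulVec_surjective_iff_isUnit.mp h2
  refine ⟨fun x => (hunit x).unit, h.smul_stdFlag_eq fun x s => ?_⟩
  exact hv _ x ⟨s, rfl⟩

/-! ### Regularity of the group operations -/

section Regularity

variable {Y : Type} {S : FunSp Y} {y : Y}

/-- Regularity of a map to `G̲`. -/
def RegGu (S : FunSp Y) (y : Y) (G : Y → D.Gu γ) : Prop :=
  ∀ k, S.RegAt (fun y' => D.coordGu (G y') k) y

/-- Regularity of a map to `N̲`. -/
def RegNu (S : FunSp Y) (y : Y) (N : Y → D.Nu γ ρ) : Prop :=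
  ∀ k, S.RegAt (fun y' => D.coordNu (N y') k) y

theorem RegGu.val {G : Y → D.Gu γ} (h : RegGu S y G) (x : D.Iu) (s t : D.J γ x) :
    S.RegAt (fun y' => (G y' x).1 s t) y := h ⟨x, s, t, true⟩

theorem RegGu.inv_val {G : Y → D.Gu γ} (h : RegGu S y G) (x : D.Iu) (s t : D.J γ x) :
    S.RegAt (fun y' => (G y' x)⁻¹.1 s t) y := h ⟨x, s, t, false⟩

theorem RegGu.mk {G : Y → D.Gu γ} (h : ∀ x s t, S.RegAt (fun y' => (G y' x).1 s t) y)
    (h' : ∀ x s t, S.RegAt (fun y' => (G y' x)⁻¹.1 s t) y) : RegGu S y G := by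
  rintro ⟨x, s, t, b⟩
  cases b
  · exact h' x s t
  · exact h x s t

theorem RegGu.of_val (hS : S.Good) {G : Y → D.Gu γ} (h : ∀ x s t, S.RegAt (fun y' => (G y' x).1 s t) y) :
    RegGu S y G := by
  refine RegGu.mk h fun x s t => ?_
  simp only [Matrix.coe_units_inv]
  exact RegAt.matInv hS (h x) ((Matrix.isUnit_iff_isUnit_det _).mp (G y x).isUnit).ne_zero s t

theorem RegGu.mul {G G' : Y → D.Gu γ} (h : RegGu S y G) (h' : RegGu S y G') :
    RegGu S y fun y => G y * G' y := by
  refine RegGu.mk (fun x s t => ?_) (fun x s t => ?_)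
  · exact RegAt.matMul (M := fun y => (G y x).1) (N := fun y => (G' y x).1) (h.val x) (h'.val x) s t
  · have := RegAt.matMul (M := fun y => (G' y x)⁻¹.1) (N := fun y => (G y x)⁻¹.1) (h'.inv_val x)
      (h.inv_val x) s t
    simp only [← Units.val_mul, ← mul_inv_rev] at this
    exact this

theorem RegGu.inv {G : Y → D.Gu γ} (h : RegGu S y G) : RegGu S y fun y => (G y)⁻¹ := by
  refine RegGu.mk (fun x s t => h.inv_val x s t) (fun x s t => ?_)
  simp only [Pi.inv_apply, inv_inv]
  exact h.val x s t

theorem RegGu.const (g : D.Gu γ) : RegGu S y fun _ => g := fun _ => S.const _ _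

theorem RegNu.A {N : Y → D.Nu γ ρ} (h : RegNu S y N) (x : D.Iu) (s : D.J γ x) (t : D.J ρ x) :
    S.RegAt (fun y' => (N y').A x s t) y := h (Sum.inl ⟨x, s, t⟩)

theorem RegNu.B {N : Y → D.Nu γ ρ} (h : RegNu S y N) (e : D.Arru) (s : D.J γ e.1.2) (t : D.J γ e.1.1) :
    S.RegAt (fun y' => (N y').B e s t) y := h (Sum.inr ⟨e, s, t⟩)

theorem RegNu.mk {N : Y → D.Nu γ ρ} (hA : ∀ x s t, S.RegAt (fun y' => (N y').A x s t) y)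
    (hB : ∀ e s t, S.RegAt (fun y' => (N y').B e s t) y) : RegNu S y N := by
  rintro (⟨x, s, t⟩ | ⟨e, s, t⟩)
  · exact hA x s t
  · exact hB e s t

theorem RegNu.smul {G : Y → D.Gu γ} {N : Y → D.Nu γ ρ} (h : RegGu S y G) (h' : RegNu S y N) :
    RegNu S y fun y => G y • N y := by
  refine RegNu.mk (fun x s t => ?_) (fun e s t => ?_)
  · exact RegAt.matMul (M := fun y => (G y x).1) (N := fun y => (N y).A x) (h.val x) (h'.A x) s t
  · exact RegAt.matMul (M := fun y => (G y e.1.2).1 * (N y).B e) (N := fun y => (G y e.1.1)⁻¹.1)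
      (RegAt.matMul (h.val _) (h'.B e)) (h.inv_val _) s t

theorem regGu_GN (r : D.GN γ η ρ) : RegGu (D.funGN γ η ρ) r fun r => r.1 :=
  fun k => regAt_coord (fun r : D.GN γ η ρ => Sum.elim (D.coordGu r.1) (D.coordNu r.2.1)) (Sum.inl k) r

theorem regNu_GN (r : D.GN γ η ρ) : RegNu (D.funGN γ η ρ) r fun r => r.2.1 :=
  fun k => regAt_coord (fun r : D.GN γ η ρ => Sum.elim (D.coordGu r.1) (D.coordNu r.2.1)) (Sum.inr k) r

theorem isMorAt_to_GN (hS : S.Good) {f : Y → D.GN γ η ρ} (h : RegGu S y fun y => (f y).1)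
    (h' : RegNu S y fun y => (f y).2.1) : IsMorAt S (D.funGN γ η ρ) f y := by
  refine isMorAt_to_coord hS ?_
  rintro (k | k)
  · exact h k
  · exact h' k

theorem good_GN : (D.funGN γ η ρ).Good := good_coord _

theorem good_seqNu : (D.funSeqNu γ ρ).Good := good_coinduced _ fun _ => good_coord _

theorem good_X : (D.funX γ η ρ).Good := good_seqNu.induced _

theorem isMor_seqNu_snd : IsMor (D.funSeqNu γ ρ) (D.funNu γ ρ) Prod.snd := by
  refine isMor_from_coinduced (good_coord _) fun δ => isMor_to_coord (good_coord _) fun k f => ?_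
  exact regAt_coord (κ := (Σ (k : ℤ) (x : D.Iu), Fin (δ k x) × D.J γ x) ⊕ _)
      (fun f : D.Frames γ ρ δ => Sum.elim (fun c => f.1.1 c.1 c.2.1 c.2.2.1 c.2.2.2) (D.coordNu f.2))
      (Sum.inr k) f

theorem isMor_X_snd : IsMor (D.funX γ η ρ) (D.funNu γ ρ) (fun p => p.1.2) :=
  isMor_seqNu_snd.comp (isMor_induced _ _)

theorem regNu_X (p : D.X γ η ρ) : RegNu (D.funX γ η ρ) p fun p => p.1.2 := fun k =>
  isMor_X_snd.2 (fun n => D.coordNu n k) p (regAt_coord _ k _)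

end Regularity

/-! ### The projection to `𝒳` -/

/-- The map `G̲ × N_η^ρ → 𝒳_η^ρ`. -/
def qX (r : D.GN γ η ρ) : D.X γ η ρ :=
  ⟨(r.1 • D.stdFlag γ η, r.1 • r.2.1), isFlag_stdFlag.smul _, (isCompat_stdFlag_iff.mpr r.2.2).smul _⟩

theorem isMor_qX : IsMor (D.funGN γ η ρ) (D.funX γ η ρ) qX := by
  refine isMor_iff.2 fun r => isMorAt_to_induced good_GN ?_
  let en : ∀ k x, Fin (flagDim γ η k x) ≃ {s : D.J γ x // D.deg η x.1.1 s.1 ≤ k} := fun k x =>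
    (Finite.equivFin _).symm
  let fr : D.GN γ η ρ → D.Frames γ ρ (flagDim γ η) := fun r =>
    (⟨fun k x a t => (r.1 x).1 t (en k x a).1, fun k x =>
      (Matrix.linearIndependent_cols_of_isUnit (r.1 x).isUnit).comp (fun a => (en k x a).1)
        (Subtype.val_injective.comp (en k x).injective)⟩, r.1 • r.2.1)
  have h1 : ∀ r, (qX r).1 = ((fun k x => Submodule.span ℂ (Set.range ((fr r).1.1 k x))), (fr r).2) := by
    intro r
    refine Prod.ext (funext fun k => funext fun x => ?_) rfl
    refine (smul_stdFlag_eq_span r.1 k x).trans ?_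
    congr 1
    exact ((en k x).surjective.range_comp fun s : {s : D.J γ x // D.deg η x.1.1 s.1 ≤ k} =>
        fun t => (r.1 x).1 t s.1).symm
  simp only [h1]
  refine ((isMorAt_to_coinduced (ι := ℤ → D.Iu → ℕ) (X := D.Frames γ ρ)
    (fun _ f => (fun k x => Submodule.span ℂ (Set.range (f.1.1 k x)), f.2)) _ (flagDim γ η)).at
      (fr r)).comp ?_
  refine isMorAt_to_coord good_GN ?_
  rintro (⟨k, x, a, t⟩ | k)
  · exact (regGu_GN r).val x t _
  · exact RegNu.smul (regGu_GN r) (regNu_GN r) k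

theorem qX_surjective : Function.Surjective (qX : D.GN γ η ρ → D.X γ η ρ) := by
  rintro ⟨⟨F, n⟩, hF, hn⟩
  obtain ⟨g, rfl⟩ := IsFlag.exists_smul_stdFlag hF
  have h := hn.smul g⁻¹
  rw [inv_smul_smul] at h
  exact ⟨(g, ⟨g⁻¹ • n, isCompat_stdFlag_iff.mp h⟩), Subtype.ext (Prod.ext rfl (smul_inv_smul g n))⟩

theorem qX_eq_iff (hγ : D.IsEven γ) (hη : D.IsEvenFor γ η) (r r' : D.GN γ η ρ) :
    qX r = qX r' ↔ ∃ p : D.Pu γ η, D.relGN η p r r' := by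
  constructor
  · intro h
    have h1 : r.1 • D.stdFlag γ η = r'.1 • D.stdFlag γ η := congrArg (fun p : D.X γ η ρ => p.1.1) h
    have h2 : r.1 • r.2.1 = r'.1 • r'.2.1 := congrArg (fun p : D.X γ η ρ => p.1.2) h
    refine ⟨⟨r'.1⁻¹ * r.1, (mem_Pu_iff_stdFlag hγ hη).mpr ?_⟩, ?_, ?_⟩
    · rw [mul_smul, h1, inv_smul_smul]
    · simp
    · rw [mul_smul, h2, inv_smul_smul]
  · rintro ⟨p, h1, h2⟩
    have hp := (mem_Pu_iff_stdFlag hγ hη).mp p.2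
    refine Subtype.ext (Prod.ext ?_ ?_)
    · change r.1 • D.stdFlag γ η = r'.1 • D.stdFlag γ η
      rw [h1, mul_smul, inv_smul_eq_iff.mpr hp.symm]
    · change r.1 • r.2.1 = r'.1 • r'.2.1
      rw [h1, h2, mul_smul, inv_smul_smul]

/-! ### Local sections -/

section Sections

variable (η) (g₀ : D.Gu γ)

/-- The sequences of subspaces in general position to the opposite of the flag of `g₀`. -/
def bigCell (ρ : Cow D.l) : Set (D.Seq γ × D.Nu γ ρ) :=
  {p | ∀ (x : D.Iu) (s : D.J γ x),
    (∀ u ∈ p.1 (D.deg η x.1.1 s.1) x, (∀ t : {t : D.J γ x // D.deg η x.1.1 t.1 ≤ D.deg η x.1.1 s.1},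
      (g₀ x)⁻¹.1.mulVec u t.1 = 0) → u = 0) ∧
    ∀ w : {t : D.J γ x // D.deg η x.1.1 t.1 ≤ D.deg η x.1.1 s.1} → ℂ,
      ∃ u ∈ p.1 (D.deg η x.1.1 s.1) x, ∀ t, (g₀ x)⁻¹.1.mulVec u t.1 = w t}

variable {η g₀}

/-- The matrix of the projection to the first coordinates, in terms of a frame. -/
def frameMat (η : Cow D.a) (g₀ : D.Gu γ) {δ : ℤ → D.Iu → ℕ} (x : D.Iu) (s : D.J γ x)
    (f : D.Frames γ ρ δ) :
    Matrix {t : D.J γ x // D.deg η x.1.1 t.1 ≤ D.deg η x.1.1 s.1} (Fin (δ (D.deg η x.1.1 s.1) x)) ℂ :=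
  Matrix.of fun t a => (g₀ x)⁻¹.1.mulVec (f.1.1 (D.deg η x.1.1 s.1) x a) t.1

theorem frameMat_mulVec {δ : ℤ → D.Iu → ℕ} (x : D.Iu) (s : D.J γ x) (f : D.Frames γ ρ δ)
    (c : Fin (δ (D.deg η x.1.1 s.1) x) → ℂ) (t) :
    (frameMat η g₀ x s f).mulVec c t =
      (g₀ x)⁻¹.1.mulVec (∑ a, c a • f.1.1 (D.deg η x.1.1 s.1) x a) t.1 := by
  change ∑ a, frameMat η g₀ x s f t a * c a = _
  rw [Matrix.mulVec_sum, Finset.sum_apply]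
  refine Finset.sum_congr rfl fun a _ => ?_
  rw [Matrix.mulVec_smul, Pi.smul_apply, smul_eq_mul, mul_comm]
  rfl

/-- The coordinates on frames. -/
abbrev coordFr {δ : ℤ → D.Iu → ℕ} (f : D.Frames γ ρ δ) :
    (Σ (k : ℤ) (x : D.Iu), Fin (δ k x) × D.J γ x) ⊕
      ((Σ x, D.J γ x × D.J ρ x) ⊕ (Σ e : D.Arru, D.J γ e.1.2 × D.J γ e.1.1)) → ℂ :=
  Sum.elim (fun c => f.1.1 c.1 c.2.1 c.2.2.1 c.2.2.2) (D.coordNu f.2)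

/-- The sequence of subspaces spanned by a frame. -/
abbrev spanFr (ρ : Cow D.l) (δ : ℤ → D.Iu → ℕ) (f : D.Frames γ ρ δ) : D.Seq γ × D.Nu γ ρ :=
  (fun k x => Submodule.span ℂ (Set.range (f.1.1 k x)), f.2)

theorem frameMat_regAt {δ : ℤ → D.Iu → ℕ} (x : D.Iu) (s : D.J γ x) (f : D.Frames γ ρ δ) (t a) :
    (coord coordFr).RegAt (fun f : D.Frames γ ρ δ => frameMat η g₀ x s f t a) f :=
  RegAt.mulVec (M := fun _ => (g₀ x)⁻¹.1) (v := fun f : D.Frames γ ρ δ => f.1.1 _ x a)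
    (fun _ _ => FunSp.const _ _ _) (fun j => regAt_coord coordFr (Sum.inl ⟨_, x, a, j⟩) f) t.1

theorem mem_bigCell_spanFr {δ : ℤ → D.Iu → ℕ} (f : D.Frames γ ρ δ) :
    spanFr ρ δ f ∈ bigCell η g₀ ρ ↔ ∀ x s,
      (∀ c, (frameMat η g₀ x s f).mulVec c = 0 → c = 0) ∧
      ∀ w, ∃ c, (frameMat η g₀ x s f).mulVec c = w := by
  refine forall_congr' fun x => forall_congr' fun s => and_congr ⟨fun h c hc => ?_, fun h u hu hu0 => ?_⟩
    (forall_congr' fun w => ⟨?_, ?_⟩)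
  · have h1 := h _ (Submodule.mem_span_range_iff_exists_fun ℂ |>.mpr ⟨c, rfl⟩) fun t => by
      rw [← frameMat_mulVec, hc]
      rfl
    exact funext fun a => (Fintype.linearIndependent_iff.mp (f.1.2 _ x)) c h1 a
  · obtain ⟨c, rfl⟩ := (Submodule.mem_span_range_iff_exists_fun ℂ).mp hu
    rw [h c (funext fun t => by rw [frameMat_mulVec]; exact hu0 t)]
    simp
  · rintro ⟨u, hu, h⟩
    obtain ⟨c, rfl⟩ := (Submodule.mem_span_range_iff_exists_fun ℂ).mp hu
    exact ⟨c, funext fun t => by rw [frameMat_mulVec]; exact h t⟩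
  · rintro ⟨c, rfl⟩
    exact ⟨_, (Submodule.mem_span_range_iff_exists_fun ℂ).mpr ⟨c, rfl⟩, fun t => (frameMat_mulVec x s f c t).symm⟩

theorem isOpen_bigCell : IsOpen[(D.funSeqNu γ ρ).top] (bigCell η g₀ ρ) := by
  refine (isOpen_coinduced _ _).2 fun δ => ?_
  have h : spanFr ρ δ ⁻¹' bigCell η g₀ ρ = ⋂ (x : D.Iu) (s : D.J γ x), {f |
      (∀ c, (frameMat η g₀ x s f).mulVec c = 0 → c = 0) ∧
      ∀ w, ∃ c, (frameMat η g₀ x s f).mulVec c = w} := by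
    ext f
    simp only [Set.mem_iInter]
    exact mem_bigCell_spanFr f
  change IsOpen[(coord coordFr).top] (spanFr ρ δ ⁻¹' bigCell η g₀ ρ)
  rw [h]
  refine @isOpen_iInter_of_finite _ _ (coord coordFr).top _ _ fun x =>
    @isOpen_iInter_of_finite _ _ (coord coordFr).top _ _ fun s => ?_
  rw [isOpen_iff_nhds]
  rintro f ⟨h1, h2⟩
  obtain ⟨U, hU, hf, hU'⟩ := injective_nhds (good_coord coordFr)
    (M := fun f : D.Frames γ ρ δ => frameMat η g₀ x s f) (frameMat_regAt x s f) h1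
  obtain ⟨V, hV, hfV, hV'⟩ := surjective_nhds (good_coord coordFr)
    (M := fun f : D.Frames γ ρ δ => frameMat η g₀ x s f) (frameMat_regAt x s f) h2
  exact ⟨U ∩ V, @IsOpen.inter _ (coord coordFr).top _ _ hU hV, ⟨hf, hfV⟩, fun f' hf' =>
    ⟨hU' f' hf'.1, hV' f' hf'.2⟩⟩

/-- The columns of the local section. -/
theorem exists_col (η : Cow D.a) (g₀ : D.Gu γ) (ρ : Cow D.l) :
    ∃ col : D.Seq γ × D.Nu γ ρ → ∀ x : D.Iu, D.J γ x → D.J γ x → ℂ,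
    ∀ p ∈ bigCell η g₀ ρ, ∀ x s, col p x s ∈ p.1 (D.deg η x.1.1 s.1) x ∧
      ∀ t, D.deg η x.1.1 t.1 ≤ D.deg η x.1.1 s.1 →
        (g₀ x)⁻¹.1.mulVec (col p x s) t = if t = s then 1 else 0 := by
  have : ∀ p : D.Seq γ × D.Nu γ ρ, ∃ c : ∀ x : D.Iu, D.J γ x → D.J γ x → ℂ, p ∈ bigCell η g₀ ρ →
      ∀ x s, c x s ∈ p.1 (D.deg η x.1.1 s.1) x ∧ ∀ t, D.deg η x.1.1 t.1 ≤ D.deg η x.1.1 s.1 →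
        (g₀ x)⁻¹.1.mulVec (c x s) t = if t = s then 1 else 0 := by
    intro p
    by_cases hp : p ∈ bigCell η g₀ ρ
    · choose c hc hc' using fun x s => (hp x s).2 fun t => if t.1 = s then 1 else 0
      exact ⟨c, fun _ x s => ⟨hc x s, fun t ht => hc' x s ⟨t, ht⟩⟩⟩
    · exact ⟨fun _ _ _ => 0, fun h => absurd h hp⟩
  choose c hc using this
  exact ⟨c, hc⟩

theorem col_regAt {col : D.Seq γ × D.Nu γ ρ → ∀ x : D.Iu, D.J γ x → D.J γ x → ℂ}
    (hcol : ∀ p ∈ bigCell η g₀ ρ, ∀ x s, col p x s ∈ p.1 (D.deg η x.1.1 s.1) x ∧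
      ∀ t, D.deg η x.1.1 t.1 ≤ D.deg η x.1.1 s.1 →
        (g₀ x)⁻¹.1.mulVec (col p x s) t = if t = s then 1 else 0)
    (x : D.Iu) (s t : D.J γ x) {p : D.Seq γ × D.Nu γ ρ} (hp : p ∈ bigCell η g₀ ρ) :
    (D.funSeqNu γ ρ).RegAt (fun p => col p x s t) p := by
  classical
  refine regAt_coinduced isOpen_bigCell (fun δ f hf => ?_) hp
  change spanFr ρ δ f ∈ bigCell η g₀ ρ at hf
  change (coord coordFr).RegAt (fun f => col (spanFr ρ δ f) x s t) f
  have hopen : IsOpen[(coord (coordFr (ρ := ρ) (γ := γ) (δ := δ))).top] (spanFr ρ δ ⁻¹' bigCell η g₀ ρ) :=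
    (isOpen_coinduced _ _).1 isOpen_bigCell δ
  have hex : ∀ f : D.Frames γ ρ δ, ∃ c : Fin (δ (D.deg η x.1.1 s.1) x) → ℂ,
      spanFr ρ δ f ∈ bigCell η g₀ ρ →
        ∑ a, c a • f.1.1 (D.deg η x.1.1 s.1) x a = col (spanFr ρ δ f) x s := by
    intro f
    by_cases hf : spanFr ρ δ f ∈ bigCell η g₀ ρ
    · obtain ⟨c, hc⟩ := (Submodule.mem_span_range_iff_exists_fun ℂ).mp (hcol _ hf x s).1
      exact ⟨c, fun _ => hc⟩
    · exact ⟨0, fun h => absurd h hf⟩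
  choose c hc using hex
  have hreg : ∀ a, (coord coordFr).RegAt (fun f : D.Frames γ ρ δ => c f a) f := by
    refine solution_regAt (good_coord coordFr) (M := fun f : D.Frames γ ρ δ => frameMat η g₀ x s f)
      (frameMat_regAt x s f) ((mem_bigCell_spanFr f).mp hf x s).1
      (b := fun _ t => if t.1 = s then 1 else 0) (fun _ => FunSp.const _ _ _) hopen hf fun f' hf' => ?_
    funext t
    rw [frameMat_mulVec, hc f' hf']
    exact (hcol _ hf' x s).2 t.1 t.2
  refine (good_coord coordFr).loc _ hopen hf (f := fun f' => ∑ a, c f' a * f'.1.1 _ x a t)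
    (fun f' hf' => ?_) (RegAt.sum _ fun a _ => FunSp.mul _ (hreg a)
      (regAt_coord coordFr (Sum.inl ⟨_, x, a, t⟩) f))
  rw [← hc f' hf', Finset.sum_apply]
  rfl

end Sections

/-- Local sections of the projection to `𝒳_η^ρ`. -/
theorem hasSections_qX : HasSections (D.funGN γ η ρ) (D.funX γ η ρ) qX := by
  classical
  intro y₀
  obtain ⟨r₀, rfl⟩ := qX_surjective y₀
  obtain ⟨col, hcol⟩ := exists_col η r₀.1 ρ
  have hex : ∀ y : D.X γ η ρ, ∃ r : D.GN γ η ρ, qX r = y ∧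
      (y.1 ∈ bigCell η r₀.1 ρ → ∀ x s t, (r.1 x).1 t s = col y.1 x s t) := by
    intro y
    by_cases hy : y.1 ∈ bigCell η r₀.1 ρ
    · have hc := hcol y.1 hy
      have hunit : ∀ x, IsUnit (Matrix.of fun t s => col y.1 x s t) := by
        intro x
        have h1 : ∀ v : D.J γ x → ℂ, (Matrix.of fun t s => col y.1 x s t).mulVec v = 0 → v = 0 := by
          intro v hv
          by_contra hne
          obtain ⟨t₀, ht₀⟩ := Function.ne_iff.mp hne
          obtain ⟨t, ht, hmin⟩ := Finset.exists_min_image (Finset.univ.filter fun t => v t ≠ 0)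
            (fun t => D.deg η x.1.1 t.1) ⟨t₀, by simpa using ht₀⟩
          simp only [Finset.mem_filter, Finset.mem_univ, true_and] at ht hmin
          have h2 : (Matrix.of fun t s => col y.1 x s t).mulVec v = ∑ s, v s • col y.1 x s := by
            funext t
            rw [Finset.sum_apply]
            change ∑ s, col y.1 x s t * v s = ∑ s, v s * col y.1 x s t
            exact Finset.sum_congr rfl fun s _ => mul_comm (col y.1 x s t) (v s)
          have h3 := congrArg (fun u => (r₀.1 x)⁻¹.1.mulVec u t) (h2.symm.trans hv)
          simp only [Matrix.mulVec_sum, Matrix.mulVec_smul, Finset.sum_apply, Pi.smul_apply,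
            Matrix.mulVec_zero, Pi.zero_apply, smul_eq_mul] at h3
          rw [Finset.sum_eq_single t] at h3
          · rw [(hc x t).2 t le_rfl, if_pos rfl, mul_one] at h3
            exact ht h3
          · intro s _ hst
            by_cases hs : v s = 0
            · rw [hs, zero_mul]
            · rw [(hc x s).2 t (hmin s hs), if_neg hst.symm, mul_zero]
          · simp
        refine Matrix.mulVec_injective_iff_isUnit.mp fun v w hvw => ?_
        exact sub_eq_zero.mp (h1 _ (by rw [Matrix.mulVec_sub, hvw, sub_self]))
      have hg := IsFlag.smul_stdFlag_eq y.2.1 (g := fun x => (hunit x).unit) fun x s => (hc x s).1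
      generalize hgdef : (fun x => (hunit x).unit) = g at hg
      have hn := y.2.2.smul g⁻¹
      rw [← hg, inv_smul_smul] at hn
      refine ⟨(g, ⟨g⁻¹ • y.1.2, isCompat_stdFlag_iff.mp hn⟩),
        Subtype.ext (Prod.ext hg (smul_inv_smul g _)), fun _ x s t => ?_⟩
      change (g x).1 t s = _
      rw [← hgdef]
      rfl
    · obtain ⟨r, hr⟩ := qX_surjective y
      exact ⟨r, hr, fun h => absurd h hy⟩
  choose σ hσ hσ' using hex
  refine ⟨Subtype.val ⁻¹' bigCell η r₀.1 ρ, σ, isOpen_induced _ _ isOpen_bigCell, ?_, fun y hy =>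
    ⟨hσ y, ?_⟩⟩
  · intro x s
    have h0 : ∀ u, u ∈ (r₀.1 • D.stdFlag γ η) (D.deg η x.1.1 s.1) x ↔
        (r₀.1 x)⁻¹.1.mulVec u ∈ D.stdFlag γ η (D.deg η x.1.1 s.1) x := by
      intro u
      constructor
      · rintro ⟨v, hv, rfl⟩
        rw [Matrix.mulVecLin_apply, Matrix.mulVec_mulVec, Units.inv_mul, Matrix.one_mulVec]
        exact hv
      · intro hu
        refine ⟨_, hu, ?_⟩
        rw [Matrix.mulVecLin_apply, Matrix.mulVec_mulVec, Units.mul_inv, Matrix.one_mulVec]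
    constructor
    · intro u hu h
      have h1 := (h0 u).mp hu
      have h2 : (r₀.1 x)⁻¹.1.mulVec u = 0 := by
        funext t
        by_contra hne
        exact hne (h ⟨t, h1 t hne⟩)
      have h3 := congrArg ((r₀.1 x).1.mulVec) h2
      rwa [Matrix.mulVec_mulVec, Units.mul_inv, Matrix.one_mulVec, Matrix.mulVec_zero] at h3
    · intro w
      refine ⟨(r₀.1 x).1.mulVec fun t => if h : D.deg η x.1.1 t.1 ≤ D.deg η x.1.1 s.1 then w ⟨t, h⟩ else 0,
        (h0 _).mpr ?_, fun t => ?_⟩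
      · rw [Matrix.mulVec_mulVec, Units.inv_mul, Matrix.one_mulVec]
        intro t ht
        by_contra hc
        exact ht (dif_neg hc)
      · rw [Matrix.mulVec_mulVec, Units.inv_mul, Matrix.one_mulVec]
        exact dif_pos t.2
  · have hopen : IsOpen[(D.funX γ η ρ).top] (Subtype.val ⁻¹' bigCell η r₀.1 ρ) :=
      isOpen_induced _ _ isOpen_bigCell
    have h1 : RegGu (D.funX γ η ρ) y fun y => (σ y).1 := by
      refine RegGu.of_val good_X fun x t s => ?_
      refine good_X.loc _ hopen hy (f := fun y => col y.1 x s t) (fun y' hy' => ?_)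
        ((isMor_induced _ _).2 _ y (col_regAt hcol x s t hy))
      exact (hσ' y' hy' x s t).symm
    refine isMorAt_to_GN good_X h1 ?_
    have h2 : ∀ y, (σ y).2.1 = (σ y).1⁻¹ • y.1.2 := fun y => by
      have h3 : (σ y).1 • (σ y).2.1 = y.1.2 := congrArg (fun p : D.X γ η ρ => p.1.2) (hσ y)
      rw [← h3, inv_smul_smul]
    simp only [h2]
    exact RegNu.smul h1.inv (regNu_X y)

/-! ### The isomorphism of `G̲ ×_{P̲_η} N_η^ρ` with `𝒳_η^ρ` -/

theorem qX_val (r : D.GN γ η ρ) : (qX r).1 = (r.1 • D.stdFlag γ η, r.1 • r.2.1) := rfl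

theorem tU_smul_stdFlag (τ : ℂˣ) : D.tU γ τ • D.stdFlag γ η = D.stdFlag γ η := by
  have key : ∀ (τ : ℂˣ) k x, ∀ v ∈ D.stdFlag γ η k x,
      (D.tU γ τ x).1.mulVec v ∈ D.stdFlag γ η k x := by
    intro τ k x v hv s hs
    refine hv s fun h => hs ?_
    change (Matrix.diagonal (fun s : D.J γ x => ((τ ^ (- D.wt γ x.1.1 s.1) : ℂˣ) : ℂ))).mulVec v s = 0
    rw [Matrix.mulVec_diagonal, h, mul_zero]
  funext k x
  apply le_antisymm
  · rintro _ ⟨v, hv, rfl⟩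
    exact key τ k x v hv
  · intro v hv
    refine ⟨_, key τ⁻¹ k x v hv, ?_⟩
    rw [Matrix.mulVecLin_apply, Matrix.mulVec_mulVec, map_inv]
    change ((D.tU γ τ x).1 * (D.tU γ τ x)⁻¹.1).mulVec v = v
    rw [Units.mul_inv, Matrix.one_mulVec]

theorem smul_mem_Nη (hγ : D.IsEven γ) (hη : D.IsEvenFor γ η) {p : D.Gu γ} (hp : p ∈ D.Pu γ η)
    {n : D.Nu γ ρ} (hn : n ∈ D.Nη γ η ρ) : p • n ∈ D.Nη γ η ρ := by
  have h := (isCompat_stdFlag_iff.mpr hn).smul p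
  rw [(mem_Pu_iff_stdFlag hγ hη).mp hp] at h
  exact isCompat_stdFlag_iff.mp h

theorem gut_smul_mem_Nη (hγ : D.IsEven γ) {y : D.Gut γ} (hy : y.left ∈ D.Pu γ γ)
    {n : D.Nu γ ρ} (hn : n ∈ D.Nη γ γ ρ) : y • n ∈ D.Nη γ γ ρ := by
  change (y.left * D.tU γ y.right) • D.wAct y.right n ∈ _
  refine smul_mem_Nη hγ (isEvenFor_self hγ) (mul_mem hy ?_) (D.wAct_mem_Nη _ hn)
  exact (mem_Pu_iff_stdFlag hγ (isEvenFor_self hγ)).mpr (tU_smul_stdFlag _)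

/-- The bijection of `G̲ ×_{P̲_η} N_η^ρ` with `𝒳_η^ρ`. -/
def eX (hγ : D.IsEven γ) (hη : D.IsEvenFor γ η) (ρ : Cow D.l) : D.IndVar γ η ρ ≃ D.X γ η ρ :=
  Equiv.ofBijective (Quot.lift qX fun r r' h => (qX_eq_iff hγ hη r r').mpr h) (by
    constructor
    · intro t t'
      induction t using Quot.ind
      induction t' using Quot.ind
      exact fun h => Quot.sound ((qX_eq_iff hγ hη _ _).mp h)
    · intro y
      obtain ⟨r, rfl⟩ := qX_surjective y
      exact ⟨Quot.mk _ r, rfl⟩)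

theorem eX_mk (hγ : D.IsEven γ) (hη : D.IsEvenFor γ η) (r : D.GN γ η ρ) :
    eX hγ hη ρ (Quot.mk _ r) = qX r := rfl

theorem isIso_eX (hγ : D.IsEven γ) (hη : D.IsEvenFor γ η) :
    IsIso (D.funIndVar γ η ρ) (D.funX γ η ρ) (eX hγ hη ρ) := by
  refine ⟨isMor_from_coinduced good_X fun _ => isMor_qX, ?_⟩
  refine hasSections_qX.isMor_desc good_X (isMor_quotient _ _) fun r => ?_
  rw [Equiv.symm_apply_eq]
  rfl

theorem smul_qX (y : D.Gut γ) (r : D.GN γ η ρ) :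
    y • qX r = qX (y.left * D.tU γ y.right * r.1, ⟨D.wAct y.right r.2.1, D.wAct_mem_Nη _ r.2.2⟩) := by
  refine Subtype.ext (Prod.ext ?_ ?_)
  · change (y.left * D.tU γ y.right) • r.1 • D.stdFlag γ η = _ • D.stdFlag γ η
    rw [← mul_smul]
  · change (y.left * D.tU γ y.right) • D.wAct y.right (r.1 • r.2.1) = _ • D.wAct y.right r.2.1
    rw [wAct_smul, ← mul_smul]

theorem eX_smul (hγ : D.IsEven γ) (hη : D.IsEvenFor γ η) (y : D.Gut γ) (t : D.IndVar γ η ρ) :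
    eX hγ hη ρ (y • t) = y • eX hγ hη ρ t := by
  induction t using Quot.ind with
  | mk r => exact (smul_qX y r).symm

theorem inclPu_smul_qX (h : D.Pu γ γ) (r : D.GN γ η ρ) : h • qX r = qX (h.1 * r.1, r.2) := by
  refine (smul_qX (D.inclPu γ γ h) r).trans (congrArg qX (Prod.ext ?_ (Subtype.ext (D.wAct_one _))))
  change h.1 * D.tU γ 1 * r.1 = _
  rw [map_one, mul_one]

theorem isMorAt_to_Pu {Y : Type} {S : FunSp Y} (hS : S.Good) {f : Y → D.Pu γ η} {y : Y}
    (h : RegGu S y fun y => (f y).1) : IsMorAt S (D.funPu γ η) f y :=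
  isMorAt_to_coord hS h

theorem regGu_Pu (p : D.Pu γ η) : RegGu (D.funPu γ η) p fun p => p.1 := fun k =>
  regAt_coord (fun p : D.Pu γ η => D.coordGu p.1) k p

/-- The action of `P̲_η` on `G̲ × N_η^ρ`. -/
def kaX (hγ : D.IsEven γ) (hη : D.IsEvenFor γ η) (p : D.Pu γ η) (r : D.GN γ η ρ) : D.GN γ η ρ :=
  (r.1 * p.1⁻¹, ⟨p.1 • r.2.1, smul_mem_Nη hγ hη p.2 r.2.2⟩)

theorem relGN_iff (hγ : D.IsEven γ) (hη : D.IsEvenFor γ η) (p : D.Pu γ η) (r r' : D.GN γ η ρ) :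
    D.relGN η p r r' ↔ r' = kaX hγ hη p r :=
  ⟨fun h => Prod.ext h.1 (Subtype.ext h.2), fun h => by rw [h]; exact ⟨rfl, rfl⟩⟩

/-- `G̲ × N_η^ρ` as a principal bundle over `𝒳_η^ρ`. -/
def bundleX (hγ : D.IsEven γ) (hη : D.IsEvenFor γ η) (ρ : Cow D.l) :
    Bundle (D.funPu γ η) (D.funPu γ γ) (D.funX γ η ρ)
      (fun r : D.GN γ η ρ => Sum.elim (D.coordGu r.1) (D.coordNu r.2.1)) where
  q := qX
  ka := kaX hγ hη
  ha h r := (h.1 * r.1, r.2)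
  q_mor := isMor_qX
  q_ka k r := ((qX_eq_iff hγ hη _ _).mpr ⟨k, (relGN_iff hγ hη _ _ _).mpr rfl⟩).symm
  q_ha h r := (inclPu_smul_qX h r).symm
  ka_ha k h r := Prod.ext (mul_assoc _ _ _) rfl
  ka_mul k k' r := by
    refine Prod.ext ?_ (Subtype.ext (mul_smul k.1 k'.1 r.2.1))
    change r.1 * (k.1 * k'.1)⁻¹ = r.1 * k'.1⁻¹ * k.1⁻¹
    rw [mul_inv_rev, mul_assoc]
  ha_one r := Prod.ext (one_mul _) rfl
  ha_mul h h' r := Prod.ext (mul_assoc _ _ _) rfl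
  free k k' r h := by
    have h1 : r.1 * k.1⁻¹ = r.1 * k'.1⁻¹ := congrArg Prod.fst h
    exact Subtype.ext (inv_injective (mul_left_cancel h1))
  triv y := by
    classical
    obtain ⟨U, σ, hU, hy, hσ⟩ := hasSections_qX y
    have hex : ∀ r : D.GN γ η ρ, ∃ p : D.Pu γ η, qX r ∈ U → r = kaX hγ hη p (σ (qX r)) := by
      intro r
      by_cases hr : qX r ∈ U
      · obtain ⟨p, hp⟩ := (qX_eq_iff hγ hη _ _).mp (hσ _ hr).1
        exact ⟨p, fun _ => (relGN_iff hγ hη _ _ _).mp hp⟩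
      · exact ⟨1, fun h => absurd h hr⟩
    choose κ hκ using hex
    refine ⟨⟨U, hU⟩, σ, κ, hy, hσ, fun r hr => ⟨(hκ r hr).symm, ?_⟩⟩
    refine isMorAt_to_Pu (good_coord _) fun k => ?_
    have h1 : RegGu (D.funGN γ η ρ) r fun r => (σ (qX r)).1 := fun k =>
      (((hσ _ hr).2.comp (isMor_qX.at r)).2 (fun r : D.GN γ η ρ => D.coordGu r.1 k) (regGu_GN _ k))
    refine good_GN.loc (qX ⁻¹' U) (isMor_qX.1 U hU) hr (fun r' hr' => ?_)
      (((regGu_GN r).inv.mul h1) k)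
    have h2 : r'.1 = (σ (qX r')).1 * (κ r').1⁻¹ := congrArg Prod.fst (hκ r' hr')
    have h3 : r'.1⁻¹ * (σ (qX r')).1 = (κ r').1 := by
      rw [inv_mul_eq_iff_eq_mul]
      exact (eq_mul_inv_iff_mul_eq.mp h2).symm
    beta_reduce
    rw [h3]
  ha_reg := by
    have key : ∀ (k : Σ x, D.J γ x × D.J γ x × Bool),
        BiReg (D.funPu γ γ) (D.funGN γ η ρ) fun h r => D.coordGu (h⁻¹.1 * r.1) k := by
      rintro ⟨x, s, t, b⟩
      cases b
      · refine BiReg.of_fintype (ι := D.J γ x) (fun u h => (h.1 x).1 u t) (fun u r => (r.1 x)⁻¹.1 s u)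
          (fun u h => (regGu_Pu h).val x u t) (fun u r => (regGu_GN r).inv_val x s u) fun h r => ?_
        change ((h.1 x)⁻¹ * r.1 x)⁻¹.1 s t = _
        rw [mul_inv_rev, inv_inv, Units.val_mul, Matrix.mul_apply]
        exact Finset.sum_congr rfl fun u _ => mul_comm _ _
      · refine BiReg.of_fintype (ι := D.J γ x) (fun u h => (h.1 x)⁻¹.1 s u) (fun u r => (r.1 x).1 u t)
          (fun u h => (regGu_Pu h).inv_val x s u) (fun u r => (regGu_GN r).val x u t) fun h r => ?_
        rfl
    rintro (k | k)
    · exact key k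
    · exact BiReg.of_fintype (ι := Unit) (fun _ _ => 1) (fun _ r => D.coordNu r.2.1 k)
        (fun _ _ => FunSp.const _ _ _) (fun _ r => regNu_GN r k) fun h r => by
          simp

theorem isIndX_iff (hγ : D.IsEven γ) (hη : D.IsEvenFor γ η) (V : RatRep (D.funPu γ η))
    (F : EqSheaf (D.funPu γ γ) (D.funX γ η ρ)) :
    D.IsIndX γ η ρ (eX hγ hη ρ) V F ↔ IsInduced (D.funGN γ η ρ) (bundleX hγ hη ρ).q
      (fun k p p' => p' = (bundleX hγ hη ρ).ka k p) (fun h p p' => p' = (bundleX hγ hη ρ).ha h p) V F := by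
  have h1 : D.relGN η = fun (k : D.Pu γ η) (p p' : D.GN γ η ρ) => p' = (bundleX hγ hη ρ).ka k p :=
    funext fun k => funext fun p => funext fun p' => propext (relGN_iff hγ hη k p p')
  have h2 : (fun (h : D.Pu γ γ) (r q : D.GN γ η ρ) => q.1 = h.1 * r.1 ∧ q.2 = r.2) =
      fun h p p' => p' = (bundleX hγ hη ρ).ha h p :=
    funext fun k => funext fun p => funext fun p' => propext
      ⟨fun h => Prod.ext h.1 h.2, fun h => by rw [h]; exact ⟨rfl, rfl⟩⟩
  change IsInduced (D.funGN γ η ρ) (bundleX hγ hη ρ).q (D.relGN η) _ V F ↔ _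
  rw [h1, h2]

end Datum

end FixedLocus
end

open scoped Topology
noncomputable section
namespace FixedLocus
open FunSp

variable {I : Type} [Fintype I] [DecidableEq I]

theorem exists_nat_bound {ι : Type} [Finite ι] (f : ι → ℤ) : ∃ N : ℕ, ∀ a, f a ≤ N := by
  obtain ⟨B, hB⟩ := (Set.finite_range f).bddAbove
  exact ⟨B.toNat, fun a => (hB ⟨a, rfl⟩).trans (Int.self_le_toNat B)⟩

namespace Datum

variable {D : Datum I} {γ η : Cow D.a} {ρ : Cow D.l}

/-! ### Regularity of maps to `G_K` and `N_K` -/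

section Regularity

variable {Y : Type} {S : FunSp Y} {y : Y}

/-- Regularity of a map to `G_K`. -/
def RegGK (S : FunSp Y) (y : Y) (G : Y → D.GK) : Prop :=
  ∀ k, S.RegAt (fun y' => D.coordGK (G y') k) y

/-- Regularity of a map to `N_K`. -/
def RegNK (S : FunSp Y) (y : Y) (N : Y → D.NK) : Prop :=
  ∀ k, S.RegAt (fun y' => D.coordNK (N y') k) y

theorem RegGK.val {G : Y → D.GK} (h : RegGK S y G) (i : I) (s t : Fin (D.a i)) (k : ℤ) :
    S.RegAt (fun y' => ((G y' i).1 s t).coeff k) y := h ⟨i, s, t, k, true⟩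

theorem RegGK.inv_val {G : Y → D.GK} (h : RegGK S y G) (i : I) (s t : Fin (D.a i)) (k : ℤ) :
    S.RegAt (fun y' => ((G y' i)⁻¹.1 s t).coeff k) y := h ⟨i, s, t, k, false⟩

theorem RegGK.mk {G : Y → D.GK} (h : ∀ i s t k, S.RegAt (fun y' => ((G y' i).1 s t).coeff k) y)
    (h' : ∀ i s t k, S.RegAt (fun y' => ((G y' i)⁻¹.1 s t).coeff k) y) : RegGK S y G := by
  rintro ⟨i, s, t, k, b⟩
  cases b
  · exact h' i s t k
  · exact h i s t k

theorem RegGK.inv {G : Y → D.GK} (h : RegGK S y G) : RegGK S y fun y => (G y)⁻¹ := by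
  refine RegGK.mk (fun i s t k => h.inv_val i s t k) (fun i s t k => ?_)
  simp only [Pi.inv_apply, inv_inv]
  exact h.val i s t k

theorem RegGK.const (g : D.GK) : RegGK S y fun _ => g := fun _ => S.const _ _

theorem coeff_matMul_regAt {l m n : Type} [Fintype m] {M : Y → Matrix l m LS} {M' : Y → Matrix m n LS}
    {N N' : ℕ} (hM : ∀ y a b, IsBdd N (M y a b)) (hM' : ∀ y a b, IsBdd N' (M' y a b))
    (h : ∀ a b k, S.RegAt (fun y => (M y a b).coeff k) y)
    (h' : ∀ a b k, S.RegAt (fun y => (M' y a b).coeff k) y) (a : l) (b : n) (k : ℤ) :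
    S.RegAt (fun y => ((M y * M' y) a b).coeff k) y := by
  have : (fun y => ((M y * M' y) a b).coeff k) = fun y => ∑ c,
      ∑ r ∈ Finset.Icc (-(N : ℤ)) (k + N'), (M y a c).coeff r * (M' y c b).coeff (k - r) := by
    funext y
    rw [Matrix.mul_apply, HahnSeries.coeff_sum]
    exact Finset.sum_congr rfl fun c _ => coeff_mul_Icc (hM y a c) (hM' y c b) k
  rw [this]
  exact RegAt.sum _ fun c _ => RegAt.sum _ fun r _ => S.mul (h a c r) (h' c b (k - r))

theorem coeff_mulVec_regAt {l m : Type} [Fintype m] {M : Y → Matrix l m LS} {v : Y → m → LS}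
    {N N' : ℕ} (hM : ∀ y a b, IsBdd N (M y a b)) (hv : ∀ y b, IsBdd N' (v y b))
    (h : ∀ a b k, S.RegAt (fun y => (M y a b).coeff k) y)
    (h' : ∀ b k, S.RegAt (fun y => (v y b).coeff k) y) (a : l) (k : ℤ) :
    S.RegAt (fun y => ((M y).mulVec (v y) a).coeff k) y :=
  coeff_matMul_regAt (n := Unit) (M' := fun y => Matrix.of fun b _ => v y b) hM (fun y b _ => hv y b) h
    (fun b _ => h' b) a () k

theorem RegGK.mul {G G' : Y → D.GK} {N N' : ℕ} (hN : ∀ y, G y ∈ D.GKbdd N)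
    (hN' : ∀ y, G' y ∈ D.GKbdd N') (h : RegGK S y G) (h' : RegGK S y G') :
    RegGK S y fun y => G y * G' y := by
  refine RegGK.mk (fun i => ?_) (fun i s t k => ?_)
  · exact coeff_matMul_regAt (M := fun y => (G y i).1) (M' := fun y => (G' y i).1)
      (fun y a b => (hN y i a b).1) (fun y a b => (hN' y i a b).1) (h.val i) (h'.val i)
  · have := coeff_matMul_regAt (M := fun y => (G' y i)⁻¹.1) (M' := fun y => (G y i)⁻¹.1)
      (fun y a b => (hN' y i a b).2) (fun y a b => (hN y i a b).2) (h'.inv_val i) (h.inv_val i) s t k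
    simp only [← Units.val_mul, ← mul_inv_rev] at this
    exact this

theorem blk_regAt {n n' : I → ℕ} {γ : Cow n} {γ' : Cow n'} (hγ : D.IsEven γ)
    {M : Y → ∀ x, Matrix (D.J γ x) (D.J γ' x) ℂ} (h : ∀ x s t, S.RegAt (fun y => M y x s t) y)
    (i : I) (s : Fin (n i)) (t : Fin (n' i)) : S.RegAt (fun y => blk hγ γ' (M y) i s t) y := by
  classical
  by_cases hst : D.wt γ' i t ≡ D.rep i (D.wt γ i s) [ZMOD 2 * D.d i]
  · have : (fun y => blk hγ γ' (M y) i s t) = fun y => M y (blockOf hγ i s) (inBlock hγ i s) ⟨t, hst⟩ :=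
      funext fun y => (dif_pos hst).trans rfl
    rw [this]
    exact h _ _ _
  · have : (fun y => blk hγ γ' (M y) i s t) = fun y => 0 := funext fun y => (dif_neg hst).trans rfl
    rw [this]
    exact S.const _ _

theorem blkB_regAt (hγ : D.IsEven γ) {M : Y → ∀ e : D.Arru, Matrix (D.J γ e.1.2) (D.J γ e.1.1) ℂ}
    (h : ∀ e s t, S.RegAt (fun y => M y e s t) y) (e : D.Arr) (s t) :
    S.RegAt (fun y => blkB hγ (M y) e s t) y := by
  classical
  by_cases hst : D.Eu (blockOf hγ e.1.1 t) (blockOf hγ e.1.2 s)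
  · have : (fun y => blkB hγ (M y) e s t) = fun y => M y ⟨(blockOf hγ e.1.1 t, blockOf hγ e.1.2 s), hst⟩
      (inBlock hγ e.1.2 s) (inBlock hγ e.1.1 t) := funext fun y => (dif_pos hst).trans rfl
    rw [this]
    exact h _ _ _
  · have : (fun y => blkB hγ (M y) e s t) = fun y => 0 := funext fun y => (dif_neg hst).trans rfl
    rw [this]
    exact S.const _ _

theorem regGK_mkG (hγ : D.IsEven γ) (hη : D.IsEvenFor γ η) {G : Y → D.Gu γ} (h : RegGu S y G) :
    RegGK S y fun y => mkG hγ hη (G y) := by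
  classical
  have key : ∀ G : Y → D.Gu γ, RegGu S y G → ∀ i s t k,
      S.RegAt (fun y => ((mkG hγ hη (G y) i).1 s t).coeff k) y := by
    intro G h i s t k
    simp only [mkG_coeff]
    exact RegAt.ite _ (fun _ => blk_regAt hγ (M := fun y x => (G y x).1) h.val i s t) fun _ => S.const _ _
  refine RegGK.mk (key G h) fun i s t k => ?_
  have := key _ h.inv i s t k
  simp only [map_inv] at this
  exact this

theorem regGu_of_mkG (hγ : D.IsEven γ) (hη : D.IsEvenFor γ η) {G : Y → D.Gu γ}
    (h : RegGK S y fun y => mkG hγ hη (G y)) : RegGu S y G := by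
  have key : ∀ G : Y → D.Gu γ, (RegGK S y fun y => mkG hγ hη (G y)) → ∀ x s t,
      S.RegAt (fun y => (G y x).1 s t) y := by
    intro G h x s t
    have := h.val x.1.1 s.1 t.1 (D.hat η x.1.1 t.1 - D.hat η x.1.1 s.1)
    simp only [mkG_coeff_J, if_true] at this
    exact this
  refine RegGu.mk (key G h) fun x s t => ?_
  refine key (fun y => (G y)⁻¹) ?_ x s t
  simp only [map_inv]
  exact h.inv

theorem regNK_mkN (hγ : D.IsEven γ) {n : Y → D.Nu γ ρ} (h : RegNu S y n) :
    RegNK S y fun y => mkN hγ η (n y) := by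
  classical
  rintro (⟨i, t, m, s, k⟩ | ⟨e, t, m, s, k⟩)
  · have : (fun y' => D.coordNK (mkN hγ η (n y')) (Sum.inl ⟨i, t, m, s, k⟩)) = fun y =>
        if 1 * k + (D.tw η i s - D.tw ρ i t) / (2 * D.d i) = m then blk hγ ρ (n y).A i s t else 0 :=
      funext fun y => wMap_zvec t m s k
    rw [this]
    exact RegAt.ite _ (fun _ => blk_regAt hγ h.A i s t) fun _ => S.const _ _
  · have : (fun y' => D.coordNK (mkN hγ η (n y')) (Sum.inr ⟨e, t, m, s, k⟩)) = fun y =>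
        if - D.c e.1.1 e.1.2 * k + (D.tw η e.1.2 s - D.tw η e.1.1 t) / (2 * D.d e.1.1) = m
          then blkB hγ (n y).B e s t else 0 :=
      funext fun y => wMap_zvec t m s k
    rw [this]
    exact RegAt.ite _ (fun _ => blkB_regAt hγ h.B e s t) fun _ => S.const _ _

theorem regNu_of_mkN (hγ : D.IsEven γ) {n : Y → D.Nu γ ρ} (h : RegNK S y fun y => mkN hγ η (n y)) :
    RegNu S y n := by
  refine RegNu.mk (fun x s t => ?_) (fun e s t => ?_)
  · have h1 := h (Sum.inl ⟨x.1.1, t.1, (D.tw η x.1.1 s.1 - D.tw ρ x.1.1 t.1) / (2 * D.d x.1.1), s.1, 0⟩)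
    have : (fun y => D.coordNK (mkN hγ η (n y)) (Sum.inl ⟨x.1.1, t.1,
        (D.tw η x.1.1 s.1 - D.tw ρ x.1.1 t.1) / (2 * D.d x.1.1), s.1, 0⟩)) = fun y => (n y).A x s t := by
      funext y
      refine (wMap_zvec t.1 _ s.1 0).trans ?_
      rw [mul_zero, zero_add, if_pos rfl, blk_apply]
    rwa [this] at h1
  · have h1 := h (Sum.inr ⟨arrOf e, t.1,
      (D.tw η e.1.2.1.1 s.1 - D.tw η e.1.1.1.1 t.1) / (2 * D.d e.1.1.1.1), s.1, 0⟩)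
    have : (fun y => D.coordNK (mkN hγ η (n y)) (Sum.inr ⟨arrOf e, t.1,
        (D.tw η e.1.2.1.1 s.1 - D.tw η e.1.1.1.1 t.1) / (2 * D.d e.1.1.1.1), s.1, 0⟩)) =
        fun y => (n y).B e s t := by
      funext y
      refine (wMap_zvec t.1 _ s.1 0).trans ?_
      rw [mul_zero, zero_add, if_pos rfl]
      exact blkB_apply hγ (n y).B e s t
    rwa [this] at h1

theorem HomZ_coeff {p q : ℤ} {hp : 0 < p} {hq : 0 < q} (hq1 : q = 1) {m n : ℕ} {B : KV m →ₗ[ℂ] KV n}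
    (hB : B ∈ HomZ p q hp hq m n) {N M : ℕ} (hM : HomBdd M B) {v : KV m} (hv : ∀ t, IsBdd N (v t))
    (s : Fin n) (k : ℤ) : (B v s).coeff k = ∑ t, ∑ r ∈ Finset.range p.toNat,
      ∑ a ∈ Finset.Icc (-(N : ℤ)) (k + M), (v t).coeff (p * a + r) * (B (zvec t r) s).coeff (k - a) := by
  rw [HomZ_apply hB, Finset.sum_apply, HahnSeries.coeff_sum]
  refine Finset.sum_congr rfl fun t _ => ?_
  rw [Finset.sum_apply, HahnSeries.coeff_sum]
  refine Finset.sum_congr rfl fun r hr => ?_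
  rw [powEmb_one q hq hq1, Pi.smul_apply, smul_eq_mul]
  have h1 : IsBdd N (decim p hp r (v t)) := by
    intro a ha
    refine hv t _ ?_
    have hr' : (r : ℤ) < p := by
      have := Finset.mem_range.mp hr
      omega
    nlinarith
  have h2 : IsBdd M (B (zvec t (r : ℤ)) s) := by
    refine hM _ (fun u => ?_) s
    rcases eq_or_ne u t with rfl | hu
    · rw [zvec_same]
      exact isBdd_single (by simp) _
    · rw [zvec_ne hu]
      exact fun _ _ => rfl
  rw [coeff_mul_Icc h1 h2]
  rfl

theorem HomBdd.apply {p q : ℤ} {hp : 0 < p} {hq : 0 < q} (hq1 : q = 1) {m n : ℕ} {B : KV m →ₗ[ℂ] KV n}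
    (hB : B ∈ HomZ p q hp hq m n) {N M : ℕ} (hM : HomBdd M B) {v : KV m} (hv : ∀ t, IsBdd N (v t))
    (s : Fin n) : IsBdd (N + M) (B v s) := by
  intro k hk
  rw [HomZ_coeff hq1 hB hM hv]
  refine Finset.sum_eq_zero fun t _ => Finset.sum_eq_zero fun r _ => ?_
  rw [Finset.Icc_eq_empty (by push_cast at hk; omega), Finset.sum_empty]

theorem HomZ_apply_regAt {p q : ℤ} {hp : 0 < p} {hq : 0 < q} (hq1 : q = 1) {m n : ℕ}
    {B : Y → HomZ p q hp hq m n} {N M : ℕ} (hM : ∀ y, HomBdd M (B y).1) {v : Y → KV m}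
    (hv : ∀ y t, IsBdd N (v y t)) (h : ∀ t r s k, S.RegAt (fun y => ((B y).1 (zvec t r) s).coeff k) y)
    (h' : ∀ t k, S.RegAt (fun y => (v y t).coeff k) y) (s : Fin n) (k : ℤ) :
    S.RegAt (fun y => ((B y).1 (v y) s).coeff k) y := by
  simp only [fun y => HomZ_coeff hq1 (B y).2 (hM y) (hv y) s k]
  exact RegAt.sum _ fun t _ => RegAt.sum _ fun r _ => RegAt.sum _ fun a _ =>
    S.mul (h' t _) (h t r s (k - a))

theorem isBdd_zvec {n : ℕ} (t : Fin n) (r : ℤ) (s : Fin n) : IsBdd r.natAbs (zvec t r s) := by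
  rcases eq_or_ne s t with rfl | hu
  · rw [zvec_same]
    exact isBdd_single (by omega) _
  · rw [zvec_ne hu]
    exact fun _ _ => rfl

theorem IsBdd.mulVec {l m : Type} [Fintype m] {N N' : ℕ} {M : Matrix l m LS} {v : m → LS}
    (hM : ∀ a b, IsBdd N (M a b)) (hv : ∀ b, IsBdd N' (v b)) (a : l) :
    IsBdd (N + N') (M.mulVec v a) := IsBdd.sum fun b _ => (hM a b).mul (hv b)

theorem regNK_smul {G : Y → D.GK} {n : Y → D.NK} {N M : ℕ} (hN : ∀ y, G y ∈ D.GKbdd N)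
    (hM : ∀ y, n y ∈ D.NObdd M) (h : RegGK S y G) (h' : RegNK S y n) :
    RegNK S y fun y => D.inclGK (G y) • n y := by
  have hsm := fun y => (inclGK_smul_eq_iff (G y) (n y) _).mp rfl
  rintro (⟨i, t, m, s, k⟩ | ⟨e, t, m, s, k⟩)
  · have : (fun y => D.coordNK (D.inclGK (G y) • n y) (Sum.inl ⟨i, t, m, s, k⟩)) = fun y =>
        ((G y i).1.mulVec (((n y).A i).1 (zvec t m)) s).coeff k := by
      funext y
      rw [(hsm y).1]
      rfl
    rw [this]
    exact coeff_mulVec_regAt (M := fun y => (G y i).1) (v := fun y => ((n y).A i).1 (zvec t m))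
      (fun y a b => (hN y i a b).1)
      (fun y s => HomBdd.apply rfl ((n y).A i).2 ((hM y).1 i) (isBdd_zvec t m) s) (h.val i)
      (fun s k => h' (Sum.inl ⟨i, t, m, s, k⟩)) s k
  · have : (fun y => D.coordNK (D.inclGK (G y) • n y) (Sum.inr ⟨e, t, m, s, k⟩)) = fun y =>
        ((G y e.1.2).1.mulVec (((n y).B e).1 ((G y e.1.1)⁻¹.1.mulVec (zvec t m))) s).coeff k := by
      funext y
      rw [(hsm y).2, Matrix.mulVec_mulVec, Units.mul_inv, Matrix.one_mulVec]
      rfl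
    rw [this]
    have hb : ∀ y u, IsBdd (N + m.natAbs) ((G y e.1.1)⁻¹.1.mulVec (zvec t m) u) := fun y =>
      IsBdd.mulVec (fun a b => (hN y e.1.1 a b).2) (isBdd_zvec t m)
    exact coeff_mulVec_regAt (M := fun y => (G y e.1.2).1)
      (v := fun y => ((n y).B e).1 ((G y e.1.1)⁻¹.1.mulVec (zvec t m)))
      (fun y a b => (hN y e.1.2 a b).1)
      (fun y s => HomBdd.apply e.2.neg_c'_eq ((n y).B e).2 ((hM y).2 e) (hb y) s) (h.val e.1.2)
      (HomZ_apply_regAt e.2.neg_c'_eq (B := fun y => (n y).B e)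
        (v := fun y => (G y e.1.1)⁻¹.1.mulVec (zvec t m)) (fun y => (hM y).2 e) hb
        (fun t r s k => h' (Sum.inr ⟨e, t, r, s, k⟩))
        (coeff_mulVec_regAt (M := fun y => (G y e.1.1)⁻¹.1) (v := fun _ => zvec t m)
          (fun y a b => (hN y e.1.1 a b).2) (fun _ => isBdd_zvec t m) (h.inv_val e.1.1)
          (fun _ _ => S.const _ _))) s k

theorem isMorAt_to_NKSub (hS : S.Good) {Z : Set D.NK} {f : Y → Z} {N : ℕ}
    (hN : ∀ y, (f y).1 ∈ D.NObdd N) (h : RegNK S y fun y => (f y).1) :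
    IsMorAt S (D.funNKSub Z) f y :=
  ((isMorAt_to_coinduced (ι := ℕ) (X := fun N => {n : Z // n.1 ∈ D.NObdd N}) (fun _ n => n.1)
    (fun _ => FunSp.coord fun n => D.coordNK n.1.1) N).at ⟨f y, hN y⟩).comp
      (f := fun y => (⟨f y, hN y⟩ : {n : Z // n.1 ∈ D.NObdd N})) (isMorAt_to_coord hS h)

end Regularity

/-! ### Boundedness -/

theorem exists_mkN_mem_NObdd (hγ : D.IsEven γ) (η : Cow D.a) (ρ : Cow D.l) :
    ∃ N : ℕ, ∀ n : D.Nu γ ρ, mkN hγ η n ∈ D.NObdd N := by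
  obtain ⟨N, hN⟩ := exists_nat_bound fun c : (Σ i, Fin (D.a i) × Fin (D.l i)) =>
    (D.tw η c.1 c.2.1 - D.tw ρ c.1 c.2.2) / (2 * D.d c.1)
  obtain ⟨N', hN'⟩ := exists_nat_bound fun c : (Σ e : D.Arr, Fin (D.a e.1.2) × Fin (D.a e.1.1)) =>
    (D.tw η c.1.1.2 c.2.1 - D.tw η c.1.1.1 c.2.2) / (2 * D.d c.1.1.1)
  refine ⟨max N N', fun n => ⟨fun i => wMap_homBdd _ fun s t => ?_, fun e => wMap_homBdd _ fun s t => ?_⟩⟩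
  · exact (hN ⟨i, s, t⟩).trans (by exact_mod_cast le_max_left _ _)
  · exact (hN' ⟨e, s, t⟩).trans (by exact_mod_cast le_max_right _ _)

theorem GKbdd_mul {N M : ℕ} {g h : D.GK} (hg : g ∈ D.GKbdd N) (hh : h ∈ D.GKbdd M) :
    g * h ∈ D.GKbdd (N + M) := by
  intro i s t
  constructor
  · exact IsBdd.sum fun u _ => (hg i s u).1.mul (hh i u t).1
  · have : ((g * h) i)⁻¹ = (h i)⁻¹ * (g i)⁻¹ := mul_inv_rev _ _
    rw [this, add_comm]
    exact IsBdd.sum fun u _ => (hh i s u).2.mul (hg i u t).2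

theorem GKbdd_inv {N : ℕ} {g : D.GK} (hg : g ∈ D.GKbdd N) : g⁻¹ ∈ D.GKbdd N := by
  intro i s t
  refine ⟨(hg i s t).2, ?_⟩
  rw [Pi.inv_apply, inv_inv]
  exact (hg i s t).1

theorem exists_mem_GKbdd (g : D.GK) : ∃ N, g ∈ D.GKbdd N := by
  choose N hN using fun c : (Σ i, Fin (D.a i) × Fin (D.a i)) => exists_isBdd ((g c.1).1 c.2.1 c.2.2)
  choose N' hN' using fun c : (Σ i, Fin (D.a i) × Fin (D.a i)) => exists_isBdd ((g c.1)⁻¹.1 c.2.1 c.2.2)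
  obtain ⟨M, hM⟩ := exists_nat_bound fun c => ((N c + N' c : ℕ) : ℤ)
  refine ⟨M, fun i s t => ?_⟩
  have := hM ⟨i, s, t⟩
  exact ⟨(hN ⟨i, s, t⟩).mono (by omega), (hN' ⟨i, s, t⟩).mono (by omega)⟩

theorem exists_mkG_mem_GKbdd (hγ : D.IsEven γ) (hη : D.IsEvenFor γ η) :
    ∃ N, ∀ β, mkG hγ hη β ∈ D.GKbdd N := by
  obtain ⟨N, hN⟩ := exists_nat_bound fun c : (Σ i, Fin (D.a i) × Fin (D.a i)) =>
    |D.wt η c.1 c.2.1 - D.wt η c.1 c.2.2|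
  have key : ∀ β i s t, IsBdd N ((mkG hγ hη β i).1 s t) := by
    intro β i s t k hk
    rw [mkG_coeff, if_neg]
    intro h
    have h1 := hN ⟨i, s, t⟩
    have h2 := le_abs_self (D.wt η i s - D.wt η i t)
    have h3 := D.two_d_pos i
    simp only at h1
    nlinarith
  refine ⟨N, fun β i s t => ⟨key β i s t, ?_⟩⟩
  have := key β⁻¹ i s t
  rwa [map_inv] at this

/-! ### The isomorphisms given by evaluation -/

theorem isIso_evN (hγ : D.IsEven γ) : IsIso (D.funNKSub (D.NKFix γ ρ)) (D.funNu γ ρ) (evN hγ) := by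
  refine ⟨isMor_from_coinduced (good_coord _) fun N => isMor_to_coord (good_coord _) fun k n => ?_, ?_⟩
  · refine regNu_of_mkN (η := γ) (n := fun n : {n : D.NKFix γ ρ // n.1 ∈ D.NObdd N} => evN hγ n.1) hγ
      (fun k => ?_) k
    simp only [mkN_evN]
    exact regAt_coord (fun n : {n : D.NKFix γ ρ // n.1 ∈ D.NObdd N} => D.coordNK n.1.1) k n
  · obtain ⟨N, hN⟩ := exists_mkN_mem_NObdd hγ γ ρ
    exact isMor_iff.2 fun n => isMorAt_to_NKSub (good_coord _) (N := N) hN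
      (regNK_mkN hγ fun k => regAt_coord D.coordNu k n)

theorem isIso_evGO (hγ : D.IsEven γ) : IsIso (D.funGOFix γ) (D.funPu γ γ) (evGO hγ).toEquiv := by
  constructor
  · refine isMor_iff.2 fun g => isMorAt_to_Pu (good_coord _) ?_
    refine regGu_of_mkG hγ (isEvenFor_self hγ) fun k => ?_
    simp only [MulEquiv.toEquiv_eq_coe, EquivLike.coe_coe, mkG_evGO]
    exact regAt_coord (fun g : D.GOFix γ => D.coordGK g.1) k g
  · refine isMor_iff.2 fun p => isMorAt_to_coord (good_coord _) ?_
    exact regGK_mkG hγ (isEvenFor_self hγ) (regGu_Pu p)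

/-- The inclusion of `P̲_η ≅ (G_O)^η̃` in `G_O`. -/
def inclGO (hγ : D.IsEven γ) (hη : D.IsEvenFor γ η) : D.Pu γ η →* D.GO :=
  ((mkG hγ hη).comp (D.Pu γ η).subtype).codRestrict D.GO fun p => (mkG_mem_GO_iff hγ hη).mpr p.2

theorem isMor_inclGO (hγ : D.IsEven γ) (hη : D.IsEvenFor γ η) :
    IsMor (D.funPu γ η) D.funGO (inclGO hγ hη) :=
  isMor_iff.2 fun p => isMorAt_to_coord (good_coord _) (regGK_mkG hγ hη (regGu_Pu p))

theorem eq_mkG_of_isEv (hγ : D.IsEven γ) (hη : D.IsEvenFor γ η) {g : D.GK} (hg : g ∈ D.GKFix η)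
    {β : D.Gu γ} (h : D.IsEv γ g β) : mkG hγ hη β = g := by
  rw [mem_GKFix_iff] at hg
  refine GK_ext fun i s t k => ?_
  rw [mkG_coeff]
  split_ifs with hk
  · have h1 : D.wt η i s ≡ D.wt η i t [ZMOD 2 * D.d i] := Int.modEq_iff_dvd.mpr ⟨k, hk.symm⟩
    have h2 : D.wt γ i t ≡ D.rep i (D.wt γ i s) [ZMOD 2 * D.d i] :=
      (((hη.wt_congr hγ i t).symm.trans h1.symm).trans (hη.wt_congr hγ i s)).trans (D.rep_modEq i _)
    have h3 := blk_apply hγ (fun x => (β x).1) (blockOf hγ i s) (inBlock hγ i s) ⟨t, h2⟩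
    refine h3.trans ((h (blockOf hγ i s) (inBlock hγ i s) ⟨t, h2⟩).trans ?_)
    refine finsum_eq_single _ k fun m hm => ?_
    by_contra hc
    have := hg i s t m hc
    exact hm (mul_left_cancel₀ (D.two_d_pos i).ne' (this.trans hk.symm))
  · by_contra hc
    exact hk (hg i s t k (Ne.symm hc))

theorem isRestr_comap (hγ : D.IsEven γ) (hη : D.IsEvenFor γ η) (V : RatRep D.funGO) :
    D.IsRestr γ η V (V.comap (inclGO hγ hη) (isMor_inclGO hγ hη)) := by
  refine ⟨rfl, fun k p hk hkp i j => ?_⟩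
  have : inclGO hγ hη p = k := Subtype.ext (eq_mkG_of_isEv hγ hη hk hkp)
  change (V.ρ (inclGO hγ hη p)).1 i j = _
  rw [this]
  rfl

theorem IsRestr.cls_eq (hγ : D.IsEven γ) (hη : D.IsEvenFor γ η) {V : RatRep D.funGO}
    {V' : RatRep (D.funPu γ η)} (h : D.IsRestr γ η V V') :
    RepRing.comap (inclGO hγ hη) (isMor_inclGO hγ hη) (RepRing.cls V) = RepRing.cls V' := by
  obtain ⟨hn, h⟩ := h
  refine (RepRing.lift_cls _ _ V).trans ?_
  refine RepRing.cls_eq_of_iso (LinearEquiv.funCongrLeft ℂ ℂ (finCongr hn)) fun p v => ?_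
  funext i
  change ∑ j, (V.ρ (inclGO hγ hη p)).1 (Fin.cast hn i) j * v j = ∑ j, (V'.ρ p).1 i j * v (Fin.cast hn j)
  rw [← Equiv.sum_comp (finCongr hn)]
  refine Finset.sum_congr rfl fun j _ => ?_
  rw [h (inclGO hγ hη p) p (mkG_mem_GKFix hγ hη p.1) (isEv_mkG hγ hη p.1)]
  rfl

end Datum

end FixedLocus
end

open scoped Topology
noncomputable section
namespace FixedLocus
open FunSp

/-! ### Lattices transversal to the polar vectors -/

section Lattice

variable {n : ℕ}

/-- Integral vectors. -/
abbrev IsInt (v : KV n) : Prop := ∀ t, IsBdd 0 (v t)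

/-- Vectors without coefficients in nonnegative degrees. -/
abbrev IsPolar (v : KV n) : Prop := ∀ t k, 0 ≤ k → (v t).coeff k = 0

/-- The lattice spanned by the columns of `g` is a complement of the space of polar vectors. -/
structure Transversal (g : GL (Fin n) LS) : Prop where
  inj : ∀ v : KV n, IsInt (g⁻¹.1.mulVec v) → IsPolar v → v = 0
  surj : ∀ w : KV n, ∃ v : KV n, IsInt (g⁻¹.1.mulVec v) ∧ IsPolar (v - w)

/-- The Laurent polynomial vector with exponents `e` and coefficients `c`. -/
def expVec {ι : Type} [Fintype ι] (e : ι → ℤ) (c : Fin n × ι → ℂ) : KV n :=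
  fun t => ∑ a, HahnSeries.single (e a) (c (t, a))

/-- The matrix of a Laurent series matrix with respect to the exponents `f` and `e`. -/
def laurMat {ι κ : Type} (f : κ → ℤ) (e : ι → ℤ) (M : Matrix (Fin n) (Fin n) LS) :
    Matrix (Fin n × κ) (Fin n × ι) ℂ := Matrix.of fun p q => (M p.1 q.1).coeff (f p.2 - e q.2)

section

variable {ι κ : Type} {e : ι → ℤ} {f : κ → ℤ}

theorem laurMat_regAt {Y : Type} {S : FunSp Y} {y : Y} {M : Y → Matrix (Fin n) (Fin n) LS}
    (h : ∀ s t k, S.RegAt (fun y => (M y s t).coeff k) y) (p q) :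
    S.RegAt (fun y => laurMat f e (M y) p q) y := h _ _ _

variable [Fintype ι]

theorem expVec_coeff (he : Function.Injective e) (c : Fin n × ι → ℂ) (t : Fin n) (a : ι) :
    (expVec e c t).coeff (e a) = c (t, a) := by
  rw [expVec, HahnSeries.coeff_sum, Finset.sum_eq_single a]
  · rw [HahnSeries.coeff_single_same]
  · intro b _ hb
    exact HahnSeries.coeff_single_of_ne fun h => hb (he h.symm)
  · simp

theorem expVec_coeff_eq_zero (c : Fin n × ι → ℂ) (t : Fin n) {k : ℤ} (hk : ∀ a, e a ≠ k) :
    (expVec e c t).coeff k = 0 := by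
  rw [expVec, HahnSeries.coeff_sum]
  exact Finset.sum_eq_zero fun a _ => HahnSeries.coeff_single_of_ne (hk a).symm

theorem eq_expVec (he : Function.Injective e) {v : KV n}
    (hv : ∀ t k, (∀ a, e a ≠ k) → (v t).coeff k = 0) :
    v = expVec e fun p => (v p.1).coeff (e p.2) := by
  funext t
  ext k
  by_cases hk : ∃ a, e a = k
  · obtain ⟨a, rfl⟩ := hk
    rw [expVec_coeff he]
  · push Not at hk
    rw [hv t k hk, expVec_coeff_eq_zero _ _ hk]

theorem mulVec_expVec_coeff (M : Matrix (Fin n) (Fin n) LS) (c : Fin n × ι → ℂ) (r : Fin n) (j : κ) :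
    (M.mulVec (expVec e c) r).coeff (f j) = (laurMat f e M).mulVec c (r, j) := by
  rw [Matrix.mulVec, dotProduct, HahnSeries.coeff_sum]
  refine Eq.trans ?_ (Fintype.sum_prod_type _).symm
  refine Finset.sum_congr rfl fun t _ => ?_
  rw [expVec, Finset.mul_sum, HahnSeries.coeff_sum]
  refine Finset.sum_congr rfl fun a _ => ?_
  rw [mul_comm, coeff_single_mul', mul_comm]
  rfl

end

/-- Exponents of polar Laurent polynomials. -/
def negE (N : ℕ) (a : Fin N) : ℤ := -(a.1 : ℤ) - 1

/-- Exponents of polynomials. -/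
def natE (N : ℕ) (a : Fin N) : ℤ := a.1

theorem negE_injective (N : ℕ) : Function.Injective (negE N) := by
  intro a b h
  simp only [negE] at h
  exact Fin.ext (by omega)

theorem natE_injective (N : ℕ) : Function.Injective (natE N) := by
  intro a b h
  simp only [natE] at h
  exact Fin.ext (by omega)

theorem exists_negE {N : ℕ} {k : ℤ} (h : k < 0) (h' : -(N : ℤ) ≤ k) : ∃ a, negE N a = k :=
  ⟨⟨(-k - 1).toNat, by omega⟩, by simp only [negE]; omega⟩

theorem exists_natE {N : ℕ} {k : ℤ} (h : 0 ≤ k) (h' : k < N) : ∃ a, natE N a = k :=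
  ⟨⟨k.toNat, by omega⟩, by simp only [natE]; omega⟩

theorem negE_lt {N : ℕ} (a : Fin N) : negE N a < 0 := by simp only [negE]; omega

theorem natE_nonneg {N : ℕ} (a : Fin N) : 0 ≤ natE N a := by simp only [natE]; omega

theorem isPolar_expVec {N : ℕ} (c : Fin n × Fin N → ℂ) : IsPolar (expVec (negE N) c) := fun t k hk =>
  expVec_coeff_eq_zero c t fun a => by have := negE_lt a; omega

theorem isInt_expVec {N : ℕ} (c : Fin n × Fin N → ℂ) : IsInt (expVec (natE N) c) := fun t k hk =>
  expVec_coeff_eq_zero c t fun a => by have := natE_nonneg a; push_cast at hk; omega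

theorem isBdd_expVec {N : ℕ} (c : Fin n × Fin N → ℂ) (t : Fin n) : IsBdd N (expVec (negE N) c t) :=
  fun k hk => expVec_coeff_eq_zero c t fun a => by simp only [negE]; omega

variable {g : GL (Fin n) LS} {N : ℕ}

theorem isBdd_of_isInt (hg : ∀ s t, IsBdd N (g.1 s t)) {v : KV n} (hv : IsInt (g⁻¹.1.mulVec v))
    (t : Fin n) : IsBdd N (v t) := by
  have : v = g.1.mulVec (g⁻¹.1.mulVec v) := by
    rw [Matrix.mulVec_mulVec, Units.mul_inv, Matrix.one_mulVec]
  rw [this]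
  exact Datum.IsBdd.mulVec hg hv t

theorem eq_expVec_of_isPolar {v : KV n} (hv : IsPolar v) (hN : ∀ t, IsBdd N (v t)) :
    v = expVec (negE N) fun p => (v p.1).coeff (negE N p.2) := by
  refine eq_expVec (negE_injective N) fun t k hk => ?_
  by_cases h0 : 0 ≤ k
  · exact hv t k h0
  · refine hN t k ?_
    by_contra hc
    obtain ⟨a, ha⟩ := exists_negE (N := N) (k := k) (by omega) (by omega)
    exact hk a ha

theorem inj_iff (hg : ∀ s t, IsBdd N (g.1 s t)) (hg' : ∀ s t, IsBdd N (g⁻¹.1 s t)) :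
    (∀ v : KV n, IsInt (g⁻¹.1.mulVec v) → IsPolar v → v = 0) ↔
      ∀ c, (laurMat (negE (N + N)) (negE N) g⁻¹.1).mulVec c = 0 → c = 0 := by
  constructor
  · intro h c hc
    have h1 := h (expVec (negE N) c) (fun t k hk => ?_) (isPolar_expVec c)
    · funext p
      rw [← expVec_coeff (negE_injective N) c p.1 p.2, h1]
      rfl
    · by_cases hkN : k < -((N + N : ℕ) : ℤ)
      · exact Datum.IsBdd.mulVec hg' (isBdd_expVec c) t k hkN
      · obtain ⟨j, rfl⟩ := exists_negE (N := N + N) (k := k) (by simpa using hk) (by omega)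
        rw [mulVec_expVec_coeff, hc]
        rfl
  · intro h v hv hp
    have h1 := eq_expVec_of_isPolar hp (isBdd_of_isInt hg hv)
    have h2 := h (fun p => (v p.1).coeff (negE N p.2)) (funext fun p => by
      rw [← mulVec_expVec_coeff, ← h1]
      exact hv p.1 _ (by have := negE_lt p.2; simpa using this))
    rw [h1, h2]
    funext t
    simp [expVec]

theorem surj_iff (hg : ∀ s t, IsBdd N (g.1 s t)) (hg' : ∀ s t, IsBdd N (g⁻¹.1 s t)) :
    (∀ w : KV n, ∃ v : KV n, IsInt (g⁻¹.1.mulVec v) ∧ IsPolar (v - w)) ↔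
      ∀ w, ∃ c, (laurMat (natE N) (natE (N + N)) g.1).mulVec c = w := by
  constructor
  · intro h w
    obtain ⟨v, hv, hvw⟩ := h (expVec (natE N) w)
    refine ⟨fun p => (g⁻¹.1.mulVec v p.1).coeff (natE (N + N) p.2), funext fun p => ?_⟩
    have h1 : (v p.1).coeff (natE N p.2) = w p := by
      have := hvw p.1 (natE N p.2) (natE_nonneg _)
      rw [Pi.sub_apply, HahnSeries.coeff_sub, expVec_coeff (natE_injective N), sub_eq_zero] at this
      exact this
    have h2 : v = g.1.mulVec (g⁻¹.1.mulVec v) := by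
      rw [Matrix.mulVec_mulVec, Units.mul_inv, Matrix.one_mulVec]
    rw [← h1]
    conv_rhs => rw [h2]
    generalize g⁻¹.1.mulVec v = y at hv
    have h6 : (g.1.mulVec y p.1).coeff (natE N p.2) = ∑ r, (g.1 p.1 r * y r).coeff (natE N p.2) := by
      rw [Matrix.mulVec, dotProduct, HahnSeries.coeff_sum]
    refine Eq.trans ?_ h6.symm
    refine (Fintype.sum_prod_type _).trans (Finset.sum_congr rfl fun r _ => ?_)
    rw [mul_comm (g.1 p.1 r), coeff_mul_eq_sum (Finset.univ.image (natE (N + N))) fun a ha hb => ?_,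
      Finset.sum_image fun _ _ _ _ h => natE_injective _ h]
    · exact Finset.sum_congr rfl fun a _ => mul_comm _ _
    · have h3 := (hv r).le ha
      have h4 := (hg p.1 r).le hb
      have h5 : natE N p.2 < N := by simp only [natE]; omega
      obtain ⟨j, hj⟩ := exists_natE (N := N + N) (k := a) (by simpa using h3) (by push_cast; omega)
      exact Finset.mem_image.2 ⟨j, Finset.mem_univ _, hj⟩
  · intro h w
    obtain ⟨c, hc⟩ := h fun p => (w p.1).coeff (natE N p.2)
    let v₁ := g.1.mulVec (expVec (natE (N + N)) c)
    let w₁ : KV n := fun t => mkLS (fun k => if k < N then 0 else (w t).coeff k - (v₁ t).coeff k) N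
      fun k hk => if_pos hk
    have hw₁ : ∀ t k, (w₁ t).coeff k = if k < N then 0 else (w t).coeff k - (v₁ t).coeff k :=
      fun _ _ => rfl
    refine ⟨v₁ + w₁, fun t k hk => ?_, fun t k hk => ?_⟩
    · rw [Matrix.mulVec_add, Matrix.mulVec_mulVec, Units.inv_mul, Matrix.one_mulVec, Pi.add_apply,
        HahnSeries.coeff_add, isInt_expVec c t k hk, zero_add, Matrix.mulVec, dotProduct,
        HahnSeries.coeff_sum]
      refine Finset.sum_eq_zero fun r _ => ?_
      rw [coeff_mul_eq_sum ∅ fun a ha hb => ?_, Finset.sum_empty]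
      have h1 := (hg' t r).le ha
      have h2 : (N : ℤ) ≤ k - a := by
        by_contra hlt
        exact hb ((hw₁ r _).trans (if_pos (by omega)))
      push_cast at hk
      omega
    · rw [Pi.sub_apply, Pi.add_apply, HahnSeries.coeff_sub, HahnSeries.coeff_add, hw₁]
      split_ifs with hkN
      · obtain ⟨j, rfl⟩ := exists_natE hk hkN
        have := congrFun hc (t, j)
        rw [← mulVec_expVec_coeff] at this
        rw [add_zero, sub_eq_zero]
        exact this
      · ring

variable {Y : Type} {S : FunSp Y} {y : Y} {G : Y → GL (Fin n) LS}

theorem Transversal.nhds (hS : S.Good) (hG : ∀ y s t, IsBdd N ((G y).1 s t))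
    (hG' : ∀ y s t, IsBdd N ((G y)⁻¹.1 s t)) (h : ∀ s t k, S.RegAt (fun y => ((G y).1 s t).coeff k) y)
    (h' : ∀ s t k, S.RegAt (fun y => ((G y)⁻¹.1 s t).coeff k) y) (hy : Transversal (G y)) :
    ∃ U, IsOpen[S.top] U ∧ y ∈ U ∧ ∀ y' ∈ U, Transversal (G y') := by
  obtain ⟨U, hU, hyU, h1⟩ := injective_nhds hS
    (M := fun y => laurMat (negE (N + N)) (negE N) (G y)⁻¹.1) (laurMat_regAt h')
    ((inj_iff (hG y) (hG' y)).mp hy.inj)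
  obtain ⟨V, hV, hyV, h2⟩ := surjective_nhds hS
    (M := fun y => laurMat (natE N) (natE (N + N)) (G y).1) (laurMat_regAt h)
    ((surj_iff (hG y) (hG' y)).mp hy.surj)
  exact ⟨U ∩ V, @IsOpen.inter _ S.top _ _ hU hV, ⟨hyU, hyV⟩, fun y' hy' =>
    ⟨(inj_iff (hG y') (hG' y')).mpr (h1 y' hy'.1), (surj_iff (hG y') (hG' y')).mpr (h2 y' hy'.2)⟩⟩

theorem Transversal.regAt (hS : S.Good) (hG : ∀ y s t, IsBdd N ((G y).1 s t))
    (hG' : ∀ y s t, IsBdd N ((G y)⁻¹.1 s t))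
    (h' : ∀ s t k, S.RegAt (fun y => ((G y)⁻¹.1 s t).coeff k) y) (hy : Transversal (G y))
    {s : Fin n} {l : Y → KV n} {U : Set Y} (hU : IsOpen[S.top] U) (hyU : y ∈ U)
    (hl : ∀ y' ∈ U, IsInt ((G y')⁻¹.1.mulVec (l y')))
    (hl' : ∀ y' ∈ U, IsPolar (l y' - zvec s 0)) (t : Fin n) (k : ℤ) :
    S.RegAt (fun y => (l y t).coeff k) y := by
  have h0 : ∀ y' ∈ U, ∀ t k, 0 ≤ k → (l y' t).coeff k = (zvec s 0 t).coeff k := fun y' hy' t k hk => by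
    have := hl' y' hy' t k hk
    rwa [Pi.sub_apply, HahnSeries.coeff_sub, sub_eq_zero] at this
  rcases le_or_gt 0 k with hk | hk
  · exact hS.loc U hU hyU (fun y' hy' => (h0 y' hy' t k hk).symm) (S.const _ _)
  rcases lt_or_ge k (-(N : ℤ)) with hkN | hkN
  · exact hS.loc U hU hyU (fun y' hy' => (isBdd_of_isInt (hG y') (hl y' hy') t k hkN).symm) (S.const 0 _)
  obtain ⟨a, rfl⟩ := exists_negE hk hkN
  have hz : zvec s 0 = Pi.single s (1 : LS) := rfl
  refine solution_regAt hS (M := fun y => laurMat (negE (N + N)) (negE N) (G y)⁻¹.1) (laurMat_regAt h')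
    ((inj_iff (hG y) (hG' y)).mp hy.inj)
    (b := fun y p => (-1) * ((G y)⁻¹.1 p.1 s).coeff (negE (N + N) p.2))
    (fun p => S.mul (S.const _ _) (h' _ _ _)) (a := fun y p => (l y p.1).coeff (negE N p.2))
    hU hyU (fun y' hy' => funext fun p => ?_) (t, a)
  have h1 : l y' = zvec s 0 + expVec (negE N) fun p => (l y' p.1).coeff (negE N p.2) := by
    rw [← sub_eq_iff_eq_add']
    refine (eq_expVec_of_isPolar (N := N) (hl' y' hy') fun t k hk => ?_).trans ?_
    · rw [Pi.sub_apply, HahnSeries.coeff_sub, isBdd_of_isInt (hG y') (hl y' hy') t k hk, zero_sub,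
        (Datum.isBdd_zvec s 0 t).mono (Nat.zero_le N) k hk, neg_zero]
    · congr 1
      funext p
      have := negE_lt p.2
      rw [Pi.sub_apply, HahnSeries.coeff_sub, Datum.isBdd_zvec s 0 p.1 _ (by simpa using this), sub_zero]
  have h2 := hl y' hy' p.1 (negE (N + N) p.2) (by have := negE_lt p.2; simpa using this)
  rw [h1, Matrix.mulVec_add, Pi.add_apply, HahnSeries.coeff_add, mulVec_expVec_coeff, hz,
    Matrix.mulVec_single_one] at h2
  rw [neg_one_mul]
  exact (neg_eq_of_add_eq_zero_right h2).symm

end Lattice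

end FixedLocus
end

open scoped Topology
noncomputable section
namespace FixedLocus
open FunSp

variable {I : Type} [Fintype I] [DecidableEq I]

namespace Datum

variable {D : Datum I} {γ η : Cow D.a} {ρ : Cow D.l}

/-! ### The map from `G̲ × N_η^ρ` to the fixed locus -/

theorem smul_mem_NO_of_mem_GO {g : D.GK} (hg : g ∈ D.GO) {n : D.NK} (hn : n ∈ D.NO) :
    D.inclGK g • n ∈ D.NO := by
  have hsm := (inclGK_smul_eq_iff g n _).mp rfl
  rw [mem_GO_iff] at hg
  refine ⟨fun i v hv s => ?_, fun e v hv s => ?_⟩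
  · rw [← hsm.1]
    exact IsBdd.mulVec (fun a b => (hg i a b).1) (hn.1 i v hv) s
  · have hv' : v = (g e.1.1).1.mulVec ((g e.1.1)⁻¹.1.mulVec v) := by
      rw [Matrix.mulVec_mulVec, Units.mul_inv, Matrix.one_mulVec]
    rw [hv', ← hsm.2]
    exact IsBdd.mulVec (fun a b => (hg e.1.2 a b).1)
      (hn.2 e _ (IsBdd.mulVec (fun a b => (hg e.1.1 a b).2) hv)) s

theorem constGK_mul_zPow (u : ∀ i, Fin (D.a i) → ℂˣ) (m : ∀ i, Fin (D.a i) → ℤ) :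
    D.constGK u * D.zPow m = D.zPow m * D.constGK u := by
  funext i
  have key : ∀ a b : Fin (D.a i) → LSˣ, diagGL a * diagGL b = diagGL b * diagGL a := fun a b => by
    rw [← MonoidHom.map_mul, ← MonoidHom.map_mul]
    exact congrArg diagGL (funext fun s => mul_comm (a s) (b s))
  exact key _ _

theorem gTil_smul_zη (τ : ℂˣ) : D.gTil γ τ • ((zη γ η : D.GK) : D.Gr) = ((zη γ η : D.GK) : D.Gr) := by
  rw [smul_mk]
  change ((D.constGK _ * D.rotGK τ (D.zPow _) : D.GK) : D.Gr) = ((D.zPow _ : D.GK) : D.Gr)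
  rw [rotGK_zPow, ← mul_assoc, constGK_mul_zPow, mul_assoc]
  refine (QuotientGroup.eq.mpr ?_).symm
  rw [inv_mul_cancel_left]
  exact mul_mem (D.constGK_mem_GO _) (D.constGK_mem_GO _)

/-- The element `g z^{η̂ - γ̂}` of `G_K`. -/
abbrev gT (hγ : D.IsEven γ) (η : Cow D.a) (β : D.Gu γ) : D.GK := mkG hγ (isEvenFor_self hγ) β * zη γ η

theorem gT_smul_mkN (hγ : D.IsEven γ) (hη : D.IsEvenFor γ η) (β : D.Gu γ) (n : D.Nu γ ρ) :
    D.inclGK (gT hγ η β) • mkN hγ η n = mkN hγ γ (β • n) := by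
  rw [map_mul, mul_smul, zη_smul_mkN hγ hη, mkG_smul_mkN]

theorem gT_inv_mul (hγ : D.IsEven γ) (hη : D.IsEvenFor γ η) (β β' : D.Gu γ) :
    (gT hγ η β)⁻¹ * gT hγ η β' = mkG hγ hη (β⁻¹ * β') := by
  rw [gT, gT, mkG_mul_zη hγ hη, mkG_mul_zη hγ hη, mul_inv_rev, mul_assoc, inv_mul_cancel_left, map_mul,
    map_inv]

theorem gT_mul_mkG (hγ : D.IsEven γ) (hη : D.IsEvenFor γ η) (β β' : D.Gu γ) :
    gT hγ η β * mkG hγ hη β' = gT hγ η (β * β') := by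
  rw [gT, gT, mul_assoc, ← mkG_mul_zη hγ hη, ← mul_assoc, map_mul]

/-- The map `G̲ × N_η^ρ → G_K × N_O`. -/
def ιT (hγ : D.IsEven γ) (hη : D.IsEvenFor γ η) (r : D.GN γ η ρ) : D.GK × D.NO :=
  (gT hγ η r.1, ⟨mkN hγ η r.2.1, (mkN_mem_NO_iff hγ hη).mpr r.2.2⟩)

theorem qT_ιT (hγ : D.IsEven γ) (hη : D.IsEvenFor γ η) (r : D.GN γ η ρ) :
    (D.qT (ιT hγ hη r)).1 = (((gT hγ η r.1 : D.GK) : D.Gr), mkN hγ γ (r.1 • r.2.1)) :=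
  Prod.ext rfl (gT_smul_mkN hγ hη _ _)

theorem qT_ιT_mem (hγ : D.IsEven γ) (hη : D.IsEvenFor γ η) (r : D.GN γ η ρ) :
    D.qT (ιT hγ hη r) ∈ D.TFix γ η ρ := by
  refine ⟨fun τ => Subtype.ext (Prod.ext ?_ ?_), ?_⟩
  · change D.gTil γ τ • (D.qT (ιT hγ hη r)).1.1 = (D.qT (ιT hγ hη r)).1.1
    rw [qT_ιT]
    have h1 : ((gT hγ η r.1 : D.GK) : D.Gr) =
        (SemidirectProduct.inl (mkG hγ (isEvenFor_self hγ) r.1) : D.GKt) • ((zη γ η : D.GK) : D.Gr) := by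
      rw [smul_mk, SemidirectProduct.left_inl, SemidirectProduct.right_inl, map_one]
      rfl
    have h2 := Subgroup.mem_centralizer_iff.mp (mkG_mem_GKFix hγ (isEvenFor_self hγ) r.1) _ ⟨τ, rfl⟩
    change D.gTil γ τ • ((gT hγ η r.1 : D.GK) : D.Gr) = _
    rw [h1, ← mul_smul]
    exact (congrArg (· • ((zη γ η : D.GK) : D.Gr)) h2).trans
      ((mul_smul _ _ _).trans (congrArg _ (gTil_smul_zη τ)))
  · change D.gDot γ ρ τ • (D.qT (ιT hγ hη r)).1.2 = (D.qT (ιT hγ hη r)).1.2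
    rw [qT_ιT]
    exact mkN_mem_NKFix hγ (isEvenFor_self hγ) _ τ
  · exact ⟨_, mkG_mem_GKFix hγ (isEvenFor_self hγ) r.1, rfl⟩

/-- The map `G̲ × N_η^ρ → 𝒯^{γ̇,η}`. -/
def qη (hγ : D.IsEven γ) (hη : D.IsEvenFor γ η) (r : D.GN γ η ρ) : D.TFix γ η ρ :=
  ⟨D.qT (ιT hγ hη r), qT_ιT_mem hγ hη r⟩

theorem qη_val (hγ : D.IsEven γ) (hη : D.IsEvenFor γ η) (r : D.GN γ η ρ) :
    (qη hγ hη r).1.1 = (((gT hγ η r.1 : D.GK) : D.Gr), mkN hγ γ (r.1 • r.2.1)) := qT_ιT hγ hη r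

theorem qη_surjective (hγ : D.IsEven γ) (hη : D.IsEvenFor γ η) :
    Function.Surjective (qη hγ hη : D.GN γ η ρ → D.TFix γ η ρ) := by
  rintro ⟨t, ht, k, hk, htk⟩
  obtain ⟨β, rfl⟩ := exists_mkG_eq hγ hk
  obtain ⟨ν, hν⟩ := exists_mkN_eq hγ (n := t.1.2) (fun τ => congrArg D.π (ht τ))
  have hmem : β⁻¹ • ν ∈ D.Nη γ η ρ := by
    rw [← mkN_mem_NO_iff hγ hη]
    obtain ⟨g, hg, hgn⟩ := t.2
    have h1 : (gT hγ η β)⁻¹ * g ∈ D.GO := QuotientGroup.eq.mp (htk.symm.trans hg.symm)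
    have h2 := smul_mem_NO_of_mem_GO h1 hgn
    have h3 : (D.inclGK (gT hγ η β))⁻¹ • mkN hγ γ ν = mkN hγ η (β⁻¹ • ν) := by
      rw [inv_smul_eq_iff, gT_smul_mkN hγ hη, smul_inv_smul]
    rwa [map_mul, mul_smul, smul_inv_smul, ← hν, map_inv, h3] at h2
  refine ⟨(β, ⟨β⁻¹ • ν, hmem⟩), Subtype.ext (Subtype.ext ?_)⟩
  rw [qη_val]
  refine Prod.ext htk.symm ?_
  change mkN hγ γ (β • β⁻¹ • ν) = _
  rw [smul_inv_smul, hν]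

theorem qη_eq_iff (hγ : D.IsEven γ) (hη : D.IsEvenFor γ η) (r r' : D.GN γ η ρ) :
    qη hγ hη r = qη hγ hη r' ↔ qX r = qX r' := by
  have h1 : ((gT hγ η r.1 : D.GK) : D.Gr) = ((gT hγ η r'.1 : D.GK) : D.Gr) ↔
      r.1 • D.stdFlag γ η = r'.1 • D.stdFlag γ η := by
    rw [QuotientGroup.eq, gT_inv_mul hγ hη, mkG_mem_GO_iff, mem_Pu_iff_stdFlag hγ hη, mul_smul,
      inv_smul_eq_iff, eq_comm]
  rw [Subtype.ext_iff, Subtype.ext_iff, qη_val, qη_val, Prod.ext_iff, Subtype.ext_iff, qX_val, qX_val,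
    Prod.ext_iff]
  exact and_congr h1 (mkN_injective hγ γ).eq_iff

/-- The bijection of `𝒯^{γ̇,η}` with `𝒳_η^ρ`. -/
def eT (hγ : D.IsEven γ) (hη : D.IsEvenFor γ η) (ρ : Cow D.l) : D.TFix γ η ρ ≃ D.X γ η ρ where
  toFun t := qX (Function.surjInv (qη_surjective hγ hη) t)
  invFun y := qη hγ hη (Function.surjInv qX_surjective y)
  left_inv t := by
    refine Eq.trans ?_ (Function.surjInv_eq (qη_surjective hγ hη) t)
    rw [qη_eq_iff, Function.surjInv_eq qX_surjective]
  right_inv y := by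
    refine Eq.trans ?_ (Function.surjInv_eq qX_surjective y)
    rw [← qη_eq_iff hγ hη, Function.surjInv_eq (qη_surjective hγ hη)]

theorem eT_qη (hγ : D.IsEven γ) (hη : D.IsEvenFor γ η) (r : D.GN γ η ρ) :
    eT hγ hη ρ (qη hγ hη r) = qX r := by
  refine (qη_eq_iff hγ hη _ _).mp ?_
  rw [Function.surjInv_eq (qη_surjective hγ hη)]

theorem eT_symm_qX (hγ : D.IsEven γ) (hη : D.IsEvenFor γ η) (r : D.GN γ η ρ) :
    (eT hγ hη ρ).symm (qX r) = qη hγ hη r := by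
  rw [Equiv.symm_apply_eq, eT_qη]

theorem smul_qη (hγ : D.IsEven γ) (hη : D.IsEvenFor γ η) (x : D.GKtFix γ) (r : D.GN γ η ρ) :
    x • qη hγ hη r = qη hγ hη ((evEquiv hγ x).left * D.tU γ (evEquiv hγ x).right * r.1,
      ⟨D.wAct (evEquiv hγ x).right r.2.1, D.wAct_mem_Nη _ r.2.2⟩) := by
  refine Subtype.ext (Subtype.ext (Prod.ext ?_ ?_))
  · change x.1 • ((gT hγ η r.1 : D.GK) : D.Gr) = ((gT hγ η _ : D.GK) : D.Gr)
    rw [smul_mk, map_mul, rotGK_mkG, ← mkG_evEquiv_left hγ, ← evEquiv_right hγ]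
    change ((_ * (_ * D.rotGK _ (D.zPow _)) : D.GK) : D.Gr) = _
    rw [rotGK_zPow, ← mul_assoc, ← mul_assoc, ← map_mul]
    have h1 : ∀ u, ((gT hγ η ((evEquiv hγ x).left * (D.tU γ (evEquiv hγ x).right * r.1 *
        (D.tU γ (evEquiv hγ x).right)⁻¹)) * D.constGK u : D.GK) : D.Gr) =
        ((gT hγ η ((evEquiv hγ x).left * D.tU γ (evEquiv hγ x).right * r.1) : D.GK) : D.Gr) := by
      refine fun u => QuotientGroup.eq.mpr ?_
      rw [mul_inv_rev, mul_assoc, gT_inv_mul hγ hη]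
      refine mul_mem (inv_mem (D.constGK_mem_GO _)) ((mkG_mem_GO_iff hγ hη).mpr ?_)
      have h2 : ((evEquiv hγ x).left * (D.tU γ (evEquiv hγ x).right * r.1 *
          (D.tU γ (evEquiv hγ x).right)⁻¹))⁻¹ * ((evEquiv hγ x).left * D.tU γ (evEquiv hγ x).right * r.1) =
          D.tU γ (evEquiv hγ x).right := by group
      rw [h2]
      exact (mem_Pu_iff_stdFlag hγ hη).mpr (tU_smul_stdFlag _)
    exact h1 _
  · have h1 := congrArg (fun p : D.X γ η ρ => p.1.2) (smul_qX (evEquiv hγ x) r)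
    change D.incl x.1 • (qη hγ hη r).1.1.2 = _
    rw [qη_val, qη_val, smul_mkN]
    exact congrArg (mkN hγ γ) h1

theorem eT_smul (hγ : D.IsEven γ) (hη : D.IsEvenFor γ η) (x : D.GKtFix γ) (t : D.TFix γ η ρ) :
    eT hγ hη ρ (x • t) = evEquiv hγ x • eT hγ hη ρ t := by
  obtain ⟨r, rfl⟩ := qη_surjective hγ hη t
  rw [smul_qη, eT_qη, eT_qη, smul_qX]

theorem evN_πFix (hγ : D.IsEven γ) (hη : D.IsEvenFor γ η) (t : D.TFix γ η ρ) :
    evN hγ (D.πFix γ η ρ t) = (eT hγ hη ρ t).1.2 := by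
  obtain ⟨r, rfl⟩ := qη_surjective hγ hη t
  rw [eT_qη]
  apply mkN_injective hγ γ
  rw [mkN_evN]
  exact congrArg Prod.snd (qη_val hγ hη r)

end Datum

end FixedLocus
end

open scoped Topology
noncomputable section
namespace FixedLocus
open FunSp

/-- A matrix that is unitriangular with respect to weights is invertible. -/
theorem isUnit_of_unitriangular {κ : Type} [Fintype κ] [DecidableEq κ] (w : κ → ℤ) {M : Matrix κ κ ℂ}
    (h : ∀ u s, w u ≤ w s → M u s = if u = s then 1 else 0) : IsUnit M := by
  have h1 : ∀ v : κ → ℂ, M.mulVec v = 0 → v = 0 := by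
    intro v hv
    by_contra hne
    obtain ⟨t₀, ht₀⟩ := Function.ne_iff.mp hne
    obtain ⟨t, ht, hmin⟩ := Finset.exists_min_image (Finset.univ.filter fun t => v t ≠ 0) w
      ⟨t₀, by simpa using ht₀⟩
    simp only [Finset.mem_filter, Finset.mem_univ, true_and] at ht hmin
    have h3 : ∑ s, M t s * v s = 0 := congrFun hv t
    rw [Finset.sum_eq_single t] at h3
    · rw [h t t le_rfl, if_pos rfl, one_mul] at h3
      exact ht h3
    · intro s _ hst
      by_cases hs : v s = 0
      · rw [hs, mul_zero]
      · rw [h t s (hmin s hs), if_neg hst.symm, zero_mul]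
    · simp
  refine Matrix.mulVec_injective_iff_isUnit.mp fun v v' hvw => ?_
  exact sub_eq_zero.mp (h1 _ (by rw [Matrix.mulVec_sub, hvw, sub_self]))

theorem transversal_one {n : ℕ} : Transversal (1 : GL (Fin n) LS) := by
  have h1 : ∀ v : KV n, ((1 : GL (Fin n) LS)⁻¹).1.mulVec v = v := fun v => by
    rw [inv_one, Units.val_one, Matrix.one_mulVec]
  refine ⟨fun v hv hv' => ?_, fun w => ?_⟩
  · rw [h1] at hv
    funext t
    ext k
    rcases lt_or_ge k 0 with hk | hk
    · exact hv t k (by simpa using hk)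
    · exact hv' t k hk
  · have hpos : ∀ f : LS, ∃ f' : LS, IsBdd 0 f' ∧ ∀ k, 0 ≤ k → (f' - f).coeff k = 0 := fun f => by
      refine ⟨mkLS (fun k => if k < 0 then 0 else f.coeff k) 0 fun k hk => if_pos hk, fun k hk => ?_,
        fun k hk => ?_⟩
      · exact (mkLS_coeff _ _ _ _).trans (if_pos (by simpa using hk))
      · rw [HahnSeries.coeff_sub, mkLS_coeff, if_neg (not_lt.mpr hk), sub_self]
    choose f hf hf' using hpos
    refine ⟨fun t => f (w t), ?_, fun t k hk => hf' (w t) k hk⟩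
    rw [h1]
    exact fun t => hf (w t)

variable {I : Type} [Fintype I] [DecidableEq I]

namespace Datum

variable {D : Datum I} {γ η : Cow D.a} {ρ : Cow D.l}

/-! ### The algebraic structure of the fixed locus -/

/-- The algebraic structure on a piece of `G_K × N_O`. -/
abbrev funGKN (D : Datum I) (N : ℕ) : FunSp {p : D.GK × D.NO // p.1 ∈ D.GKbdd N} :=
  FunSp.coord fun p => D.coordGN p.1

theorem regGK_GKN {N : ℕ} (p : {p : D.GK × D.NO // p.1 ∈ D.GKbdd N}) :
    RegGK (D.funGKN N) p fun p => p.1.1 := fun k => regAt_coord _ (Sum.inl k) p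

theorem regNK_GKN {N : ℕ} (p : {p : D.GK × D.NO // p.1 ∈ D.GKbdd N}) :
    RegNK (D.funGKN N) p fun p => p.1.2.1 := fun k => regAt_coord _ (Sum.inr k) p

theorem good_TSub (Y : Set D.T) : (D.funTSub Y).Good :=
  good_coinduced _ fun _ => ((good_coord _).quotient _).induced _

theorem good_PT : (D.funPT γ η ρ).Good := good_coinduced _ fun _ => good_coord _

theorem isOpen_TSub (Y : Set D.T) {V : Set D.T}
    (h : ∀ N, IsOpen[(D.funGKN N).top] {p | D.qT p.1 ∈ V}) :
    IsOpen[(D.funTSub Y).top] {t | t.1 ∈ V} := by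
  refine (isOpen_coinduced _ _).mpr fun N => ?_
  have h1 : IsOpen[(D.funTN N).top] {t | t.1 ∈ V} := (isOpen_coinduced _ _).mpr fun _ => h N
  exact isOpen_induced Subtype.val (D.funTN N) h1

theorem regAt_TSub {Y : Set D.T} {V : Set D.T} (h : ∀ N, IsOpen[(D.funGKN N).top] {p | D.qT p.1 ∈ V})
    {F : D.T → ℂ}
    (hF : ∀ N (p : {p : D.GK × D.NO // p.1 ∈ D.GKbdd N}), D.qT p.1 ∈ V →
      (D.funGKN N).RegAt (fun p => F (D.qT p.1)) p) {t : Y} (ht : t.1 ∈ V) :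
    (D.funTSub Y).RegAt (fun t => F t.1) t := by
  refine regAt_coinduced (isOpen_TSub Y h) (fun N t ht => ?_) ht
  have h1 : IsOpen[(D.funTN N).top] {t | t.1 ∈ V} := (isOpen_coinduced _ _).mpr fun _ => h N
  have h2 : (D.funTN N).RegAt (fun t => F t.1) t.1 :=
    regAt_coinduced h1 (fun _ p hp => hF N p hp) ht
  exact (isMor_induced Subtype.val (D.funTN N)).2 _ t h2

theorem isOpen_univ_GKN (N : ℕ) : IsOpen[(D.funGKN N).top] {p | D.qT p.1 ∈ (Set.univ : Set D.T)} :=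
  @isOpen_univ _ (D.funGKN N).top

theorem regNK_π {Y : Set D.T} (t : Y) : RegNK (D.funTSub Y) t fun t => D.π t.1 := fun k =>
  regAt_TSub (F := fun t => D.coordNK (D.π t) k) isOpen_univ_GKN
    (fun _ p _ => regNK_smul (fun p => p.2) (fun p => p.1.2.2) (regGK_GKN p) (regNK_GKN p) k)
    (Set.mem_univ _)

theorem regNu_evN_πFix (hγ : D.IsEven γ) (t : D.TFix γ η ρ) :
    RegNu (D.funTSub (D.TFix γ η ρ)) t fun t => evN hγ (D.πFix γ η ρ t) := by
  refine regNu_of_mkN (η := γ) hγ ?_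
  have : (fun t : D.TFix γ η ρ => mkN hγ γ (evN hγ (D.πFix γ η ρ t))) = fun t => D.π t.1 :=
    funext fun t => mkN_evN hγ _
  rw [this]
  exact regNK_π t

/-- The elements `g z^{η̂ - γ̂}` have uniformly bounded poles. -/
theorem exists_gT_mem_GKbdd (hγ : D.IsEven γ) (η : Cow D.a) :
    ∃ N, ∀ β : D.Gu γ, gT hγ η β ∈ D.GKbdd N := by
  obtain ⟨N, hN⟩ := exists_mkG_mem_GKbdd hγ (isEvenFor_self hγ)
  obtain ⟨M, hM⟩ := exists_mem_GKbdd (zη γ η : D.GK)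
  exact ⟨N + M, fun β => GKbdd_mul (hN β) hM⟩

theorem regGK_gT (hγ : D.IsEven γ) (η : Cow D.a) {Y : Type} {S : FunSp Y} {y : Y} {G : Y → D.Gu γ}
    (h : RegGu S y G) : RegGK S y fun y => gT hγ η (G y) := by
  obtain ⟨N, hN⟩ := exists_mkG_mem_GKbdd hγ (isEvenFor_self hγ)
  obtain ⟨M, hM⟩ := exists_mem_GKbdd (zη γ η : D.GK)
  exact RegGK.mul (fun y => hN (G y)) (fun _ => hM) (regGK_mkG hγ _ h) (RegGK.const _)

theorem isMor_ιT (hγ : D.IsEven γ) (hη : D.IsEvenFor γ η) {N : ℕ} (hN : ∀ β : D.Gu γ, gT hγ η β ∈ D.GKbdd N) :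
    IsMor (D.funGN γ η ρ) (D.funGKN N) fun r => ⟨ιT hγ hη r, hN r.1⟩ := by
  refine isMor_to_coord good_GN fun k r => ?_
  rcases k with k | k
  · exact regGK_gT hγ η (regGu_GN r) k
  · exact regNK_mkN (η := η) hγ (regNu_GN r) k

theorem isMor_qη (hγ : D.IsEven γ) (hη : D.IsEvenFor γ η) :
    IsMor (D.funGN γ η ρ) (D.funTSub (D.TFix γ η ρ)) (qη hγ hη) := by
  obtain ⟨N, hN⟩ := exists_gT_mem_GKbdd hγ η
  have h1 : IsMor (D.funGN γ η ρ) (D.funTN N)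
      fun r => ⟨D.qT (ιT hγ hη r), ιT hγ hη r, hN r.1, rfl⟩ :=
    (isMor_quotient (fun p : {p : D.GK × D.NO // p.1 ∈ D.GKbdd N} =>
      (⟨D.qT p.1, p.1, p.2, rfl⟩ : D.TN N)) (D.funGKN N)).comp (isMor_ιT hγ hη hN)
  have h2 : IsMor (D.funGN γ η ρ) (FunSp.induced Subtype.val (D.funTN N))
      fun r => (⟨⟨D.qT (ιT hγ hη r), ιT hγ hη r, hN r.1, rfl⟩, qT_ιT_mem hγ hη r⟩ :
        {t : D.TN N // t.1 ∈ D.TFix γ η ρ}) :=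
    isMor_iff.mpr fun r => isMorAt_to_induced good_GN (h1.at r)
  exact (isMorAt_to_coinduced (ι := ℕ) (X := fun N => {t : D.TN N // t.1 ∈ D.TFix γ η ρ})
    (fun _ t => (⟨t.1.1, t.2⟩ : D.TFix γ η ρ)) (fun N => FunSp.induced Subtype.val (D.funTN N)) N).comp h2

theorem isMor_ιPT (hγ : D.IsEven γ) (hη : D.IsEvenFor γ η) :
    IsMor (D.funGN γ η ρ) (D.funPT γ η ρ) fun r => ⟨ιT hγ hη r, qT_ιT_mem hγ hη r⟩ := by
  obtain ⟨N, hN⟩ := exists_gT_mem_GKbdd hγ η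
  have h1 : IsMor (D.funGN γ η ρ) (FunSp.coord fun p => D.coordGN p.1.1)
      fun r => (⟨⟨ιT hγ hη r, qT_ιT_mem hγ hη r⟩, hN r.1⟩ : {p : D.PT γ η ρ // p.1.1 ∈ D.GKbdd N}) := by
    refine isMor_to_coord good_GN fun k r => ?_
    rcases k with k | k
    · exact regGK_gT hγ η (regGu_GN r) k
    · exact regNK_mkN (η := η) hγ (regNu_GN r) k
  exact (isMorAt_to_coinduced (ι := ℕ) (X := fun N => {p : D.PT γ η ρ // p.1.1 ∈ D.GKbdd N})
    (fun _ p => p.1) (fun _ => FunSp.coord fun p => D.coordGN p.1.1) N).comp h1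

/-! ### Local sections over the fixed locus -/

theorem isInt_inv_mul_mulVec {h k : D.GK} (hk : k ∈ D.GO) {i : I} {v : KV (D.a i)}
    (hv : IsInt ((h i)⁻¹.1.mulVec v)) : IsInt (((h * k) i)⁻¹.1.mulVec v) := by
  have h1 : ((h * k) i)⁻¹.1 = (k i)⁻¹.1 * (h i)⁻¹.1 := congrArg Units.val (mul_inv_rev (h i) (k i))
  rw [h1, ← Matrix.mulVec_mulVec]
  exact IsBdd.mulVec (fun a b => (mem_GO_iff.mp hk i a b).2) hv

/-- The condition on the lattice `L` of a point of `𝒯` that `h₀⁻¹ L` is a complement of the polar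
vectors. -/
def cell (h₀ : D.GK) : Set D.T :=
  {t | ∀ g : D.GK, (g : D.Gr) = t.1.1 → ∀ i, Transversal ((h₀⁻¹ * g) i)}

theorem isInt_of_mk_eq {h₀ g g' : D.GK} (hg : (g : D.Gr) = (g' : D.Gr)) {i : I} {v : KV (D.a i)}
    (hv : IsInt (((h₀⁻¹ * g) i)⁻¹.1.mulVec v)) : IsInt (((h₀⁻¹ * g') i)⁻¹.1.mulVec v) := by
  have h := isInt_inv_mul_mulVec (QuotientGroup.eq.mp hg) hv
  rwa [mul_assoc, mul_inv_cancel_left] at h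

theorem transversal_of_mk_eq {h₀ g g' : D.GK} (hg : (g : D.Gr) = (g' : D.Gr)) {i : I}
    (h : Transversal ((h₀⁻¹ * g) i)) : Transversal ((h₀⁻¹ * g') i) where
  inj v hv := h.inj v (isInt_of_mk_eq hg.symm hv)
  surj w := by
    obtain ⟨v, hv, hv'⟩ := h.surj w
    exact ⟨v, isInt_of_mk_eq hg hv, hv'⟩

theorem mem_cell_iff {h₀ g : D.GK} {t : D.T} (hg : (g : D.Gr) = t.1.1) :
    t ∈ cell h₀ ↔ ∀ i, Transversal ((h₀⁻¹ * g) i) :=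
  ⟨fun h => h g hg, fun h _ hg' i => transversal_of_mk_eq (hg.trans hg'.symm) (h i)⟩

theorem exists_bdd_GKN (h₀ : D.GK) (N : ℕ) : ∃ M, ∀ p : {p : D.GK × D.NO // p.1 ∈ D.GKbdd N},
    h₀⁻¹ * p.1.1 ∈ D.GKbdd M := by
  obtain ⟨M, hM⟩ := exists_mem_GKbdd h₀⁻¹
  exact ⟨M + N, fun p => GKbdd_mul hM p.2⟩

theorem regGK_inv_mul_GKN (h₀ : D.GK) {N : ℕ} (p : {p : D.GK × D.NO // p.1 ∈ D.GKbdd N}) :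
    RegGK (D.funGKN N) p fun p => h₀⁻¹ * p.1.1 := by
  obtain ⟨M, hM⟩ := exists_mem_GKbdd h₀⁻¹
  exact RegGK.mul (fun _ => hM) (fun p => p.2) (RegGK.const _) (regGK_GKN p)

theorem isOpen_cell (h₀ : D.GK) (N : ℕ) : IsOpen[(D.funGKN N).top] {p | D.qT p.1 ∈ cell h₀} := by
  obtain ⟨M, hM⟩ := exists_bdd_GKN h₀ N
  have h1 : {p : {p : D.GK × D.NO // p.1 ∈ D.GKbdd N} | D.qT p.1 ∈ cell h₀} =
      ⋂ i, {p | Transversal ((h₀⁻¹ * p.1.1) i)} := by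
    ext p
    rw [Set.mem_iInter]
    exact mem_cell_iff (g := p.1.1) (t := D.qT p.1) rfl
  rw [h1]
  refine @isOpen_iInter_of_finite _ _ (D.funGKN N).top _ _ fun i => ?_
  refine (isOpen_iff_nhds _ _).mpr fun p hp => ?_
  have h2 := regGK_inv_mul_GKN h₀ p
  let G : {p : D.GK × D.NO // p.1 ∈ D.GKbdd N} → GL (Fin (D.a i)) LS := fun p => (h₀⁻¹ * p.1.1) i
  have h3 := Transversal.nhds (S := D.funGKN N) (y := p) (G := G) (good_coord _)
    (fun p s t => (hM p i s t).1) (fun p s t => (hM p i s t).2)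
  exact h3 (h2.val i) (h2.inv_val i) hp

theorem exists_frame (h₀ : D.GK) : ∃ l : D.T → ∀ i, Fin (D.a i) → KV (D.a i), ∀ t ∈ cell h₀, ∀ g : D.GK,
    (g : D.Gr) = t.1.1 → ∀ i s, IsInt (((h₀⁻¹ * g) i)⁻¹.1.mulVec (l t i s)) ∧
      IsPolar (l t i s - zvec s 0) := by
  classical
  have : ∀ t : D.T, ∃ l : ∀ i, Fin (D.a i) → KV (D.a i), t ∈ cell h₀ → ∀ g : D.GK,
      (g : D.Gr) = t.1.1 → ∀ i s, IsInt (((h₀⁻¹ * g) i)⁻¹.1.mulVec (l i s)) ∧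
        IsPolar (l i s - zvec s 0) := by
    intro t
    by_cases ht : t ∈ cell h₀
    · obtain ⟨g, hg⟩ := QuotientGroup.mk_surjective t.1.1
      choose l hl hl' using fun i (s : Fin (D.a i)) => (ht g hg i).surj (zvec s 0)
      exact ⟨l, fun _ g' hg' i s => ⟨isInt_of_mk_eq (hg.trans hg'.symm) (hl i s), hl' i s⟩⟩
    · exact ⟨fun _ _ => 0, fun h => absurd h ht⟩
  choose l hl using this
  exact ⟨l, hl⟩

theorem regAt_frame {h₀ : D.GK} {l : D.T → ∀ i, Fin (D.a i) → KV (D.a i)}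
    (hl : ∀ t ∈ cell h₀, ∀ g : D.GK, (g : D.Gr) = t.1.1 → ∀ i s,
      IsInt (((h₀⁻¹ * g) i)⁻¹.1.mulVec (l t i s)) ∧ IsPolar (l t i s - zvec s 0))
    {Y : Set D.T} {t : Y} (ht : t.1 ∈ cell h₀) (i : I) (s u : Fin (D.a i)) (k : ℤ) :
    (D.funTSub Y).RegAt (fun t => (l t.1 i s u).coeff k) t := by
  refine regAt_TSub (F := fun t => (l t i s u).coeff k) (isOpen_cell h₀) (fun N p hp => ?_) ht
  obtain ⟨M, hM⟩ := exists_bdd_GKN h₀ N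
  have h2 := regGK_inv_mul_GKN h₀ p
  let G : {p : D.GK × D.NO // p.1 ∈ D.GKbdd N} → GL (Fin (D.a i)) LS := fun p => (h₀⁻¹ * p.1.1) i
  have h3 := Transversal.regAt (S := D.funGKN N) (y := p) (G := G) (good_coord _)
    (fun p s t => (hM p i s t).1) (fun p s t => (hM p i s t).2)
  have h4 := h3 (h2.inv_val i) ((mem_cell_iff (g := p.1.1) (t := D.qT p.1) rfl).mp hp i) (s := s)
    (l := fun p => l (D.qT p.1) i s) (isOpen_cell h₀ N) hp
  exact h4 (fun p' hp' => (hl (D.qT p'.1) hp' p'.1.1 rfl i s).1)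
    (fun p' hp' => (hl (D.qT p'.1) hp' p'.1.1 rfl i s).2) u k

/-- The leading coefficients of the image of an integral vector under an element `mkG b`. -/
theorem coeff_mkG_mulVec (hγ : D.IsEven γ) (hη : D.IsEvenFor γ η) (b : D.Gu γ) (x : D.Iu) (s u : D.J γ x)
    (y : KV (D.a x.1.1)) :
    ((mkG hγ hη b x.1.1).1.mulVec y u.1).coeff (D.hat η x.1.1 s.1 - D.hat η x.1.1 u.1) =
      ∑ w : D.J γ x, (b x).1 u w * (y w.1).coeff (D.hat η x.1.1 s.1 - D.hat η x.1.1 w.1) := by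
  classical
  have h1 : ∀ w : D.J γ x, (mkG hγ hη b x.1.1).1 u.1 w.1 =
      HahnSeries.single (D.hat η x.1.1 w.1 - D.hat η x.1.1 u.1) ((b x).1 u w) := fun w => by
    ext k
    rw [mkG_coeff_J, HahnSeries.coeff_single]
    congr
  have h2 : ∀ w : Fin (D.a x.1.1), ¬ D.wt γ x.1.1 w ≡ x.1.2 [ZMOD 2 * D.d x.1.1] →
      (mkG hγ hη b x.1.1).1 u.1 w = 0 := fun w hw => by
    ext k
    rw [mkG_coeff]
    split_ifs with h
    · by_contra hc
      exact hw ((blk_ne_zero hc).symm.trans u.2)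
    · rfl
  have h3 : (mkG hγ hη b x.1.1).1.mulVec y u.1 = ∑ w : D.J γ x, (mkG hγ hη b x.1.1).1 u.1 w.1 * y w.1 := by
    change ∑ w, (mkG hγ hη b x.1.1).1 u.1 w * y w = _
    refine (Fintype.sum_subtype_add_sum_subtype
      (fun w => D.wt γ x.1.1 w ≡ x.1.2 [ZMOD 2 * D.d x.1.1]) _).symm.trans ?_
    refine (congrArg (_ + ·) (Finset.sum_eq_zero fun w _ => ?_)).trans (add_zero _)
    rw [h2 w.1 w.2, zero_mul]
  rw [h3, HahnSeries.coeff_sum]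
  refine Finset.sum_congr rfl fun w _ => ?_
  rw [h1, coeff_single_mul']
  congr 2
  ring

theorem exists_adapted_lift (hγ : D.IsEven γ) (hη : D.IsEvenFor γ η) (β₀ : D.Gu γ)
    {l : D.T → ∀ i, Fin (D.a i) → KV (D.a i)}
    (hl : ∀ t ∈ cell (gT hγ η β₀), ∀ g : D.GK, (g : D.Gr) = t.1.1 → ∀ i s,
      IsInt ((((gT hγ η β₀)⁻¹ * g) i)⁻¹.1.mulVec (l t i s)) ∧ IsPolar (l t i s - zvec s 0))
    (t : D.TFix γ η ρ) : ∃ r : D.GN γ η ρ, qη hγ hη r = t ∧ (t.1 ∈ cell (gT hγ η β₀) → ∀ x (u s : D.J γ x),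
      ((β₀⁻¹ * r.1) x).1 u s = (l t.1 x.1.1 s.1 u.1).coeff (D.hat η x.1.1 s.1 - D.hat η x.1.1 u.1)) := by
  classical
  obtain ⟨r, rfl⟩ := qη_surjective hγ hη t
  by_cases ht : (qη hγ hη r).1 ∈ cell (gT hγ η β₀)
  swap
  · exact ⟨r, rfl, fun h => absurd h ht⟩
  generalize hb : β₀⁻¹ * r.1 = b
  have hl1 := hl (qη hγ hη r).1 ht (gT hγ η r.1) rfl
  rw [gT_inv_mul hγ hη, hb] at hl1
  generalize l (qη hγ hη r).1 = l at hl1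
  set y : ∀ i, Fin (D.a i) → KV (D.a i) := fun i s => (mkG hγ hη b i)⁻¹.1.mulVec (l i s) with hy
  have hly : ∀ i s, (mkG hγ hη b i).1.mulVec (y i s) = l i s := fun i s => by
    rw [hy, Matrix.mulVec_mulVec, Units.mul_inv, Matrix.one_mulVec]
  let G : ∀ x : D.Iu, Matrix (D.J γ x) (D.J γ x) ℂ := fun x => Matrix.of fun u s =>
    (l x.1.1 s.1 u.1).coeff (D.hat η x.1.1 s.1 - D.hat η x.1.1 u.1)
  let Y : ∀ x : D.Iu, Matrix (D.J γ x) (D.J γ x) ℂ := fun x => Matrix.of fun u s =>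
    (y x.1.1 s.1 u.1).coeff (D.hat η x.1.1 s.1 - D.hat η x.1.1 u.1)
  have hGY : ∀ x, G x = (b x).1 * Y x := fun x => by
    ext u s
    change (l x.1.1 s.1 u.1).coeff _ = _
    rw [← hly, coeff_mkG_mulVec]
    rfl
  have hG : ∀ x, IsUnit (G x) := fun x => by
    refine isUnit_of_unitriangular (fun u => D.hat η x.1.1 u.1) fun u s hus => ?_
    have h1 := (hl1 x.1.1 s.1).2 u.1 _ (sub_nonneg.mpr hus)
    rw [Pi.sub_apply, HahnSeries.coeff_sub, sub_eq_zero] at h1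
    refine h1.trans ?_
    split_ifs with h
    · subst h
      rw [sub_self, zvec_same]
      exact HahnSeries.coeff_single_same _ _
    · rw [zvec, Pi.single_eq_of_ne fun h' => h (Subtype.ext h')]
      rfl
  have hY : ∀ x, IsUnit (Y x) := fun x => by
    have h1 : Y x = (b x)⁻¹.1 * G x := by
      rw [hGY, ← Matrix.mul_assoc, Units.inv_mul, Matrix.one_mul]
    rw [h1]
    exact (b x)⁻¹.isUnit.mul (hG x)
  let p : D.Gu γ := fun x => (hY x).unit
  have hp : p ∈ D.Pu γ η := mem_Pu_iff.mpr fun x u s hus => by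
    by_contra hc
    exact hus ((hl1 x.1.1 s.1).1 u.1 _ (by simpa using hc))
  refine ⟨kaX hγ hη ⟨p⁻¹, inv_mem hp⟩ r, ?_, fun _ x u s => ?_⟩
  · rw [qη_eq_iff]
    exact (bundleX hγ hη ρ).q_ka _ r
  · change ((β₀⁻¹ * (r.1 * p⁻¹⁻¹)) x).1 u s = G x u s
    rw [inv_inv, ← mul_assoc, hb, hGY]
    rfl

theorem hasSections_qη (hγ : D.IsEven γ) (hη : D.IsEvenFor γ η) :
    HasSections (D.funGN γ η ρ) (D.funTSub (D.TFix γ η ρ)) (qη hγ hη) := by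
  intro t₀
  obtain ⟨r₀, rfl⟩ := qη_surjective hγ hη t₀
  obtain ⟨l, hl⟩ := exists_frame (gT hγ η r₀.1)
  choose σ hσ hσ' using exists_adapted_lift (ρ := ρ) hγ hη r₀.1 hl
  have hopen := isOpen_TSub (D.TFix γ η ρ) (isOpen_cell (gT hγ η r₀.1))
  refine ⟨_, σ, hopen, ?_, fun t ht => ⟨hσ t, ?_⟩⟩
  · refine (mem_cell_iff (g := gT hγ η r₀.1) (t := (qη hγ hη r₀).1) rfl).mpr fun i => ?_
    rw [inv_mul_cancel]
    exact transversal_one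
  · have h1 : RegGu (D.funTSub (D.TFix γ η ρ)) t fun t => r₀.1⁻¹ * (σ t).1 :=
      RegGu.of_val (good_TSub _) fun x u s => (good_TSub _).loc _ hopen ht
        (fun t' ht' => (hσ' t' ht' x u s).symm) (regAt_frame hl ht x.1.1 s.1 u.1 _)
    have h2 : RegGu (D.funTSub (D.TFix γ η ρ)) t fun t => (σ t).1 := by
      have := (RegGu.const r₀.1).mul h1
      simpa only [mul_inv_cancel_left] using this
    refine isMorAt_to_GN (good_TSub _) h2 ?_
    have h3 := RegNu.smul h2.inv (regNu_evN_πFix hγ t)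
    have h4 : (fun t => (σ t).2.1) = fun t => (σ t).1⁻¹ • evN hγ (D.πFix γ η ρ t) := funext fun t => by
      have h5 : evN hγ (D.πFix γ η ρ t) = (σ t).1 • (σ t).2.1 := by
        conv_lhs => rw [← hσ t]
        rw [evN_πFix hγ hη, eT_qη]
        exact congrArg Prod.snd (qX_val _)
      rw [h5, inv_smul_smul]
    rw [h4]
    exact h3

theorem isIso_eT (hγ : D.IsEven γ) (hη : D.IsEvenFor γ η) :
    IsIso (D.funTSub (D.TFix γ η ρ)) (D.funX γ η ρ) (eT hγ hη ρ) :=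
  ⟨(hasSections_qη hγ hη).isMor_desc (good_TSub _) isMor_qX (eT_qη hγ hη),
    hasSections_qX.isMor_desc good_X (isMor_qη hγ hη) (eT_symm_qX hγ hη)⟩

/-! ### The induced classes -/

/-- The quotient map to the fixed locus. -/
abbrev qPT (p : D.PT γ η ρ) : D.TFix γ η ρ := ⟨D.qT p.1, p.2⟩

/-- The action of `G_O` on the preimage of the fixed locus. -/
abbrev kaT (k : D.GO) (p p' : D.PT γ η ρ) : Prop :=
  p'.1.1 = p.1.1 * k.1⁻¹ ∧ p'.1.2.1 = D.inclGK k.1 • p.1.2.1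

/-- The action of `(G_O)^γ̃` on the preimage of the fixed locus. -/
abbrev haT (h : D.GOFix γ) (p p' : D.PT γ η ρ) : Prop := p'.1.1 = h.1 * p.1.1 ∧ p'.1.2 = p.1.2

theorem isMor_qPT : IsMor (D.funPT γ η ρ) (D.funTSub (D.TFix γ η ρ)) qPT := by
  refine isMor_from_coinduced (good_TSub _) fun N => ?_
  have h0 : IsMor (FunSp.coord fun p : {p : D.PT γ η ρ // p.1.1 ∈ D.GKbdd N} => D.coordGN p.1.1)
      (D.funGKN N) fun p => ⟨p.1.1, p.2⟩ :=
    isMor_to_coord (good_coord _) fun k p => regAt_coord _ k p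
  have h1 : IsMor (FunSp.coord fun p : {p : D.PT γ η ρ // p.1.1 ∈ D.GKbdd N} => D.coordGN p.1.1) (D.funTN N)
      fun p => ⟨D.qT p.1.1, p.1.1, p.2, rfl⟩ :=
    (isMor_quotient (fun p : {p : D.GK × D.NO // p.1 ∈ D.GKbdd N} =>
      (⟨D.qT p.1, p.1, p.2, rfl⟩ : D.TN N)) (D.funGKN N)).comp h0
  have h2 : IsMor (FunSp.coord fun p : {p : D.PT γ η ρ // p.1.1 ∈ D.GKbdd N} => D.coordGN p.1.1)
      (FunSp.induced Subtype.val (D.funTN N))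
      fun p => (⟨⟨D.qT p.1.1, p.1.1, p.2, rfl⟩, p.1.2⟩ : {t : D.TN N // t.1 ∈ D.TFix γ η ρ}) :=
    isMor_iff.mpr fun p => isMorAt_to_induced (good_coord _) (h1.at p)
  exact (isMorAt_to_coinduced (ι := ℕ) (X := fun N => {t : D.TN N // t.1 ∈ D.TFix γ η ρ})
    (fun _ t => (⟨t.1.1, t.2⟩ : D.TFix γ η ρ)) (fun N => FunSp.induced Subtype.val (D.funTN N)) N).comp h2

theorem qPT_of_kaT {k : D.GO} {p p' : D.PT γ η ρ} (h : kaT k p p') : qPT p' = qPT p := by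
  refine Subtype.ext (Subtype.ext (Prod.ext ?_ ?_))
  · change ((p'.1.1 : D.GK) : D.Gr) = ((p.1.1 : D.GK) : D.Gr)
    rw [h.1]
    exact QuotientGroup.mk_mul_of_mem _ (inv_mem k.2)
  · change D.inclGK p'.1.1 • p'.1.2.1 = D.inclGK p.1.1 • p.1.2.1
    rw [h.1, h.2, ← mul_smul, ← map_mul, inv_mul_cancel_right]

theorem exists_kaT {p p' : D.PT γ η ρ} (h : qPT p = qPT p') :
    ∃ k : D.GO, k.1 = p'.1.1⁻¹ * p.1.1 ∧ kaT k p p' := by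
  have h0 : (D.qT p.1).1 = (D.qT p'.1).1 := congrArg (fun t : D.TFix γ η ρ => t.1.1) h
  have h1 : ((p'.1.1 : D.GK) : D.Gr) = ((p.1.1 : D.GK) : D.Gr) := (congrArg Prod.fst h0).symm
  have h2 : D.inclGK p.1.1 • p.1.2.1 = D.inclGK p'.1.1 • p'.1.2.1 := congrArg Prod.snd h0
  refine ⟨⟨_, QuotientGroup.eq.mp h1⟩, rfl, ?_, ?_⟩
  · rw [mul_inv_rev, inv_inv, mul_inv_cancel_left]
  · rw [map_mul, mul_smul, h2, map_inv, inv_smul_smul]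

theorem qPT_of_haT {h : D.GOFix γ} {p p' : D.PT γ η ρ} (hp : haT h p p') : qPT p' = h • qPT p := by
  refine Subtype.ext (Subtype.ext (Prod.ext ?_ ?_))
  · change ((p'.1.1 : D.GK) : D.Gr) = (SemidirectProduct.inl h.1 : D.GKt) • ((p.1.1 : D.GK) : D.Gr)
    rw [hp.1, smul_mk, SemidirectProduct.left_inl, SemidirectProduct.right_inl, map_one]
    rfl
  · change D.inclGK p'.1.1 • p'.1.2.1 = D.inclGK h.1 • D.inclGK p.1.1 • p.1.2.1
    rw [hp.1, hp.2, map_mul, mul_smul]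

theorem exists_haT (h : D.GOFix γ) (p' : D.PT γ η ρ) : ∃ p, haT h p p' := by
  have h1 : D.qT (h.1⁻¹ * p'.1.1, p'.1.2) = (h⁻¹ • qPT p').1 := by
    refine Subtype.ext (Prod.ext ?_ ?_)
    · change ((h.1⁻¹ * p'.1.1 : D.GK) : D.Gr) =
        (SemidirectProduct.inl h.1⁻¹ : D.GKt) • ((p'.1.1 : D.GK) : D.Gr)
      rw [smul_mk, SemidirectProduct.left_inl, SemidirectProduct.right_inl, map_one]
      rfl
    · change D.inclGK (h.1⁻¹ * p'.1.1) • p'.1.2.1 = D.inclGK h.1⁻¹ • D.inclGK p'.1.1 • p'.1.2.1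
      rw [map_mul, mul_smul]
  refine ⟨⟨(h.1⁻¹ * p'.1.1, p'.1.2), ?_⟩, (mul_inv_cancel_left _ _).symm, rfl⟩
  rw [h1]
  exact (h⁻¹ • qPT p').2

/-- The equivariant isomorphism of `𝒯^{γ̇,η}` and `𝒳_η^ρ`. -/
def eqIsoT (hγ : D.IsEven γ) (hη : D.IsEvenFor γ η) (ρ : Cow D.l) :
    EqIso (D.funGOFix γ) (D.funTSub (D.TFix γ η ρ)) (D.funPu γ γ) (D.funX γ η ρ) where
  Ψ := eT hγ hη ρ
  φ := evGO hγ
  hΨ := isIso_eT hγ hη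
  hφ := isIso_evGO hγ
  eqv h t := by
    refine (eT_smul hγ hη (D.inclGOFix γ h) t).trans ?_
    rw [evEquiv_inclGOFix]
    rfl

/-- The reduction of `G_K × N_O` to `G̲ × N_η^ρ` over the fixed locus. -/
def reductionT (hγ : D.IsEven γ) (hη : D.IsEvenFor γ η) (ρ : Cow D.l) :
    Reduction (bundleX hγ hη ρ) (eqIsoT hγ hη ρ) D.funGO (D.funPT γ η ρ) qPT kaT haT where
  ι r := ⟨ιT hγ hη r, qT_ιT_mem hγ hη r⟩
  j := inclGO hγ hη
  good := good_PT
  ι_mor := isMor_ιPT hγ hη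
  j_mor := isMor_inclGO hγ hη
  q_ι r := eT_qη hγ hη r
  ka_mul k k' p p' p'' h h' := by
    constructor
    · rw [h'.1, h.1, mul_assoc, ← mul_inv_rev]
      rfl
    · rw [h'.2, h.2, ← mul_smul, ← map_mul]
      rfl
  ka_inv k p p' h := by
    constructor
    · rw [h.1]
      change p.1.1 = p.1.1 * k.1⁻¹ * k.1⁻¹⁻¹
      rw [inv_inv, inv_mul_cancel_right]
    · rw [h.2]
      change p.1.2.1 = D.inclGK k.1⁻¹ • D.inclGK k.1 • p.1.2.1
      rw [map_inv, inv_smul_smul]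
  q_ka k p p' h := qPT_of_kaT h
  ka_ι k r := by
    constructor
    · change gT hγ η (r.1 * k.1⁻¹) = gT hγ η r.1 * (mkG hγ hη k.1)⁻¹
      rw [← map_inv, gT_mul_mkG]
    · exact (mkG_smul_mkN hγ hη k.1 r.2.1).symm
  of_ι k' r r' h := by
    have h1 : gT hγ η r'.1 = gT hγ η r.1 * k'.1⁻¹ := h.1
    have h2 : mkN hγ η r'.2.1 = D.inclGK k'.1 • mkN hγ η r.2.1 := h.2
    have h3 : k'.1 = mkG hγ hη (r'.1⁻¹ * r.1) := by
      rw [← gT_inv_mul hγ hη, h1]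
      group
    have h4 : r'.1⁻¹ * r.1 ∈ D.Pu γ η := (mkG_mem_GO_iff hγ hη).mp (h3 ▸ k'.2)
    refine ⟨⟨_, h4⟩, Subtype.ext h3.symm, Prod.ext ?_ (Subtype.ext ?_)⟩
    · change r'.1 = r.1 * (r'.1⁻¹ * r.1)⁻¹
      group
    · apply mkN_injective hγ η
      rw [h2, h3, mkG_smul_mkN]
      rfl
  ha_ι h k r p p' hp hk := by
    constructor
    · rw [hp.1, hk.1]
      change h.1 * (gT hγ η r.1 * k.1⁻¹) = gT hγ η ((evGO hγ h).1 * r.1) * k.1⁻¹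
      rw [gT, gT, map_mul, mkG_evGO, ← mul_assoc, ← mul_assoc]
    · rw [hp.2, hk.2]
      rfl
  triv p := by
    classical
    obtain ⟨U, σ, hU, hp, hσ⟩ := hasSections_qη hγ hη (qPT p)
    have hex : ∀ p : D.PT γ η ρ, ∃ k : D.GO, qPT p ∈ U → k.1 = p.1.1⁻¹ * gT hγ η (σ (qPT p)).1 ∧
        kaT k ⟨ιT hγ hη (σ (qPT p)), qT_ιT_mem hγ hη _⟩ p := by
      intro p
      by_cases hr : qPT p ∈ U
      · obtain ⟨k, hk, hk'⟩ := exists_kaT (p := ⟨ιT hγ hη (σ (qPT p)), qT_ιT_mem hγ hη _⟩) (hσ _ hr).1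
        exact ⟨k, fun _ => ⟨hk, hk'⟩⟩
      · exact ⟨1, fun h => absurd h hr⟩
    choose κ hκ using hex
    have hW := isMor_qPT.1 U hU
    have hreg : ∀ p', qPT p' ∈ U → IsMorAt (D.funPT γ η ρ) (D.funGN γ η ρ) (fun p => σ (qPT p)) p' :=
      fun p' hp' => (hσ _ hp').2.comp (isMor_qPT.at p')
    refine ⟨qPT ⁻¹' U, fun p => σ (qPT p), κ, hW, hp, fun p' hp' =>
      ⟨(hκ p' hp').2, hreg p' hp', ?_⟩⟩
    refine isMorAt_from_coinduced (good_coord _) hW (fun N x hx => ?_) hp'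
    refine isMorAt_to_coord (good_coord _) fun k => ?_
    obtain ⟨M, hM⟩ := exists_gT_mem_GKbdd hγ η
    have hx' := (isMorAt_to_coinduced (ι := ℕ) (X := fun N => {p : D.PT γ η ρ // p.1.1 ∈ D.GKbdd N})
      (fun _ p => p.1) (fun _ => FunSp.coord fun p => D.coordGN p.1.1) N)
    have h1 : RegGu (FunSp.coord fun p : {p : D.PT γ η ρ // p.1.1 ∈ D.GKbdd N} => D.coordGN p.1.1) x
        fun p => (σ (qPT p.1)).1 := fun k =>
      ((hreg x.1 hx).comp (hx'.at x)).2 (fun r : D.GN γ η ρ => D.coordGu r.1 k) (regGu_GN _ k)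
    have h2 : RegGK (FunSp.coord fun p : {p : D.PT γ η ρ // p.1.1 ∈ D.GKbdd N} => D.coordGN p.1.1) x
        fun p => p.1.1.1 := fun k => regAt_coord _ (Sum.inl k) x
    have h3 := RegGK.mul (fun p => GKbdd_inv p.2) (fun _ => hM _) h2.inv (regGK_gT hγ η h1) k
    refine (good_coord _).loc _ (hx'.1 _ hW) hx (fun y hy => ?_) h3
    exact congrArg (fun g => D.coordGK g k) (hκ y.1 hy).1.symm

/-- The restriction of the induced sheaf to the fixed locus. -/
def indTCoh (hγ : D.IsEven γ) (hη : D.IsEvenFor γ η) (ρ : Cow D.l) (V : RatRep D.funGO) :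
    EqCoh (D.funGOFix γ) (D.funTSub (D.TFix γ η ρ)) :=
  (eqIsoT hγ hη ρ).symm.transCoh
    ((bundleX hγ hη ρ).indCoh (V.comap (inclGO hγ hη) (isMor_inclGO hγ hη)))

theorem isIndT_indTCoh (hγ : D.IsEven γ) (hη : D.IsEvenFor γ η) (ρ : Cow D.l) (V : RatRep D.funGO) :
    D.IsIndT γ η ρ V (indTCoh hγ hη ρ V).1 := (reductionT hγ hη ρ).trans_ind_isInduced V

theorem kEquiv_cls_of_isIndT (hγ : D.IsEven γ) (hη : D.IsEvenFor γ η) {V : RatRep D.funGO}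
    {F : EqCoh (D.funGOFix γ) (D.funTSub (D.TFix γ η ρ))} (hF : D.IsIndT γ η ρ V F.1) :
    (eqIsoT hγ hη ρ).symm.kEquiv ((bundleX hγ hη ρ).indMap
      (RepRing.comap (inclGO hγ hη) (isMor_inclGO hγ hη) (RepRing.cls V))) = KGroup.cls F := by
  rw [IsRestr.cls_eq hγ hη (isRestr_comap hγ hη V), (bundleX hγ hη ρ).indMap_cls (F := (bundleX hγ hη ρ).indCoh
    (V.comap (inclGO hγ hη) (isMor_inclGO hγ hη))) ((bundleX hγ hη ρ).ind_isInduced _),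
    EqIso.kEquiv_cls _ (F₂ := indTCoh hγ hη ρ V) ((eqIsoT hγ hη ρ).symm.isTransport_trans _)]
  exact IsInduced.cls_eq (fun _ _ _ => qPT_of_haT) exists_haT (isIndT_indTCoh hγ hη ρ V) hF

/-! ### The projection to `N_K` -/

theorem isMor_evN_πFix (hγ : D.IsEven γ) (hη : D.IsEvenFor γ η) :
    IsMor (D.funTSub (D.TFix γ η ρ)) (D.funNu γ ρ) fun t => evN hγ (D.πFix γ η ρ t) := by
  have h : (fun t => evN hγ (D.πFix γ η ρ t)) = fun t => (eT hγ hη ρ t).1.2 :=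
    funext (evN_πFix hγ hη)
  rw [h]
  exact isMor_X_snd.comp (isIso_eT hγ hη).1

theorem isMor_πFix (hγ : D.IsEven γ) (hη : D.IsEvenFor γ η) :
    IsMor (D.funTSub (D.TFix γ η ρ)) (D.funNKSub (D.NKFix γ ρ)) (D.πFix γ η ρ) := by
  have h := (isIso_evN hγ).2.comp (isMor_evN_πFix (ρ := ρ) hγ hη)
  simpa only [Equiv.symm_apply_apply] using h

/-- The map `ℛ^{γ̇,η} → N_γ^ρ`. -/
def πR (hγ : D.IsEven γ) (t : D.RFix γ η ρ) : D.Nη γ γ ρ :=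
  ⟨evN hγ (D.πFix γ η ρ t.1), (mem_NO_iff_evN hγ _).mp t.2⟩

theorem isMor_πR (hγ : D.IsEven γ) (hη : D.IsEvenFor γ η) :
    IsMor (FunSp.induced Subtype.val (D.funTSub (D.TFix γ η ρ)))
      (FunSp.induced Subtype.val (D.funNu γ ρ)) (πR hγ : D.RFix γ η ρ → D.Nη γ γ ρ) :=
  isMor_iff.mpr fun t => isMorAt_to_induced ((good_TSub _).induced _)
    (((isMor_evN_πFix hγ hη).comp (isMor_induced _ _)).at t)

theorem evN_πFix_smul (hγ : D.IsEven γ) (x : D.GKtFix γ) (t : D.TFix γ η ρ) :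
    evN hγ (D.πFix γ η ρ (x • t)) = evEquiv hγ x • evN hγ (D.πFix γ η ρ t) :=
  evN_smul hγ x (D.πFix γ η ρ t)

theorem smul_mem_RFix (hγ : D.IsEven γ) {x : D.GKtFix γ} (hx : x.1.left ∈ D.GO) {t : D.TFix γ η ρ}
    (ht : t ∈ D.RFix γ η ρ) : x • t ∈ D.RFix γ η ρ := by
  have h1 := (mem_NO_iff_evN hγ (D.πFix γ η ρ t)).mp ht
  refine (mem_NO_iff_evN hγ (D.πFix γ η ρ (x • t))).mpr ?_
  rw [evN_πFix_smul]
  exact gut_smul_mem_Nη hγ ((mem_GO_iff_evEquiv hγ x).mp hx) h1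

end Datum

end FixedLocus
end

theorem proposition3 {I : Type} [Fintype I] [DecidableEq I] (D : FixedLocus.Datum I)
    (γ η : FixedLocus.Datum.Cow D.a) (ρ : FixedLocus.Datum.Cow D.l)
    (hγ : D.IsEven γ) (hρ : D.IsEven ρ) (hη : D.IsEvenFor γ η)
    (hγd : D.IsDom γ γ) (hηd : D.IsDom γ η) :
    -- (a): the isomorphism `G̲ ×_{P̲_η} N_η^ρ ≅ 𝒳_η^ρ`
    ∃ e : D.IndVar γ η ρ ≃ D.X γ η ρ,
      FixedLocus.FunSp.IsIso (D.funIndVar γ η ρ) (D.funX γ η ρ) e ∧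
      (∀ (y : D.Gut γ) (t : D.IndVar γ η ρ), e (y • t) = y • e t) ∧
      (∀ (g : D.Gu γ) (n : D.Nη γ η ρ),
        (e (Quot.mk _ (g, n))).1 = (g • D.stdFlag γ η, g • n.1)) ∧
    -- the identifications of groups `ev` and `φ`, and the identifications of spaces `Ψ` and `Θ`
    ∃ (ev : D.GKtFix γ ≃* D.Gut γ) (φ : D.GOFix γ ≃* D.Pu γ γ)
      (Ψ : D.TFix γ η ρ ≃ D.X γ η ρ) (Θ : D.NKFix γ ρ ≃ D.Nu γ ρ),
      (∀ x : D.GKtFix γ, (ev x).right = x.1.right ∧ D.IsEv γ x.1.left (ev x).left) ∧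
      (∀ x : D.GKtFix γ, x.1.left ∈ D.GO ↔ (ev x).left ∈ D.Pu γ γ) ∧
      (∀ k : D.GOFix γ, D.IsEv γ k.1 (φ k).1) ∧
      -- (b): the isomorphism `𝒯^{γ̇,η} ≅ 𝒳_η^ρ` and its equivariance
      FixedLocus.FunSp.IsIso (D.funTSub (D.TFix γ η ρ)) (D.funX γ η ρ) Ψ ∧
      (∀ (x : D.GKtFix γ) (t : D.TFix γ η ρ), Ψ (x • t) = ev x • Ψ t) ∧
      -- (b): the identification of the induced classes
      (∃ (indT : FixedLocus.RepRing D.funGO →ₗ[ℂ]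
            FixedLocus.KGroup (D.funGOFix γ) (D.funTSub (D.TFix γ η ρ)))
          (indX : FixedLocus.RepRing (D.funPu γ η) →ₗ[ℂ]
            FixedLocus.KGroup (D.funPu γ γ) (D.funX γ η ρ))
          (res : FixedLocus.RepRing D.funGO →ₗ[ℂ] FixedLocus.RepRing (D.funPu γ η))
          (Tr : FixedLocus.KGroup (D.funGOFix γ) (D.funTSub (D.TFix γ η ρ)) ≃ₗ[ℂ]
            FixedLocus.KGroup (D.funPu γ γ) (D.funX γ η ρ)),
        (∀ V : FixedLocus.RatRep D.funGO,
          (∃ F : FixedLocus.EqCoh (D.funGOFix γ) (D.funTSub (D.TFix γ η ρ)),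
            D.IsIndT γ η ρ V F.1) ∧
          ∀ F : FixedLocus.EqCoh (D.funGOFix γ) (D.funTSub (D.TFix γ η ρ)),
            D.IsIndT γ η ρ V F.1 →
              indT (FixedLocus.RepRing.cls V) = FixedLocus.KGroup.cls F) ∧
        (∀ V : FixedLocus.RatRep (D.funPu γ η),
          (∃ F : FixedLocus.EqCoh (D.funPu γ γ) (D.funX γ η ρ), D.IsIndX γ η ρ e V F.1) ∧
          ∀ F : FixedLocus.EqCoh (D.funPu γ γ) (D.funX γ η ρ), D.IsIndX γ η ρ e V F.1 →
            indX (FixedLocus.RepRing.cls V) = FixedLocus.KGroup.cls F) ∧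
        (∀ V : FixedLocus.RatRep D.funGO,
          (∃ V' : FixedLocus.RatRep (D.funPu γ η), D.IsRestr γ η V V') ∧
          ∀ V' : FixedLocus.RatRep (D.funPu γ η), D.IsRestr γ η V V' →
            res (FixedLocus.RepRing.cls V) = FixedLocus.RepRing.cls V') ∧
        (∀ F₁ : FixedLocus.EqCoh (D.funGOFix γ) (D.funTSub (D.TFix γ η ρ)),
          (∃ F₂ : FixedLocus.EqCoh (D.funPu γ γ) (D.funX γ η ρ),
            FixedLocus.IsTransport Ψ φ F₁.1 F₂.1) ∧
          ∀ F₂ : FixedLocus.EqCoh (D.funPu γ γ) (D.funX γ η ρ),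
            FixedLocus.IsTransport Ψ φ F₁.1 F₂.1 →
              Tr (FixedLocus.KGroup.cls F₁) = FixedLocus.KGroup.cls F₂) ∧
        ∀ v : FixedLocus.RepRing D.funGO, Tr (indT v) = indX (res v)) ∧
      -- (c): the right square and its equivariance
      FixedLocus.FunSp.IsIso (D.funNKSub (D.NKFix γ ρ)) (D.funNu γ ρ) Θ ∧
      (∀ n : D.NKFix γ ρ, D.IsEvN n.1 (Θ n)) ∧
      (∀ (x : D.GKtFix γ) (n : D.NKFix γ ρ), Θ (x • n) = ev x • Θ n) ∧
      FixedLocus.FunSp.IsMor (D.funTSub (D.TFix γ η ρ)) (D.funNKSub (D.NKFix γ ρ))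
        (D.πFix γ η ρ) ∧
      FixedLocus.FunSp.IsMor (D.funX γ η ρ) (D.funNu γ ρ) (fun p => p.1.2) ∧
      (∀ t : D.TFix γ η ρ, Θ (D.πFix γ η ρ t) = (Ψ t).1.2) ∧
      -- (c): the left square and its equivariance
      (∀ n : D.NKFix γ ρ, n.1 ∈ D.NO ↔ Θ n ∈ D.Nη γ γ ρ) ∧
      (∀ x : D.GKtFix γ, x.1.left ∈ D.GO → ∀ t ∈ D.RFix γ η ρ, x • t ∈ D.RFix γ η ρ) ∧
      (∀ y : D.Gut γ, y.left ∈ D.Pu γ γ → ∀ n ∈ D.Nη γ γ ρ, y • n ∈ D.Nη γ γ ρ) ∧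
      ∃ π₁ : D.RFix γ η ρ → D.Nη γ γ ρ,
        FixedLocus.FunSp.IsMor
          (FixedLocus.FunSp.induced Subtype.val (D.funTSub (D.TFix γ η ρ)))
          (FixedLocus.FunSp.induced Subtype.val (D.funNu γ ρ)) π₁ ∧
        (∀ t : D.RFix γ η ρ, Θ (D.πFix γ η ρ t.1) = (π₁ t).1) ∧
        ∀ (x : D.GKtFix γ) (t t' : D.RFix γ η ρ), x.1.left ∈ D.GO → t'.1 = x • t.1 →
          (π₁ t').1 = ev x • (π₁ t).1 := by
  open FixedLocus FixedLocus.Datum in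
  refine ⟨eX hγ hη ρ, isIso_eX hγ hη, eX_smul hγ hη, fun g n => ?_, evEquiv hγ, evGO hγ, eT hγ hη ρ,
    evN hγ, fun x => ⟨evEquiv_right hγ x, isEv_evEquiv hγ x⟩, mem_GO_iff_evEquiv hγ, isEv_evGO hγ,
    isIso_eT hγ hη, eT_smul hγ hη, ⟨(eqIsoT hγ hη ρ).symm.kEquiv.toLinearMap ∘ₗ
      (bundleX hγ hη ρ).indMap ∘ₗ RepRing.comap (inclGO hγ hη) (isMor_inclGO hγ hη),
      (bundleX hγ hη ρ).indMap, RepRing.comap (inclGO hγ hη) (isMor_inclGO hγ hη),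
      (eqIsoT hγ hη ρ).kEquiv, fun V => ⟨⟨_, isIndT_indTCoh hγ hη ρ V⟩,
        fun F hF => kEquiv_cls_of_isIndT hγ hη hF⟩,
      fun V => ⟨⟨(bundleX hγ hη ρ).indCoh V, (isIndX_iff hγ hη V _).mpr ((bundleX hγ hη ρ).ind_isInduced V)⟩,
        fun F hF => (bundleX hγ hη ρ).indMap_cls ((isIndX_iff hγ hη V _).mp hF)⟩,
      fun V => ⟨⟨_, isRestr_comap hγ hη V⟩, fun V' hV' => hV'.cls_eq hγ hη⟩,
      fun F₁ => ⟨⟨(eqIsoT hγ hη ρ).transCoh F₁, (eqIsoT hγ hη ρ).isTransport_trans F₁.1⟩,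
        fun F₂ hF => (eqIsoT hγ hη ρ).kEquiv_cls hF⟩,
      fun v => (eqIsoT hγ hη ρ).kEquiv.apply_symm_apply _⟩,
    isIso_evN hγ, isEvN_evN hγ, evN_smul hγ, isMor_πFix hγ hη, isMor_X_snd, evN_πFix hγ hη,
    mem_NO_iff_evN hγ, fun x hx t ht => smul_mem_RFix hγ hx ht, fun y hy n hn => gut_smul_mem_Nη hγ hy hn,
    πR hγ, isMor_πR hγ hη, fun _ => rfl, fun x t t' _ ht => ?_⟩
  · exact (congrArg Subtype.val (eX_mk hγ hη (g, n))).trans (qX_val _)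
  · change evN hγ (D.πFix γ η ρ t'.1) = _
    rw [ht, evN_πFix_smul]
    rfl
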